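/- **Setting.** Let $\Sigma$ be the alphabet consisting of the bits $0,1$ and a separator, and $\mathcal B=(\Sigma^*)^{\Sigma^*}$. Oracle Turing machines have an oracle query tape and an oracle answer tape; with oracle $\varphi\in\mathcal B$ an oracle call takes one step, in which the content of the answer tape is replaced by the value of $\varphi$ on the content of the query tape. The second-order polynomials are the smallest class of maps $\mathbb N^{\mathbb N}\times\mathbb N\to\mathbb N$ that contains $(l,n)\mapsto p(n)$ for $p\in\mathbb N[X]$ and is closed under sum, product and $P\mapsto\big((l,n)\mapsto l(P(l,n))\big)$. A *preparametrised space* $\mathbf X=(X,\xi_{\mathbf X},\mu_{\mathbf X})$ is a set $X$ with a partial surjection $\xi_{\mathbf X}:\subseteq\mathcal B\to X$ (if $\xi_{\mathbf X}(\varphi)=x$, then $\varphi$ is a name of $x$) and a map $\mu_{\mathbf X}$ that sends each name to a non-decreasing function $\mathbb N\to\mathbb N$. A function $f:\mathbf X\to\mathbf Y$ is *polytime computable* if there are an oracle machine $M^?$ and second-order polynomials $P,Q$ such that for every name $\varphi$ of every $x\in X$ the machine with oracle $\varphi$ halts on every string $\mathbf a$ within $P(\mu_{\mathbf X}(\varphi),|\mathbf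 a|)$ steps, the string function $M^\varphi$ that it computes is a name of $f(x)$, and $\mu_{\mathbf Y}(M^\varphi)(n)\le Q(\mu_{\mathbf X}(\varphi),n)$ for all $n$. A *parametrised space* is a preparametrised space whose identity is polytime computable. The names in $\mathbf X\times\mathbf Y$ of $(x,y)$ are the pairs $\langle\varphi,\psi\rangle$ of names of $x$ and $y$, where $\langle\varphi,\psi\rangle(0\mathbf b)=\varphi(\mathbf b)$, $\langle\varphi,\psi\rangle(1\mathbf b)=\psi(\mathbf b)$ and $\langle\varphi,\psi\rangle$ is the empty string on all other strings, and $\mu_{\mathbf X\times\mathbf Y}(\langle\varphi,\psi\rangle)(n)=\max\{\mu_{\mathbf X}(\varphi)(n),\mu_{\mathbf Y}(\psi)(n)\}$. Let $\mathrm{I}\mathbb D$ be the set of the intervals $[r\pm\varepsilon]=[r-\varepsilon,r+\varepsilon]$ with dyadic rational $r$ and dyadic rational $\varepsilon>0$, together with $[-\infty,\infty]$. String functions encode functions $\mathbb N\to\mathrm{I}\mathbb D$ and $\mathrm{I}\mathbb D\to\mathrm{I}\mathbb D$ as follows. An argument $n\in\mathbb N$ is given as the binary code of the integer $2^n$; a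 dyadic number is written as a sign bit, its binary expansion without leading zeros in the integer part, and the separator as the binary point; $[r\pm\varepsilon]$ is given by the bitwise interleaving of a control string with the codes of $r$ and $\varepsilon$, padded by zeros to a common length; $[-\infty,\infty]$ is given by the empty string. Write $\operatorname{lb}$ for the binary logarithm and $I=[0,1]$. * $\mathbb R_i$: a name of $x\in\mathbb R$ is (an encoding of) a nested sequence $\varphi:\mathbb N\to\mathrm{I}\mathbb D$ with $\bigcap_n\varphi(n)=\{x\}$, and $\mu_{\mathbb R_i}(\varphi)(n)=\min\{N:\operatorname{diam}\varphi(N)\le2^{-n}\}+\lceil\operatorname{lb}(|x|+1)\rceil$. The space $I_i$ is the restriction of $\mathbb R_i$ to the names of points of $I$. * $C(I)_i$: a name of a continuous $f:I\to\mathbb R$ is (an encoding of) a map $\psi:\mathrm{I}\mathbb D\to\mathrm{I}\mathbb D$ such that, for every $x\in I$ and every nested sequence $\varphi$ in $\mathrm{I}\mathbb D$ with $\bigcap_n\varphi(n)=\{x\}$, the sequence $\psi\circ\varphi$ is nested with $\bigcap_n\psi(\varphi(n))=\{f(x)\}$; and $\mu_{if}(\psi)(n)=\lceil\operatorname{lb}(\|f\|_\infty+1)\rceil+\min\{N:\operatorname{diam}\psi(J)\le2^{-n}\text{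 for all }J\in\mathrm{I}\mathbb D\text{ with }J\cap I\neq\emptyset\text{ and }\operatorname{diam}J\le2^{-N}\}$. **Corollary.** $(C(I)_i,\mathrm{eval})$ is an exponential object of $I_i$ and $\mathbb R_i$ for parametrised spaces and polytime computable maps. Explicitly: $\mathbb R_i$, $I_i$ and $C(I)_i$ are parametrised spaces; the evaluation $\mathrm{eval}:C(I)_i\times I_i\to\mathbb R_i$, $(f,x)\mapsto f(x)$, is polytime computable; and for every parametrised space $\mathbf Z$, the product $\mathbf Z\times I_i$ is a parametrised space, and for every polytime computable $F:\mathbf Z\times I_i\to\mathbb R_i$ there exists a unique polytime computable map $c(F):\mathbf Z\to C(I)_i$ such that $c(F)(z)(x)=F(z,x)$ for all $z\in\mathbf Z$ and $x\in I$. -/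

import Mathlib

universe u

namespace ParSpace

/-! ### Strings and oracle machines -/

/-- The alphabet: the two bits and a separator symbol. -/
inductive Letter where
  | bit (b : Bool)
  | sep

/-- Finite strings. -/
abbrev Str := List Letter

/-- Baire space: all string functions. -/
abbrev Baire := Str → Str

/-- A tape: its cells (`none` is the blank) and the position of its head. -/
structure Tape where
  cells : ℤ → Option Letter
  head : ℤ

/-- The cells of a tape that holds the string `w` from cell `0` on and is blank elsewhere. -/
def cellsOf (w : Str) : ℤ → Option Letter :=
  fun i => if 0 ≤ i then w[i.toNat]? else none

open Classical in
/-- The content of a tape: the string that begins in cell `0` and ends before the first blank cell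
to the right. (A tape of a running machine has only finitely many nonblank cells.) -/
noncomputable def Tape.content (T : Tape) : Str :=
  if h : ∃ n : ℕ, T.cells n = none then
    (List.range (Nat.find h)).filterMap fun i : ℕ => T.cells i
  else []

/-- The tapes of an oracle machine with `k` work tapes. -/
inductive TapeIx (k : ℕ) where
  | input
  | output
  | query
  | answer
  | work (i : Fin k)

/-- Head movements. -/
inductive Move where
  | left
  | stay
  | right

/-- The displacement of a head movement. -/
def Move.shift : Move → ℤ
  | .left => -1
  | .stay => 0
  | .right => 1

/-- Write a symbol in the scanned cell, then move the head. -/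
def Tape.act (T : Tape) (s : Option Letter) (m : Move) : Tape where
  cells := Function.update T.cells T.head s
  head := T.head + m.shift

/-- A deterministic multitape oracle Turing machine. In the state `oracle` the machine consults the
oracle and continues in the state `resume`; it stops in the state `halt`. -/
structure OracleMachine where
  State : Type
  [decEq : DecidableEq State]
  [finite : Finite State]
  workTapes : ℕ
  start : State
  oracle : State
  resume : State
  halt : State
  transition : State → (TapeIx workTapes → Option Letter) →
    State × (TapeIx workTapes → Option Letter × Move)

attribute [instance] OracleMachine.decEq OracleMachine.finite

namespace OracleMachine

/-- A configuration: the state and all tapes. -/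
structure Config (M : OracleMachine) where
  state : M.State
  tape : TapeIx M.workTapes → Tape

/-- The initial configuration on input `a`: all tapes but the input tape are blank, and all heads
stand on cell `0`. -/
def init (M : OracleMachine) (a : Str) : M.Config where
  state := M.start
  tape
    | .input => ⟨cellsOf a, 0⟩
    | _ => ⟨cellsOf [], 0⟩

/-- One step with oracle `φ`. An oracle call takes one step, which replaces the content of the
answer tape by the oracle's answer and leaves all head positions unchanged. -/
noncomputable def step (M : OracleMachine) (φ : Baire) (c : M.Config) : M.Config :=
  if c.state = M.halt then c
  else if c.state = M.oracle then
    { state := M.resume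
      tape := fun
        | .answer => ⟨cellsOf (φ (c.tape .query).content), (c.tape .answer).head⟩
        | i => c.tape i }
  else
    let r := M.transition c.state fun i => (c.tape i).cells (c.tape i).head
    { state := r.1
      tape := fun i => (c.tape i).act (r.2 i).1 (r.2 i).2 }

/-- The configuration after `t` steps on input `a` with oracle `φ`. -/
noncomputable def run (M : OracleMachine) (φ : Baire) (a : Str) (t : ℕ) : M.Config :=
  (M.step φ)^[t] (M.init a)

/-- On input `a` with oracle `φ` the machine stops after at most `t` steps, with the string `w` on
its output tape. -/
def HaltsWithin (M : OracleMachine) (φ : Baire) (a : Str) (t : ℕ) (w : Str) : Prop :=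
  ∃ s ≤ t, (M.run φ a s).state = M.halt ∧ ((M.run φ a s).tape .output).content = w

end OracleMachine

/-- The second-order polynomials. -/
inductive IsSOP : ((ℕ → ℕ) → ℕ → ℕ) → Prop
  | poly (p : Polynomial ℕ) : IsSOP fun _ n => p.eval n
  | app {P} : IsSOP P → IsSOP fun l n => l (P l n)
  | add {P Q} : IsSOP P → IsSOP Q → IsSOP fun l n => P l n + Q l n
  | mul {P Q} : IsSOP P → IsSOP Q → IsSOP fun l n => P l n * Q l n

/-! ### Parametrised spaces -/

/-- A preparametrised space on the set `X`: a representation (a partial surjection from Baire space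
onto `X`, given by its graph `IsName`) with a parameter for it. The values of `param` outside the
domain of the representation are never used. -/
structure PreparametrisedSpace (X : Type u) where
  IsName : Baire → X → Prop
  isName_unique : ∀ {φ x y}, IsName φ x → IsName φ y → x = y
  exists_isName : ∀ x, ∃ φ, IsName φ x
  param : Baire → ℕ → ℕ
  param_mono : ∀ {φ x}, IsName φ x → ∀ n, param φ n ≤ param φ (n + 1)

/-- `f` is computable in polynomial time: some machine computes a realiser of `f` (on a name `φ`
it computes the string function `ψ`), `P` bounds its running time and `Q` its parameter blowup. -/
def PolytimeComputable {X Y : Type*} (A : PreparametrisedSpace X) (B : PreparametrisedSpace Y)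
    (f : X → Y) : Prop :=
  ∃ (M : OracleMachine) (P Q : (ℕ → ℕ) → ℕ → ℕ), IsSOP P ∧ IsSOP Q ∧
    ∀ φ x, A.IsName φ x → ∃ ψ : Baire,
      (∀ a, M.HaltsWithin φ a (P (A.param φ) a.length) (ψ a)) ∧
      B.IsName ψ (f x) ∧
      ∀ n, B.param ψ n ≤ Q (A.param φ) n

/-- A parametrised space is a preparametrised space whose identity is polytime computable. -/
def PreparametrisedSpace.IsParametrised {X : Type*} (A : PreparametrisedSpace X) : Prop :=
  PolytimeComputable A A id

/-- The pairing function of Baire space. -/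
def bairePair (φ ψ : Baire) : Baire
  | .bit false :: b => φ b
  | .bit true :: b => ψ b
  | _ => []

/-- The product of two preparametrised spaces. -/
def PreparametrisedSpace.prod {X Y : Type*} (A : PreparametrisedSpace X)
    (B : PreparametrisedSpace Y) : PreparametrisedSpace (X × Y) where
  IsName χ p := ∃ φ ψ, χ = bairePair φ ψ ∧ A.IsName φ p.1 ∧ B.IsName ψ p.2
  isName_unique := by
    rintro χ p q ⟨φ, ψ, rfl, h1, h2⟩ ⟨φ', ψ', h, h1', h2'⟩
    have e1 : φ = φ' := funext fun b => congrFun h (.bit false :: b)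
    have e2 : ψ = ψ' := funext fun b => congrFun h (.bit true :: b)
    subst e1 e2
    exact Prod.ext (A.isName_unique h1 h1') (B.isName_unique h2 h2')
  exists_isName p := by
    obtain ⟨φ, hφ⟩ := A.exists_isName p.1
    obtain ⟨ψ, hψ⟩ := B.exists_isName p.2
    exact ⟨_, φ, ψ, rfl, hφ, hψ⟩
  param χ n := max (A.param (fun b => χ (.bit false :: b)) n)
    (B.param (fun b => χ (.bit true :: b)) n)
  param_mono := by
    rintro χ p ⟨φ, ψ, rfl, h1, h2⟩ n
    exact max_le_max (A.param_mono h1 n) (B.param_mono h2 n)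

/-! ### Notations of integers, dyadic numbers and dyadic intervals -/

/-- The natural number with the binary digits `l`, the most significant one first. -/
def binVal (l : List Bool) : ℕ := l.foldl (fun v b => 2 * v + b.toNat) 0

/-- The notation of the integers: a sign bit, followed by the binary digits, the first of which
has to be `1`; the strings that have no second digit denote zero. -/
inductive IntCode : Str → ℤ → Prop
  | empty : IntCode [] 0
  | single (b : Bool) : IntCode [.bit b] 0
  | digits (b : Bool) (l : List Bool) :
      IntCode (.bit b :: .bit true :: l.map .bit)
        ((if b then -1 else 1) * (binVal (true :: l) : ℤ))

open Classical in
/-- The sign that is given by the first bit of a string. -/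
noncomputable def strSign (w : Str) : ℚ := if w.head? = some (.bit true) then -1 else 1

/-- The notation of the dyadic numbers: a code of an integer, the separator, and the binary digits
after the point. The first bit is the sign of the whole number. -/
def DyadicCode (s : Str) (q : ℚ) : Prop :=
  ∃ (w : Str) (z : ℤ) (u : List Bool), IntCode w z ∧ s = w ++ .sep :: u.map .bit ∧
    q = strSign w * (|(z : ℚ)| + (binVal u : ℚ) / 2 ^ u.length)

/-- The control string `1 … 1 0 β 0 … 0` of the pairing of `a` and `b`, where the number of ones is
the smaller of the two lengths and `β` tells whether `b` is longer than `a`. -/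
def pairControl (a b : Str) (i : ℕ) : Letter :=
  if i < min a.length b.length then .bit true
  else if i = min a.length b.length + 1 then .bit (decide (a.length < b.length))
  else .bit false

/-- The pairing of strings: the control string and the two strings, padded by zeros to the same
length, are interleaved. -/
def strPair (a b : Str) : Str :=
  (List.range (max (max a.length b.length) (min a.length b.length + 2))).flatMap fun i =>
    [pairControl a b i, a.getD i (.bit false), b.getD i (.bit false)]

/-- Dyadic rational numbers. -/
def IsDyadic (q : ℚ) : Prop := ∃ (k : ℤ) (n : ℕ), q = k / 2 ^ n

/-- The infinite interval, and the intervals `[mid - rad, mid + rad]` of positive length with dyadic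
midpoint and radius. -/
inductive DyadicInterval where
  | infinite
  | finite (mid rad : ℚ) (mid_dyadic : IsDyadic mid) (rad_dyadic : IsDyadic rad)
      (rad_pos : 0 < rad)

namespace DyadicInterval

/-- The real numbers in an interval. -/
def toSet : DyadicInterval → Set ℝ
  | infinite => Set.univ
  | finite r ε _ _ _ => Set.Icc ((r : ℝ) - ε) (r + ε)

/-- The length of an interval. -/
def diam : DyadicInterval → WithTop ℚ
  | infinite => ⊤
  | finite _ ε _ _ _ => ((2 * ε : ℚ) : WithTop ℚ)

/-- The length of the interval is at most `2⁻ⁿ`. -/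
def DiamLE (J : DyadicInterval) (n : ℕ) : Prop := J.diam ≤ (((2 : ℚ) ^ n)⁻¹ : ℚ)

end DyadicInterval

/-- The notation of the dyadic intervals: the empty string denotes the infinite interval, and a pair
of codes of `r` and `ε` denotes `[r - ε, r + ε]`. -/
inductive IntervalCode : Str → DyadicInterval → Prop
  | infinite : IntervalCode [] .infinite
  | finite {a b : Str} {r ε : ℚ} (hr : IsDyadic r) (hε : IsDyadic ε) (pos : 0 < ε) :
      DyadicCode a r → DyadicCode b ε → IntervalCode (strPair a b) (.finite r ε hr hε pos)

/-- The string function `χ` encodes the sequence `Φ` of intervals; the index `n` is passed as a code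
of the integer `2 ^ n`. -/
def EncodesSeq (χ : Baire) (Φ : ℕ → DyadicInterval) : Prop :=
  ∀ a n, IntCode a (2 ^ n) → IntervalCode (χ a) (Φ n)

/-- The string function `χ` encodes the interval function `Ψ`. -/
def EncodesFun (χ : Baire) (Ψ : DyadicInterval → DyadicInterval) : Prop :=
  ∀ s J, IntervalCode s J → IntervalCode (χ s) (Ψ J)

/-- The intervals `Φ n` are nested and `x` is their only common point. -/
def ShrinksTo (Φ : ℕ → DyadicInterval) (x : ℝ) : Prop :=
  (∀ n, (Φ (n + 1)).toSet ⊆ (Φ n).toSet) ∧ ⋂ n, (Φ n).toSet = {x}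

/-- The interval representation of the real numbers. -/
def IsRealName (χ : Baire) (x : ℝ) : Prop := ∃ Φ, EncodesSeq χ Φ ∧ ShrinksTo Φ x

/-- The interval function representation of the continuous functions on the unit interval. -/
def IsFunName (χ : Baire) (f : C(unitInterval, ℝ)) : Prop :=
  ∃ Ψ, EncodesFun χ Ψ ∧ ∀ (Φ : ℕ → DyadicInterval) (x : unitInterval),
    ShrinksTo Φ x → ShrinksTo (fun n => Ψ (Φ n)) (f x)

/-- The parameter of the interval reals,
`min {N | diam (Φ N) ≤ 2⁻ⁿ} + ⌈lb (|x| + 1)⌉` for a name that encodes the sequence `Φ` with limit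
`x`. -/
noncomputable def realParam (χ : Baire) (n : ℕ) : ℕ :=
  sInf {N : ℕ | ∃ Φ, EncodesSeq χ Φ ∧ (Φ N).DiamLE n} +
    ⌈Real.logb 2 (|Classical.epsilon (IsRealName χ)| + 1)⌉₊

/-- The parameter of the interval functions,
`⌈lb (‖f‖ + 1)⌉ + min {N | diam J ≤ 2⁻ᴺ implies diam (Ψ J) ≤ 2⁻ⁿ}` for a name of `f` that encodes
the interval function `Ψ`, where `J` ranges over the intervals that meet the unit interval. -/
noncomputable def funParam (χ : Baire) (n : ℕ) : ℕ :=
  ⌈Real.logb 2 (‖Classical.epsilon (IsFunName χ)‖ + 1)⌉₊ +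
    sInf {N : ℕ | ∃ Ψ, EncodesFun χ Ψ ∧ ∀ J : DyadicInterval,
      (J.toSet ∩ Set.Icc 0 1).Nonempty → J.DiamLE N → (Ψ J).DiamLE n}

/-! ### The notations are well-defined and total -/

theorem binVal_append_bit (l : List Bool) (b : Bool) :
    binVal (l ++ [b]) = 2 * binVal l + b.toNat := by
  simp [binVal]

theorem binVal_append_zeros (l : List Bool) (k : ℕ) :
    binVal (l ++ List.replicate k false) = binVal l * 2 ^ k := by
  induction k with
  | zero => simp
  | succ k ih =>
    rw [List.replicate_succ', ← List.append_assoc, binVal_append_bit, ih, pow_succ]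
    simp only [Bool.toNat_false]
    ring

theorem exists_binVal_of_lt (n : ℕ) : ∀ m < 2 ^ n, ∃ l : List Bool, l.length = n ∧ binVal l = m := by
  induction n with
  | zero => intro m hm; exact ⟨[], rfl, by simp at hm; simp [binVal, hm]⟩
  | succ n ih =>
    intro m hm
    obtain ⟨l, hl, hv⟩ := ih (m / 2) (by rw [pow_succ] at hm; omega)
    refine ⟨l ++ [decide (m % 2 = 1)], by simp [hl], ?_⟩
    rw [binVal_append_bit, hv]
    rcases Nat.mod_two_eq_zero_or_one m with h | h <;> simp [h] <;> omega

theorem exists_binVal_true (m : ℕ) (hm : 0 < m) : ∃ l, binVal (true :: l) = m := by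
  induction m using Nat.strong_induction_on with
  | _ m ih =>
    rcases Nat.lt_or_ge m 2 with h | h
    · exact ⟨[], by simp [binVal]; omega⟩
    · obtain ⟨l, hl⟩ := ih (m / 2) (by omega) (by omega)
      refine ⟨l ++ [decide (m % 2 = 1)], ?_⟩
      rw [← List.cons_append, binVal_append_bit, hl]
      rcases Nat.mod_two_eq_zero_or_one m with h | h <;> simp [h] <;> omega

theorem bit_injective : Function.Injective Letter.bit := fun _ _ h => by cases h; rfl

theorem IntCode.unique {s : Str} {z z' : ℤ} (h : IntCode s z) (h' : IntCode s z') : z = z' := by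
  cases h with
  | empty => cases h'; rfl
  | single b => cases h'; rfl
  | digits b l =>
    generalize hs : (Letter.bit b :: Letter.bit true :: l.map Letter.bit) = s at h'
    cases h' with
    | empty => simp at hs
    | single b => simp at hs
    | digits b' l' =>
      simp only [List.cons.injEq, Letter.bit.injEq, true_and] at hs
      obtain ⟨rfl, hl⟩ := hs
      rw [List.map_injective_iff.2 bit_injective hl]

theorem IntCode.sep_notMem {s : Str} {z : ℤ} (h : IntCode s z) : Letter.sep ∉ s := by
  cases h <;> simp

theorem exists_intCode (b : Bool) (m : ℕ) : ∃ s z, IntCode s z ∧ |z| = m ∧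
    strSign s = if b then -1 else 1 := by
  rcases Nat.eq_zero_or_pos m with rfl | hm
  · exact ⟨_, _, .single b, by simp, by simp [strSign]⟩
  · obtain ⟨l, hl⟩ := exists_binVal_true m hm
    refine ⟨_, _, .digits b l, ?_, by simp [strSign]⟩
    rw [hl]
    cases b <;> simp

theorem exists_intCode_pow (n : ℕ) : ∃ a, IntCode a (2 ^ n) := by
  obtain ⟨l, hl⟩ := exists_binVal_true (2 ^ n) (by positivity)
  have := IntCode.digits false l
  rw [hl] at this
  exact ⟨_, by simpa using this⟩

theorem append_sep_inj {w w' v v' : Str} (hw : Letter.sep ∉ w) (hw' : Letter.sep ∉ w')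
    (h : w ++ Letter.sep :: v = w' ++ Letter.sep :: v') : w = w' ∧ v = v' := by
  induction w generalizing w' with
  | nil =>
    cases w' with
    | nil => simpa using h
    | cons c w' => simp at h hw'; exact absurd h.1 hw'.1
  | cons c w ih =>
    cases w' with
    | nil => simp at h hw; exact absurd h.1.symm hw.1
    | cons c' w' =>
      simp only [List.cons_append, List.cons.injEq] at h
      simp only [List.mem_cons, not_or] at hw hw'
      obtain ⟨rfl, rfl⟩ := ih hw.2 hw'.2 h.2
      exact ⟨by rw [h.1], rfl⟩

theorem DyadicCode.unique {s : Str} {q q' : ℚ} (h : DyadicCode s q) (h' : DyadicCode s q') :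
    q = q' := by
  obtain ⟨w, z, u, hw, hs, rfl⟩ := h
  obtain ⟨w', z', u', hw', hs', rfl⟩ := h'
  obtain ⟨rfl, hu⟩ := append_sep_inj hw.sep_notMem hw'.sep_notMem (hs.symm.trans hs')
  rw [hw.unique hw', List.map_injective_iff.2 bit_injective hu]

theorem DyadicCode.pad {s : Str} {q : ℚ} (h : DyadicCode s q) (k : ℕ) :
    DyadicCode (s ++ List.replicate k (.bit false)) q := by
  obtain ⟨w, z, u, hw, rfl, rfl⟩ := h
  refine ⟨w, z, u ++ List.replicate k false, hw, by simp, ?_⟩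
  rw [binVal_append_zeros, List.length_append, List.length_replicate, pow_add]
  push_cast
  rw [mul_div_mul_right _ _ (by positivity)]

theorem exists_dyadicCode {q : ℚ} (h : IsDyadic q) : ∃ s, DyadicCode s q := by
  obtain ⟨k, n, rfl⟩ := h
  obtain ⟨u, hu, hv⟩ := exists_binVal_of_lt n (k.natAbs % 2 ^ n) (Nat.mod_lt _ (by positivity))
  obtain ⟨w, z, hw, hz, hs⟩ := exists_intCode (decide (k < 0)) (k.natAbs / 2 ^ n)
  refine ⟨_, w, z, u, hw, rfl, ?_⟩
  have hz' : |(z : ℚ)| = ((k.natAbs / 2 ^ n : ℕ) : ℚ) := by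
    rw [← Int.cast_abs, hz, Int.cast_natCast]
  have hk : (k.natAbs : ℚ) = |(k : ℚ)| := by rw [Nat.cast_natAbs]; simp
  have key : ((k.natAbs / 2 ^ n : ℕ) : ℚ) + ((k.natAbs % 2 ^ n : ℕ) : ℚ) / 2 ^ n = |(k : ℚ)| / 2 ^ n := by
    rw [eq_div_iff (by positivity), add_mul, div_mul_cancel₀ _ (by positivity), ← hk]
    exact_mod_cast Nat.div_add_mod' k.natAbs (2 ^ n)
  rw [hs, hz', hv, hu, key]
  rcases lt_or_ge k 0 with h | h
  · have : (k : ℚ) < 0 := by exact_mod_cast h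
    simp [h, abs_of_neg this]
    ring
  · have : (0 : ℚ) ≤ k := by exact_mod_cast h
    simp [not_lt.2 h, abs_of_nonneg this]

/-- The string in the positions `j`, `j + 3`, `j + 6`, … of `s`. -/
def everyThird (j : ℕ) (s : Str) : Str :=
  (List.range (s.length / 3)).map fun i => s.getD (3 * i + j) (.bit false)

theorem flatMap_triple_getD (f g h : ℕ → Letter) (L i j : ℕ) (hi : i < L) (hj : j < 3) :
    ((List.range L).flatMap fun i => [f i, g i, h i]).getD (3 * i + j) (.bit false) =
      [f i, g i, h i].getD j (.bit false) := by
  have hlen : ∀ L, ((List.range L).flatMap fun i => [f i, g i, h i]).length = 3 * L := by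
    intro L
    simp [List.length_flatMap]
    ring
  induction L with
  | zero => omega
  | succ L ih =>
    rw [List.range_succ, List.flatMap_append]
    rcases Nat.lt_or_ge i L with h1 | h1
    · rw [List.getD_append _ _ _ _ (by rw [hlen]; omega), ih h1]
    · have : i = L := by omega
      subst this
      rw [List.getD_append_right _ _ _ _ (by rw [hlen]; omega), hlen]
      simp

theorem strPair_length (a b : Str) : (strPair a b).length =
    3 * max (max a.length b.length) (min a.length b.length + 2) := by
  simp [strPair, List.length_flatMap]
  ring

theorem range_map_getD (a : Str) (L : ℕ) (h : a.length ≤ L) :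
    ((List.range L).map fun i => a.getD i (.bit false)) =
      a ++ List.replicate (L - a.length) (.bit false) := by
  apply List.ext_getElem
  · simp; omega
  · intro i h1 h2
    simp only [List.getElem_map, List.getElem_range]
    rcases Nat.lt_or_ge i a.length with h3 | h3
    · simp [List.getElem_append_left, h3]
    · simp [List.getElem_append_right, h3]

theorem everyThird_strPair (a b : Str) :
    (∃ k, everyThird 1 (strPair a b) = a ++ List.replicate k (.bit false)) ∧
    (∃ k, everyThird 2 (strPair a b) = b ++ List.replicate k (.bit false)) := by
  constructor
  · refine ⟨_, Eq.trans ?_ (range_map_getD a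
      (max (max a.length b.length) (min a.length b.length + 2)) (by omega))⟩
    rw [everyThird, strPair_length, Nat.mul_div_cancel_left _ (by norm_num)]
    refine List.map_congr_left fun i hi => ?_
    rw [strPair, flatMap_triple_getD _ _ _ _ _ _ (List.mem_range.1 hi) (by norm_num)]
    rfl
  · refine ⟨_, Eq.trans ?_ (range_map_getD b
      (max (max a.length b.length) (min a.length b.length + 2)) (by omega))⟩
    rw [everyThird, strPair_length, Nat.mul_div_cancel_left _ (by norm_num)]
    refine List.map_congr_left fun i hi => ?_
    rw [strPair, flatMap_triple_getD _ _ _ _ _ _ (List.mem_range.1 hi) (by norm_num)]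
    rfl

theorem strPair_ne_nil (a b : Str) : strPair a b ≠ [] := by
  intro h
  have := strPair_length a b
  rw [h] at this
  simp at this

theorem IntervalCode.unique {s : Str} {J J' : DyadicInterval} (h : IntervalCode s J)
    (h' : IntervalCode s J') : J = J' := by
  cases h with
  | infinite =>
    generalize hs : ([] : Str) = s at h'
    cases h' with
    | infinite => rfl
    | finite => exact absurd hs.symm (strPair_ne_nil _ _)
  | @finite a b r ε hr hε pos ha hb =>
    generalize hs : strPair a b = s at h'
    cases h' with
    | infinite => exact absurd hs (strPair_ne_nil _ _)
    | @finite a' b' r' ε' hr' hε' pos' ha' hb' =>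
      obtain ⟨⟨k, h1⟩, ⟨l, h2⟩⟩ := everyThird_strPair a b
      obtain ⟨⟨k', h1'⟩, ⟨l', h2'⟩⟩ := everyThird_strPair a' b'
      have e1 := (hs ▸ h1).symm.trans h1'
      have e2 := (hs ▸ h2).symm.trans h2'
      have : r = r' := (ha.pad k).unique (e1 ▸ ha'.pad k')
      have : ε = ε' := (hb.pad l).unique (e2 ▸ hb'.pad l')
      subst r' ε'
      rfl

theorem exists_intervalCode (J : DyadicInterval) : ∃ s, IntervalCode s J := by
  cases J with
  | infinite => exact ⟨_, .infinite⟩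
  | finite r ε hr hε pos =>
    obtain ⟨a, ha⟩ := exists_dyadicCode hr
    obtain ⟨b, hb⟩ := exists_dyadicCode hε
    exact ⟨_, .finite hr hε pos ha hb⟩

theorem EncodesSeq.unique {χ : Baire} {Φ Φ' : ℕ → DyadicInterval} (h : EncodesSeq χ Φ)
    (h' : EncodesSeq χ Φ') : Φ = Φ' := by
  funext n
  obtain ⟨a, ha⟩ := exists_intCode_pow n
  exact (h a n ha).unique (h' a n ha)

theorem EncodesFun.unique {χ : Baire} {Ψ Ψ' : DyadicInterval → DyadicInterval}
    (h : EncodesFun χ Ψ) (h' : EncodesFun χ Ψ') : Ψ = Ψ' := by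
  funext J
  obtain ⟨s, hs⟩ := exists_intervalCode J
  exact (h s J hs).unique (h' s J hs)

theorem exists_encodesSeq (Φ : ℕ → DyadicInterval) : ∃ χ, EncodesSeq χ Φ := by
  classical
  choose c hc using exists_intervalCode
  refine ⟨fun a => if h : ∃ n, IntCode a (2 ^ n) then c (Φ h.choose) else [], fun a n h => ?_⟩
  have h' : ∃ n, IntCode a (2 ^ n) := ⟨n, h⟩
  have e : h'.choose = n :=
    Int.pow_right_injective (by norm_num : 1 < (2 : ℤ).natAbs) (h'.choose_spec.unique h)
  simp only [h', dite_true, e]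
  exact hc _

theorem exists_encodesFun (Ψ : DyadicInterval → DyadicInterval) : ∃ χ, EncodesFun χ Ψ := by
  classical
  choose c hc using exists_intervalCode
  refine ⟨fun a => if h : ∃ J, IntervalCode a J then c (Ψ h.choose) else [], fun a J h => ?_⟩
  have h' : ∃ J, IntervalCode a J := ⟨J, h⟩
  have e : h'.choose = J := h'.choose_spec.unique h
  simp only [h', dite_true, e]
  exact hc _

/-! ### The interval representations and their parameters are well-defined -/

theorem IsDyadic.add {p q : ℚ} (hp : IsDyadic p) (hq : IsDyadic q) : IsDyadic (p + q) := by
  obtain ⟨k, n, rfl⟩ := hp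
  obtain ⟨l, m, rfl⟩ := hq
  refine ⟨k * 2 ^ m + l * 2 ^ n, n + m, ?_⟩
  push_cast
  rw [pow_add]
  field_simp

theorem IsDyadic.neg {p : ℚ} (hp : IsDyadic p) : IsDyadic (-p) := by
  obtain ⟨k, n, rfl⟩ := hp
  exact ⟨-k, n, by push_cast; ring⟩

theorem IsDyadic.div_pow {p : ℚ} (hp : IsDyadic p) (m : ℕ) : IsDyadic (p / 2 ^ m) := by
  obtain ⟨k, n, rfl⟩ := hp
  exact ⟨k, n + m, by rw [pow_add, div_div]⟩

theorem DyadicInterval.diam_mono {J J' : DyadicInterval} (h : J.toSet ⊆ J'.toSet) :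
    J.diam ≤ J'.diam := by
  cases J' with
  | infinite => exact le_top
  | finite r' ε' hr' hε' pos' =>
    cases J with
    | infinite =>
      have := (h (Set.mem_univ ((r' : ℝ) + ε' + 1))).2
      linarith
    | finite r ε hr hε pos =>
      have pos'' : (0 : ℝ) < ε := by exact_mod_cast pos
      have h1 : ((r : ℝ) - ε) ∈ Set.Icc ((r' : ℝ) - ε') (r' + ε') := h ⟨le_rfl, by linarith⟩
      have h2 : ((r : ℝ) + ε) ∈ Set.Icc ((r' : ℝ) - ε') (r' + ε') := h ⟨by linarith, le_rfl⟩
      have : (ε : ℝ) ≤ ε' := by linarith [h1.1, h2.2]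
      have : ε ≤ ε' := by exact_mod_cast this
      simp only [DyadicInterval.diam, WithTop.coe_le_coe]
      linarith

theorem DyadicInterval.DiamLE.dist_le {J : DyadicInterval} {n : ℕ} (h : J.DiamLE n) {x y : ℝ}
    (hx : x ∈ J.toSet) (hy : y ∈ J.toSet) : |y - x| ≤ (2 ^ n)⁻¹ := by
  cases J with
  | infinite => simp [DyadicInterval.DiamLE, DyadicInterval.diam] at h
  | finite r ε hr hε pos =>
    simp only [DyadicInterval.DiamLE, DyadicInterval.diam, WithTop.coe_le_coe] at h
    have h' : 2 * (ε : ℝ) ≤ (2 ^ n)⁻¹ := by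
      have := (Rat.cast_le (K := ℝ)).2 h
      push_cast at this
      exact this
    rw [abs_le]
    constructor <;> linarith [hx.1, hx.2, hy.1, hy.2]

theorem DyadicInterval.DiamLE.anti {J : DyadicInterval} {m n : ℕ} (h : J.DiamLE n) (hmn : m ≤ n) :
    J.DiamLE m := by
  refine le_trans h (WithTop.coe_le_coe.2 ?_)
  gcongr
  norm_num

theorem ShrinksTo.antitone {Φ : ℕ → DyadicInterval} {x : ℝ} (h : ShrinksTo Φ x) :
    Antitone fun n => (Φ n).toSet := antitone_nat_of_succ_le h.1

theorem ShrinksTo.mem {Φ : ℕ → DyadicInterval} {x : ℝ} (h : ShrinksTo Φ x) (n : ℕ) :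
    x ∈ (Φ n).toSet := by
  have : x ∈ ⋂ n, (Φ n).toSet := by rw [h.2]; rfl
  exact Set.mem_iInter.1 this n

theorem ShrinksTo.unique {Φ : ℕ → DyadicInterval} {x y : ℝ} (h : ShrinksTo Φ x)
    (h' : ShrinksTo Φ y) : x = y := Set.singleton_injective (h.2.symm.trans h'.2)

theorem ShrinksTo.exists_diamLE {Φ : ℕ → DyadicInterval} {x : ℝ} (h : ShrinksTo Φ x) (n : ℕ) :
    ∃ N, (Φ N).DiamLE n := by
  have out : ∀ y, y ≠ x → ∃ m, y ∉ (Φ m).toSet := by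
    intro y hy
    by_contra! hc
    have : y ∈ ⋂ n, (Φ n).toSet := Set.mem_iInter.2 hc
    rw [h.2] at this
    exact hy this
  have hp : (0 : ℝ) < (2 ^ n)⁻¹ / 2 := by positivity
  obtain ⟨m1, h1⟩ := out (x - (2 ^ n)⁻¹ / 2) (by linarith)
  obtain ⟨m2, h2⟩ := out (x + (2 ^ n)⁻¹ / 2) (by linarith)
  refine ⟨max m1 m2, ?_⟩
  have h1' : x - (2 ^ n)⁻¹ / 2 ∉ (Φ (max m1 m2)).toSet :=
    fun hc => h1 (h.antitone (le_max_left m1 m2) hc)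
  have h2' : x + (2 ^ n)⁻¹ / 2 ∉ (Φ (max m1 m2)).toSet :=
    fun hc => h2 (h.antitone (le_max_right m1 m2) hc)
  have hx := h.mem (max m1 m2)
  cases hJ : Φ (max m1 m2) with
  | infinite => rw [hJ] at h1'; exact absurd (Set.mem_univ _) h1'
  | finite r ε hr hε pos =>
    rw [hJ] at h1' h2' hx
    simp only [DyadicInterval.toSet, Set.mem_Icc, not_and_or, not_le] at h1' h2' hx
    simp only [DyadicInterval.DiamLE, DyadicInterval.diam, WithTop.coe_le_coe]
    have : 2 * (ε : ℝ) ≤ (2 ^ n)⁻¹ := by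
      rcases h1' with h1' | h1' <;> rcases h2' with h2' | h2' <;> linarith
    rw [← Rat.cast_le (K := ℝ)]
    push_cast
    exact this

theorem shrinksTo_of {Φ : ℕ → DyadicInterval} {x : ℝ}
    (h1 : ∀ n, (Φ (n + 1)).toSet ⊆ (Φ n).toSet) (h2 : ∀ n, x ∈ (Φ n).toSet)
    (h3 : ∀ δ > 0, ∃ n, ∀ y ∈ (Φ n).toSet, |y - x| ≤ δ) : ShrinksTo Φ x := by
  refine ⟨h1, Set.Subset.antisymm (fun y hy => ?_) ?_⟩
  · rw [Set.mem_singleton_iff]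
    by_contra hne
    have hpos : 0 < |y - x| := abs_pos.2 (sub_ne_zero.2 hne)
    obtain ⟨n, hn⟩ := h3 (|y - x| / 2) (by positivity)
    have := hn y (Set.mem_iInter.1 hy n)
    linarith
  · rintro y rfl
    exact Set.mem_iInter.2 h2

theorem exists_inv_pow_lt (C : ℝ) {δ : ℝ} (hδ : 0 < δ) : ∃ n : ℕ, C / 2 ^ n ≤ δ := by
  obtain ⟨n, hn⟩ := pow_unbounded_of_one_lt (C / δ) (by norm_num : (1 : ℝ) < 2)
  refine ⟨n, ?_⟩
  rw [div_le_iff₀ (by positivity)]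
  rw [div_lt_iff₀ hδ] at hn
  linarith

theorem exists_shrinksTo (x : ℝ) : ∃ Φ, ShrinksTo Φ x ∧
    ∀ n, Set.Icc (x - (2 ^ n)⁻¹) (x + (2 ^ n)⁻¹) ⊆ (Φ n).toSet := by
  let k : ℕ → ℤ := fun n => ⌊x * 2 ^ n⌋
  have hk : ∀ n, (k n : ℝ) ≤ x * 2 ^ n ∧ x * 2 ^ n < k n + 1 := fun n =>
    ⟨Int.floor_le _, Int.lt_floor_add_one _⟩
  have hk1 : ∀ n, 2 * k n ≤ k (n + 1) ∧ k (n + 1) ≤ 2 * k n + 1 := by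
    intro n
    have h1 := hk n
    have h2 := hk (n + 1)
    rw [pow_succ] at h2
    constructor
    · have : (2 * k n : ℝ) < k (n + 1) + 1 := by linarith
      have : 2 * k n < k (n + 1) + 1 := by exact_mod_cast this
      omega
    · have : (k (n + 1) : ℝ) < 2 * k n + 2 := by linarith
      have : k (n + 1) < 2 * k n + 2 := by exact_mod_cast this
      omega
  let Φ : ℕ → DyadicInterval := fun n =>
    .finite (((2 * k n + 1 : ℤ) : ℚ) / 2 ^ (n + 1)) (((3 : ℤ) : ℚ) / 2 ^ (n + 1)) ⟨_, _, rfl⟩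
      ⟨_, _, rfl⟩ (by positivity)
  have hΦ : ∀ n, (Φ n).toSet = Set.Icc ((k n - 1 : ℝ) / 2 ^ n) ((k n + 2 : ℝ) / 2 ^ n) := by
    intro n
    simp only [Φ, DyadicInterval.toSet]
    push_cast
    congr 1 <;> rw [pow_succ] <;> field_simp <;> ring
  have hsub : ∀ n, Set.Icc (x - (2 ^ n)⁻¹) (x + (2 ^ n)⁻¹) ⊆ (Φ n).toSet := by
    intro n
    rw [hΦ]
    have h2 : (0 : ℝ) < 2 ^ n := by positivity
    apply Set.Icc_subset_Icc
    · rw [div_le_iff₀ h2, sub_mul, inv_mul_cancel₀ h2.ne']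
      linarith [(hk n).1]
    · rw [le_div_iff₀ h2, add_mul, inv_mul_cancel₀ h2.ne']
      linarith [(hk n).2]
  refine ⟨Φ, shrinksTo_of ?_ ?_ ?_, hsub⟩
  · intro n
    rw [hΦ, hΦ]
    have h2 : (0 : ℝ) < 2 ^ n := by positivity
    have h := hk1 n
    have ha : (2 * k n : ℝ) ≤ k (n + 1) := by exact_mod_cast h.1
    have hb : (k (n + 1) : ℝ) ≤ 2 * k n + 1 := by exact_mod_cast h.2
    apply Set.Icc_subset_Icc
    · rw [pow_succ, div_le_div_iff₀ h2 (by positivity)]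
      nlinarith
    · rw [pow_succ, div_le_div_iff₀ (by positivity) h2]
      nlinarith
  · intro n
    have : (0 : ℝ) < (2 ^ n)⁻¹ := by positivity
    exact hsub n ⟨by linarith, by linarith⟩
  · intro δ hδ
    obtain ⟨n, hn⟩ := exists_inv_pow_lt 3 hδ
    refine ⟨n, fun y hy => le_trans ?_ hn⟩
    rw [hΦ] at hy
    have h2 : (0 : ℝ) < 2 ^ n := by positivity
    have hy1 := (div_le_iff₀ h2).1 hy.1
    have hy2 := (le_div_iff₀ h2).1 hy.2
    have h := hk n
    rw [abs_le, neg_le, le_div_iff₀ h2, le_div_iff₀ h2]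
    constructor <;> nlinarith

theorem exists_shrinksTo_from (J : DyadicInterval) {x : ℝ} (hx : x ∈ J.toSet) :
    ∃ Φ, Φ 0 = J ∧ ShrinksTo Φ x := by
  cases J with
  | infinite =>
    obtain ⟨Φ, h, -⟩ := exists_shrinksTo x
    refine ⟨fun n => n.casesOn .infinite Φ, rfl, shrinksTo_of ?_ ?_ ?_⟩
    · rintro (_ | n)
      · exact Set.subset_univ _
      · exact h.1 n
    · rintro (_ | n)
      · exact Set.mem_univ _
      · exact h.mem n
    · intro δ hδ
      obtain ⟨n, hn⟩ := exists_inv_pow_lt 1 hδ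
      obtain ⟨N, hN⟩ := h.exists_diamLE n
      refine ⟨N + 1, fun y hy => (hN.dist_le (h.mem N) hy).trans ?_⟩
      rwa [← one_div]
  | finite r ε hr hε pos =>
    have pos' : (0 : ℝ) < ε := by exact_mod_cast pos
    classical
    let g : ℕ → ℚ → ℚ := fun n q =>
      if x ≤ (q : ℝ) then q - ε / 2 ^ (n + 1) else q + ε / 2 ^ (n + 1)
    let c : ℕ → ℚ := fun n => Nat.rec (motive := fun _ => ℚ) r g n
    have hc : ∀ n, c (n + 1) =
        if x ≤ (c n : ℝ) then c n - ε / 2 ^ (n + 1) else c n + ε / 2 ^ (n + 1) := fun n => rfl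
    have hd : ∀ n, IsDyadic (c n) := by
      intro n
      induction n with
      | zero => exact hr
      | succ n ih =>
        rw [hc]
        split_ifs
        · rw [sub_eq_add_neg]
          exact ih.add (hε.div_pow _).neg
        · exact ih.add (hε.div_pow _)
    have hhalf : ∀ n, (ε : ℝ) / 2 ^ n = 2 * (ε / 2 ^ (n + 1)) := by
      intro n
      rw [pow_succ]
      field_simp
    let Φ : ℕ → DyadicInterval := fun n =>
      .finite (c n) (ε / 2 ^ n) (hd n) (hε.div_pow n) (by positivity)
    have hΦ : ∀ n, (Φ n).toSet = Set.Icc ((c n : ℝ) - ε / 2 ^ n) (c n + ε / 2 ^ n) := by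
      intro n
      simp [Φ, DyadicInterval.toSet]
    have hmem : ∀ n, x ∈ (Φ n).toSet := by
      intro n
      rw [hΦ]
      induction n with
      | zero => simpa [c, DyadicInterval.toSet] using hx
      | succ n ih =>
        rw [hc]
        rw [hhalf n] at ih
        obtain ⟨i1, i2⟩ := ih
        split_ifs with h
        · push_cast
          constructor <;> linarith
        · push_cast
          push Not at h
          constructor <;> linarith
    refine ⟨Φ, by simp [Φ, c], shrinksTo_of ?_ hmem ?_⟩
    · intro n
      have hp : (0 : ℝ) < ε / 2 ^ (n + 1) := by positivity
      rw [hΦ (n + 1), hΦ n, hc, hhalf n]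
      apply Set.Icc_subset_Icc <;> split_ifs <;> push_cast <;> linarith
    · intro δ hδ
      obtain ⟨n, hn⟩ := exists_inv_pow_lt (2 * ε) hδ
      refine ⟨n, fun y hy => le_trans ?_ hn⟩
      have hx' := hmem n
      rw [hΦ] at hx' hy
      rw [mul_div_assoc, abs_le]
      constructor <;> linarith [hx'.1, hx'.2, hy.1, hy.2]

theorem IsRealName.unique {χ : Baire} {x y : ℝ} (h : IsRealName χ x) (h' : IsRealName χ y) :
    x = y := by
  obtain ⟨Φ, h1, h2⟩ := h
  obtain ⟨Φ', h1', h2'⟩ := h'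
  obtain rfl := h1.unique h1'
  exact h2.unique h2'

theorem exists_isRealName (x : ℝ) : ∃ χ, IsRealName χ x := by
  obtain ⟨Φ, h, -⟩ := exists_shrinksTo x
  obtain ⟨χ, hχ⟩ := exists_encodesSeq Φ
  exact ⟨χ, Φ, hχ, h⟩

theorem sInf_nat_anti {A B : Set ℕ} (hA : A.Nonempty) (h : A ⊆ B) : sInf B ≤ sInf A :=
  Nat.sInf_le (h (Nat.sInf_mem hA))

theorem realParam_mono {χ : Baire} {x : ℝ} (h : IsRealName χ x) (n : ℕ) :
    realParam χ n ≤ realParam χ (n + 1) := by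
  obtain ⟨Φ, h1, h2⟩ := h
  obtain ⟨N, hN⟩ := h2.exists_diamLE (n + 1)
  unfold realParam
  refine Nat.add_le_add_right (sInf_nat_anti ?_ ?_) _
  · exact ⟨N, Φ, h1, hN⟩
  · rintro m ⟨Φ', h1', hm⟩
    exact ⟨Φ', h1', hm.anti n.le_succ⟩

/-- A name of a continuous function is monotone on the intervals that meet the unit interval. -/
theorem funName_mono {Ψ : DyadicInterval → DyadicInterval} {f : C(unitInterval, ℝ)}
    (h : ∀ (Φ : ℕ → DyadicInterval) (x : unitInterval),
      ShrinksTo Φ x → ShrinksTo (fun n => Ψ (Φ n)) (f x)) {J J' : DyadicInterval}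
    (hJ : (J.toSet ∩ Set.Icc 0 1).Nonempty) (hJJ : J.toSet ⊆ J'.toSet) :
    (Ψ J).toSet ⊆ (Ψ J').toSet := by
  obtain ⟨x, hxJ, hxI⟩ := hJ
  obtain ⟨Φ, rfl, hΦ⟩ := exists_shrinksTo_from J hxJ
  have : ShrinksTo (fun n => n.casesOn J' Φ) x := by
    refine shrinksTo_of ?_ ?_ ?_
    · rintro (_ | n)
      · exact hJJ
      · exact hΦ.1 n
    · rintro (_ | n)
      · exact hJJ hxJ
      · exact hΦ.mem n
    · intro δ hδ
      obtain ⟨n, hn⟩ := exists_inv_pow_lt 1 hδ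
      obtain ⟨N, hN⟩ := hΦ.exists_diamLE n
      refine ⟨N + 1, fun y hy => (hN.dist_le (hΦ.mem N) hy).trans ?_⟩
      rwa [← one_div]
  exact (h _ ⟨x, hxI⟩ this).1 0

/-- The minimum in the parameter of the interval functions exists. -/
theorem exists_modulus {Ψ : DyadicInterval → DyadicInterval} {f : C(unitInterval, ℝ)}
    (h : ∀ (Φ : ℕ → DyadicInterval) (x : unitInterval),
      ShrinksTo Φ x → ShrinksTo (fun n => Ψ (Φ n)) (f x)) (n : ℕ) :
    ∃ N, ∀ J : DyadicInterval, (J.toSet ∩ Set.Icc 0 1).Nonempty → J.DiamLE N →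
      (Ψ J).DiamLE n := by
  by_contra! hc
  choose J hJ hJd hJn using hc
  choose x hxJ hxI using hJ
  obtain ⟨y, hyI, σ, hσ, hlim⟩ := isCompact_Icc.tendsto_subseq hxI
  obtain ⟨Φ, hΦ, hsub⟩ := exists_shrinksTo y
  obtain ⟨M, hM⟩ := (h Φ ⟨y, hyI⟩ hΦ).exists_diamLE n
  have hp : (0 : ℝ) < (2 ^ M)⁻¹ / 2 := by positivity
  obtain ⟨N0, hN0⟩ := Metric.tendsto_atTop.1 hlim _ hp
  have hd := hN0 (max N0 (M + 1)) (le_max_left _ _)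
  set i := σ (max N0 (M + 1)) with hi
  have hiM : M + 1 ≤ i := (le_max_right _ _).trans hσ.le_apply
  have hsubJ : (J i).toSet ⊆ (Φ M).toSet := by
    refine Set.Subset.trans (fun z hz => ?_) (hsub M)
    have h1 := ((hJd i).anti hiM).dist_le (hxJ i) hz
    rw [pow_succ, mul_inv] at h1
    have h2 : |x i - y| < (2 ^ M)⁻¹ / 2 := hd
    have h3 := abs_lt.1 h2
    have h4 := abs_le.1 h1
    constructor <;> linarith
  exact hJn i (le_trans (DyadicInterval.diam_mono (funName_mono h ⟨x i, hxJ i, hxI i⟩ hsubJ)) hM)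

theorem IsFunName.unique {χ : Baire} {f g : C(unitInterval, ℝ)} (h : IsFunName χ f)
    (h' : IsFunName χ g) : f = g := by
  obtain ⟨Ψ, h1, h2⟩ := h
  obtain ⟨Ψ', h1', h2'⟩ := h'
  obtain rfl := h1.unique h1'
  ext x
  obtain ⟨Φ, hΦ, -⟩ := exists_shrinksTo x
  exact (h2 Φ x hΦ).unique (h2' Φ x hΦ)

theorem funParam_mono {χ : Baire} {f : C(unitInterval, ℝ)} (h : IsFunName χ f) (n : ℕ) :
    funParam χ n ≤ funParam χ (n + 1) := by
  obtain ⟨Ψ, h1, h2⟩ := h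
  obtain ⟨N, hN⟩ := exists_modulus h2 (n + 1)
  unfold funParam
  refine Nat.add_le_add_left (sInf_nat_anti ?_ ?_) _
  · exact ⟨N, Ψ, h1, hN⟩
  · rintro m ⟨Ψ', h1', hm⟩
    exact ⟨Ψ', h1', fun J hJ hd => (hm J hJ hd).anti n.le_succ⟩

/-- Every continuous function on the unit interval has a name. -/
theorem exists_isFunName (f : C(unitInterval, ℝ)) : ∃ χ, IsFunName χ f := by
  classical
  -- the values of `f` on an interval
  let V : DyadicInterval → Set ℝ := fun J => f '' {y : unitInterval | (y : ℝ) ∈ J.toSet}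
  have hcomp : IsCompact (Set.range f) := isCompact_range f.continuous
  have hbb : ∀ J, BddBelow (V J) := fun J => hcomp.bddBelow.mono (Set.image_subset_range _ _)
  have hba : ∀ J, BddAbove (V J) := fun J => hcomp.bddAbove.mono (Set.image_subset_range _ _)
  have hV : ∀ {J J' : DyadicInterval}, J.toSet ⊆ J'.toSet → V J ⊆ V J' :=
    fun h => Set.image_mono fun y hy => h hy
  -- the precision for an interval of radius `ε`, and the rounded bounds
  let k : ℚ → ℕ := fun ε => ⌊ε⁻¹⌋₊
  let lo : DyadicInterval → ℕ → ℤ := fun J n => ⌊sInf (V J) * 2 ^ n⌋ - 1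
  let hi : DyadicInterval → ℕ → ℤ := fun J n => ⌈sSup (V J) * 2 ^ n⌉ + 1
  have hlohi : ∀ J n, lo J n < hi J n := by
    intro J n
    have h1 : sInf (V J) * 2 ^ n ≤ sSup (V J) * 2 ^ n :=
      mul_le_mul_of_nonneg_right (Real.sInf_le_sSup _ (hbb J) (hba J)) (by positivity)
    have h2 := Int.floor_le_ceil (sInf (V J) * 2 ^ n)
    have h3 := Int.ceil_mono h1
    simp only [lo, hi]
    omega
  let Ψ : DyadicInterval → DyadicInterval := fun J => match J with
    | .infinite => .infinite
    | .finite r ε hr hε pos => .finite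
        (((lo (.finite r ε hr hε pos) (k ε) + hi (.finite r ε hr hε pos) (k ε) : ℤ) : ℚ)
          / 2 ^ (k ε + 1))
        (((hi (.finite r ε hr hε pos) (k ε) - lo (.finite r ε hr hε pos) (k ε) : ℤ) : ℚ)
          / 2 ^ (k ε + 1)) ⟨_, _, rfl⟩ ⟨_, _, rfl⟩
        (div_pos (by exact_mod_cast sub_pos.2 (hlohi _ _)) (by positivity))
  have hΨ : ∀ r ε hr hε pos, (Ψ (.finite r ε hr hε pos)).toSet =
      Set.Icc ((lo (.finite r ε hr hε pos) (k ε) : ℝ) / 2 ^ k ε)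
        ((hi (.finite r ε hr hε pos) (k ε) : ℝ) / 2 ^ k ε) := by
    intro r ε hr hε pos
    simp only [Ψ, DyadicInterval.toSet]
    push_cast
    congr 1 <;> rw [pow_succ] <;> field_simp <;> ring
  obtain ⟨χ, hχ⟩ := exists_encodesFun Ψ
  refine ⟨χ, Ψ, hχ, fun Φ x hΦ => shrinksTo_of (fun n => ?_) (fun n => ?_) (fun δ hδ => ?_)⟩
  · -- nestedness
    have hsub := hΦ.1 n
    have hdm := DyadicInterval.diam_mono hsub
    have hmemV : f x ∈ V (Φ (n + 1)) := ⟨x, hΦ.mem (n + 1), rfl⟩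
    cases hJ' : Φ n with
    | infinite => exact Set.subset_univ _
    | finite r' ε' hr' hε' pos' =>
      cases hJ : Φ (n + 1) with
      | infinite =>
        rw [hJ, hJ'] at hdm
        exact absurd (top_le_iff.1 hdm) (WithTop.coe_ne_top)
      | finite r ε hr hε pos =>
        rw [hJ, hJ'] at hdm hsub
        rw [hJ] at hmemV
        simp only [DyadicInterval.diam, WithTop.coe_le_coe] at hdm
        have hk : k ε' ≤ k ε := Nat.floor_mono (inv_anti₀ pos (by linarith))
        have h1 := csInf_le_csInf (hbb _) ⟨_, hmemV⟩ (hV hsub)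
        have h2 := csSup_le_csSup (hba _) ⟨_, hmemV⟩ (hV hsub)
        rw [hΨ, hΨ]
        obtain ⟨d, hd⟩ := Nat.exists_eq_add_of_le hk
        have h2p : (0 : ℝ) < 2 ^ k ε' := by positivity
        have h2d : (1 : ℝ) ≤ 2 ^ d := one_le_pow₀ (by norm_num)
        apply Set.Icc_subset_Icc
        · rw [hd, pow_add, div_le_div_iff₀ h2p (by positivity), ← mul_assoc, mul_right_comm]
          refine mul_le_mul_of_nonneg_right ?_ h2p.le
          have h3 : ⌊sInf (V (.finite r' ε' hr' hε' pos')) * 2 ^ k ε'⌋ * 2 ^ d ≤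
              ⌊sInf (V (.finite r ε hr hε pos)) * 2 ^ (k ε' + d)⌋ := by
            rw [Int.le_floor]
            push_cast
            rw [pow_add, ← mul_assoc]
            refine mul_le_mul_of_nonneg_right ?_ (by positivity)
            exact (Int.floor_le _).trans (mul_le_mul_of_nonneg_right h1 h2p.le)
          have h3' : ((⌊sInf (V (.finite r' ε' hr' hε' pos')) * 2 ^ k ε'⌋ : ℤ) : ℝ) * 2 ^ d ≤
              ⌊sInf (V (.finite r ε hr hε pos)) * 2 ^ (k ε' + d)⌋ := by exact_mod_cast h3
          simp only [lo]
          push_cast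
          linarith
        · rw [hd, pow_add, div_le_div_iff₀ (by positivity) h2p, ← mul_assoc, mul_right_comm]
          refine mul_le_mul_of_nonneg_right ?_ h2p.le
          have h3 : ⌈sSup (V (.finite r ε hr hε pos)) * 2 ^ (k ε' + d)⌉ ≤
              ⌈sSup (V (.finite r' ε' hr' hε' pos')) * 2 ^ k ε'⌉ * 2 ^ d := by
            rw [Int.ceil_le]
            push_cast
            rw [pow_add, ← mul_assoc]
            refine mul_le_mul_of_nonneg_right ?_ (by positivity)
            exact (mul_le_mul_of_nonneg_right h2 h2p.le).trans (Int.le_ceil _)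
          have h3' : ((⌈sSup (V (.finite r ε hr hε pos)) * 2 ^ (k ε' + d)⌉ : ℤ) : ℝ) ≤
              (⌈sSup (V (.finite r' ε' hr' hε' pos')) * 2 ^ k ε'⌉ : ℝ) * 2 ^ d := by
            exact_mod_cast h3
          simp only [hi]
          push_cast
          linarith
  · -- membership
    have hmemV : f x ∈ V (Φ n) := ⟨x, hΦ.mem n, rfl⟩
    cases hJ : Φ n with
    | infinite => exact Set.mem_univ _
    | finite r ε hr hε pos =>
      rw [hJ] at hmemV
      have h2p : (0 : ℝ) < 2 ^ k ε := by positivity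
      have h1 := mul_le_mul_of_nonneg_right (csInf_le (hbb _) hmemV) h2p.le
      have h2 := mul_le_mul_of_nonneg_right (le_csSup (hba _) hmemV) h2p.le
      rw [hΨ]
      refine ⟨(div_le_iff₀ h2p).2 ?_, (le_div_iff₀ h2p).2 ?_⟩
      · simp only [lo]
        push_cast
        linarith [Int.floor_le (sInf (V (.finite r ε hr hε pos)) * 2 ^ k ε)]
      · simp only [hi]
        push_cast
        linarith [Int.le_ceil (sSup (V (.finite r ε hr hε pos)) * 2 ^ k ε)]
  · -- convergence
    obtain ⟨η, hη, hcont⟩ := Metric.continuous_iff.1 f.continuous x (δ / 4) (by positivity)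
    obtain ⟨m, hm⟩ := exists_inv_pow_lt 1 (half_pos hη)
    obtain ⟨p, hp⟩ := exists_inv_pow_lt 2 (half_pos hδ)
    obtain ⟨N, hN⟩ := hΦ.exists_diamLE (max m p)
    have hmemV : f x ∈ V (Φ N) := ⟨x, hΦ.mem N, rfl⟩
    have hVb : ∀ v ∈ V (Φ N), |v - f x| ≤ δ / 4 := by
      rintro _ ⟨y, hy, rfl⟩
      refine (hcont y ?_).le
      have := (hN.anti (le_max_left m p)).dist_le (hΦ.mem N) hy
      rw [← one_div] at this
      exact lt_of_le_of_lt (this.trans hm) (half_lt_self hη)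
    refine ⟨N, fun y hy => ?_⟩
    change y ∈ (Ψ (Φ N)).toSet at hy
    cases hJ : Φ N with
    | infinite =>
      rw [hJ] at hN
      simp [DyadicInterval.DiamLE, DyadicInterval.diam] at hN
    | finite r ε hr hε pos =>
      rw [hJ] at hN hy hmemV hVb
      rw [hΨ] at hy
      have hN' := hN.anti (le_max_right m p)
      simp only [DyadicInterval.DiamLE, DyadicInterval.diam, WithTop.coe_le_coe] at hN'
      have hpk : p ≤ k ε := by
        refine Nat.le_floor ?_
        have h1 : ε ≤ (2 ^ p)⁻¹ := by linarith
        have h2 : (2 : ℚ) ^ p ≤ ε⁻¹ := by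
          rw [le_inv_comm₀ (by positivity) pos]
          exact h1
        refine le_trans ?_ h2
        exact_mod_cast (Nat.lt_two_pow_self (n := p)).le
      have h2p : (0 : ℝ) < 2 ^ k ε := by positivity
      have hq : (2 : ℝ) / 2 ^ k ε ≤ δ / 2 := by
        refine le_trans ?_ hp
        gcongr
        norm_num
      rw [div_le_iff₀ h2p] at hq
      have i1 : f x - δ / 4 ≤ sInf (V (.finite r ε hr hε pos)) :=
        le_csInf ⟨_, hmemV⟩ fun v hv => by linarith [(abs_le.1 (hVb v hv)).1]
      have i2 : sSup (V (.finite r ε hr hε pos)) ≤ f x + δ / 4 :=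
        csSup_le ⟨_, hmemV⟩ fun v hv => by linarith [(abs_le.1 (hVb v hv)).2]
      have y1 := (div_le_iff₀ h2p).1 hy.1
      have y2 := (le_div_iff₀ h2p).1 hy.2
      simp only [lo] at y1
      simp only [hi] at y2
      push_cast at y1 y2
      have f1 := Int.lt_floor_add_one (sInf (V (.finite r ε hr hε pos)) * 2 ^ k ε)
      have f2 := Int.ceil_lt_add_one (sSup (V (.finite r ε hr hε pos)) * 2 ^ k ε)
      have j1 := mul_le_mul_of_nonneg_right i1 h2p.le
      have j2 := mul_le_mul_of_nonneg_right i2 h2p.le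
      rw [abs_le]
      constructor
      · refine le_of_mul_le_mul_right ?_ h2p
        nlinarith
      · refine le_of_mul_le_mul_right ?_ h2p
        nlinarith

/-! ### The spaces -/

/-- The parametrised space of interval reals. -/
noncomputable def intervalReals : PreparametrisedSpace ℝ where
  IsName := IsRealName
  isName_unique := IsRealName.unique
  exists_isName := exists_isRealName
  param := realParam
  param_mono := realParam_mono

/-- The unit interval as a subspace of the interval reals. -/
noncomputable def intervalUnit : PreparametrisedSpace unitInterval where
  IsName χ x := IsRealName χ x
  isName_unique h h' := Subtype.ext (h.unique h')
  exists_isName x := exists_isRealName x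
  param := realParam
  param_mono h := realParam_mono h

/-- The parametrised space of interval functions. -/
noncomputable def intervalFunctions : PreparametrisedSpace C(unitInterval, ℝ) where
  IsName := IsFunName
  isName_unique := IsFunName.unique
  exists_isName := exists_isFunName
  param := funParam
  param_mono := funParam_mono

end ParSpace

/-!
`C(I)` with interval functions as names is an exponential object because the two maps that matter
can be computed by machines whose running times and parameters obey explicit bounds. That leaves
two tasks: to say which string functions these machines compute and why they are the right names,
and to produce the machines.

*Real numbers.* The codes of intervals in a name can be arbitrarily long, so they cannot be
copied. Instead, on the code of `2 ^ n`, the first `O(m)` letters of `φ (codeStr m)` are read as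
an approximation (`Cand`) for all `m ≤ n`, and the answer is the code of an interval around the
approximations with the most digits (`HullOf`). This interval can only shrink when approximations
are added (`HullOf.subset`), so that the answers are nested. The time depends on `n` alone, which
makes the identity of the reals polytime computable, and with it that of a product with the unit
interval (`realProg_halts`, `prodProg_halts_fst`, `prodProg_halts_snd`).

*Evaluation.* From names of `f` and `x` approximations to `f x` are collected in the same way. The
`m`th one comes from the value of the name of `f` at a short interval around the `m`th
approximation to `x`, cut off to the unit interval (`evalCand`, `polytimeComputable_eval`).

*Currying.* Let the machine `M` compute `F`, and let `φ` be a name of `z`. For an interval `J` let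
`M` run on `⟨φ, χ⟩` for certain `χ`, the names (`pointName`) of those dyadic numbers `0.c` that
all points of `J`, cut off to the unit interval, are close to (`IsJob`). A run counts only if it
asks for no more digits than `c` has (`GoodQuery`). Then `M` cannot tell `0.c` from any point
close to it, so that the result approximates the values at all points of `J` (`Evaluates.near`).
Conversely, by the time bound `M` asks for short strings only, and `length_query_le` shows that
the runs count once `J` is small (`Evaluates.exists_jobCand`). The interval around all results is
the value at `J`. It depends on the interval `J` alone and not on its code (`mem_jobs_iff`), and
it is monotone in `J` since smaller intervals have more such numbers (`IsJob.anti`). Therefore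
`curryOut` names the function `F (z, ·)` (`Evaluates.isFunName`), which also shows that this
function is continuous. A point of the unit interval has names with parameter at most
`n + 1`; thus all bounds are second-order polynomials in the parameter of `φ` (`exists_curry`).
The identity of `C(I)` is the curried evaluation.

*Machines.* Programs are terms of a small language `Cmd` with finite registers and stacks.
`Compile.machine` turns a program into an oracle machine, and `Exec.haltsWithin` bounds its
running time by the square of that of the program. A universal program `simProg` runs a given
oracle machine and answers its queries by a subprogram (`ex_simProg`), and `curryProg_halts`
combines it with binary arithmetic on the digits of the end points of `J`.
-/

namespace ParSpace

/-! ### Stack programs -/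

/-- The symbols on a stack: what a tape cell may hold. -/
abbrev Sym := Option Letter

/-- What one operation does to a stack. -/
inductive StackAct where
  | keep
  | pop
  | push (x : Sym)

/-- The effect of an action on a stack, whose top is the head of the list. -/
def StackAct.run : StackAct → List Sym → List Sym
  | keep, l => l
  | pop, l => l.tail
  | push x, l => x :: l

/-- What a stack program can see: the tops of its stacks, the next letter of the input and the next
letter of the oracle's last answer. -/
structure Tops (ι : Type) where
  st : ι → Option Sym
  inp : Option Letter
  ans : Option Letter

/-- One operation: the new value of the finite control, an action on each stack, whether a letter of
the input or of the answer is consumed, and the letters appended to the query and to the output. -/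
structure Act (V ι : Type) where
  v : V
  st : ι → StackAct := fun _ => .keep
  inp : Bool := false
  ans : Bool := false
  qry : Option Letter := none
  out : Option Letter := none

/-- The state of a stack program. The lists `inp` and `ans` are what is left of the input and of the
last answer; `qry` and `out` are what has been written so far. -/
@[ext]
structure St (V ι : Type) where
  v : V
  st : ι → List Sym
  inp : Str
  ans : Str
  qry : Str
  out : Str

variable {V ι : Type}

/-- The visible part of a state. -/
def St.tops (σ : St V ι) : Tops ι := ⟨fun i => (σ.st i).head?, σ.inp.head?, σ.ans.head?⟩

/-- The effect of an operation. -/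
def St.act (σ : St V ι) (a : Act V ι) : St V ι where
  v := a.v
  st i := (a.st i).run (σ.st i)
  inp := bif a.inp then σ.inp.tail else σ.inp
  ans := bif a.ans then σ.ans.tail else σ.ans
  qry := σ.qry ++ a.qry.toList
  out := σ.out ++ a.out.toList

/-- Programs that work on finitely many stacks with a finite control. The command `call` replaces
the answer by the value of the oracle on the query and empties the query. -/
inductive Cmd (V ι : Type) where
  | op (f : V → Tops ι → Act V ι)
  | call
  | seq (a b : Cmd V ι)
  | ite (p : V → Tops ι → Bool) (a b : Cmd V ι)
  | loop (p : V → Tops ι → Bool) (a : Cmd V ι)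

namespace Cmd

/-- The commands still to be executed after one step, if `L` is the list of them before it. -/
def next (v : V) (t : Tops ι) : List (Cmd V ι) → List (Cmd V ι)
  | [] => []
  | op _ :: K => K
  | call :: K => K
  | seq a b :: K => a :: b :: K
  | ite p a b :: K => (bif p v t then a else b) :: K
  | loop p a :: K => bif p v t then a :: loop p a :: K else K

/-- The effect on the state of one step. -/
def effect (φ : Baire) (σ : St V ι) : List (Cmd V ι) → St V ι
  | op f :: _ => σ.act (f σ.v σ.tops)
  | call :: _ => { σ with ans := φ σ.qry, qry := [] }
  | _ => σ

/-- One step of a program: the first component lists the commands still to be executed. -/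
def step (φ : Baire) (x : List (Cmd V ι) × St V ι) : List (Cmd V ι) × St V ι :=
  (next x.2.v x.2.tops x.1, effect φ x.2 x.1)

/-- The continuations that occur when `c` is executed before the continuation `K`. -/
def conts : Cmd V ι → List (Cmd V ι) → Set (List (Cmd V ι))
  | op f, K => {op f :: K}
  | call, K => {call :: K}
  | seq a b, K => {seq a b :: K} ∪ a.conts (b :: K) ∪ b.conts K
  | ite p a b, K => {ite p a b :: K} ∪ a.conts K ∪ b.conts K
  | loop p a, K => {loop p a :: K} ∪ a.conts (loop p a :: K)

theorem conts_finite (c : Cmd V ι) (K : List (Cmd V ι)) : (c.conts K).Finite := by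
  induction c generalizing K with
  | op f => exact Set.finite_singleton _
  | call => exact Set.finite_singleton _
  | seq a b iha ihb => exact ((Set.finite_singleton _).union (iha _)).union (ihb _)
  | ite p a b iha ihb => exact ((Set.finite_singleton _).union (iha _)).union (ihb _)
  | loop p a ih => exact (Set.finite_singleton _).union (ih _)

theorem mem_conts (c : Cmd V ι) (K : List (Cmd V ι)) : c :: K ∈ c.conts K := by
  cases c <;> simp [conts]

theorem next_mem_conts (v : V) (t : Tops ι) (c : Cmd V ι) (K L : List (Cmd V ι))
    (h : L ∈ c.conts K) : next v t L ∈ c.conts K ∨ next v t L = K := by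
  induction c generalizing K with
  | op f => obtain rfl := h; exact .inr rfl
  | call => obtain rfl := h; exact .inr rfl
  | seq a b iha ihb =>
    rcases h with (h | h) | h
    · obtain rfl := h
      exact .inl (.inl (.inr (mem_conts _ _)))
    · rcases iha _ h with h | h
      · exact .inl (.inl (.inr h))
      · exact .inl (.inr (h ▸ mem_conts _ _))
    · rcases ihb _ h with h | h
      · exact .inl (.inr h)
      · exact .inr h
  | ite p a b iha ihb =>
    rcases h with (h | h) | h
    · obtain rfl := h
      simp only [next]
      cases p v t
      · exact .inl (.inr (mem_conts _ _))
      · exact .inl (.inl (.inr (mem_conts _ _)))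
    · rcases iha _ h with h | h
      · exact .inl (.inl (.inr h))
      · exact .inr h
    · rcases ihb _ h with h | h
      · exact .inl (.inr h)
      · exact .inr h
  | loop p a ih =>
    rcases h with h | h
    · obtain rfl := h
      simp only [next]
      cases p v t
      · exact .inr rfl
      · exact .inl (.inr (mem_conts _ _))
    · rcases ih _ h with h | h
      · exact .inl (.inr h)
      · exact .inl (h ▸ .inl rfl)

/-- The continuations of a program. They serve as states of the machine that executes it. -/
abbrev Kont (c : Cmd V ι) : Type := {L : List (Cmd V ι) // L ∈ c.conts [] ∪ {[]}}

instance (c : Cmd V ι) : Finite (Kont c) :=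
  ((c.conts_finite []).union (Set.finite_singleton _)).to_subtype

theorem next_mem (v : V) (t : Tops ι) (c : Cmd V ι) (L : Kont c) :
    next v t L.1 ∈ c.conts [] ∪ {[]} := by
  rcases L.2 with h | h
  · exact next_mem_conts v t c [] _ h
  · rw [Set.mem_singleton_iff] at h
    rw [h]
    exact .inr rfl

/-- The next continuation. -/
def Kont.next {c : Cmd V ι} (v : V) (t : Tops ι) (L : Kont c) : Kont c :=
  ⟨Cmd.next v t L.1, next_mem v t c L⟩

end Cmd

/-! ### Execution with time bounds -/

/-- With oracle `φ` the program `c` leads from the state `σ` to the state `σ'` in at most `T`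
steps. -/
def Exec (φ : Baire) (c : Cmd V ι) (σ : St V ι) (T : ℕ) (σ' : St V ι) : Prop :=
  ∃ t ≤ T, ∀ K, (Cmd.step φ)^[t] (c :: K, σ) = (K, σ')

namespace Exec

variable {φ : Baire} {c c' : Cmd V ι} {σ σ₁ σ₂ : St V ι} {T T₁ T₂ : ℕ}

theorem mono (h : Exec φ c σ T₁ σ₁) (hT : T₁ ≤ T₂) : Exec φ c σ T₂ σ₁ := by
  obtain ⟨t, ht, h⟩ := h
  exact ⟨t, ht.trans hT, h⟩

theorem congr (h : Exec φ c σ T₁ σ₁) (hσ : σ₁ = σ₂) (hT : T₁ ≤ T₂) : Exec φ c σ T₂ σ₂ :=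
  hσ ▸ h.mono hT

theorem op (f : V → Tops ι → Act V ι) (σ : St V ι) :
    Exec φ (.op f) σ 1 (σ.act (f σ.v σ.tops)) :=
  ⟨1, le_rfl, fun _ => rfl⟩

theorem call (σ : St V ι) : Exec φ .call σ 1 { σ with ans := φ σ.qry, qry := [] } :=
  ⟨1, le_rfl, fun _ => rfl⟩

theorem seq (h₁ : Exec φ c σ T₁ σ₁) (h₂ : Exec φ c' σ₁ T₂ σ₂) :
    Exec φ (.seq c c') σ (T₁ + T₂ + 1) σ₂ := by
  obtain ⟨t₁, ht₁, h₁⟩ := h₁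
  obtain ⟨t₂, ht₂, h₂⟩ := h₂
  refine ⟨t₂ + t₁ + 1, by omega, fun K => ?_⟩
  rw [Function.iterate_succ_apply, Function.iterate_add_apply]
  change (Cmd.step φ)^[t₂] ((Cmd.step φ)^[t₁] (c :: c' :: K, σ)) = _
  rw [h₁, h₂]

theorem ite_true {p : V → Tops ι → Bool} (hp : p σ.v σ.tops = true) (h : Exec φ c σ T σ₁) :
    Exec φ (.ite p c c') σ (T + 1) σ₁ := by
  obtain ⟨t, ht, h⟩ := h
  refine ⟨t + 1, by omega, fun K => ?_⟩
  rw [Function.iterate_succ_apply]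
  simpa [Cmd.step, Cmd.next, Cmd.effect, hp] using h K

theorem ite_false {p : V → Tops ι → Bool} (hp : p σ.v σ.tops = false) (h : Exec φ c' σ T σ₁) :
    Exec φ (.ite p c c') σ (T + 1) σ₁ := by
  obtain ⟨t, ht, h⟩ := h
  refine ⟨t + 1, by omega, fun K => ?_⟩
  rw [Function.iterate_succ_apply]
  simpa [Cmd.step, Cmd.next, Cmd.effect, hp] using h K

theorem loop_end {p : V → Tops ι → Bool} (hp : p σ.v σ.tops = false) :
    Exec φ (.loop p c) σ 1 σ :=
  ⟨1, le_rfl, fun K => by simp [Cmd.step, Cmd.next, Cmd.effect, hp]⟩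

theorem loop_step {p : V → Tops ι → Bool} (hp : p σ.v σ.tops = true) (h₁ : Exec φ c σ T₁ σ₁)
    (h₂ : Exec φ (.loop p c) σ₁ T₂ σ₂) : Exec φ (.loop p c) σ (T₁ + T₂ + 1) σ₂ := by
  obtain ⟨t₁, ht₁, h₁⟩ := h₁
  obtain ⟨t₂, ht₂, h₂⟩ := h₂
  refine ⟨t₂ + t₁ + 1, by omega, fun K => ?_⟩
  rw [Function.iterate_succ_apply, Function.iterate_add_apply]
  have : Cmd.step φ (Cmd.loop p c :: K, σ) = (c :: Cmd.loop p c :: K, σ) := by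
    simp [Cmd.step, Cmd.next, Cmd.effect, hp]
  rw [this, h₁, h₂]

/-- A loop that consumes the list `l`: the family `S` describes the state in terms of the rest of
the list and of an accumulated value. -/
theorem loop_foldl {α β : Type*} {p : V → Tops ι → Bool} (S : List α → β → St V ι) (g : β → α → β)
    (T : ℕ) (hend : ∀ b, p (S [] b).v (S [] b).tops = false)
    (hp : ∀ x l b, p (S (x :: l) b).v (S (x :: l) b).tops = true)
    (hstep : ∀ x l b, Exec φ c (S (x :: l) b) T (S l (g b x))) (l : List α) (b : β) :
    Exec φ (.loop p c) (S l b) (l.length * (T + 1) + 1) (S [] (l.foldl g b)) := by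
  induction l generalizing b with
  | nil => simpa using loop_end (hend b)
  | cons x l ih =>
    refine (loop_step (hp x l b) (hstep x l b) (ih _)).mono ?_
    simp only [List.length_cons]
    ring_nf
    omega

end Exec

/-! ### Tapes that hold lists -/

theorem Tape.act_stay (T : Tape) : T.act (T.cells T.head) .stay = T := by
  cases T
  simp [Tape.act, Move.shift]

theorem Tape.content_of_getD (T : Tape) (l : List Sym)
    (h : ∀ n : ℕ, T.cells n = l.getD n none) :
    T.content = (l.takeWhile Option.isSome).filterMap id := by
  have hex : ∃ n : ℕ, T.cells n = none := ⟨l.length, by simp [h]⟩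
  rw [Tape.content, dif_pos hex]
  have hfind : Nat.find hex = (l.takeWhile Option.isSome).length := by
    rw [Nat.find_eq_iff]
    refine ⟨?_, fun n hn => ?_⟩
    · rw [h]
      clear h hex
      induction l with
      | nil => rfl
      | cons x l ih => cases x <;> simp_all
    · rw [h]
      clear h hex
      induction l generalizing n with
      | nil => simp at hn
      | cons x l ih =>
        cases x with
        | none => simp at hn
        | some x =>
          cases n with
          | zero => simp
          | succ n => simpa using ih n (by simpa using hn)
  rw [hfind]
  have key : (l.takeWhile Option.isSome) = (List.range (l.takeWhile Option.isSome).length).map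
      fun i : ℕ => T.cells i := by
    apply List.ext_getElem (by simp)
    intro n h1 h2
    rw [List.getElem_map, List.getElem_range, h]
    rw [(List.takeWhile_prefix Option.isSome (l := l)).getElem h1]
    rw [List.getD_eq_getElem]
  conv_rhs => rw [key, List.filterMap_map]
  rfl

theorem Tape.content_cellsOf (w : Str) (z : ℤ) : (Tape.mk (cellsOf w) z).content = w := by
  rw [Tape.content_of_getD _ (w.map some)]
  · rw [List.takeWhile_eq_self_iff.2 (by simp)]
    simp [List.filterMap_map]
  · intro n
    simp only [cellsOf, Int.natCast_nonneg, ↓reduceIte, Int.toNat_natCast]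
    grind

/-- From its head on the tape holds the sequence `f`; to the left of the head it is blank. -/
def Tape.HoldsRight (T : Tape) (f : ℕ → Option Letter) : Prop :=
  T.cells = fun j => if T.head ≤ j then f (j - T.head).toNat else none

theorem Tape.HoldsRight.read {T : Tape} {f : ℕ → Option Letter} (h : T.HoldsRight f) :
    T.cells T.head = f 0 := by
  rw [h]; simp

theorem Tape.HoldsRight.pop {T : Tape} {f : ℕ → Option Letter} (h : T.HoldsRight f) :
    (T.act none .right).HoldsRight fun n => f (n + 1) := by
  unfold Tape.HoldsRight at *
  funext j
  change Function.update T.cells T.head none j =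
    if T.head + 1 ≤ j then f ((j - (T.head + 1)).toNat + 1) else none
  grind

theorem Tape.HoldsRight.push {T : Tape} {f : ℕ → Option Letter} (h : T.HoldsRight f)
    (s : Option Letter) :
    ((T.act (T.cells T.head) .left).act s .stay).HoldsRight fun n =>
      if n = 0 then s else f (n - 1) := by
  unfold Tape.HoldsRight at *
  funext j
  simp only [Tape.act, Move.shift, Function.update_eq_self]
  grind

theorem Tape.HoldsRight.congr {T : Tape} {f g : ℕ → Option Letter} (h : T.HoldsRight f)
    (hfg : ∀ n, f n = g n) : T.HoldsRight g := by
  rwa [show g = f from funext fun n => (hfg n).symm]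

/-- The tape holds the string `w` from cell `0` on, and the head stands on its last letter. -/
def Tape.HoldsLeft (T : Tape) (w : Str) : Prop :=
  T.cells = cellsOf w ∧ T.head = (w.length : ℤ) - 1

theorem Tape.HoldsLeft.append {T : Tape} {w : Str} (h : T.HoldsLeft w) (x : Letter) :
    ((T.act (T.cells T.head) .right).act (some x) .stay).HoldsLeft (w ++ [x]) := by
  obtain ⟨h1, h2⟩ := h
  refine ⟨?_, by simp [Tape.act, Move.shift, h2]⟩
  funext j
  simp only [Tape.act, Move.shift, Function.update_eq_self, h2, sub_add_cancel]
  by_cases hj : j = w.length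
  · subst hj; simp [cellsOf]
  · rw [Function.update_of_ne hj, h1]
    simp only [cellsOf]
    grind

theorem Tape.HoldsLeft.dropLast {T : Tape} {w : Str} {x : Letter} (h : T.HoldsLeft (w ++ [x])) :
    (T.act none .left).HoldsLeft w := by
  obtain ⟨h1, h2⟩ := h
  simp only [List.length_append, List.length_singleton, Nat.cast_add, Nat.cast_one,
    add_sub_cancel_right] at h2
  refine ⟨?_, by simp [Tape.act, Move.shift, h2]; ring⟩
  funext j
  simp only [Tape.act, h2]
  by_cases hj : j = w.length
  · subst hj; simp [cellsOf]
  · rw [Function.update_of_ne hj, h1]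
    simp only [cellsOf]
    grind

theorem Tape.HoldsLeft.read {T : Tape} {w : Str} (h : T.HoldsLeft w) :
    T.cells T.head = w.getLast? := by
  obtain ⟨h1, h2⟩ := h
  rw [h1, h2, cellsOf, List.getLast?_eq_getElem?]
  split_ifs with h0
  · congr 1
    omega
  · rw [List.getElem?_eq_none]
    omega

/-! ### Stack programs run on oracle machines -/

namespace Compile

variable {V ι : Type}

instance : Finite Letter :=
  Finite.of_surjective (fun x : Option Bool => match x with | none => Letter.sep | some b => .bit b)
    (by rintro (b | _); exacts [⟨some b, rfl⟩, ⟨none, rfl⟩])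

instance : Finite StackAct :=
  Finite.of_surjective
    (fun x : Option (Option Sym) => match x with
      | none => StackAct.keep
      | some none => .pop
      | some (some x) => .push x)
    (by rintro (_ | _ | x); exacts [⟨none, rfl⟩, ⟨some none, rfl⟩, ⟨some (some x), rfl⟩])

instance [Finite V] [Finite ι] : Finite (Act V ι) :=
  Finite.of_injective
    (fun a : Act V ι => (a.v, a.st, a.inp, a.ans, a.qry, a.out))
    (by rintro ⟨_, _, _, _, _, _⟩ ⟨_, _, _, _, _, _⟩ h; simpa using h)

/-- The states of the machine for the program `c`. Its main states `run` carry a continuation and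
the finite control of the program; an operation takes a second step, in the state `write`. -/
inductive State (c : Cmd V ι) where
  | init
  | run (L : Cmd.Kont c) (v : V)
  | write (L : Cmd.Kont c) (a : Act V ι)
  | rewind
  | oracle
  | resume
  | halt

instance (c : Cmd V ι) [Finite V] [Finite ι] : Finite (State c) :=
  Finite.of_surjective
    (fun x : Fin 5 ⊕ (Cmd.Kont c × V) ⊕ (Cmd.Kont c × Act V ι) => match x with
      | .inl 0 => State.init
      | .inl 1 => .rewind
      | .inl 2 => .oracle
      | .inl 3 => .resume
      | .inl 4 => .halt
      | .inr (.inl (L, v)) => .run L v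
      | .inr (.inr (L, a)) => .write L a)
    (by
      rintro (_ | ⟨L, v⟩ | ⟨L, a⟩ | _ | _ | _ | _)
      exacts [⟨.inl 0, rfl⟩, ⟨.inr (.inl (L, v)), rfl⟩, ⟨.inr (.inr (L, a)), rfl⟩, ⟨.inl 1, rfl⟩,
        ⟨.inl 2, rfl⟩, ⟨.inl 3, rfl⟩, ⟨.inl 4, rfl⟩])

/-- The names of the work tapes. Each stack has one tape for each symbol, which marks the places of
that symbol in the stack. The tape `pos` counts the letters of the answer that have been consumed.
The tapes `ret` hold the return address of an oracle call. -/
inductive WorkIx (c : Cmd V ι) where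
  | stk (i : ι) (x : Sym)
  | pos
  | ret (L : Cmd.Kont c) (v : V)

instance (c : Cmd V ι) [Finite V] [Finite ι] : Finite (WorkIx c) :=
  Finite.of_surjective
    (fun x : Unit ⊕ (ι × Sym) ⊕ (Cmd.Kont c × V) => match x with
      | .inl _ => WorkIx.pos
      | .inr (.inl (i, x)) => .stk i x
      | .inr (.inr (L, v)) => .ret L v)
    (by
      rintro (⟨i, x⟩ | _ | ⟨L, v⟩)
      exacts [⟨.inr (.inl (i, x)), rfl⟩, ⟨.inl (), rfl⟩, ⟨.inr (.inr (L, v)), rfl⟩])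

variable (c : Cmd V ι) [Finite V] [Finite ι]

/-- A numbering of the work tapes. -/
noncomputable def ix : WorkIx c ≃ Fin (Nat.card (WorkIx c)) := Finite.equivFin _

variable {c}

/-- The tape with a given name. -/
noncomputable def tp (w : WorkIx c) : TapeIx (Nat.card (WorkIx c)) := .work (ix c w)

variable (c) in
/-- The indices of the tapes of the machine for `c`. -/
abbrev TIx := TapeIx (Nat.card (WorkIx c))

/-- A family indexed by the tapes. -/
noncomputable def fam {β : Type} (inp out qry ans : β) (wk : WorkIx c → β) : TIx c → β
  | .input => inp
  | .output => out
  | .query => qry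
  | .answer => ans
  | .work i => wk ((ix c).symm i)

section fam
variable {β : Type} (inp out qry ans : β) (wk : WorkIx c → β)
@[simp] theorem fam_input : fam inp out qry ans wk .input = inp := rfl
@[simp] theorem fam_output : fam inp out qry ans wk .output = out := rfl
@[simp] theorem fam_query : fam inp out qry ans wk .query = qry := rfl
@[simp] theorem fam_answer : fam inp out qry ans wk .answer = ans := rfl
@[simp] theorem fam_tp (w : WorkIx c) : fam inp out qry ans wk (tp w) = wk w := by simp [fam, tp]
end fam

open Classical in
/-- The tops of the stacks, as read from the tapes. -/
noncomputable def topsOf (s : TIx c → Option Letter) : Tops ι where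
  st i := if h : ∃ x, s (tp (.stk i x)) ≠ none then some h.choose else none
  inp := s .input
  ans := s .answer

/-- What an operation does in its first step to the tapes of a stack. -/
def act1 (s : Option Letter) : StackAct → Option Letter × Move
  | .keep => (s, .stay)
  | .pop => (none, .right)
  | .push _ => (s, .left)

open Classical in
/-- The mark for the symbol `x` in a place of a stack. -/
noncomputable def mark (x : Sym) (o : Option Sym) : Option Letter :=
  if o = some x then some .sep else none

/-- What an operation does in its second step to a tape of a stack. -/
noncomputable def act2 (s : Option Letter) (x : Sym) : StackAct → Option Letter × Move
  | .push y => (mark x (some y), .stay)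
  | _ => (s, .stay)

open Classical in
/-- The transition function of the machine for `c` with initial control `v₀`. -/
noncomputable def transition (L₀ : Cmd.Kont c) (v₀ : V) (q : State c) (s : TIx c → Option Letter) :
    State c × (TIx c → Option Letter × Move) :=
  let idle : TIx c → Option Letter × Move := fun i => (s i, .stay)
  match q with
  | .init => (.run L₀ v₀, fam (s .input, .stay) (s .output, .left) (s .query, .left)
      (s .answer, .stay) fun
        | .pos => (s (tp .pos), .left)
        | w => (s (tp w), .stay))
  | .run L v => match L.1 with
    | [] => (.halt, idle)
    | .op f :: _ =>
      let a := f v (topsOf s)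
      (.write (L.next v (topsOf s)) a,
        fam (if a.inp then (none, .right) else (s .input, .stay))
          (s .output, if a.out.isSome then .right else .stay)
          (s .query, if a.qry.isSome then .right else .stay)
          (if a.ans then (none, .right) else (s .answer, .stay)) fun
            | .stk i x => act1 (s (tp (.stk i x))) (a.st i)
            | .pos => (s (tp .pos), if a.ans then .right else .stay)
            | .ret L v => (s (tp (.ret L v)), .stay))
    | .call :: _ => (.rewind,
        fam (s .input, .stay) (s .output, .stay) (s .query, .stay) (s .answer, .stay) fun w =>
          if w = .ret (L.next v (topsOf s)) v then (some .sep, .stay) else (s (tp w), .stay))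
    | _ => (.run (L.next v (topsOf s)) v, idle)
  | .write L a => (.run L a.v,
      fam (s .input, .stay) (if a.out.isSome then a.out else s .output, .stay)
        (if a.qry.isSome then a.qry else s .query, .stay) (s .answer, .stay) fun
          | .stk i x => act2 (s (tp (.stk i x))) x (a.st i)
          | .pos => (if a.ans then some .sep else s (tp .pos), .stay)
          | .ret L v => (s (tp (.ret L v)), .stay))
  | .rewind =>
    if s (tp .pos) = none then (.oracle, idle)
    else (.rewind, fam (s .input, .stay) (s .output, .stay) (s .query, .stay) (s .answer, .left)
      fun | .pos => (none, .left) | w => (s (tp w), .stay))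
  | .resume =>
    if s .query = none then
      if h : ∃ r : Cmd.Kont c × V, s (tp (.ret r.1 r.2)) ≠ none then
        (.run h.choose.1 h.choose.2,
          fam (s .input, .stay) (s .output, .stay) (s .query, .stay) (s .answer, .stay) fun
            | .ret _ _ => (none, .stay)
            | w => (s (tp w), .stay))
      else (.halt, idle)
    else (.resume, fam (s .input, .stay) (s .output, .stay) (none, .left) (s .answer, .stay)
      fun w => (s (tp w), .stay))
  | _ => (.halt, idle)

variable (c) in
open Classical in
/-- The machine that executes the program `c` with initial control `v₀`. -/
noncomputable def machine (v₀ : V) : OracleMachine where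
  State := State c
  decEq := Classical.decEq _
  workTapes := Nat.card (WorkIx c)
  start := .init
  oracle := .oracle
  resume := .resume
  halt := .halt
  transition := transition ⟨[c], .inl (c.mem_conts [])⟩ v₀

/-- The tapes represent the state `σ`, after `k` letters of the current answer have been
consumed. -/
structure Holds (tape : TIx c → Tape) (σ : St V ι) (k : ℕ) : Prop where
  inp : (tape .input).HoldsRight fun n => σ.inp[n]?
  out : (tape .output).HoldsLeft σ.out
  qry : (tape .query).HoldsLeft σ.qry
  ans : (tape .answer).HoldsRight fun n => σ.ans[n]?
  head_ans : (tape .answer).head = k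
  stk (i : ι) (x : Sym) : (tape (tp (.stk i x))).HoldsRight fun n =>
    mark x (σ.st i)[n]?
  pos : (tape (tp .pos)).HoldsLeft (List.replicate k .sep)
  ret (L v) : (tape (tp (.ret L v))).cells = fun _ => none

theorem Holds.tops {tape : TIx c → Tape} {σ : St V ι} {k : ℕ} (h : Holds tape σ k) :
    topsOf (fun i => (tape i).cells (tape i).head) = σ.tops := by
  have hst : ∀ i x, ((tape (tp (.stk i x))).cells (tape (tp (.stk i x))).head) ≠ none ↔
      (σ.st i).head? = some x := by
    intro i x
    rw [(h.stk i x).read]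
    cases σ.st i <;> simp [mark]
  simp only [topsOf, St.tops, Tops.mk.injEq]
  refine ⟨?_, ?_, ?_⟩
  · funext i
    split_ifs with h1
    · exact ((hst i _).1 h1.choose_spec).symm
    · cases h2 : (σ.st i).head? with
      | none => rfl
      | some x => exact absurd ⟨x, (hst i x).2 h2⟩ h1
  · rw [h.inp.read]; cases σ.inp <;> rfl
  · rw [h.ans.read]; cases σ.ans <;> rfl

variable {v₀ : V} {φ : Baire}

/-- A configuration of the machine. -/
structure Cfg (c : Cmd V ι) [Finite V] [Finite ι] where
  state : State c
  tape : TIx c → Tape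

variable (v₀ φ) in
/-- One step of the machine. -/
noncomputable def step (x : Cfg c) : Cfg c :=
  match x.state with
  | .halt => x
  | .oracle =>
    { state := .resume
      tape := fun
        | .answer => ⟨cellsOf (φ (x.tape .query).content), (x.tape .answer).head⟩
        | i => x.tape i }
  | q =>
    let r := transition ⟨[c], .inl (c.mem_conts [])⟩ v₀ q fun i => (x.tape i).cells (x.tape i).head
    ⟨r.1, fun i => (x.tape i).act (r.2 i).1 (r.2 i).2⟩

/-- A configuration as one of an oracle machine. -/
noncomputable def Cfg.config (v₀ : V) (x : Cfg c) : (machine c v₀).Config := ⟨x.state, x.tape⟩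

theorem step_config (x : Cfg c) :
    (machine c v₀).step φ (x.config v₀) = (step v₀ φ x).config v₀ := by
  obtain ⟨q, tape⟩ := x
  have ne {q : State c} (h1 : q ≠ .halt) (h2 : q ≠ .oracle) :
      (machine c v₀).step φ (Cfg.config v₀ ⟨q, tape⟩) =
        let r := transition ⟨[c], .inl (c.mem_conts [])⟩ v₀ q fun i =>
          (tape i).cells (tape i).head
        Cfg.config v₀ ⟨r.1, fun i => (tape i).act (r.2 i).1 (r.2 i).2⟩ :=
    (if_neg h1).trans (if_neg h2)
  cases q with
  | halt => exact if_pos rfl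
  | oracle =>
    refine (if_neg (show State.oracle ≠ State.halt by simp)).trans ((if_pos rfl).trans ?_)
    refine congrArg (OracleMachine.Config.mk (M := machine c v₀) State.resume) ?_
    funext i
    cases i <;> rfl
  | init => exact ne (by simp) (by simp)
  | run L v => exact ne (by simp) (by simp)
  | write L a => exact ne (by simp) (by simp)
  | rewind => exact ne (by simp) (by simp)
  | resume => exact ne (by simp) (by simp)

/-- The tapes at the start. -/
def initTape (a : Str) : TIx c → Tape
  | .input => ⟨cellsOf a, 0⟩
  | _ => ⟨cellsOf [], 0⟩

theorem init_eq (a : Str) :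
    (machine c v₀).init a = Cfg.config v₀ ⟨.init, initTape a⟩ := by
  refine congrArg (OracleMachine.Config.mk (M := machine c v₀) State.init) ?_
  funext i
  cases i <;> rfl

theorem step_op {tape : TIx c → Tape} {σ : St V ι} {k : ℕ} (h : Holds tape σ k) (L : Cmd.Kont c)
    (f : V → Tops ι → Act V ι) (K : List (Cmd V ι)) (hL : L.1 = .op f :: K) :
    ∃ tape', (step v₀ φ)^[2] ⟨.run L σ.v, tape⟩ =
      ⟨.run (L.next σ.v σ.tops) (f σ.v σ.tops).v, tape'⟩ ∧
      Holds tape' (σ.act (f σ.v σ.tops)) (k + (f σ.v σ.tops).ans.toNat) := by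
  rw [Function.iterate_succ_apply, Function.iterate_one]
  simp only [step, transition, hL, h.tops]
  refine ⟨_, rfl, ?_⟩
  set a := f σ.v σ.tops
  constructor
  · simp only [fam_input, St.act]
    cases a.inp
    · simpa [Tape.act_stay] using h.inp
    · simp only [↓reduceIte, Tape.act_stay, cond_true]
      exact h.inp.pop.congr fun n => by simp
  · simp only [fam_output, St.act]
    cases a.out
    · simpa [Tape.act_stay] using h.out
    · simpa using h.out.append _
  · simp only [fam_query, St.act]
    cases a.qry
    · simpa [Tape.act_stay] using h.qry
    · simpa using h.qry.append _
  · simp only [fam_answer, St.act]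
    cases a.ans
    · simpa [Tape.act_stay] using h.ans
    · simp only [↓reduceIte, Tape.act_stay, cond_true]
      exact h.ans.pop.congr fun n => by simp
  · simp only [fam_answer]
    have := h.head_ans
    cases a.ans <;> simp [Tape.act, Move.shift, this]
  · intro i x
    simp only [fam_tp, St.act]
    cases a.st i with
    | keep => simpa [act1, act2, Tape.act_stay, StackAct.run] using h.stk i x
    | pop =>
      simp only [act1, act2, Tape.act_stay, StackAct.run]
      exact (h.stk i x).pop.congr fun n => by simp
    | push y =>
      simp only [act1, act2, StackAct.run]
      refine ((h.stk i x).push _).congr fun n => ?_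
      cases n <;> simp
  · simp only [fam_tp]
    cases a.ans
    · simpa [Tape.act_stay] using h.pos
    · simpa [List.replicate_succ'] using h.pos.append .sep
  · intro L v
    simp only [fam_tp, Tape.act_stay]
    exact h.ret L v

theorem step_silent {tape : TIx c → Tape} {σ : St V ι} {k : ℕ} (h : Holds tape σ k)
    (L : Cmd.Kont c) (h0 : L.1 ≠ []) (h1 : ∀ f K, L.1 ≠ .op f :: K) (h2 : ∀ K, L.1 ≠ .call :: K) :
    step v₀ φ ⟨.run L σ.v, tape⟩ = ⟨.run (L.next σ.v σ.tops) σ.v, tape⟩ := by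
  simp only [step, transition]
  simp [h.tops, Tape.act_stay]

/-- Before an oracle call the head of the answer tape is moved back to cell `0`; the marks on the
tape `pos` count the steps left. -/
theorem rewind_run (k : ℕ) (tape : TIx c → Tape)
    (hpos : (tape (tp .pos)).HoldsLeft (List.replicate k .sep)) (hans : (tape .answer).head = k) :
    ∃ tape', (step v₀ φ)^[k + 1] ⟨.rewind, tape⟩ = ⟨.oracle, tape'⟩ ∧
      (tape' .answer).head = 0 ∧ (tape' (tp .pos)).HoldsLeft [] ∧
      tape' .input = tape .input ∧ tape' .output = tape .output ∧ tape' .query = tape .query ∧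
      ∀ w, w ≠ .pos → tape' (tp w) = tape (tp w) := by
  induction k generalizing tape with
  | zero =>
    refine ⟨tape, ?_, by simpa using hans, hpos, rfl, rfl, rfl, fun _ _ => rfl⟩
    have hr := hpos.read
    simp only [List.replicate_zero, List.getLast?_nil] at hr
    simp [step, transition, hr, Tape.act_stay]
  | succ k ih =>
    have hr := hpos.read
    rw [List.replicate_succ', List.getLast?_concat] at hr
    rw [List.replicate_succ'] at hpos
    have e1 : ∃ tape1, step v₀ φ ⟨.rewind, tape⟩ = ⟨.rewind, tape1⟩ ∧
        tape1 (tp .pos) = (tape (tp .pos)).act none .left ∧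
        tape1 .answer = (tape .answer).act ((tape .answer).cells (tape .answer).head) .left ∧
        tape1 .input = tape .input ∧ tape1 .output = tape .output ∧
        tape1 .query = tape .query ∧ ∀ w, w ≠ .pos → tape1 (tp w) = tape (tp w) := by
      simp only [step, transition, hr, reduceCtorEq, ↓reduceIte]
      refine ⟨_, rfl, by simp, by simp, by simp [Tape.act_stay], by simp [Tape.act_stay],
        by simp [Tape.act_stay], fun w hw => ?_⟩
      cases w <;> simp [Tape.act_stay] at hw ⊢
    obtain ⟨tape1, e1, p1, a1, i1, o1, q1, w1⟩ := e1
    obtain ⟨tape', e, h1, h2, h3, h4, h5, h6⟩ := ih tape1 (p1 ▸ hpos.dropLast) (by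
      simp only [a1, Tape.act, Move.shift, hans]; push_cast; ring)
    refine ⟨tape', ?_, h1, h2, h3.trans i1, h4.trans o1, h5.trans q1,
      fun w hw => (h6 w hw).trans (w1 w hw)⟩
    rw [Function.iterate_succ_apply, e1, e]

/-- After an oracle call the query tape is erased, and the tape `ret` that carries a mark tells where
the execution goes on. -/
theorem resume_run (w : Str) (tape : TIx c → Tape) (r : Cmd.Kont c × V)
    (hq : (tape .query).HoldsLeft w)
    (hr : ∀ L v, (tape (tp (.ret L v))).cells (tape (tp (.ret L v))).head ≠ none ↔ (L, v) = r) :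
    ∃ tape', (step v₀ φ)^[w.length + 1] ⟨.resume, tape⟩ = ⟨.run r.1 r.2, tape'⟩ ∧
      (tape' .query).HoldsLeft [] ∧
      tape' .input = tape .input ∧ tape' .output = tape .output ∧ tape' .answer = tape .answer ∧
      (∀ i x, tape' (tp (.stk i x)) = tape (tp (.stk i x))) ∧ tape' (tp .pos) = tape (tp .pos) ∧
      ∀ L v, tape' (tp (.ret L v)) = (tape (tp (.ret L v))).act none .stay := by
  induction w using List.reverseRecOn generalizing tape with
  | nil =>
    have h0 := hq.read
    simp only [List.getLast?_nil] at h0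
    have hex : ∃ r : Cmd.Kont c × V,
        (tape (tp (.ret r.1 r.2))).cells (tape (tp (.ret r.1 r.2))).head ≠ none :=
      ⟨r, (hr _ _).2 rfl⟩
    have hch : hex.choose = r := (hr _ _).1 hex.choose_spec
    simp only [List.length_nil, zero_add, Function.iterate_one, step, transition, h0, ↓reduceIte,
      dif_pos hex]
    refine ⟨_, by rw [hch], ?_⟩
    have h0' := h0 ▸ (tape .query).act_stay
    simp [Tape.act_stay, hq, h0']
  | append_singleton w x ih =>
    have h0 := hq.read
    rw [List.getLast?_concat] at h0
    have e1 : ∃ tape1, step v₀ φ ⟨.resume, tape⟩ = ⟨.resume, tape1⟩ ∧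
        tape1 .query = (tape .query).act none .left ∧
        tape1 .input = tape .input ∧ tape1 .output = tape .output ∧
        tape1 .answer = tape .answer ∧ ∀ w, tape1 (tp w) = tape (tp w) := by
      simp only [step, transition, h0, reduceCtorEq, ↓reduceIte]
      exact ⟨_, rfl, by simp, by simp [Tape.act_stay], by simp [Tape.act_stay],
        by simp [Tape.act_stay], by simp [Tape.act_stay]⟩
    obtain ⟨tape1, e1, q1, i1, o1, a1, w1⟩ := e1
    obtain ⟨tape', e, h⟩ := ih tape1 (q1 ▸ hq.dropLast) (by simpa [w1] using hr)
    refine ⟨tape', ?_, by simpa [i1, o1, a1, w1] using h⟩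
    rw [List.length_append, List.length_singleton, Function.iterate_succ_apply, e1, e]

theorem step_call {tape : TIx c → Tape} {σ : St V ι} {k : ℕ} (h : Holds tape σ k) (L : Cmd.Kont c)
    (K : List (Cmd V ι)) (hL : L.1 = .call :: K) :
    ∃ tape', (step v₀ φ)^[k + σ.qry.length + 4] ⟨.run L σ.v, tape⟩ =
      ⟨.run (L.next σ.v σ.tops) σ.v, tape'⟩ ∧
      Holds tape' { σ with ans := φ σ.qry, qry := [] } 0 := by
  rw [show k + σ.qry.length + 4 = (σ.qry.length + 1) + (k + 2 + 1) by ring,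
    Function.iterate_add_apply, Function.iterate_succ_apply' _ (k + 2),
    Function.iterate_succ_apply _ (k + 1)]
  have e1 : ∃ tape1, step v₀ φ ⟨.run L σ.v, tape⟩ = ⟨.rewind, tape1⟩ ∧
      tape1 .input = tape .input ∧ tape1 .output = tape .output ∧ tape1 .query = tape .query ∧
      tape1 .answer = tape .answer ∧ (∀ i x, tape1 (tp (.stk i x)) = tape (tp (.stk i x))) ∧
      tape1 (tp .pos) = tape (tp .pos) ∧
      (∀ L' v, (tape1 (tp (.ret L' v))).cells (tape1 (tp (.ret L' v))).head ≠ none ↔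
        (L', v) = (L.next σ.v σ.tops, σ.v)) ∧
      ∀ L' v, ((tape1 (tp (.ret L' v))).act none .stay).cells = fun _ => none := by
    simp only [step, transition, hL, h.tops]
    refine ⟨_, rfl, by simp [Tape.act_stay], by simp [Tape.act_stay], by simp [Tape.act_stay],
      by simp [Tape.act_stay], by simp [Tape.act_stay], by simp [Tape.act_stay], ?_, ?_⟩
    · intro L' v
      simp only [fam_tp, WorkIx.ret.injEq, Prod.mk.injEq]
      split_ifs with hif <;> rw [h.tops, WorkIx.ret.injEq] at hif
      · simp [Tape.act, Move.shift, hif]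
      · simp [Tape.act, h.ret, hif]
    · intro L' v
      funext j
      simp only [fam_tp]
      split_ifs <;> simp [Tape.act, Move.shift, h.ret]
  obtain ⟨tape1, e1, i1, o1, q1, a1, s1, p1, r1, c1⟩ := e1
  obtain ⟨tape2, e2, a2, p2, i2, o2, q2, w2⟩ := rewind_run (v₀ := v₀) (φ := φ) k tape1
    (by rw [p1]; exact h.pos) (by rw [a1]; exact h.head_ans)
  rw [e1, e2]
  simp only [step]
  obtain ⟨tape3, e3, q3, i3, o3, a3, s3, p3, r3⟩ := resume_run (v₀ := v₀) (φ := φ) σ.qry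
    (fun
        | .answer => ⟨cellsOf (φ (tape2 .query).content), (tape2 .answer).head⟩
        | i => tape2 i) (L.next σ.v σ.tops, σ.v)
    (by simp only [q2, q1]; exact h.qry) (by
      intro L' v
      have := r1 L' v
      rw [← w2 (.ret L' v) (by simp)] at this
      simpa [tp] using this)
  refine ⟨tape3, e3, ?_⟩
  constructor
  · rw [i3]; simp only [i2, i1]; exact h.inp
  · rw [o3]; simp only [o2, o1]; exact h.out
  · exact q3
  · rw [a3]
    have : (tape2 .query).content = σ.qry := by
      rw [q2, q1, ← Tape.content_cellsOf σ.qry (tape .query).head, ← h.qry.1]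
    simp only [this, a2]
    funext j
    simp [cellsOf]
  · rw [a3]; simp [a2]
  · intro i x
    rw [s3]
    simp only [tp]
    simp only [← tp.eq_1]
    rw [w2 _ (by simp), s1]
    exact h.stk i x
  · rw [p3]
    simpa [tp] using p2
  · intro L' v
    rw [r3]
    simp only [tp]
    simp only [← tp.eq_1]
    rw [w2 _ (by simp), c1]

theorem step_cmd {tape : TIx c → Tape} {σ : St V ι} {k : ℕ} (h : Holds tape σ k) (L : Cmd.Kont c)
    (h0 : L.1 ≠ []) : ∃ s ≤ k + σ.qry.length + 4, ∃ k' ≤ k + 1, ∃ tape' L',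
      (step v₀ φ)^[s] ⟨.run L σ.v, tape⟩ = ⟨.run L' (Cmd.step φ (L.1, σ)).2.v, tape'⟩ ∧
      L'.1 = (Cmd.step φ (L.1, σ)).1 ∧ Holds tape' (Cmd.step φ (L.1, σ)).2 k' ∧
      (Cmd.step φ (L.1, σ)).2.qry.length ≤ σ.qry.length + 1 := by
  by_cases h1 : ∃ f K, L.1 = .op f :: K
  · obtain ⟨f, K, hL⟩ := h1
    obtain ⟨tape', e, h'⟩ := step_op (v₀ := v₀) (φ := φ) h L f K hL
    refine ⟨2, by omega, k + (f σ.v σ.tops).ans.toNat, ?_, tape', L.next σ.v σ.tops, ?_, rfl, ?_, ?_⟩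
    · exact Nat.add_le_add_left (Bool.toNat_le _) k
    · rw [e]; simp [Cmd.step, Cmd.effect, hL, St.act]
    · simpa [Cmd.step, Cmd.effect, hL] using h'
    · simp only [Cmd.step, Cmd.effect, hL, St.act, List.length_append]
      cases (f σ.v σ.tops).qry <;> simp
  by_cases h2 : ∃ K, L.1 = .call :: K
  · obtain ⟨K, hL⟩ := h2
    obtain ⟨tape', e, h'⟩ := step_call (v₀ := v₀) (φ := φ) h L K hL
    refine ⟨_, le_rfl, 0, by omega, tape', L.next σ.v σ.tops, ?_, rfl, ?_, ?_⟩
    · rw [e]; simp [Cmd.step, Cmd.effect, hL]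
    · simpa [Cmd.step, Cmd.effect, hL] using h'
    · simp [Cmd.step, Cmd.effect, hL]
  · push Not at h1 h2
    have heff : Cmd.effect φ σ L.1 = σ := by
      unfold Cmd.effect
      split
      · rename_i f K hK; exact absurd hK (h1 f K)
      · rename_i K hK; exact absurd hK (h2 K)
      · rfl
    refine ⟨1, by omega, k, by omega, tape, L.next σ.v σ.tops, ?_, rfl, ?_, ?_⟩
    · rw [Function.iterate_one, step_silent h L h0 h1 h2]; simp [Cmd.step, heff]
    · simpa [Cmd.step, heff] using h
    · simp [Cmd.step, heff]

end Compile

/-- The state in which a program starts on input `a`. -/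
def St.start {V ι : Type} (v₀ : V) (a : Str) : St V ι := ⟨v₀, fun _ => [], a, [], [], []⟩

open Compile in
/-- A program runs on an oracle machine with quadratic overhead: the heads of the query and of the
answer tape have to be moved back at each oracle call. -/
theorem Exec.haltsWithin {V ι : Type} [Finite V] [Finite ι] {c : Cmd V ι} {v₀ : V} {φ : Baire}
    {a : Str} {T : ℕ} {σ : St V ι} (h : Exec φ c (St.start v₀ a) T σ) :
    (machine c v₀).HaltsWithin φ a (4 * (T + 1) ^ 2) σ.out := by
  obtain ⟨t, ht, h⟩ := h
  specialize h []
  have init : ∃ tape, step v₀ φ ⟨.init, initTape a⟩ =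
      ⟨.run ⟨[c], .inl (c.mem_conts [])⟩ v₀, tape⟩ ∧ Holds tape (St.start v₀ a) 0 := by
    refine ⟨_, rfl, ?_⟩
    have hin : (initTape a : TIx c → Tape) .input = ⟨cellsOf a, 0⟩ := rfl
    have hout : (initTape a : TIx c → Tape) .output = ⟨cellsOf [], 0⟩ := rfl
    have hqry : (initTape a : TIx c → Tape) .query = ⟨cellsOf [], 0⟩ := rfl
    have hans : (initTape a : TIx c → Tape) .answer = ⟨cellsOf [], 0⟩ := rfl
    have htp : ∀ w, (initTape a : TIx c → Tape) (tp w) = ⟨cellsOf [], 0⟩ := fun w => rfl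
    have hstay : ∀ w, (Tape.mk (cellsOf w) 0).act (cellsOf w 0) .stay = ⟨cellsOf w, 0⟩ :=
      fun w => Tape.act_stay _
    have hnil : cellsOf [] = fun _ => none := by funext j; simp [cellsOf]
    constructor
    · simp only [transition, fam_input, hin, hstay, St.start]
      funext j
      simp [cellsOf]
    · simp [transition, fam_output, hout, Tape.act, Tape.HoldsLeft, St.start, Move.shift]
    · simp [transition, fam_query, hqry, Tape.act, Tape.HoldsLeft, St.start, Move.shift]
    · simp only [transition, fam_answer, hans, hstay, St.start]
      funext j
      simp [cellsOf]
    · simp only [transition, fam_answer, hans, hstay, Nat.cast_zero]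
    · intro i x
      simp only [transition, fam_tp, htp, hstay, St.start]
      simp [Tape.HoldsRight, hnil, mark]
    · simp only [transition, fam_tp, htp]
      simp [Tape.act, Tape.HoldsLeft, Move.shift]
    · intro L v
      simp only [transition, fam_tp, htp, hstay]
      exact hnil
  have run : ∀ n ≤ t, (∀ m < n, ((Cmd.step φ)^[m] ([c], St.start v₀ a)).1 ≠ []) →
      ∃ s ≤ 1 + n * (2 * n + 4), ∃ k ≤ n, ∃ (tape : TIx c → Tape) (L : Cmd.Kont c),
      (step v₀ φ)^[s] ⟨.init, initTape a⟩ =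
        ⟨.run L ((Cmd.step φ)^[n] ([c], St.start v₀ a)).2.v, tape⟩ ∧
      L.1 = ((Cmd.step φ)^[n] ([c], St.start v₀ a)).1 ∧
      Holds tape ((Cmd.step φ)^[n] ([c], St.start v₀ a)).2 k ∧
      ((Cmd.step φ)^[n] ([c], St.start v₀ a)).2.qry.length ≤ n := by
    intro n hn hne
    induction n with
    | zero =>
      obtain ⟨tape, e, hh⟩ := init
      exact ⟨1, by omega, 0, le_rfl, tape, _, e, rfl, hh, by simp [St.start]⟩
    | succ n ih =>
      obtain ⟨s, hs, k, hk, tape, L, e, hL, hh, hq⟩ := ih (by omega) fun m hm => hne m (by omega)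
      obtain ⟨s', hs', k', hk', tape', L', e', hL', hh', hq'⟩ := step_cmd (v₀ := v₀) (φ := φ) hh L
        (by rw [hL]; exact hne n (by omega))
      simp only [hL, Prod.mk.eta] at e' hL' hh' hq'
      rw [Function.iterate_succ_apply']
      refine ⟨s' + s, ?_, k', by omega, tape', L', ?_, hL', hh', by omega⟩
      · nlinarith
      · rw [Function.iterate_add_apply, e, e']
  -- the first time at which no command is left
  have hex : ∃ n, ((Cmd.step φ)^[n] ([c], St.start v₀ a)).1 = [] := ⟨t, by rw [h]⟩
  classical
  obtain ⟨n, hn, hmin⟩ : ∃ n, ((Cmd.step φ)^[n] ([c], St.start v₀ a)).1 = [] ∧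
      ∀ m < n, ((Cmd.step φ)^[m] ([c], St.start v₀ a)).1 ≠ [] :=
    ⟨Nat.find hex, Nat.find_spec hex, fun m hm => Nat.find_min hex hm⟩
  have hnt : n ≤ t := by
    by_contra hlt
    exact hmin t (by omega) (by rw [h])
  have hσ : ((Cmd.step φ)^[n] ([c], St.start v₀ a)) = ([], σ) := by
    have fix : ∀ x : List (Cmd V ι) × St V ι, x.1 = [] → Cmd.step φ x = x := by
      rintro ⟨L, τ⟩ rfl
      rfl
    rw [← h, show t = (t - n) + n by omega, Function.iterate_add_apply,
      Function.iterate_fixed (fix _ hn)]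
  obtain ⟨s, hs, k, hk, tape, L, e, hL, hh, hq⟩ := run n hnt hmin
  rw [hσ] at e hL hh
  have hfin : step v₀ φ ⟨.run L σ.v, tape⟩ = ⟨.halt, tape⟩ := by
    simp only [step, transition]
    simp only at hL
    simp [hL, Tape.act_stay]
  have hiter : ∀ m, (machine c v₀).run φ a m =
      ((step v₀ φ)^[m] ⟨.init, initTape a⟩).config v₀ := by
    intro m
    induction m with
    | zero => exact init_eq a
    | succ m ih =>
      rw [OracleMachine.run, Function.iterate_succ_apply', Function.iterate_succ_apply',
        ← step_config, ← ih, OracleMachine.run]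
  refine ⟨s + 1, ?_, ?_, ?_⟩
  · have : n * (2 * n + 4) ≤ t * (2 * t + 4) := by gcongr
    have : t * (2 * t + 4) ≤ T * (2 * T + 4) := by gcongr
    nlinarith
  · rw [hiter, Function.iterate_succ_apply', e, hfin]
    rfl
  · rw [hiter, Function.iterate_succ_apply', e, hfin]
    change (tape .output).content = _
    rw [← Tape.content_cellsOf σ.out (tape .output).head, ← hh.out.1]

/-! ### The stacks and registers of the programs -/

/-- The names of the stacks that do not belong to a simulated tape. -/
inductive Nm where
  | vq | va | t1 | t2 | x | y | cap | cp | c1 | c2 | np | nk | bp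
  | bk | pa | pk | pb | lv | lm | iv | da | db | dc | dt | du
  deriving DecidableEq

instance : Finite Nm :=
  Finite.of_injective (fun n : Nm => (⟨n.ctorIdx, by cases n <;> decide⟩ : Fin 25))
    (by intro a b h; cases a <;> cases b <;> first | rfl | (exact absurd h (by decide)))

/-- The names of all stacks. A tape of the simulated machine is kept on three stacks: `tc` holds the
cells between cell `0` and the scanned cell, `tp` and `tn` hold the cells beyond on the right and on
the left. -/
inductive Ix (k : ℕ) where
  | tc (t : TapeIx k)
  | tp (t : TapeIx k)
  | tn (t : TapeIx k)
  | nm (i : Nm)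

instance (k : ℕ) : Finite (TapeIx k) :=
  Finite.of_surjective
    (fun x : Fin 4 ⊕ Fin k => match x with
      | .inl 0 => TapeIx.input
      | .inl 1 => .output
      | .inl 2 => .query
      | .inl 3 => .answer
      | .inr i => .work i)
    (by
      rintro (_ | _ | _ | _ | i)
      exacts [⟨.inl 0, rfl⟩, ⟨.inl 1, rfl⟩, ⟨.inl 2, rfl⟩, ⟨.inl 3, rfl⟩, ⟨.inr i, rfl⟩])

instance (k : ℕ) : Finite (Ix k) :=
  Finite.of_surjective
    (fun x : (TapeIx k ⊕ TapeIx k) ⊕ (TapeIx k ⊕ Nm) => match x with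
      | .inl (.inl t) => Ix.tc t
      | .inl (.inr t) => .tp t
      | .inr (.inl t) => .tn t
      | .inr (.inr i) => .nm i)
    (by
      rintro (t | t | t | i)
      exacts [⟨.inl (.inl t), rfl⟩, ⟨.inl (.inr t), rfl⟩, ⟨.inr (.inl t), rfl⟩,
        ⟨.inr (.inr i), rfl⟩])

/-- The registers that belong to the simulation of the machine `M`: its state, the scanned symbols,
the sides of cell `0` on which the heads stand, whether the rest of the answer tape is the answer of
the oracle (or the stack `va`), and whether the simulation has been given up. -/
structure SimRegs (M : OracleMachine) where
  q : M.State
  hd : TapeIx M.workTapes → Sym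
  neg : TapeIx M.workTapes → Bool
  real : Bool
  abort : Bool

/-- The finite control of the programs. -/
structure Regs (M : OracleMachine) where
  sim : SimRegs M
  /-- whether a candidate has been found, its sign, its last digits and a counter -/
  ok : Bool
  sg : Bool
  nib : Fin 16
  cnt : Fin 5
  /-- the last digits of the smallest best candidate, and the spread -/
  bn : Fin 16
  d : Fin 16
  /-- further flags -/
  go : Bool
  f1 : Bool
  f2 : Bool
  df : Fin 3
  ic : Fin 3

instance (M : OracleMachine) : Finite (SimRegs M) :=
  Finite.of_injective (fun r : SimRegs M => (r.q, r.hd, r.neg, r.real, r.abort))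
    (by rintro ⟨⟩ ⟨⟩ h; simpa using h)

instance (M : OracleMachine) : Finite (Regs M) :=
  Finite.of_injective (fun r : Regs M => ((r.sim, r.ok, r.sg, r.nib, r.cnt, r.bn),
    (r.d, r.go, r.f1, r.f2, r.df, r.ic)))
    (by rintro ⟨⟩ ⟨⟩ h; simp_all)

/-- The registers at the start of a program. -/
def Regs.init (M : OracleMachine) : Regs M :=
  ⟨⟨M.start, fun _ => none, fun _ => false, false, false⟩, false, false, 0, 0, 0, 0, false,
    false, false, 0, 0⟩

/-- Programs with these stacks and registers. -/
abbrev Prog (M : OracleMachine) := Cmd (Regs M) (Ix M.workTapes)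

/-- The states of these programs, as a record. -/
@[ext]
structure PS (M : OracleMachine) where
  v : Regs M
  tc : TapeIx M.workTapes → List Sym
  tp : TapeIx M.workTapes → List Sym
  tn : TapeIx M.workTapes → List Sym
  (vq va t1 t2 x y cap cp c1 c2 np nk bp : List Sym)
  (bk pa pk pb lv lm iv da db dc dt du : List Sym)
  (inp ans qry out : Str)

/-- The named stacks of a state. -/
def PS.get {M : OracleMachine} (σ : PS M) : Nm → List Sym
  | .vq => σ.vq
  | .va => σ.va
  | .t1 => σ.t1
  | .t2 => σ.t2
  | .x => σ.x
  | .y => σ.y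
  | .cap => σ.cap
  | .cp => σ.cp
  | .c1 => σ.c1
  | .c2 => σ.c2
  | .np => σ.np
  | .nk => σ.nk
  | .bp => σ.bp
  | .bk => σ.bk
  | .pa => σ.pa
  | .pk => σ.pk
  | .pb => σ.pb
  | .lv => σ.lv
  | .lm => σ.lm
  | .iv => σ.iv
  | .da => σ.da
  | .db => σ.db
  | .dc => σ.dc
  | .dt => σ.dt
  | .du => σ.du

/-- The state of the stack machine that a record stands for. -/
def PS.toSt {M : OracleMachine} (σ : PS M) : St (Regs M) (Ix M.workTapes) where
  v := σ.v
  st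
    | .tc t => σ.tc t
    | .tp t => σ.tp t
    | .tn t => σ.tn t
    | .nm i => σ.get i
  inp := σ.inp
  ans := σ.ans
  qry := σ.qry
  out := σ.out

/-- Execution with a time bound, for states that are given as records. -/
def Ex {M : OracleMachine} (φ : Baire) (c : Prog M) (σ : PS M) (T : ℕ) (σ' : PS M) : Prop :=
  Exec φ c σ.toSt T σ'.toSt

namespace Ex

variable {M : OracleMachine} {φ : Baire} {c c' : Prog M} {σ σ₁ σ₂ : PS M} {T T₁ T₂ : ℕ}

theorem mono (h : Ex φ c σ T₁ σ₁) (hT : T₁ ≤ T₂) : Ex φ c σ T₂ σ₁ := Exec.mono h hT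

theorem congr (h : Ex φ c σ T₁ σ₁) (hσ : σ₁ = σ₂) (hT : T₁ ≤ T₂) : Ex φ c σ T₂ σ₂ :=
  hσ ▸ h.mono hT

theorem op {f : Regs M → Tops (Ix M.workTapes) → Act (Regs M) (Ix M.workTapes)}
    (hv : (f σ.v σ.toSt.tops).v = σ₁.v := by rfl)
    (htc : ∀ t, ((f σ.v σ.toSt.tops).st (.tc t)).run (σ.tc t) = σ₁.tc t := by intro t; rfl)
    (htp : ∀ t, ((f σ.v σ.toSt.tops).st (.tp t)).run (σ.tp t) = σ₁.tp t := by intro t; rfl)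
    (htn : ∀ t, ((f σ.v σ.toSt.tops).st (.tn t)).run (σ.tn t) = σ₁.tn t := by intro t; rfl)
    (hnm : ∀ i, ((f σ.v σ.toSt.tops).st (.nm i)).run (σ.get i) = σ₁.get i := by
      intro i; cases i <;> rfl)
    (hi : (bif (f σ.v σ.toSt.tops).inp then σ.inp.tail else σ.inp) = σ₁.inp := by rfl)
    (ha : (bif (f σ.v σ.toSt.tops).ans then σ.ans.tail else σ.ans) = σ₁.ans := by rfl)
    (hq : σ.qry ++ (f σ.v σ.toSt.tops).qry.toList = σ₁.qry := by exact List.append_nil _)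
    (ho : σ.out ++ (f σ.v σ.toSt.tops).out.toList = σ₁.out := by exact List.append_nil _) :
    Ex φ (.op f) σ 1 σ₁ := by
  refine (Exec.op f σ.toSt).congr (St.ext hv (funext fun i => ?_) hi ha hq ho) le_rfl
  rcases i with t | t | t | i
  exacts [htc t, htp t, htn t, hnm i]

theorem call (σ : PS M) : Ex φ .call σ 1 { σ with ans := φ σ.qry, qry := [] } :=
  Exec.call σ.toSt

theorem seq (h₁ : Ex φ c σ T₁ σ₁) (h₂ : Ex φ c' σ₁ T₂ σ₂) :
    Ex φ (.seq c c') σ (T₁ + T₂ + 1) σ₂ := Exec.seq h₁ h₂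

theorem ite_true {p : Regs M → Tops (Ix M.workTapes) → Bool} (h : Ex φ c σ T σ₁)
    (hp : p σ.v σ.toSt.tops = true := by rfl) : Ex φ (.ite p c c') σ (T + 1) σ₁ :=
  Exec.ite_true hp h

theorem ite_false {p : Regs M → Tops (Ix M.workTapes) → Bool} (h : Ex φ c' σ T σ₁)
    (hp : p σ.v σ.toSt.tops = false := by rfl) : Ex φ (.ite p c c') σ (T + 1) σ₁ :=
  Exec.ite_false hp h

theorem loop_end {p : Regs M → Tops (Ix M.workTapes) → Bool}
    (hp : p σ.v σ.toSt.tops = false := by rfl) : Ex φ (.loop p c) σ 1 σ :=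
  Exec.loop_end hp

theorem loop_step {p : Regs M → Tops (Ix M.workTapes) → Bool} (h₁ : Ex φ c σ T₁ σ₁)
    (h₂ : Ex φ (.loop p c) σ₁ T₂ σ₂) (hp : p σ.v σ.toSt.tops = true := by rfl) :
    Ex φ (.loop p c) σ (T₁ + T₂ + 1) σ₂ :=
  Exec.loop_step hp h₁ h₂

theorem loop_foldl {α β : Type*} {p : Regs M → Tops (Ix M.workTapes) → Bool}
    (S : List α → β → PS M) (g : β → α → β) (T : ℕ)
    (hstep : ∀ x l b, Ex φ c (S (x :: l) b) T (S l (g b x)))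
    (hend : ∀ b, p (S [] b).v (S [] b).toSt.tops = false := by intros; rfl)
    (hp : ∀ x l b, p (S (x :: l) b).v (S (x :: l) b).toSt.tops = true := by intros; rfl)
    (l : List α) (b : β) :
    Ex φ (.loop p c) (S l b) (l.length * (T + 1) + 1) (S [] (l.foldl g b)) :=
  Exec.loop_foldl (fun l b => (S l b).toSt) g T hend hp hstep l b

/-- A loop that counts down. -/
theorem loop_nat {β : Type*} {p : Regs M → Tops (Ix M.workTapes) → Bool}
    (S : ℕ → β → PS M) (g : β → β) (T : ℕ)
    (hstep : ∀ n b, Ex φ c (S (n + 1) b) T (S n (g b)))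
    (hend : ∀ b, p (S 0 b).v (S 0 b).toSt.tops = false := by intros; rfl)
    (hp : ∀ n b, p (S (n + 1) b).v (S (n + 1) b).toSt.tops = true := by intros; rfl)
    (n : ℕ) (b : β) :
    Ex φ (.loop p c) (S n b) (n * (T + 1) + 1) (S 0 (g^[n] b)) := by
  induction n generalizing b with
  | zero => exact (loop_end (hend b)).mono (by simp)
  | succ n ih =>
    refine (loop_step (hstep n b) (ih _) (hp n b)).mono ?_
    ring_nf
    omega

/-- A loop that consumes the list `l`, with an invariant. -/
theorem loop_inv {α : Type*} {p : Regs M → Tops (Ix M.workTapes) → Bool}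
    (I : List α → PS M → Prop) (T : ℕ)
    (hstep : ∀ x l σ, I (x :: l) σ → p σ.v σ.toSt.tops = true ∧ ∃ σ', Ex φ c σ T σ' ∧ I l σ')
    (hend : ∀ σ, I [] σ → p σ.v σ.toSt.tops = false) (l : List α) (σ : PS M) (h : I l σ) :
    ∃ σ', Ex φ (.loop p c) σ (l.length * (T + 1) + 1) σ' ∧ I [] σ' := by
  induction l generalizing σ with
  | nil => exact ⟨σ, (loop_end (hend σ h)).mono (by simp), h⟩
  | cons x l ih =>
    obtain ⟨hp, σ', h1, h2⟩ := hstep x l σ h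
    obtain ⟨σ'', h3, h4⟩ := ih σ' h2
    refine ⟨σ'', (loop_step h1 h3 hp).mono ?_, h4⟩
    simp only [List.length_cons]
    ring_nf
    omega

end Ex

theorem foldl_cons_eq {α : Type*} (l b : List α) :
    l.foldl (fun b x => x :: b) b = l.reverse ++ b := by
  induction l generalizing b with
  | nil => simp
  | cons x l ih => simp [ih]

/-! ### Moving stacks -/

section

variable {M : OracleMachine} {φ : Baire}

/-- The state with the stack `i` replaced by `l`. -/
def PS.put (σ : PS M) : Nm → List Sym → PS M
  | .vq, l => { σ with vq := l }
  | .va, l => { σ with va := l }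
  | .t1, l => { σ with t1 := l }
  | .t2, l => { σ with t2 := l }
  | .x, l => { σ with x := l }
  | .y, l => { σ with y := l }
  | .cap, l => { σ with cap := l }
  | .cp, l => { σ with cp := l }
  | .c1, l => { σ with c1 := l }
  | .c2, l => { σ with c2 := l }
  | .np, l => { σ with np := l }
  | .nk, l => { σ with nk := l }
  | .bp, l => { σ with bp := l }
  | .bk, l => { σ with bk := l }
  | .pa, l => { σ with pa := l }
  | .pk, l => { σ with pk := l }
  | .pb, l => { σ with pb := l }
  | .lv, l => { σ with lv := l }
  | .lm, l => { σ with lm := l }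
  | .iv, l => { σ with iv := l }
  | .da, l => { σ with da := l }
  | .db, l => { σ with db := l }
  | .dc, l => { σ with dc := l }
  | .dt, l => { σ with dt := l }
  | .du, l => { σ with du := l }

theorem PS.get_put (σ : PS M) (i j : Nm) (l : List Sym) :
    (σ.put i l).get j = if j = i then l else σ.get j := by
  cases i <;> cases j <;> rfl

@[simp] theorem PS.get_put_same (σ : PS M) (i : Nm) (l : List Sym) : (σ.put i l).get i = l := by
  cases i <;> rfl

@[simp] theorem PS.get_put_ne (σ : PS M) {i j : Nm} (h : j ≠ i) (l : List Sym) :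
    (σ.put i l).get j = σ.get j := by
  rw [get_put, if_neg h]

@[simp] theorem PS.put_v (σ : PS M) (i : Nm) (l) : (σ.put i l).v = σ.v := by cases i <;> rfl
@[simp] theorem PS.put_tc (σ : PS M) (i : Nm) (l) : (σ.put i l).tc = σ.tc := by cases i <;> rfl
@[simp] theorem PS.put_tp (σ : PS M) (i : Nm) (l) : (σ.put i l).tp = σ.tp := by cases i <;> rfl
@[simp] theorem PS.put_tn (σ : PS M) (i : Nm) (l) : (σ.put i l).tn = σ.tn := by cases i <;> rfl
@[simp] theorem PS.put_inp (σ : PS M) (i : Nm) (l) : (σ.put i l).inp = σ.inp := by cases i <;> rfl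
@[simp] theorem PS.put_ans (σ : PS M) (i : Nm) (l) : (σ.put i l).ans = σ.ans := by cases i <;> rfl
@[simp] theorem PS.put_qry (σ : PS M) (i : Nm) (l) : (σ.put i l).qry = σ.qry := by cases i <;> rfl
@[simp] theorem PS.put_out (σ : PS M) (i : Nm) (l) : (σ.put i l).out = σ.out := by cases i <;> rfl

@[simp] theorem PS.put_get (σ : PS M) (i : Nm) : σ.put i (σ.get i) = σ := by cases i <;> rfl

/-- What one sees on top of a named stack. -/
theorem PS.tops_nm (σ : PS M) (i : Nm) : σ.toSt.tops.st (.nm i) = (σ.get i).head? := rfl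

/-- Tests whether the stack `s` is nonempty. -/
def has (s : Nm) : Regs M → Tops (Ix M.workTapes) → Bool := fun _ t => (t.st (.nm s)).isSome

/-- Pushes a symbol. -/
def push (s : Nm) (x : Sym) : Prog M := .op fun v _ => { v := v, st := fun
  | .nm i => if i = s then .push x else .keep
  | _ => .keep }

/-- Removes the top of a stack. -/
def pop (s : Nm) : Prog M := .op fun v _ => { v := v, st := fun
  | .nm i => if i = s then .pop else .keep
  | _ => .keep }

/-- Moves the stack `s` to the stack `d`, which reverses the order. -/
def mv (s d : Nm) : Prog M :=
  .loop (has s) <| .op fun v t =>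
    { v := v
      st := fun
        | .nm i => if i = s then .pop
          else if i = d then .push ((t.st (.nm s)).getD none) else .keep
        | _ => .keep }

theorem ex_mv (φ : Baire) (s d : Nm) (σ : PS M) (h : s ≠ d := by decide) :
    Ex φ (mv s d) σ (2 * (σ.get s).length + 1)
      ((σ.put s []).put d ((σ.get s).reverse ++ σ.get d)) := by
  have key : Ex φ (mv s d) _ _ _ := Ex.loop_foldl
    (fun l b => (σ.put s l).put d b) (fun b x => x :: b) 1
    (fun x l b => by
      refine Ex.op (by simp) (by simp [StackAct.run]) (by simp [StackAct.run])
        (by simp [StackAct.run]) (fun i => ?_) (by simp) (by simp) (by simp) (by simp)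
      by_cases h1 : i = s
      · subst h1; simp [StackAct.run, h]
      · by_cases h2 : i = d
        · subst h2; simp [StackAct.run, h, h1, PS.tops_nm]
        · simp [h1, h2, StackAct.run])
    (by intro b; simp [has, PS.tops_nm, h]) (by intro x l b; simp [has, PS.tops_nm, h])
    (σ.get s) (σ.get d)
  rw [foldl_cons_eq] at key
  have e : (σ.put s (σ.get s)).put d (σ.get d) = σ := by simp
  rw [e] at key
  exact key.mono (by omega)

/-- Empties the stack `s`. -/
def clr (s : Nm) : Prog M :=
  .loop (has s) (pop s)

theorem ex_clr (φ : Baire) (s : Nm) (σ : PS M) :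
    Ex φ (clr s) σ (2 * (σ.get s).length + 1) (σ.put s []) := by
  have key : Ex φ (clr s) _ _ _ := Ex.loop_foldl
    (fun l (_ : Unit) => σ.put s l) (fun b _ => b) 1
    (fun x l b => by
      refine Ex.op (by simp) (by simp [StackAct.run]) (by simp [StackAct.run])
        (by simp [StackAct.run]) (fun i => ?_) (by simp) (by simp) (by simp) (by simp)
      by_cases h1 : i = s
      · subst h1; simp [StackAct.run]
      · simp [h1, StackAct.run])
    (by intro b; simp [has, PS.tops_nm]) (by intro x l b; simp [has, PS.tops_nm])
    (σ.get s) ()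
  rw [PS.put_get] at key
  exact key.mono (by omega)

/-- Moves the stack `s` to both of the stacks `d` and `e`, which reverses the order. -/
def mv2 (s d e : Nm) : Prog M :=
  .loop (has s) <| .op fun v t =>
    { v := v
      st := fun
        | .nm i => if i = s then .pop
          else if i = d ∨ i = e then .push ((t.st (.nm s)).getD none) else .keep
        | _ => .keep }

theorem ex_mv2 (φ : Baire) (s d e : Nm) (σ : PS M) (h : s ≠ d := by decide)
    (h' : s ≠ e := by decide) (h'' : d ≠ e := by decide) :
    Ex φ (mv2 s d e) σ (2 * (σ.get s).length + 1)
      (((σ.put s []).put d ((σ.get s).reverse ++ σ.get d)).put e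
        ((σ.get s).reverse ++ σ.get e)) := by
  have key : Ex φ (mv2 s d e) _ _ _ := Ex.loop_foldl
    (fun l (b : List Sym) => ((σ.put s l).put d (b ++ σ.get d)).put e (b ++ σ.get e))
    (fun b x => x :: b) 1
    (fun x l b => by
      refine Ex.op (by simp) (by simp [StackAct.run]) (by simp [StackAct.run])
        (by simp [StackAct.run]) (fun i => ?_) (by simp) (by simp) (by simp) (by simp)
      by_cases h1 : i = s
      · subst h1; simp [StackAct.run, h, h']
      · by_cases h2 : i = d
        · subst h2; simp [StackAct.run, h, h1, h', h'', PS.tops_nm]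
        · by_cases h3 : i = e
          · subst h3; simp [StackAct.run, h, h1, h', h2, PS.tops_nm]
          · simp [h1, h2, h3, StackAct.run])
    (by intro b; simp [has, PS.tops_nm, h, h']) (by intro x l b; simp [has, PS.tops_nm, h, h'])
    (σ.get s) []
  rw [foldl_cons_eq] at key
  have e : ((σ.put s (σ.get s)).put d ([] ++ σ.get d)).put e ([] ++ σ.get e) = σ := by simp
  rw [e, List.append_nil] at key
  exact key.mono (by omega)

/-- The unary notation of a number on a stack. -/
def un (n : ℕ) : List Sym := List.replicate n none

@[simp] theorem length_un (n : ℕ) : (un n).length = n := List.length_replicate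
@[simp] theorem reverse_un (n : ℕ) : (un n).reverse = un n := List.reverse_replicate
theorem un_succ (n : ℕ) : un (n + 1) = none :: un n := rfl
@[simp] theorem un_zero : un 0 = [] := rfl
theorem un_add (m n : ℕ) : un m ++ un n = un (m + n) := List.replicate_append_replicate

/-! ### Reading the codes of intervals -/

/-- The next letter of the oracle's answer, or of the stack `va`. -/
def nextLetter (real : Bool) (t : Tops (Ix M.workTapes)) : Option Letter :=
  if real then t.ans else (t.st (.nm .va)).getD none

/-- Consumes a letter of the source and copies it to the stack `d`, if there is one. -/
def rd (real : Bool) (d : Option Nm) : Prog M := .op fun v t =>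
  { v := v
    st := fun
      | .nm i => if d = some i then (match nextLetter real t with
            | some a => .push (some a)
            | none => .keep)
          else if i = .va ∧ real = false then .pop else .keep
      | _ => .keep
    ans := real }

/-- The state after the source has been replaced by `w`. -/
def PS.src (σ : PS M) (real : Bool) (w : Str) : PS M :=
  if real then { σ with ans := w } else { σ with va := w.map some }

theorem ex_rd_none (real : Bool) (σ : PS M) (w : Str) :
    Ex φ (rd real none) (σ.src real w) 1 (σ.src real w.tail) := by
  cases real
  · cases w <;> exact Ex.op
  · exact Ex.op

theorem ex_rd_t1 (real : Bool) (σ : PS M) (w : Str) :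
    Ex φ (rd real (some .t1)) (σ.src real w) 1
      ({ σ with t1 := w.head?.toList.map some ++ σ.t1 }.src real w.tail) := by
  cases real
  · cases w <;> exact Ex.op
  · cases w <;> exact Ex.op

theorem ex_rd_t2 (real : Bool) (σ : PS M) (w : Str) :
    Ex φ (rd real (some .t2)) (σ.src real w) 1
      ({ σ with t2 := w.head?.toList.map some ++ σ.t2 }.src real w.tail) := by
  cases real
  · cases w <;> exact Ex.op
  · cases w <;> exact Ex.op

/-- The two strings that are interleaved in the first `3 * n` letters of a string. -/
def tracks : ℕ → Str → Str × Str
  | 0, _ => ([], [])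
  | n + 1, w => (w.tail.head?.toList ++ (tracks n w.tail.tail.tail).1,
      w.tail.tail.head?.toList ++ (tracks n w.tail.tail.tail).2)

/-- Reads three letters of the source. -/
def rd3 (real : Bool) : Prog M :=
  .seq (rd real none) (.seq (rd real (some .t1)) (rd real (some .t2)))

/-- The effect of `rd3` on the source and on the stacks `t1` and `t2`. -/
def rd3Fun (b : Str × List Sym × List Sym) : Str × List Sym × List Sym :=
  (b.1.tail.tail.tail, b.1.tail.head?.toList.map some ++ b.2.1,
    b.1.tail.tail.head?.toList.map some ++ b.2.2)

theorem rd3Fun_iterate (n : ℕ) (w : Str) (a b : List Sym) :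
    ∃ w' : Str, w'.length ≤ w.length ∧ rd3Fun^[n] (w, a, b) =
      (w', ((tracks n w).1.map some).reverse ++ a, ((tracks n w).2.map some).reverse ++ b) := by
  induction n generalizing w a b with
  | zero => exact ⟨w, le_rfl, rfl⟩
  | succ n ih =>
    rw [Function.iterate_succ_apply]
    obtain ⟨w', hl, h⟩ := ih w.tail.tail.tail (w.tail.head?.toList.map some ++ a)
      (w.tail.tail.head?.toList.map some ++ b)
    refine ⟨w', hl.trans (by simp only [List.length_tail]; omega), h.trans ?_⟩
    have hr : ∀ o : Option Letter, (o.toList.map some).reverse = o.toList.map some := by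
      intro o; cases o <;> rfl
    simp [tracks, hr]

theorem ex_rd3 (real : Bool) (σ : PS M) (b : Str × List Sym × List Sym) :
    Ex φ (rd3 real) ({ σ with t1 := b.2.1, t2 := b.2.2 }.src real b.1) 5
      ({ σ with t1 := (rd3Fun b).2.1, t2 := (rd3Fun b).2.2 }.src real (rd3Fun b).1) :=
  (ex_rd_none real _ _).seq ((ex_rd_t1 real _ _).seq (ex_rd_t2 real _ _))

/-- Reads `3 * m` triples of letters, where `m` is the height of the stack `cap`. -/
def fetchLoop (real : Bool) : Prog M :=
  .loop (has .cap) <|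
    .seq (.op fun v _ =>
      { v := v
        st := fun
          | .nm .cap => .pop
          | .nm .cp => .push none
          | .nm .c1 => .push none
          | .nm .c2 => .push none
          | _ => .keep })
      (.seq (rd3 real) (.seq (rd3 real) (rd3 real)))

/-- Reads `3 * m` triples of letters, where `m` is the height of the stack `cap`. This stack is
distributed to the stacks `cp`, `c1` and `c2`. -/
def fetch (real : Bool) : Prog M :=
  .seq (fetchLoop real)
    (.seq (mv .t1 .x) (mv .t2 .y))

theorem length_tracks (n : ℕ) (w : Str) :
    (tracks n w).1.length ≤ n ∧ (tracks n w).2.length ≤ n := by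
  induction n generalizing w with
  | zero => simp [tracks]
  | succ n ih =>
    have hr : ∀ o : Option Letter, o.toList.length ≤ 1 := by
      intro o; cases o <;> simp
    have := ih w.tail.tail.tail
    have h1 := hr w.tail.head?
    have h2 := hr w.tail.tail.head?
    simp only [tracks, List.length_append]
    omega

theorem ex_fetch (real : Bool) (σ : PS M) (w : Str) (m : ℕ) (hcap : σ.cap = un m)
    (h1 : σ.t1 = []) (h2 : σ.t2 = []) (hx : σ.x = []) (hy : σ.y = []) (hcp : σ.cp = [])
    (hc1 : σ.c1 = []) (hc2 : σ.c2 = []) :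
    ∃ w' : Str, w'.length ≤ w.length ∧ Ex φ (fetch real) (σ.src real w) (40 * (m + 1))
      ({ σ with cap := [], cp := un m, c1 := un m, c2 := un m,
                x := (tracks (3 * m) w).1.map some,
                y := (tracks (3 * m) w).2.map some }.src real w') := by
  obtain ⟨w', hl', hw⟩ := rd3Fun_iterate (3 * m) w [] []
  refine ⟨w', hl', ?_⟩
  have key : Ex φ (fetchLoop real) _ _ _ := Ex.loop_nat
    (fun n (b : (Str × List Sym × List Sym) × ℕ) =>
      ({ σ with cap := un n, cp := un b.2, c1 := un b.2, c2 := un b.2,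
                t1 := b.1.2.1, t2 := b.1.2.2 }.src real b.1.1))
    (fun b => (rd3Fun (rd3Fun (rd3Fun b.1)), b.2 + 1)) 19
    (fun n b => by
      have h := ex_rd3 (φ := φ) real { σ with
        cap := un n, cp := un (b.2 + 1), c1 := un (b.2 + 1), c2 := un (b.2 + 1) }
      refine Ex.seq (T₁ := 1) ?_ ((h b.1).seq ((h (rd3Fun b.1)).seq (h (rd3Fun (rd3Fun b.1)))))
      cases real <;> exact Ex.op)
    (by intro b; cases real <;> rfl) (by intro n b; cases real <;> rfl) m ((w, [], []), 0)
  have hit : ∀ n b, (fun b : (Str × List Sym × List Sym) × ℕ =>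
      (rd3Fun (rd3Fun (rd3Fun b.1)), b.2 + 1))^[n] b =
      (rd3Fun^[3 * n] b.1, b.2 + n) := by
    intro n
    induction n with
    | zero => intro b; rfl
    | succ n ih =>
      intro b
      rw [Function.iterate_succ_apply, ih, mul_add, mul_one, Function.iterate_add_apply]
      refine Prod.ext rfl ?_
      simp only
      omega
  rw [hit, hw] at key
  simp only [zero_add, List.append_nil] at key
  have e0 : ({ σ with cap := un m, cp := un 0, c1 := un 0, c2 := un 0, t1 := [], t2 := [] } : PS M)
      = σ := by
    cases σ
    simp_all
  rw [e0] at key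
  have hl := length_tracks (3 * m) w
  refine ((key.seq ((ex_mv _ _ _ _).seq (ex_mv _ _ _ _))).congr ?_ ?_)
  · cases real <;> simp [PS.src, PS.put, PS.get, hx, hy, h1, h2]
  · have e1 : ∀ (τ : PS M) w, (τ.src real w).get .t1 = τ.t1 := by
      intro τ w; cases real <;> rfl
    have e2 : ∀ (τ : PS M) w l l', (((τ.src real w).put .t1 l).put .x l').get .t2 = τ.t2 := by
      intro τ w l l'; cases real <;> rfl
    rw [e1, e2]
    simp only [List.length_reverse, List.length_map]
    omega

/-! ### Approximations of the midpoint of an interval -/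

/-- The number of leading zeros of a string, but at most `m`. -/
def zerosUpTo : ℕ → Str → ℕ
  | m + 1, .bit false :: w => zerosUpTo m w + 1
  | _, _ => 0

/-- Removes the first letter if it is a bit. -/
def dropSign : Str → Str
  | .bit _ :: w => w
  | w => w

/-- Whether the first letter is the bit `1`. -/
def isNeg : Str → Bool
  | .bit b :: _ => b
  | _ => false

/-- For the code `w` of a positive number `ε < 1`, the number of zeros after the binary point, but
at most `m`. -/
def radLevel (m : ℕ) (w : Str) : ℕ :=
  match dropSign w with
  | .sep :: u => zerosUpTo m u
  | _ => 0

/-- Splits a string at the separator, if it is preceded by at most `m` bits only. -/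
def splitSep : ℕ → Str → Option (List Bool × Str)
  | _, .sep :: w => some ([], w)
  | m + 1, .bit b :: w => (splitSep m w).map fun p => (b :: p.1, p.2)
  | _, _ => none

/-- The bit at the beginning of a string. -/
def headBit : Str → Bool
  | .bit b :: _ => b
  | _ => false

/-- The first `k` bits of a string, which is padded by zeros. -/
def takeBits : ℕ → Str → List Bool
  | 0, _ => []
  | k + 1, w => headBit w :: takeBits k w.tail

/-- A dyadic number with `lvl` digits after the binary point, as an approximation up to
`2 ^ (1 - lvl)`. -/
structure Cand where
  lvl : ℕ
  neg : Bool
  ip : List Bool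
  fr : List Bool

/-- The notation of an approximation. -/
def Cand.str (c : Cand) : Str := .bit c.neg :: (c.ip.map .bit ++ .sep :: c.fr.map .bit)

/-- The last digits of a number. -/
def nibOf (l : List Bool) : Fin 16 := l.foldl (fun v b => 2 * v + if b then 1 else 0) 0

/-- The number of multiples of `2 ^ (-lvl)` in the approximation, modulo 16. -/
def Cand.nib (c : Cand) : Fin 16 := if c.neg then -nibOf c.fr else nibOf c.fr

/-- The approximation that is given by the codes `X` of the midpoint and `Y` of the radius of an
interval, if at most `m` digits on either side of the binary point are used. -/
def candOf (m : ℕ) (X Y : Str) : Option Cand :=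
  if 4 ≤ radLevel m Y then
    (splitSep m (dropSign X)).map fun p =>
      ⟨radLevel m Y, isNeg X, p.1, takeBits (radLevel m Y) p.2⟩
  else none

/-- A number, cut off at `4`. -/
def sat4 (n : ℕ) : Fin 5 := ⟨min n 4, by omega⟩

/-- Counts leading zeros on the stack `y`, as long as there is something on `c1`. -/
def zerosLoop : Prog M :=
  .loop (fun _ t => match t.st (.nm .y), t.st (.nm .c1) with
      | some (some (.bit false)), some _ => true
      | _, _ => false) <| .op fun v _ =>
    { v := { v with cnt := if v.cnt = 4 then 4 else v.cnt + 1 }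
      st := fun
        | .nm .y => .pop
        | .nm .c1 => .pop
        | .nm .nk => .push none
        | _ => .keep }

theorem sat4_succ (n : ℕ) : sat4 (n + 1) = if sat4 n = 4 then 4 else sat4 n + 1 := by
  unfold sat4
  grind

theorem sat4_eq (n : ℕ) : sat4 n = 4 ↔ 4 ≤ n := by
  unfold sat4
  rw [Fin.ext_iff]
  change min n 4 = 4 ↔ _
  omega

theorem ex_zerosLoop (σ : PS M) (m k : ℕ) (w : Str) :
    Ex φ zerosLoop
      { σ with y := w.map some, c1 := un m, nk := un k, v := { σ.v with cnt := sat4 k } } (2 * m + 1)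
      { σ with y := (w.drop (zerosUpTo m w)).map some, c1 := un (m - zerosUpTo m w),
               nk := un (k + zerosUpTo m w),
               v := { σ.v with cnt := sat4 (k + zerosUpTo m w) } } := by
  induction m generalizing w k with
  | zero => 
    have : zerosUpTo 0 w = 0 := rfl
    rw [this]
    refine Ex.loop_end ?_
    rcases w with _ | ⟨_ | _, w⟩
    · rfl
    · rename_i b; cases b <;> rfl
    · rfl
  | succ m ih =>
    rcases w with _ | ⟨b | _, w⟩
    · exact Ex.mono Ex.loop_end (by omega)
    · cases b
      · refine ((Ex.loop_step (Ex.op (by rw [sat4_succ])) (ih (k + 1) w)).congr ?_ ?_)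
        · have e : zerosUpTo (m + 1) (.bit false :: w) = zerosUpTo m w + 1 := rfl
          grind
        · omega
      · exact Ex.mono Ex.loop_end (by omega)
    · exact Ex.mono Ex.loop_end (by omega)

/-- Moves the bits in front of the separator from `x` to `np`, as long as there is something on
`c2`. -/
def bitsLoop : Prog M :=
  .loop (fun _ t => match t.st (.nm .x), t.st (.nm .c2) with
      | some (some (.bit _)), some _ => true
      | _, _ => false) <| .op fun v t =>
    { v := v
      st := fun
        | .nm .x => .pop
        | .nm .c2 => .pop
        | .nm .np => .push ((t.st (.nm .x)).getD none)
        | _ => .keep }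

theorem ex_bitsLoop (σ : PS M) (m : ℕ) (w : Str) (l : List Sym) :
    ∃ (m' : ℕ) (w' : Str) (l' : List Sym), m' ≤ m ∧ w'.length ≤ w.length ∧ l'.length ≤ l.length + m ∧
      Ex φ bitsLoop
      { σ with x := w.map some, c2 := un m, np := l } (2 * m + 1)
      { σ with x := w'.map some, c2 := un m', np := l' } ∧
      ∀ p, (splitSep m w = some p → w' = .sep :: p.2 ∧
        l' = ((p.1.map Letter.bit).map some).reverse ++ l) ∧
        (splitSep m w = none → w'.head? ≠ some .sep) := by
  induction m generalizing w l with
  | zero =>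
    refine ⟨0, w, l, le_rfl, le_rfl, le_rfl, Ex.loop_end ?_, fun p => ⟨fun h => ?_, fun h => ?_⟩⟩
    · rcases w with _ | ⟨_ | _, w⟩ <;> rfl
    · rcases w with _ | ⟨_ | _, w⟩ <;> simp [splitSep] at h
      subst h; simp
    · rcases w with _ | ⟨_ | _, w⟩ <;> simp [splitSep] at h ⊢
  | succ m ih =>
    rcases w with _ | ⟨b | _, w⟩
    · exact ⟨m + 1, [], l, le_rfl, le_rfl, by omega,
        Ex.mono Ex.loop_end (by omega), by simp [splitSep]⟩
    · obtain ⟨m', w', l', h1, h2, h3, h4, h5⟩ := ih w (some (.bit b) :: l)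
      simp only [List.length_cons] at h3
      refine ⟨m', w', l', by omega, by simp; omega, by omega,
        (Ex.loop_step Ex.op h4).mono (by omega), fun p => ⟨fun h => ?_, fun h => ?_⟩⟩
      · simp only [splitSep, Option.map_eq_some_iff] at h
        grind
      · simp only [splitSep, Option.map_eq_none_iff] at h
        exact (h5 p).2 h
    · exact ⟨m + 1, .sep :: w, l, le_rfl, le_rfl, by omega, Ex.mono Ex.loop_end (by omega),
        fun p => ⟨fun h => by simp [splitSep] at h; subst h; simp, by simp [splitSep]⟩⟩

/-- The bit that a stack symbol stands for. -/
def symBit : Option Sym → Bool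
  | some (some (.bit b)) => b
  | _ => false

/-- Copies as many bits from `x` to `np` as there are symbols on `nk`. -/
def fracLoop : Prog M :=
  .seq (.loop (has .nk) <| .op fun v t =>
    { v := { v with nib := 2 * v.nib + if symBit (t.st (.nm .x)) then 1 else 0 }
      st := fun
        | .nm .x => .pop
        | .nm .nk => .pop
        | .nm .t1 => .push none
        | .nm .np => .push (some (.bit (symBit (t.st (.nm .x)))))
        | _ => .keep })
    (mv .t1 .nk)

theorem ex_fracLoop (σ : PS M) (k : ℕ) (w : Str) (ht : σ.t1 = []) :
    Ex φ fracLoop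
      { σ with x := w.map some, nk := un k, v := { σ.v with nib := 0 } } (10 * (k + 1))
      { σ with x := (w.drop k).map some, nk := un k,
               np := (((takeBits k w).map Letter.bit).map some).reverse ++ σ.np,
               v := { σ.v with nib := nibOf (takeBits k w) } } := by
  have key : ∀ k w (l : List Sym) a j, Ex (M := M) φ (.loop (has .nk) <|
      .op fun v t =>
      { v := { v with nib := 2 * v.nib + if symBit (t.st (.nm .x)) then 1 else 0 }
        st := fun
          | .nm .x => .pop
          | .nm .nk => .pop
          | .nm .t1 => .push none
          | .nm .np => .push (some (.bit (symBit (t.st (.nm .x)))))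
          | _ => .keep })
      { σ with x := w.map some, nk := un k, t1 := un j, np := l, v := { σ.v with nib := a } }
      (2 * k + 1)
      { σ with x := (w.drop k).map some, nk := [], t1 := un (j + k),
               np := (((takeBits k w).map Letter.bit).map some).reverse ++ l,
               v := { σ.v with
                nib := (takeBits k w).foldl (fun v b => 2 * v + if b then 1 else 0) a } } := by
    intro k
    induction k with
    | zero => intro w l a j; exact Ex.loop_end
    | succ k ih =>
      intro w l a j
      refine (Ex.loop_step ?_ (ih w.tail (some (.bit (headBit w)) :: l)
        (2 * a + if headBit w then 1 else 0) (j + 1))).congr ?_ (T₁ := 1 + (2 * k + 1) + 1) ?_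
      · rcases w with _ | ⟨_ | _, w⟩ <;> exact Ex.op
      · simp only [takeBits, List.map_cons, List.reverse_cons, List.append_assoc,
          List.singleton_append, List.foldl_cons, List.drop_tail]
        rw [show j + 1 + k = j + (k + 1) by omega]
      · omega
  have h := (key k w σ.np 0 0).seq (ex_mv _ .t1 .nk _)
  have e : ({ σ with x := w.map some, nk := un k, t1 := un 0, v := { σ.v with nib := 0 } } : PS M) =
      { σ with x := w.map some, nk := un k, v := { σ.v with nib := 0 } } := by
    cases σ; simp_all
  rw [e] at h
  refine h.congr ?_ ?_
  · simp [PS.put, PS.get, nibOf, ht]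
  · simp [PS.get]; omega

/-- Does nothing. -/
def skip : Prog M := .op fun v _ => { v := v }

theorem ex_skip (σ : PS M) : Ex φ skip σ 1 σ := Ex.op

/-- Whether the next symbol of a stack is the separator. -/
def isSep : Option Sym → Bool
  | some (some .sep) => true
  | _ => false

/-- Pops a stack if its top is a bit. -/
def popBit : Option Sym → StackAct
  | some (some (.bit _)) => .pop
  | _ => .keep

/-- Reads the radius of an interval from `y`: the number of zeros after its point goes to `nk`. -/
def radBlock : Prog M :=
  .seq (.op fun v t =>
    { v := { v with ok := false, sg := false, nib := 0, cnt := 0 }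
      st := fun
        | .nm .y => popBit (t.st (.nm .y))
        | _ => .keep })
    (.ite (fun _ t => isSep (t.st (.nm .y)))
      (.seq (.op fun v _ =>
        { v := v
          st := fun
            | .nm .y => .pop
            | _ => .keep }) zerosLoop)
      skip)

theorem ex_radBlock (σ : PS M) (m : ℕ) (Y : Str) (hy : σ.y = Y.map some) (hc1 : σ.c1 = un m)
    (hnk : σ.nk = []) :
    ∃ (Y' : Str) (m' : ℕ), Y'.length ≤ Y.length ∧ m' ≤ m ∧ Ex φ radBlock σ (2 * m + 6)
      { σ with y := Y'.map some, c1 := un m', nk := un (radLevel m Y),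
               v := { σ.v with
                 ok := false, sg := false, nib := 0, cnt := sat4 (radLevel m Y) } } := by
  have h1 : Ex φ (.op fun v t =>
      { v := { v with ok := false, sg := false, nib := 0, cnt := 0 }
        st := fun
          | .nm .y => popBit (t.st (.nm .y))
          | _ => .keep }) σ 1 { σ with
            y := (dropSign Y).map some, c1 := un m, nk := un 0,
            v := { σ.v with ok := false, sg := false, nib := 0, cnt := sat4 0 } } := by
    obtain ⟨⟩ := σ
    dsimp only at hy hc1 hnk
    subst hy hc1 hnk
    rcases Y with _ | ⟨_ | _, Y⟩ <;> exact Ex.op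
  have hlen : (dropSign Y).length ≤ Y.length := by
    rcases Y with _ | ⟨_ | _, Y⟩ <;> simp [dropSign]
  by_cases hs : ∃ u, dropSign Y = .sep :: u
  · obtain ⟨u, hu⟩ := hs
    have hr : radLevel m Y = zerosUpTo m u := by simp [radLevel, hu]
    rw [hu] at h1 hlen
    refine ⟨u.drop (zerosUpTo m u), m - zerosUpTo m u, ?_, by omega, (h1.seq (Ex.ite_true
      (.seq (T₁ := 1) Ex.op (ex_zerosLoop (M := M) { σ with
        v := { σ.v with ok := false, sg := false, nib := 0 } } m 0 u)))).congr ?_ ?_⟩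
    · simp at hlen ⊢; omega
    · simp [hr]
    · omega
  · have hr : radLevel m Y = 0 := by
      unfold radLevel
      split
      · rename_i h; exact absurd ⟨_, h⟩ hs
      · rfl
    refine ⟨dropSign Y, m, hlen, le_rfl, (h1.seq (Ex.ite_false (ex_skip _) ?_)).congr ?_ ?_⟩
    · change isSep ((dropSign Y).map some).head? = false
      rcases h : dropSign Y with _ | ⟨_ | _, u⟩
      · rfl
      · rfl
      · exact absurd ⟨_, h⟩ hs
    · simp [hr]
    · omega

/-- Reads the midpoint of an interval from `x`, with as many digits after the point as there are
symbols on `nk`. -/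
def midBlock : Prog M :=
  .seq (.op fun v t =>
    { v := { v with sg := symBit (t.st (.nm .x)) }
      st := fun
        | .nm .x => popBit (t.st (.nm .x))
        | .nm .np => .push (some (.bit (symBit (t.st (.nm .x)))))
        | _ => .keep })
  (.seq bitsLoop
    (.ite (fun _ t => isSep (t.st (.nm .x)))
      (.seq (.op fun v _ =>
        { v := { v with ok := true, nib := 0 }
          st := fun
            | .nm .x => .pop
            | .nm .np => .push (some .sep)
            | _ => .keep })
      (.seq fracLoop
        (.op fun v _ => { v := { v with nib := if v.sg then -v.nib else v.nib } })))
      skip))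

theorem ex_midBlock (σ : PS M) (m k : ℕ) (X : Str) (hx : σ.x = X.map some) (hc2 : σ.c2 = un m)
    (hnk : σ.nk = un k) (hnp : σ.np = []) (ht1 : σ.t1 = []) (hok : σ.v.ok = false)
    (hnib : σ.v.nib = 0) :
    ∃ (X' : Str) (m' : ℕ) (l : List Sym) (o : Option Cand),
      X'.length ≤ X.length ∧ m' ≤ m ∧ l.length ≤ m + k + 2 ∧
      Ex φ midBlock σ (10 * (m + k + 3))
        { σ with x := X'.map some, c2 := un m', nk := un k, np := l,
                 v := { σ.v with sg := isNeg X, ok := o.isSome, nib := o.elim 0 Cand.nib } } ∧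
      o = (splitSep m (dropSign X)).map (fun p => ⟨k, isNeg X, p.1, takeBits k p.2⟩) ∧
      ∀ c, o = some c → l = (c.str.map some).reverse := by
  have h1 : Ex φ (.op fun v t =>
      { v := { v with sg := symBit (t.st (.nm .x)) }
        st := fun
          | .nm .x => popBit (t.st (.nm .x))
          | .nm .np => .push (some (.bit (symBit (t.st (.nm .x)))))
          | _ => .keep }) σ 1 { σ with
            x := (dropSign X).map some, c2 := un m, nk := un k,
            np := [some (.bit (isNeg X))], v := { σ.v with sg := isNeg X } } := by
    obtain ⟨⟩ := σ
    dsimp only at hx hc2 hnk hnp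
    subst hx hc2 hnk hnp
    rcases X with _ | ⟨_ | _, X⟩ <;> exact Ex.op
  have hlen : (dropSign X).length ≤ X.length := by
    rcases X with _ | ⟨_ | _, X⟩ <;> simp [dropSign]
  obtain ⟨m', w', l', i1, i2, i3, i4, i5⟩ := ex_bitsLoop (φ := φ) { σ with
    nk := un k,
    v := { σ.v with sg := isNeg X } } m (dropSign X) [some (.bit (isNeg X))]
  cases hs : splitSep m (dropSign X) with
  | none =>
    have h2 := (i5 ([], [])).2 hs
    refine ⟨w', m', l', none, by omega, i1, by simp at i3; omega,
      (h1.seq (i4.seq (Ex.ite_false (ex_skip _) ?_))).congr ?_ ?_, rfl, by simp⟩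
    · change isSep (w'.map some).head? = false
      rcases w' with _ | ⟨_ | _, w'⟩ <;> simp_all [isSep]
    · simp [hok, hnib]
    · omega
  | some p =>
    obtain ⟨rfl, rfl⟩ := (i5 p).1 hs
    simp only [List.length_append, List.length_reverse, List.length_map, List.length_singleton]
      at i3
    simp only [List.length_cons] at i2
    have h3 := ex_fracLoop (φ := φ) { σ with
      c2 := un m',
      np := some .sep :: (((p.1.map Letter.bit).map some).reverse ++ [some (.bit (isNeg X))]),
      v := { σ.v with sg := isNeg X, ok := true } } k p.2 ht1
    refine ⟨p.2.drop k, m', (((takeBits k p.2).map Letter.bit).map some).reverse ++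
        some .sep :: (((p.1.map Letter.bit).map some).reverse ++ [some (.bit (isNeg X))]),
      some ⟨k, isNeg X, p.1, takeBits k p.2⟩, by simp; omega, i1, ?_,
      (h1.seq (i4.seq (Ex.ite_true (Ex.seq (T₁ := 1) ?_ (h3.seq (T₂ := 1) Ex.op)) rfl))).congr
        rfl ?_, rfl, ?_⟩
    · have : (takeBits k p.2).length = k := by
        generalize p.2 = u
        clear * -
        induction k generalizing u with
        | zero => rfl
        | succ k ih => simp [takeBits, ih]
      simp [this]; omega
    · exact Ex.op
    · omega
    · rintro c hc
      obtain rfl := Option.some.inj hc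
      simp [Cand.str]

theorem length_takeBits (k : ℕ) (w : Str) : (takeBits k w).length = k := by
  induction k generalizing w with
  | zero => rfl
  | succ k ih => simp [takeBits, ih]

/-- Computes the approximation that is given by the strings on the stacks `x` and `y`. -/
def candProg : Prog M :=
  .seq radBlock
  (.seq (.ite (fun v _ => decide (v.cnt = 4)) midBlock skip)
  (.seq (clr .x) (.seq (clr .y) (.seq (clr .c1) (.seq (clr .c2) (.seq (mv .cp .cap)
  (.seq (.ite (fun v _ => v.ok) skip (.seq (clr .nk) (clr .np)))
    (.op fun v _ => { v := { v with cnt := 0, sg := false } }))))))))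

/-- The state in which the approximation `o` has been computed. -/
def PS.withCand (σ : PS M) (m : ℕ) (o : Option Cand) : PS M :=
  { σ with x := [], y := [], c1 := [], c2 := [], cp := [], cap := un m
           np := o.elim [] fun c => (c.str.map some).reverse
           nk := o.elim [] fun c => un c.lvl
           v := { σ.v with ok := o.isSome, sg := false, cnt := 0, nib := o.elim 0 Cand.nib } }

theorem zerosUpTo_le (m : ℕ) (w : Str) : zerosUpTo m w ≤ m := by
  induction m generalizing w with
  | zero => exact le_rfl
  | succ m ih =>
    rcases w with _ | ⟨(_ | _) | _, w⟩
    · exact Nat.zero_le _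
    · exact Nat.succ_le_succ (ih w)
    · exact Nat.zero_le _
    · exact Nat.zero_le _

theorem radLevel_le (m : ℕ) (w : Str) : radLevel m w ≤ m := by
  unfold radLevel
  split
  · exact zerosUpTo_le _ _
  · exact Nat.zero_le _

theorem ex_candCleanup (σ : PS M) (m k : ℕ) (o : Option Cand) (X Y : Str) (a b : ℕ) (l : List Sym)
    (ha : a ≤ m) (hb : b ≤ m) (hk : k ≤ m) (hl : l.length ≤ m + k + 2)
    (hX : X.length ≤ 3 * m) (hY : Y.length ≤ 3 * m)
    (hx : σ.x = X.map some) (hy : σ.y = Y.map some) (hc1 : σ.c1 = un a) (hc2 : σ.c2 = un b)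
    (hcp : σ.cp = un m) (hcap : σ.cap = []) (hnk : σ.nk = un k) (hnp : σ.np = l)
    (hok : σ.v.ok = o.isSome) (hnib : σ.v.nib = o.elim 0 Cand.nib)
    (ho : ∀ c, o = some c → l = (c.str.map some).reverse ∧ c.lvl = k) :
    Ex φ (.seq (clr .x) (.seq (clr .y) (.seq (clr .c1) (.seq (clr .c2) (.seq (mv .cp .cap)
      (.seq (.ite (fun v _ => v.ok) skip (.seq (clr .nk) (clr .np)))
        (.op fun v _ => { v := { v with cnt := 0, sg := false } }))))))) σ (30 * (m + 2))
      (σ.withCand m o) := by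
  have hfin : ∀ τ : PS M, Ex φ (.op fun v _ => { v := { v with cnt := 0, sg := false } }) τ 1
      { τ with v := { τ.v with cnt := 0, sg := false } } := fun τ => Ex.op
  have h0 : ∀ {T₂ : ℕ} {σ₂ : PS M}, Ex φ (.ite (fun v _ => v.ok) skip (.seq (clr .nk) (clr .np)))
      { σ with x := [], y := [], c1 := [], c2 := [], cp := [], cap := un m } T₂ σ₂ →
      T₂ ≤ 10 * m + 20 → { σ₂ with v := { σ₂.v with cnt := 0, sg := false } } = σ.withCand m o →
      Ex φ (.seq (clr .x) (.seq (clr .y) (.seq (clr .c1) (.seq (clr .c2) (.seq (mv .cp .cap)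
      (.seq (.ite (fun v _ => v.ok) skip (.seq (clr .nk) (clr .np)))
        (.op fun v _ => { v := { v with cnt := 0, sg := false } }))))))) σ (30 * (m + 2))
      (σ.withCand m o) := by
    intro T₂ σ₂ h hT he
    refine (((ex_clr _ .x _).seq ((ex_clr _ .y _).seq ((ex_clr _ .c1 _).seq ((ex_clr _ .c2 _).seq
      ((ex_mv _ .cp .cap _).seq
        (Ex.seq (T₁ := T₂) (σ₁ := σ₂) ?_ (hfin _)))))))).congr ?_ ?_
    · simpa [PS.put, PS.get, hcap, hcp] using h
    · exact he
    · simp [PS.put, PS.get, hx, hy, hc1, hc2, hcp]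
      omega
  cases o with
  | some c =>
    obtain ⟨h1, h2⟩ := ho c rfl
    refine h0 (Ex.ite_true (ex_skip _) hok) (by omega) ?_
    apply PS.ext
    all_goals first | rfl | simp [PS.withCand, h1, h2, hnk, hnp, hok, hnib]
  | none =>
    refine h0 (Ex.ite_false ((ex_clr _ _ _).seq (ex_clr _ _ _)) hok) ?_ ?_
    · simp [PS.put, PS.get, hnk, hnp]
      omega
    · apply PS.ext
      all_goals first | rfl | simp [PS.withCand, PS.put, hok, hnib]

theorem ex_candProg (σ : PS M) (m : ℕ) (X Y : Str) (hX : X.length ≤ 3 * m)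
    (hY : Y.length ≤ 3 * m) (hx : σ.x = X.map some) (hy : σ.y = Y.map some) (hc1 : σ.c1 = un m)
    (hc2 : σ.c2 = un m) (hcp : σ.cp = un m) (hcap : σ.cap = []) (hnk : σ.nk = [])
    (hnp : σ.np = []) (ht1 : σ.t1 = []) :
    Ex φ candProg σ (100 * (m + 1)) (σ.withCand m (candOf m X Y)) := by
  obtain ⟨Y', a, hY', ha, h1⟩ := ex_radBlock (φ := φ) σ m Y hy hc1 hnk
  have hk := radLevel_le m Y
  by_cases h4 : 4 ≤ radLevel m Y
  · obtain ⟨X', b, l, o, hX', hb, hl, h2, ho, hol⟩ := ex_midBlock (φ := φ) { σ with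
      y := Y'.map some, c1 := un a, nk := un (radLevel m Y),
      v := { σ.v with ok := false, sg := false, nib := 0, cnt := sat4 (radLevel m Y) } } m
      (radLevel m Y) X hx hc2 rfl hnp ht1 rfl rfl
    have h3 := ex_candCleanup (φ := φ) m (radLevel m Y) o X' Y' a b l ha hb hk hl
      (hX'.trans hX) (hY'.trans hY) (σ := { σ with
        x := X'.map some, y := Y'.map some, c1 := un a, c2 := un b, nk := un (radLevel m Y), np := l,
        v := { σ.v with ok := o.isSome, sg := isNeg X, nib := o.elim 0 Cand.nib,
                        cnt := sat4 (radLevel m Y) } })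
      rfl rfl rfl rfl hcp hcap rfl rfl rfl rfl (fun c hc => ⟨hol c hc, by
        rw [ho, Option.map_eq_some_iff] at hc
        obtain ⟨p, _, rfl⟩ := hc
        rfl⟩)
    refine (h1.seq (Ex.seq (Ex.ite_true h2 ?_) h3)).congr ?_ ?_
    · simpa using (sat4_eq _).2 h4
    · rw [candOf, if_pos h4, ← ho]
      rfl
    · omega
  · have h3 := ex_candCleanup (φ := φ) m (radLevel m Y) none X Y' a m [] ha le_rfl hk (by simp)
      hX (hY'.trans hY) (σ := { σ with
        y := Y'.map some, c1 := un a, nk := un (radLevel m Y),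
        v := { σ.v with ok := false, sg := false, nib := 0,
                        cnt := sat4 (radLevel m Y) } })
      hx rfl rfl hc2 hcp hcap rfl hnp rfl rfl (by simp)
    refine (h1.seq (Ex.seq (Ex.ite_false (ex_skip _) ?_) h3)).congr ?_ ?_
    · simpa [sat4_eq] using h4
    · rw [candOf, if_neg h4]
      rfl
    · omega

/-! ### Collecting approximations -/

/-- A summary of a set of approximations: the largest number `lvl` of digits that occurs (or `0`),
the smallest approximation with that many digits together with its last digits, and the distance to
the largest one, in multiples of `2 ^ (-lvl)` and cut off at `14`. -/
structure Coll where
  lvl : ℕ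
  str : Str
  nib : Fin 16
  d : Fin 16

/-- The summary of the empty set. -/
def Coll.empty : Coll := ⟨0, [], 0, 0⟩

/-- A number, cut off at `14`. -/
def cut14 (n : ℕ) : Fin 16 := ⟨min n 14, by omega⟩

/-- The summary after a further approximation `c` has been added. As two approximations with the
same number of digits differ by few multiples of `2 ^ (-lvl)` only, the last digits tell which of
them is smaller. -/
def Coll.add (s : Coll) (c : Cand) : Coll :=
  if s.lvl < c.lvl then ⟨c.lvl, c.str, c.nib, 0⟩
  else if s.lvl = c.lvl then
    if 8 ≤ c.nib - s.nib then
      ⟨c.lvl, c.str, c.nib, cut14 (s.d.val + (s.nib - c.nib).val)⟩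
    else { s with d := max s.d (cut14 (c.nib - s.nib).val) }
  else s

/-- The summary after an approximation has been added, if there is one. -/
def Coll.addOpt (s : Coll) (o : Option Cand) : Coll := o.elim s s.add

/-- The approximation that is given by the code `w` of an interval, if at most `m` digits on either
side of the binary point are used. -/
def candStr (m : ℕ) (w : Str) : Option Cand := candOf m (tracks (3 * m) w).1 (tracks (3 * m) w).2

/-- Moves symbols from `nk` to `t1` and from `bk` to `t2`, as long as there are symbols on both. -/
def cmpLoop : Prog M :=
  .loop (fun _ t => (t.st (.nm .nk)).isSome && (t.st (.nm .bk)).isSome) <| .op fun v _ =>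
    { v := v
      st := fun
        | .nm .nk => .pop
        | .nm .bk => .pop
        | .nm .t1 => .push none
        | .nm .t2 => .push none
        | _ => .keep }

theorem ex_cmpLoop (σ : PS M) (a b i j : ℕ) :
    Ex φ cmpLoop { σ with nk := un a, bk := un b, t1 := un i, t2 := un j } (2 * b + 1)
      { σ with
        nk := un (a - b), bk := un (b - a)
        t1 := un (i + min a b), t2 := un (j + min a b) } := by
  induction a generalizing b i j with
  | zero =>
    simp only [Nat.zero_sub, Nat.sub_zero, Nat.zero_min, Nat.add_zero]
    exact Ex.mono Ex.loop_end (by omega)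
  | succ a ih =>
    cases b with
    | zero =>
      simp only [Nat.zero_sub, Nat.sub_zero, Nat.min_zero, Nat.add_zero]
      exact Ex.loop_end
    | succ b =>
      refine (Ex.loop_step (T₁ := 1) Ex.op (ih b (i + 1) (j + 1))).congr ?_ (by omega)
      grind

/-- The decision whether the new approximation replaces the best one. -/
def updateBest (v : Regs M) (newMore bestMore : Bool) : Regs M :=
  if newMore then { v with go := true, bn := v.nib, d := 0 }
  else if bestMore then { v with go := false }
  else if 8 ≤ v.nib - v.bn then
    { v with go := true, bn := v.nib, d := cut14 (v.d.val + (v.bn - v.nib).val) }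
  else { v with go := false, d := max v.d (cut14 (v.nib - v.bn).val) }

/-- Compares the heights of the stacks `nk` and `bk` and decides whether the new approximation
replaces the best one. -/
def compare : Prog M :=
  .seq cmpLoop (.seq (.op fun v t =>
      { v := updateBest v (t.st (.nm .nk)).isSome (t.st (.nm .bk)).isSome })
    (.seq (mv .t1 .nk) (mv .t2 .bk)))

theorem isSome_head_un (a b : ℕ) : (un (a - b)).head?.isSome = decide (b < a) := by
  cases h : a - b with
  | zero => rw [eq_comm, un_zero]; simpa using (by omega)
  | succ n => rw [eq_comm, un_succ]; simpa using (by omega)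

theorem ex_compare (σ : PS M) (a b : ℕ) (h1 : σ.t1 = []) (h2 : σ.t2 = []) (hnk : σ.nk = un a)
    (hbk : σ.bk = un b) :
    Ex φ compare σ (10 * (a + b + 1))
      { σ with v := updateBest σ.v (decide (b < a)) (decide (a < b)) } := by
  have k1 := ex_cmpLoop (φ := φ) σ a b 0 0
  have e1 : ({ σ with nk := un a, bk := un b, t1 := un 0, t2 := un 0 } : PS M) = σ := by
    cases σ
    simp_all
  rw [e1] at k1
  refine (k1.seq (Ex.seq (T₁ := 1) Ex.op ((ex_mv _ .t1 .nk
    { σ with nk := un (a - b), bk := un (b - a), t1 := un (0 + min a b), t2 := un (0 + min a b),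
             v := updateBest σ.v (un (a - b)).head?.isSome (un (b - a)).head?.isSome }).seq
    (ex_mv _ .t2 .bk _)))).congr ?_ ?_
  · simp only [PS.put, PS.get, reverse_un, un_add, isSome_head_un]
    grind
  · simp only [PS.put, PS.get, length_un]
    omega

/-- Adds the approximation on the stacks `np` and `nk` to the summary. -/
def collect : Prog M :=
  .seq (.ite (fun v _ => v.ok)
    (.seq compare
    (.ite (fun v _ => v.go) (.seq (clr .bp) (.seq (clr .bk) (.seq (mv .np .bp) (mv .nk .bk))))
      (.seq (clr .np) (clr .nk))))
    skip)
    (.op fun v _ => { v := { v with ok := false, nib := 0, go := false, f1 := false, f2 := false } })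

/-- The state in which the summary is `s` and there is no approximation to be added. -/
def PS.withColl (σ : PS M) (s : Coll) : PS M :=
  { σ with
    np := [], nk := [], bp := s.str.map some, bk := un s.lvl
    v := { σ.v with
      ok := false, sg := false, cnt := 0, nib := 0, go := false, f1 := false, f2 := false
      bn := s.nib, d := s.d } }

theorem ex_collect_some (σ : PS M) (s : Coll) (c : Cand) (h1 : σ.t1 = []) (h2 : σ.t2 = [])
    (hnp : σ.np = (c.str.map some).reverse) (hnk : σ.nk = un c.lvl) (hbp : σ.bp = s.str.map some)
    (hbk : σ.bk = un s.lvl) (hok : σ.v.ok = true) (hsg : σ.v.sg = false) (hcnt : σ.v.cnt = 0)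
    (hnib : σ.v.nib = c.nib) (hbn : σ.v.bn = s.nib) (hd : σ.v.d = s.d) :
    Ex φ collect σ (30 * (s.lvl + s.str.length + c.lvl + c.str.length + 1))
      (σ.withColl (s.add c)) := by
  have k1 := ex_compare (φ := φ) σ c.lvl s.lvl h1 h2 hnk hbk
  have k2 : ∀ τ : PS M, Ex φ (.op fun v _ =>
      { v := { v with ok := false, nib := 0, go := false, f1 := false, f2 := false } })
    τ 1 { τ with v := { τ.v with ok := false, nib := 0, go := false, f1 := false, f2 := false } } :=
      fun τ => Ex.op
  have replace : ∀ (v : Regs M) (nib : Fin 16) (d : Fin 16), v.go = true →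
      v = { σ.v with go := true, bn := nib, d := d } →
      Ex φ (.ite (fun v _ => v.go) (.seq (clr .bp) (.seq (clr .bk) (.seq (mv .np .bp) (mv .nk .bk))))
      (.seq (clr .np) (clr .nk))) { σ with v := v }
        (10 * (s.lvl + s.str.length + c.lvl + c.str.length + 1))
        { σ with
          v := { σ.v with go := true, bn := nib, d := d }
          np := [], nk := [], bp := c.str.map some, bk := un c.lvl } := by
    intro v nib d hv hv'
    refine (Ex.ite_true ((ex_clr _ .bp _).seq ((ex_clr _ .bk _).seq
      ((ex_mv _ .np .bp _).seq (ex_mv _ .nk .bk _)))) hv).congr ?_ ?_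
    · simp [PS.put, PS.get, hnp, hnk, hv']
    · simp [PS.put, PS.get, hnp, hnk, hbp, hbk]
      omega
  have discard : ∀ (v : Regs M), v.go = false →
      Ex φ (.ite (fun v _ => v.go) (.seq (clr .bp) (.seq (clr .bk) (.seq (mv .np .bp) (mv .nk .bk))))
      (.seq (clr .np) (clr .nk))) { σ with v := v }
        (10 * (s.lvl + s.str.length + c.lvl + c.str.length + 1))
        { σ with v := v, np := [], nk := [] } := by
    intro v hv
    refine (Ex.ite_false ((ex_clr _ .np _).seq (ex_clr _ .nk _)) hv).congr rfl ?_
    simp [PS.put, PS.get, hnp, hnk]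
    omega
  have fin : ∀ {σ₂}, Ex φ (.ite (fun v _ => v.go) (.seq (clr .bp) (.seq (clr .bk)
      (.seq (mv .np .bp) (mv .nk .bk)))) (.seq (clr .np) (clr .nk)))
      { σ with v := updateBest σ.v (decide (s.lvl < c.lvl)) (decide (c.lvl < s.lvl)) }
        (10 * (s.lvl + s.str.length + c.lvl + c.str.length + 1)) σ₂ →
      { σ₂ with v := { σ₂.v with ok := false, nib := 0, go := false, f1 := false, f2 := false } } =
        σ.withColl (s.add c) →
      Ex φ collect σ (30 * (s.lvl + s.str.length + c.lvl + c.str.length + 1))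
        (σ.withColl (s.add c)) := by
    intro σ₂ h he
    exact ((Ex.ite_true (k1.seq h) hok).seq (k2 _)).congr he (by omega)
  by_cases c1 : s.lvl < c.lvl
  · refine fin (replace _ c.nib 0 ?_ ?_) ?_
    · simp [updateBest, c1]
    · simp [updateBest, c1, hnib]
    · apply PS.ext
      all_goals first | rfl | simp [PS.withColl, Coll.add, c1, hsg, hcnt]
  by_cases c2 : c.lvl < s.lvl
  · refine fin (discard _ ?_) ?_
    · simp [updateBest, c1, c2]
    · apply PS.ext
      all_goals first
        | rfl
        | simp [PS.withColl, Coll.add, c1, c2.ne', hsg, hcnt, updateBest, c2, hbn, hd, hbp, hbk]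
  have e : s.lvl = c.lvl := by omega
  by_cases c3 : 8 ≤ c.nib - s.nib
  · refine fin (replace _ c.nib (cut14 (s.d.val + (s.nib - c.nib).val)) ?_ ?_) ?_
    · simp [updateBest, e, hnib, hbn, c3]
    · simp [updateBest, e, hnib, hbn, hd, c3]
    · apply PS.ext
      all_goals first | rfl | simp [PS.withColl, Coll.add, e, c3, hsg, hcnt]
  · refine fin (discard _ ?_) ?_
    · simp [updateBest, e, hnib, hbn, c3]
    · apply PS.ext
      all_goals first
        | rfl
        | simp [PS.withColl, Coll.add, e, hsg, hcnt, updateBest, c3, hbn, hd, hbp, hbk, hnib]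

theorem ex_collect (σ : PS M) (s : Coll) (o : Option Cand) (h1 : σ.t1 = []) (h2 : σ.t2 = [])
    (hnp : σ.np = o.elim [] fun c => (c.str.map some).reverse)
    (hnk : σ.nk = o.elim [] fun c => un c.lvl) (hbp : σ.bp = s.str.map some)
    (hbk : σ.bk = un s.lvl) (hok : σ.v.ok = o.isSome) (hsg : σ.v.sg = false) (hcnt : σ.v.cnt = 0)
    (hnib : σ.v.nib = o.elim 0 Cand.nib) (hbn : σ.v.bn = s.nib) (hd : σ.v.d = s.d) (B : ℕ)
    (hB : ∀ c, o = some c → c.lvl + c.str.length ≤ B) :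
    Ex φ collect σ (30 * (s.lvl + s.str.length + B + 1)) (σ.withColl (s.addOpt o)) := by
  cases o with
  | none =>
    refine ((Ex.ite_false (ex_skip _) hok).seq (Ex.op (σ₁ := { σ with
      v := { σ.v with ok := false, nib := 0, go := false, f1 := false, f2 := false } }))).congr ?_ (by omega)
    apply PS.ext
    all_goals first
      | rfl
      | simp_all [PS.withColl, Coll.addOpt]
  | some c =>
    refine (ex_collect_some σ s c h1 h2 hnp hnk hbp hbk hok hsg hcnt hnib hbn hd).mono ?_
    have := hB c rfl
    omega

theorem splitSep_length {m : ℕ} {w : Str} {p : List Bool × Str} (h : splitSep m w = some p) :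
    p.1.length ≤ m := by
  induction m generalizing w p with
  | zero =>
    rcases w with _ | ⟨_ | _, w⟩ <;> simp [splitSep] at h
    subst h; simp
  | succ m ih =>
    rcases w with _ | ⟨_ | _, w⟩
    · simp [splitSep] at h
    · simp only [splitSep, Option.map_eq_some_iff] at h
      obtain ⟨q, hq, rfl⟩ := h
      simpa using ih hq
    · simp [splitSep] at h
      subst h; simp

/-- The approximations from the first `m` digits are short. -/
theorem candOf_length {m : ℕ} {X Y : Str} {c : Cand} (h : candOf m X Y = some c) :
    c.lvl ≤ m ∧ c.str.length ≤ 2 * m + 2 := by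
  unfold candOf at h
  split_ifs at h
  simp only [Option.map_eq_some_iff] at h
  obtain ⟨p, hp, rfl⟩ := h
  have h1 := splitSep_length hp
  have h2 := radLevel_le m Y
  refine ⟨h2, ?_⟩
  simp [Cand.str, length_takeBits]
  omega

/-- The auxiliary stacks are empty. -/
structure PS.Clean (σ : PS M) : Prop where
  t1 : σ.t1 = []
  t2 : σ.t2 = []
  x : σ.x = []
  y : σ.y = []
  cp : σ.cp = []
  c1 : σ.c1 = []
  c2 : σ.c2 = []
  np : σ.np = []
  nk : σ.nk = []
  pa : σ.pa = []
  pk : σ.pk = []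
  pb : σ.pb = []

/-- The stacks and registers hold the summary `s`, and there is no approximation to be added. -/
structure PS.HasColl (σ : PS M) (s : Coll) : Prop where
  bp : σ.bp = s.str.map some
  bk : σ.bk = un s.lvl
  bn : σ.v.bn = s.nib
  d : σ.v.d = s.d

/-- Reads the code of an interval and adds the approximation that it gives to the summary. -/
def harvest (real : Bool) : Prog M := .seq (fetch real) (.seq candProg collect)

theorem ex_harvest (real : Bool) (σ : PS M) (s : Coll) (m : ℕ) (w : Str) (hcl : σ.Clean)
    (hs : σ.HasColl s) (hcap : σ.cap = un m) :
    ∃ w' : Str, w'.length ≤ w.length ∧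
      Ex φ (harvest real) (σ.src real w) (300 * (s.lvl + s.str.length + m + 1))
      ((σ.withColl (s.addOpt (candStr m w))).src real w') := by
  obtain ⟨w', hl', h1⟩ := ex_fetch (φ := φ) real σ w m hcap
    hcl.t1 hcl.t2 hcl.x hcl.y hcl.cp hcl.c1 hcl.c2
  have hl := length_tracks (3 * m) w
  refine ⟨w', hl', ?_⟩
  have h2 := ex_candProg (φ := φ) (PS.src { σ with
      cap := [], cp := un m, c1 := un m, c2 := un m,
      x := (tracks (3 * m) w).1.map some, y := (tracks (3 * m) w).2.map some } real w') m _ _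
      hl.1 hl.2 (by cases real <;> rfl) (by cases real <;> rfl) (by cases real <;> rfl)
      (by cases real <;> rfl) (by cases real <;> rfl) (by cases real <;> rfl)
      (by cases real <;> exact hcl.nk) (by cases real <;> exact hcl.np)
      (by cases real <;> exact hcl.t1)
  have h3 := ex_collect (φ := φ) (PS.withCand (PS.src { σ with
      cap := [], cp := un m, c1 := un m, c2 := un m,
      x := (tracks (3 * m) w).1.map some, y := (tracks (3 * m) w).2.map some } real w') m
        (candStr m w)) s (candStr m w) (by cases real <;> exact hcl.t1)
      (by cases real <;> exact hcl.t2) rfl rfl (by cases real <;> exact hs.bp)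
      (by cases real <;> exact hs.bk) rfl rfl rfl rfl (by cases real <;> exact hs.bn)
      (by cases real <;> exact hs.d) (3 * m + 2) (fun c hc => by
        have := candOf_length hc
        omega)
  refine (h1.seq (h2.seq h3)).congr ?_ (by omega)
  apply PS.ext
  all_goals
    cases real <;> first
      | rfl
      | exact hcap.symm
      | exact hcl.x.symm
      | exact hcl.y.symm
      | exact hcl.cp.symm
      | exact hcl.c1.symm
      | exact hcl.c2.symm

/-! ### Writing the codes of intervals -/

/-- The binary digits of a number below 16, the most significant one first. -/
def nibBits (r : Fin 16) : List Bool :=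
  [r.val.testBit 3, r.val.testBit 2, r.val.testBit 1, r.val.testBit 0]

/-- The code of `r * 2 ^ (-k)` with `k` digits after the point. -/
def radStr (k : ℕ) (r : Fin 16) : Str :=
  .bit false :: .sep :: (List.replicate (k - 4) (.bit false) ++ (nibBits r).map .bit)

/-- Interleaves two strings with a string of ones. The second string is padded by zeros to the
length of the first one. -/
def zipStr : Str → Str → Str
  | [], _ => []
  | x :: a, b => .bit true :: x :: b.head?.getD (.bit false) :: zipStr a b.tail

/-- The code of the interval with the midpoint that is given by `a` and with radius
`r * 2 ^ (-k)`. -/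
def encStr (a : Str) (k : ℕ) (r : Fin 16) : Str :=
  zipStr a (radStr k r) ++ List.replicate 6 (.bit false)

theorem length_zipStr (a b : Str) : (zipStr a b).length = 3 * a.length := by
  induction a generalizing b with
  | nil => rfl
  | cons x a ih => simp [zipStr, ih]; omega

/-- Where a string can be written to. -/
inductive Dst where
  | out
  | qry
  | t1
  deriving DecidableEq

/-- The state after a string has been written. -/
def PS.emit (σ : PS M) (dst : Dst) (w : Str) : PS M :=
  match dst with
  | .out => { σ with out := σ.out ++ w }
  | .qry => { σ with qry := σ.qry ++ w }
  | .t1 => { σ with t1 := (w.map some).reverse ++ σ.t1 }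

theorem PS.emit_nil (σ : PS M) (dst : Dst) : σ.emit dst [] = σ := by
  cases dst <;> simp [emit]

theorem PS.emit_emit (σ : PS M) (dst : Dst) (v w : Str) :
    (σ.emit dst v).emit dst w = σ.emit dst (v ++ w) := by
  cases dst <;> simp [emit]

/-- Writes a letter. -/
def emitOp (dst : Dst) (f : Regs M → Tops (Ix M.workTapes) → Letter) : Prog M := .op fun v t =>
  { v := v
    st := fun
      | .nm .t1 => if dst = .t1 then .push (some (f v t)) else .keep
      | _ => .keep
    qry := if dst = .qry then some (f v t) else none
    out := if dst = .out then some (f v t) else none }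

theorem ex_emitOp (dst : Dst) (f : Regs M → Tops (Ix M.workTapes) → Letter) (σ : PS M) :
    Ex φ (emitOp dst f) σ 1 (σ.emit dst [f σ.v σ.toSt.tops]) := by
  cases dst
  · exact Ex.op (ho := rfl)
  · exact Ex.op (hq := rfl)
  · exact Ex.op

theorem ex_emitOp' (dst : Dst) (f : Regs M → Tops (Ix M.workTapes) → Letter) (σ : PS M)
    (x : Letter) (h : f σ.v σ.toSt.tops = x) :
    Ex φ (emitOp dst f) σ 1 (σ.emit dst [x]) := h ▸ ex_emitOp dst f σ

/-- Writes a string. -/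
def emitStr (dst : Dst) : Str → Prog M
  | [] => skip
  | x :: w => .seq (emitOp dst fun _ _ => x) (emitStr dst w)

theorem ex_emitStr (dst : Dst) (w : Str) (σ : PS M) :
    Ex φ (emitStr dst w) σ (2 * w.length + 1) (σ.emit dst w) := by
  induction w generalizing σ with
  | nil => rw [PS.emit_nil]; exact ex_skip σ
  | cons x w ih =>
    refine ((ex_emitOp dst _ σ).seq (ih _)).congr ?_ ?_
    · rw [PS.emit_emit]; rfl
    · simp; omega

/-- The letter that a stack symbol stands for. -/
def symLetter : Option Sym → Letter
  | some (some x) => x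
  | _ => .bit false

/-- Pushes as many zeros to `pb` as there are symbols on `pk`. -/
def zeroLoop : Prog M :=
  .loop (has .pk) (.op fun v _ => { v := v, st := fun
          | .nm .pk => .pop
          | .nm .pb => .push (some (.bit false))
          | _ => .keep })

/-- Replaces the string on the stack `pb` by the code of `r * 2 ^ (-k)`, where `k` is the height of
the stack `pk`. -/
def putRad (r : Regs M → Fin 16) : Prog M :=
  .seq (.op fun v _ => { v := v, st := fun
          | .nm .pk => .pop
          | .nm .pb => .push (some (.bit ((r v).val.testBit 0)))
          | _ => .keep })
  (.seq (.op fun v _ => { v := v, st := fun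
          | .nm .pk => .pop
          | .nm .pb => .push (some (.bit ((r v).val.testBit 1)))
          | _ => .keep })
  (.seq (.op fun v _ => { v := v, st := fun
          | .nm .pk => .pop
          | .nm .pb => .push (some (.bit ((r v).val.testBit 2)))
          | _ => .keep })
  (.seq (.op fun v _ => { v := v, st := fun
          | .nm .pk => .pop
          | .nm .pb => .push (some (.bit ((r v).val.testBit 3)))
          | _ => .keep })
  (.seq zeroLoop
  (.seq (push .pb (some .sep))
  (push .pb (some (.bit false))))))))

theorem ex_putRad (r : Regs M → Fin 16) (σ : PS M) (k : ℕ) (hk : 4 ≤ k) (hpk : σ.pk = un k)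
    (hpb : σ.pb = []) :
    Ex φ (putRad r) σ (2 * k + 20) { σ with pk := [], pb := (radStr k (r σ.v)).map some } := by
  obtain ⟨k, rfl⟩ := Nat.exists_eq_add_of_le' hk
  have h : Ex φ zeroLoop _ _ _ := Ex.loop_nat
    (fun n (b : List Sym) => { σ with pk := un n, pb := b }) (fun b => some (.bit false) :: b) 1
    (fun n b => Ex.op) (by intros; rfl) (by intros; rfl) k
    ((nibBits (r σ.v)).map fun b => some (.bit b))
  have hit : ∀ (n : ℕ) (b : List Sym), (fun b => some (Letter.bit false) :: b)^[n] b =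
      List.replicate n (some (.bit false)) ++ b := by
    intro n
    induction n with
    | zero => intro b; rfl
    | succ n ih =>
      intro b
      rw [Function.iterate_succ_apply', ih]
      rfl
  rw [hit] at h
  have e : σ = { σ with pk := un (k + 4), pb := [] } := by cases σ; simp_all
  rw [e]
  refine (Ex.seq (T₁ := 1) (σ₁ := { σ with
      pk := un (k + 3), pb := [some (.bit ((r σ.v).val.testBit 0))] }) Ex.op
    (Ex.seq (T₁ := 1) (σ₁ := { σ with
      pk := un (k + 2), pb := [some (.bit ((r σ.v).val.testBit 1)),
        some (.bit ((r σ.v).val.testBit 0))] }) Ex.op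
    (Ex.seq (T₁ := 1) (σ₁ := { σ with
      pk := un (k + 1), pb := [some (.bit ((r σ.v).val.testBit 2)),
        some (.bit ((r σ.v).val.testBit 1)), some (.bit ((r σ.v).val.testBit 0))] }) Ex.op
    (Ex.seq (T₁ := 1) Ex.op
    (h.seq (Ex.seq (T₁ := 1) (σ₁ := { σ with
      pk := [], pb := some .sep :: (List.replicate k (some (.bit false)) ++
        (nibBits (r σ.v)).map fun b => some (.bit b)) }) Ex.op (T₂ := 1) (σ₂ := { σ with
      pk := [], pb := some (.bit false) :: some .sep :: (List.replicate k (some (.bit false)) ++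
        (nibBits (r σ.v)).map fun b => some (.bit b)) }) Ex.op)))))).congr ?_ ?_
  · apply PS.ext
    all_goals first | rfl | simp [radStr]
  · omega

/-- Writes the code of an interval. The stack `pa` holds the code of its midpoint; its radius is
`r * 2 ^ (-k)`, where `k` is the height of the stack `pk`. -/
def writer (dst : Dst) (r : Regs M → Fin 16) : Prog M :=
  .seq (putRad r)
  (.seq (.loop (has .pa)
    (.seq (emitOp dst fun _ _ => .bit true)
    (.seq (emitOp dst fun _ t => symLetter (t.st (.nm .pa)))
    (.seq (emitOp dst fun _ t => symLetter (t.st (.nm .pb)))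
      (.op fun v _ => { v := v, st := fun
          | .nm .pa => .pop
          | .nm .pb => .pop
          | _ => .keep })))))
  (.seq (clr .pb) (emitStr dst (List.replicate 6 (.bit false)))))

theorem ex_writer (dst : Dst) (r : Regs M → Fin 16) (σ : PS M) (a : Str) (k : ℕ) (hk : 4 ≤ k)
    (hpa : σ.pa = a.map some) (hpk : σ.pk = un k) (hpb : σ.pb = []) :
    Ex φ (writer dst r) σ (20 * (a.length + k + 2))
      ({ σ with pa := [], pk := [] }.emit dst (encStr a k (r σ.v))) := by
  have key : ∀ (a b : Str) (τ : PS M), Ex φ (.loop (has .pa)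
      (.seq (emitOp dst fun _ _ => .bit true)
      (.seq (emitOp dst fun _ t => symLetter (t.st (.nm .pa)))
      (.seq (emitOp dst fun _ t => symLetter (t.st (.nm .pb)))
        (.op fun v _ => { v := v, st := fun
          | .nm .pa => .pop
          | .nm .pb => .pop
          | _ => .keep }))))) { τ with pa := a.map some, pb := b.map some } (8 * a.length + 1)
      ({ τ with pa := [], pb := (b.drop a.length).map some }.emit dst (zipStr a b)) := by
    intro a
    induction a with
    | nil =>
      intro b τ
      rw [zipStr, PS.emit_nil]
      exact Ex.loop_end
    | cons x a ih =>
      intro b τ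
      have e1 := ex_emitOp' (φ := φ) dst (fun _ _ => .bit true)
        { τ with pa := (x :: a).map some, pb := b.map some } (.bit true) rfl
      have e2 := ex_emitOp' (φ := φ) dst (fun _ t => symLetter (t.st (.nm .pa)))
        (PS.emit { τ with pa := (x :: a).map some, pb := b.map some } dst [.bit true]) x
        (by cases dst <;> rfl)
      rw [PS.emit_emit] at e2
      have e3 := ex_emitOp' (φ := φ) dst (fun _ t => symLetter (t.st (.nm .pb)))
        (PS.emit { τ with pa := (x :: a).map some, pb := b.map some } dst [.bit true, x])
        (b.head?.getD (.bit false)) (by cases dst <;> cases b <;> rfl)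
      rw [PS.emit_emit] at e3
      refine (Ex.loop_step (T₂ := 8 * a.length + 1) (e1.seq (e2.seq (e3.seq (T₂ := 1)
        (σ₂ := PS.emit { τ with
        pa := a.map some, pb := b.tail.map some } dst [.bit true, x, b.head?.getD (.bit false)])
        ?_))) ?_).congr (σ₁ := PS.emit { PS.emit τ dst
          [.bit true, x, b.head?.getD (.bit false)] with
          pa := [], pb := (b.tail.drop a.length).map some } dst (zipStr a b.tail)) ?_ ?_
      · cases dst <;> cases b <;> exact Ex.op
      · have h := ih b.tail (PS.emit τ dst [.bit true, x, b.head?.getD (.bit false)])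
        cases dst <;> exact h
      · rw [show b.tail.drop a.length = b.drop (x :: a).length by simp]
        cases dst <;> simp [PS.emit, zipStr]
      · simp only [List.length_cons]; omega
  have h1 := ex_putRad (φ := φ) r σ k hk hpk hpb
  have h2 := key a (radStr k (r σ.v)) { σ with pk := [] }
  have e : ({ σ with pk := [], pb := (radStr k (r σ.v)).map some } : PS M) =
      { σ with pk := [], pa := a.map some, pb := (radStr k (r σ.v)).map some } := by
    cases σ; simp_all
  rw [e] at h1
  refine (h1.seq (h2.seq ((ex_clr _ .pb _).seq (ex_emitStr dst _ _)))).congr ?_ ?_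
  · rw [encStr, ← PS.emit_emit]
    congr 1
    apply PS.ext
    all_goals cases dst <;> first | rfl | exact hpb.symm
  · have e2 : ∀ (τ : PS M) l, (τ.emit dst l).get .pb = τ.pb := by
      intro τ l; cases dst <;> rfl
    rw [e2]
    simp [radStr, nibBits]
    omega

/-! ### Programs that compute real numbers -/

/-- The code of the integer `2 ^ n`. -/
def codeStr (n : ℕ) : Str := .bit false :: .bit true :: List.replicate n (.bit false)

/-- The code of the interval that a summary stands for. -/
def collOut (s : Coll) : Str := if s.lvl = 0 then [] else encStr s.str s.lvl (15 - s.d)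

/-- The summary of the approximations `C 0, …, C n`. -/
def collUpTo (C : ℕ → Option Cand) : ℕ → Coll
  | 0 => Coll.empty.addOpt (C 0)
  | n + 1 => (collUpTo C n).addOpt (C (n + 1))

/-- The digits of the number of `[0, 1 - 2 ^ (-lvl)]` that is closest to an approximation. -/
def Cand.clamp (c : Cand) : List Bool :=
  c.fr.map fun b => if c.neg then false else if c.ip.any id then true else b

/-- The code of a dyadic number of the unit interval. -/
def unitStr (c : List Bool) : Str := .bit false :: .sep :: c.map .bit

/-- The summary is that of approximations with at most `L` digits on either side of the point. -/
structure Coll.Bounded (s : Coll) (L : ℕ) : Prop where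
  len : s.lvl + s.str.length ≤ 3 * L + 2
  four : s.lvl = 0 ∨ 4 ≤ s.lvl

theorem Coll.Bounded.empty (L : ℕ) : Coll.empty.Bounded L :=
  ⟨by simp [Coll.empty], .inl rfl⟩

theorem Coll.Bounded.addOpt {s : Coll} {L : ℕ} (hs : s.Bounded L) {o : Option Cand}
    (ho : ∀ c, o = some c → 4 ≤ c.lvl ∧ c.lvl + c.str.length ≤ 3 * L + 2) :
    (s.addOpt o).Bounded L := by
  cases o with
  | none => exact hs
  | some c =>
    obtain ⟨h1, h2⟩ := ho c rfl
    change (s.add c).Bounded L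
    unfold Coll.add
    split_ifs
    · exact ⟨h2, .inr h1⟩
    · exact ⟨h2, .inr h1⟩
    · exact ⟨hs.1, hs.2⟩
    · exact hs

theorem candStr_bound {m L : ℕ} {w : Str} {c : Cand} (h : candStr m w = some c) (hm : m ≤ L) :
    4 ≤ c.lvl ∧ c.lvl + c.str.length ≤ 3 * L + 2 := by
  have h1 := candOf_length h
  unfold candStr candOf at h
  split_ifs at h with h4
  simp only [Option.map_eq_some_iff] at h
  obtain ⟨p, hp, rfl⟩ := h
  exact ⟨h4, by omega⟩

/-- Writes the string `pre`, followed by the code of `2 ^ m`, where `m` is the height of the stack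
`cap`. -/
def codeOut (dst : Dst) (pre : Str) : Prog M :=
  .seq (emitStr dst (pre ++ [.bit false, .bit true]))
  (.seq (.loop (has .cap)
    (.seq (emitOp dst fun _ _ => .bit false) (.op fun v _ => { v := v, st := fun
          | .nm .cap => .pop
          | .nm .cp => .push none
          | _ => .keep })))
    (mv .cp .cap))

theorem ex_codeOut (dst : Dst) (pre : Str) (σ : PS M) (m : ℕ) (hcap : σ.cap = un m)
    (hcp : σ.cp = []) :
    Ex φ (codeOut dst pre) σ (10 * (m + pre.length + 1)) (σ.emit dst (pre ++ codeStr m)) := by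
  have key := Ex.loop_nat (φ := φ) (M := M) (p := has .cap)
    (c := .seq (emitOp dst fun _ _ => .bit false) (.op fun v _ => { v := v, st := fun
          | .nm .cap => .pop
          | .nm .cp => .push none
          | _ => .keep }))
    (fun n (b : Str × ℕ) => PS.emit { σ with cap := un n, cp := un b.2 } dst b.1)
    (fun b => (b.1 ++ [.bit false], b.2 + 1)) 3
    (fun n b => by
      have h := ex_emitOp' (φ := φ) dst (fun _ _ => .bit false)
        (PS.emit { σ with cap := un (n + 1), cp := un b.2 } dst b.1) _ rfl
      rw [PS.emit_emit] at h
      refine h.seq (T₂ := 1) ?_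
      cases dst <;> exact Ex.op)
    (by intro b; cases dst <;> rfl) (by intro n b; cases dst <;> rfl) m
    (pre ++ [.bit false, .bit true], 0)
  have hit : ∀ n (b : Str × ℕ), (fun b : Str × ℕ => (b.1 ++ [Letter.bit false], b.2 + 1))^[n] b =
      (b.1 ++ List.replicate n (.bit false), b.2 + n) := by
    intro n
    induction n with
    | zero => intro b; simp
    | succ n ih =>
      intro b
      rw [Function.iterate_succ_apply, ih, List.append_assoc, Nat.add_assoc, Nat.add_comm 1]
      rfl
  rw [hit] at key
  have e : ({ σ with cap := un m, cp := un 0 } : PS M) = σ := by cases σ; simp_all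
  dsimp only at key
  rw [e] at key
  refine ((ex_emitStr dst _ _).seq (key.seq (ex_mv _ .cp .cap _))).congr
    ?_ ?_
  · cases dst <;> simp [PS.emit, PS.put, PS.get, hcap, hcp, codeStr]
  · have e2 : (PS.emit { σ with cap := un 0, cp := un (0 + m) } dst
        (pre ++ [.bit false, .bit true] ++ List.replicate m (.bit false))).get .cp = un (0 + m) := by
      cases dst <;> rfl
    rw [e2]
    simp
    omega

/-- Writes the interval that the summary stands for. -/
def finish : Prog M :=
  .ite (has .bk)
    (.seq (mv .bp .t1) (.seq (mv .t1 .pa) (.seq (mv .bk .pk) (writer .out fun v => 15 - v.d))))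
    skip

theorem ex_finish (σ : PS M) (s : Coll) (L : ℕ) (hs : σ.HasColl s) (hcl : σ.Clean)
    (hb : s.Bounded L) :
    ∃ σ', Ex φ finish σ (200 * (L + 1)) σ' ∧ σ'.out = σ.out ++ collOut s := by
  rcases hb.four with h0 | h4
  · refine ⟨σ, (Ex.ite_false (ex_skip σ) ?_).mono (by omega), by simp [collOut, h0]⟩
    change (σ.bk.head?).isSome = false
    rw [hs.bk, h0]
    rfl
  · refine ⟨_, (Ex.ite_true ((ex_mv _ .bp .t1 _).seq
      ((ex_mv _ .t1 .pa _).seq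
      ((ex_mv _ .bk .pk _).seq (ex_writer .out _ _ s.str s.lvl h4 ?_ ?_
        ?_)))) ?_).mono ?_, ?_⟩
    · simp [PS.put, PS.get, hs.bp, hcl.t1, hcl.pa]
    · simp [PS.put, PS.get, hs.bk, hcl.pk]
    · exact hcl.pb
    · change (σ.bk.head?).isSome = true
      rw [hs.bk]
      obtain ⟨k, hk⟩ := Nat.exists_eq_add_of_le' h4
      rw [hk]
      rfl
    · have := hb.len
      simp [PS.put, PS.get, hs.bp, hs.bk, hcl.t1]
      omega
    · have : s.lvl ≠ 0 := by omega
      simp [collOut, this, PS.emit, PS.put, PS.get, hs.d]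

/-- Adds the approximations that `body` computes for `0, …, n` to the summary, where `n` is the
length of the rest of the input, and writes the result. -/
def runner (body : Prog M) : Prog M :=
  .seq body (.seq (.loop (fun _ t => t.inp.isSome)
    (.seq (.op fun v _ => { v := v, inp := true, st := fun
          | .nm .cap => .push none
          | _ => .keep }) body)) finish)

theorem ex_runner (body : Prog M) (C : ℕ → Option Cand) (T L : ℕ)
    (hC : ∀ m ≤ L, ∀ c, C m = some c → 4 ≤ c.lvl ∧ c.lvl + c.str.length ≤ 3 * L + 2)
    (hbody : ∀ (τ : PS M) s m, τ.Clean → τ.HasColl s → τ.cap = un m → τ.qry = [] → m ≤ L →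
      s.Bounded L → ∃ r, Ex φ body τ T { τ.withColl (s.addOpt (C m)) with ans := r })
    (σ : PS M) (hcl : σ.Clean) (hs : σ.HasColl .empty) (hcap : σ.cap = []) (hq : σ.qry = [])
    (hL : σ.inp.length ≤ L) :
    ∃ σ', Ex φ (runner body) σ ((L + 1) * (T + 3) + 200 * (L + 1) + 3) σ' ∧
      σ'.out = σ.out ++ collOut (collUpTo C σ.inp.length) := by
  obtain ⟨r, h0⟩ := hbody σ .empty 0 hcl hs hcap hq (Nat.zero_le _) (.empty L)
  obtain ⟨σ₁, h1, ⟨m, i0, i1, i2, i3, i4, i5, i6, i7⟩⟩ := Ex.loop_inv (φ := φ) (M := M)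
    (p := fun _ t => t.inp.isSome) (c := .seq (.op fun v _ => { v := v, inp := true, st := fun
          | .nm .cap => .push none
          | _ => .keep }) body)
    (I := fun l τ => ∃ m, m + l.length = σ.inp.length ∧ τ.inp = l ∧ τ.Clean ∧
      τ.HasColl (collUpTo C m) ∧ τ.cap = un m ∧ τ.qry = [] ∧ (collUpTo C m).Bounded L ∧
      τ.out = σ.out) (T := 1 + T + 1)
    (by
      rintro x l τ ⟨m, j0, j1, j2, j3, j4, j5, j6, j7⟩
      simp only [List.length_cons] at j0
      have e : Ex φ (.op fun v _ => { v := v, inp := true, st := fun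
          | .nm .cap => .push none
          | _ => .keep }) τ 1 { τ with inp := l, cap := un (m + 1) } := by
        obtain ⟨⟩ := τ
        dsimp only at j1 j4
        subst j1 j4
        exact Ex.op
      obtain ⟨r, h⟩ := hbody { τ with inp := l, cap := un (m + 1) } (collUpTo C m) (m + 1)
        ⟨j2.1, j2.2, j2.3, j2.4, j2.5, j2.6, j2.7, j2.8, j2.9, j2.10, j2.11, j2.12⟩
        ⟨j3.1, j3.2, j3.3, j3.4⟩ rfl j5 (by omega) j6
      refine ⟨by change (τ.inp.head?).isSome = true; rw [j1]; rfl, _, e.seq h, m + 1, by omega,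
        rfl, ?_, ⟨rfl, rfl, rfl, rfl⟩, rfl, j5, j6.addOpt (hC _ (by omega)), j7⟩
      exact ⟨j2.1, j2.2, j2.3, j2.4, j2.5, j2.6, j2.7, rfl, rfl, j2.10, j2.11, j2.12⟩)
    (by
      rintro τ ⟨m, j0, j1, -⟩
      change (τ.inp.head?).isSome = false
      rw [j1]
      rfl)
    σ.inp { σ.withColl (Coll.empty.addOpt (C 0)) with ans := r }
    ⟨0, by simp, rfl, ⟨hcl.1, hcl.2, hcl.3, hcl.4, hcl.5, hcl.6, hcl.7, rfl, rfl, hcl.10, hcl.11,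
      hcl.12⟩, ⟨rfl, rfl, rfl, rfl⟩, hcap, hq, (Coll.Bounded.empty L).addOpt (hC _ (Nat.zero_le _)),
      rfl⟩
  obtain ⟨σ₂, h2, h3⟩ := ex_finish (φ := φ) σ₁ _ L i3 i2 i6
  simp only [List.length_nil, Nat.add_zero] at i0
  refine ⟨σ₂, (h0.seq (h1.seq h2)).mono ?_, by rw [h3, i7, i0]⟩
  have : σ.inp.length * (1 + T + 1 + 1) ≤ L * (1 + T + 1 + 1) := Nat.mul_le_mul_right _ hL
  nlinarith

/-- Asks for the interval with index `m` of a real number, where `m` is the height of the stack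
`cap`, and adds it to the summary. -/
def realBody (pre : Str) : Prog M :=
  .seq (codeOut .qry pre) (.seq .call (harvest true))

theorem ex_realBody (pre : Str) (L : ℕ) (τ : PS M) (s : Coll) (m : ℕ) (hcl : τ.Clean)
    (hs : τ.HasColl s) (hcap : τ.cap = un m) (hq : τ.qry = []) (hm : m ≤ L) (hb : s.Bounded L) :
    ∃ r, Ex φ (realBody pre) τ (2000 * (L + pre.length + 1))
      { τ.withColl (s.addOpt (candStr m (φ (pre ++ codeStr m)))) with ans := r } := by
  obtain ⟨r, -, h⟩ := ex_harvest (φ := φ) true τ s m (φ (pre ++ codeStr m)) hcl hs hcap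
  refine ⟨r, ((ex_codeOut .qry pre τ m hcap hcl.cp).seq ((Ex.call _).seq
    (T₂ := 300 * (s.lvl + s.str.length + m + 1)) (σ₂ := { τ.withColl
      (s.addOpt (candStr m (φ (pre ++ codeStr m)))) with ans := r }) ?_)).mono ?_⟩
  · simp only [PS.emit, hq, List.nil_append]
    convert h using 1
    simp only [PS.src, if_true]
    apply PS.ext
    all_goals first | rfl | exact hq.symm
  · have := hb.len
    omega

/-! ### The evaluation of functions -/

/-- Replaces the bits of the stack `pa` in front of the separator by a flag that tells whether one
of them is `1`. -/
def orLoop : Prog M :=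
  .loop (fun _ t => match t.st (.nm .pa) with
      | some (some (.bit _)) => true
      | _ => false) <| .op fun v t =>
    { v := { v with f2 := v.f2 || symBit (t.st (.nm .pa)) }
      st := fun
        | .nm .pa => .pop
        | _ => .keep }

theorem ex_orLoop (σ : PS M) (l : List Bool) (w : Str) (b : Bool) :
    Ex φ orLoop
      { σ with v := { σ.v with f2 := b }, pa := (l.map Letter.bit ++ .sep :: w).map some }
      (2 * l.length + 1)
      { σ with v := { σ.v with f2 := b || l.any id }, pa := (.sep :: w).map some } := by
  induction l generalizing b with
  | nil => simp only [List.any_nil, Bool.or_false]; exact Ex.loop_end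
  | cons x l ih =>
    refine (Ex.loop_step (T₁ := 1) Ex.op (ih (b || x))).congr ?_
      (by simp only [List.length_cons]; omega)
    rw [List.any_cons, Bool.or_assoc]
    rfl

/-- Replaces the bits on `pa` according to two flags and moves them to `t1`. -/
def clampLoop : Prog M :=
  .loop (has .pa) <| .op fun v t =>
    { v := v
      st := fun
        | .nm .pa => .pop
        | .nm .t1 => .push (some (.bit
          (if v.f1 then false else if v.f2 then true else symBit (t.st (.nm .pa)))))
        | _ => .keep }

/-- Removes the separator from `pa` and replaces the bits behind it according to two flags. -/
def clampDigits : Prog M :=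
  .seq (.op fun v _ =>
    { v := v
      st := fun
        | .nm .pa => .pop
        | _ => .keep })
  (.seq clampLoop
  (mv .t1 .pa))

theorem ex_clampDigits (σ : PS M) (a b : Bool) (l : List Bool) (ht1 : σ.t1 = []) :
    Ex φ clampDigits
      { σ with v := { σ.v with f1 := a, f2 := b }, pa := (.sep :: l.map Letter.bit).map some }
      (10 * (l.length + 1))
      { σ with
        v := { σ.v with f1 := a, f2 := b }
        pa := ((l.map fun x => if a then false else if b then true else x).map Letter.bit).map
          some } := by
  have key : Ex φ clampLoop _ _ _ := Ex.loop_foldl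
    (fun l r => { σ with pa := (l.map Letter.bit).map some, t1 := r,
                         v := { σ.v with f1 := a, f2 := b } })
    (fun r x => some (.bit (if a then false else if b then true else x)) :: r) 1
    (fun x l b => Ex.op) (by intros; rfl) (by intros; rfl) l []
  have hf : ∀ (l : List Bool) (r : List Sym), l.foldl (fun r x =>
      some (.bit (if a then false else if b then true else x)) :: r) r =
      (l.map fun x => some (Letter.bit
        (if a then false else if b then true else x))).reverse ++ r := by
    intro l
    induction l with
    | nil => intro b; rfl
    | cons x l ih => intro b; rw [List.foldl_cons, ih]; simp
  rw [hf] at key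
  refine (Ex.seq (T₁ := 1) (σ₁ := { σ with
      pa := (l.map Letter.bit).map some, t1 := []
      v := { σ.v with f1 := a, f2 := b } }) ?_ (key.seq
    (ex_mv _ .t1 .pa _))).congr ?_ ?_
  · rw [← ht1]; exact Ex.op
  · simp [PS.put, PS.get, ht1, Function.comp_def]
  · simp [PS.get]
    omega

/-- Moves the approximation from `np` and `nk` to `pa` and `pk`, and replaces it by the closest
number of the unit interval. -/
def clampBlock : Prog M :=
  .seq (mv .np .pa)
  (.seq (.op fun v t =>
    { v := { v with f1 := symBit (t.st (.nm .pa)), f2 := false }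
      st := fun
        | .nm .pa => .pop
        | _ => .keep })
  (.seq orLoop
  (.seq clampDigits
  (.seq (push .pa (some .sep))
  (.seq (push .pa (some (.bit false)))
  (.seq (mv .nk .pk)
  (.op fun v _ => { v := { v with ok := false, nib := 0, f1 := false, f2 := false } })))))))

theorem ex_clampBlock (σ : PS M) (c : Cand) (ht1 : σ.t1 = []) (hpa : σ.pa = []) (hpk : σ.pk = [])
    (hnp : σ.np = (c.str.map some).reverse) (hnk : σ.nk = un c.lvl) :
    Ex φ clampBlock σ (20 * (c.lvl + c.str.length + 1))
      { σ with
        np := [], nk := [], pa := (unitStr c.clamp).map some, pk := un c.lvl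
        v := { σ.v with ok := false, nib := 0, f1 := false, f2 := false } } := by
  have h1 := ex_mv φ .np .pa σ
  have e1 : (σ.put .np []).put .pa ((σ.get .np).reverse ++ σ.get .pa) =
      { σ with np := [], pa := c.str.map some } := by
    simp [PS.put, PS.get, hnp, hpa]
  rw [e1] at h1
  have h2 := ex_orLoop (φ := φ) { σ with np := [], v := { σ.v with f1 := c.neg } } c.ip
    (c.fr.map .bit) false
  rw [Bool.false_or] at h2
  have h3 := ex_clampDigits (φ := φ) { σ with np := [] } c.neg (c.ip.any id) c.fr ht1
  refine (h1.seq (Ex.seq (T₁ := 1) Ex.op (h2.seq (h3.seq (Ex.seq (T₁ := 1) (σ₁ := { σ with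
      np := [], pa := (.sep :: c.clamp.map .bit).map some,
      v := { σ.v with f1 := c.neg, f2 := c.ip.any id } }) Ex.op
    (Ex.seq (T₁ := 1) (σ₁ := { σ with
      np := [], pa := (unitStr c.clamp).map some,
      v := { σ.v with f1 := c.neg, f2 := c.ip.any id } }) Ex.op
      ((ex_mv _ .nk .pk _).seq (T₂ := 1) (σ₂ := { σ with
        np := [], nk := [], pa := (unitStr c.clamp).map some, pk := un c.lvl,
        v := { σ.v with ok := false, nib := 0, f1 := false, f2 := false } }) ?_))))))).congr rfl ?_
  · refine Ex.op (hnm := fun i => ?_)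
    cases i <;> first | rfl | (change σ.nk.reverse ++ σ.pk = un c.lvl; simp [hnk, hpk])
  · simp [PS.get, hnp, hnk, Cand.str]
    omega

/-- Evaluates a function at the approximation of a real number with index `m`, where `m` is the
height of the stack `cap`, and adds the result to the summary. -/
def evalBody : Prog M :=
  .seq (codeOut .qry [.bit true]) (.seq .call (.seq (fetch true) (.seq candProg
    (.ite (fun v _ => v.ok)
      (.seq clampBlock (.seq (emitStr .qry [.bit false]) (.seq (writer .qry fun _ => 8)
        (.seq .call (harvest true)))))
      collect))))

/-- The approximation that `evalBody` computes. -/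
def evalCand (φ : Baire) (m : ℕ) : Option Cand :=
  (candStr m (φ (.bit true :: codeStr m))).bind fun c =>
    candStr m (φ (.bit false :: encStr (unitStr c.clamp) c.lvl 8))

theorem ex_evalBody (L : ℕ) (τ : PS M) (s : Coll) (m : ℕ) (hcl : τ.Clean)
    (hs : τ.HasColl s) (hcap : τ.cap = un m) (hq : τ.qry = []) (hm : m ≤ L) (hb : s.Bounded L) :
    ∃ r, Ex φ evalBody τ (4000 * (L + 1))
      { τ.withColl (s.addOpt (evalCand φ m)) with ans := r } := by
  have h1 := ex_codeOut (φ := φ) .qry [.bit true] τ m hcap hcl.cp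
  obtain ⟨r, -, h2⟩ := ex_fetch (φ := φ) true τ (φ (.bit true :: codeStr m)) m hcap
    hcl.t1 hcl.t2 hcl.x
    hcl.y hcl.cp hcl.c1 hcl.c2
  have hl := length_tracks (3 * m) (φ (.bit true :: codeStr m))
  have h3 := ex_candProg (φ := φ) { τ with
      cap := [], cp := un m, c1 := un m, c2 := un m,
      x := (tracks (3 * m) (φ (.bit true :: codeStr m))).1.map some,
      y := (tracks (3 * m) (φ (.bit true :: codeStr m))).2.map some, ans := r } m _ _
      hl.1 hl.2 rfl rfl rfl rfl rfl rfl hcl.nk hcl.np hcl.t1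
  have hc : Ex φ .call (PS.emit τ .qry ([.bit true] ++ codeStr m)) 1
      (τ.src true (φ (.bit true :: codeStr m))) := by
    refine (Ex.call _).congr ?_ le_rfl
    simp only [PS.src, if_true, PS.emit, hq, List.nil_append, List.singleton_append]
  have hlen := hb.len
  have fin : ∀ {T₂ σ₂}, Ex φ (.ite (fun v _ => v.ok)
      (.seq clampBlock (.seq (emitStr .qry [.bit false]) (.seq (writer .qry fun _ => 8)
        (.seq .call (harvest true)))))
      collect) (PS.withCand { τ with ans := r } m (candStr m (φ (.bit true :: codeStr m)))) T₂ σ₂ →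
      T₂ ≤ 3000 * (L + 1) → Ex φ evalBody τ (4000 * (L + 1)) σ₂ := by
    intro T₂ σ₂ h hT
    refine (h1.seq (hc.seq (h2.seq (h3.seq (T₂ := T₂) (σ₂ := σ₂) ?_)))).mono ?_
    · exact h
    · simp only [List.length_singleton]
      omega
  cases ho : candStr m (φ (.bit true :: codeStr m)) with
  | none =>
    have h4 := ex_collect (φ := φ) (PS.withCand { τ with ans := r } m none) s none hcl.t1 hcl.t2
      rfl rfl hs.bp hs.bk rfl rfl rfl rfl hs.bn hs.d 0 (by simp)
    refine ⟨r, fin (T₂ := 30 * (s.lvl + s.str.length + 0 + 1) + 1) ?_ (by omega)⟩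
    rw [ho]
    refine (Ex.ite_false h4 rfl).congr ?_ le_rfl
    rw [evalCand, ho]
    apply PS.ext
    all_goals first
      | rfl
      | exact hcap.symm
      | exact hcl.x.symm
      | exact hcl.y.symm
      | exact hcl.cp.symm
      | exact hcl.c1.symm
      | exact hcl.c2.symm
  | some c =>
    have hcb := candStr_bound ho hm
    have hcl' : c.clamp.length + 1 ≤ c.str.length := by simp [Cand.clamp, Cand.str]; omega
    have h4 := ex_clampBlock (φ := φ) (PS.withCand { τ with ans := r } m (some c)) c hcl.t1 hcl.pa
      hcl.pk rfl rfl
    set w := φ (.bit false :: encStr (unitStr c.clamp) c.lvl 8) with hw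
    obtain ⟨r', -, h5⟩ := ex_harvest (φ := φ) true { τ with
        v := { τ.v with ok := false, sg := false, cnt := 0, nib := 0, f1 := false, f2 := false } }
      s m w ⟨hcl.1, hcl.2, hcl.3, hcl.4, hcl.5, hcl.6, hcl.7, hcl.8, hcl.9, hcl.10, hcl.11, hcl.12⟩
      ⟨hs.1, hs.2, hs.3, hs.4⟩ hcap
    refine ⟨r', fin (T₂ := (20 * (c.lvl + c.str.length + 1) + (2 * 1 + 1 +
      (20 * ((unitStr c.clamp).length + c.lvl + 2) + (1 +
        300 * (s.lvl + s.str.length + m + 1) + 1) + 1) + 1) + 1) + 1) ?_ ?_⟩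
    · rw [ho]
      refine (Ex.ite_true (h4.seq ((ex_emitStr .qry [.bit false] _).seq ((ex_writer .qry _ _
        (unitStr c.clamp) c.lvl hcb.1 rfl rfl ?_).seq (Ex.seq (Ex.call _)
          (T₂ := 300 * (s.lvl + s.str.length + m + 1)) (σ₂ := { τ.withColl
          (s.addOpt (evalCand φ m)) with ans := r' }) ?_)))) rfl)
      · exact hcl.pb
      have e : evalCand φ m = candStr m w := by rw [evalCand, ho]; rfl
      rw [e]
      convert h5 using 1
      simp only [PS.emit, PS.withCand, hq, List.nil_append, List.singleton_append, PS.src, if_true]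
      apply PS.ext
      all_goals first
        | rfl
        | exact hcap.symm
        | exact hcl.x.symm
        | exact hcl.y.symm
        | exact hcl.cp.symm
        | exact hcl.c1.symm
        | exact hcl.c2.symm
        | exact hcl.pa.symm
        | exact hcl.pk.symm
        | exact hcl.np.symm
        | exact hcl.nk.symm
    · simp only [unitStr, List.length_cons, List.length_map]
      omega

end

/-! ### Tapes on stacks -/

/-- The cells of a tape: `P` lists them from cell `0` on to the right, `N` from cell `-1` on to the
left. -/
def zCells (P N : List Sym) : ℤ → Sym := fun i =>
  if 0 ≤ i then P.getD i.toNat none else N.getD (-1 - i).toNat none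

/-- A tape on stacks: on which side of cell `0` the head stands (`neg` for the left one), the cells
between cell `0` and the head (the top is next to the head), the scanned symbol, and the cells
beyond on the right and on the left. -/
structure Zip where
  neg : Bool
  c : List Sym
  h : Sym
  p : List Sym
  n : List Sym

/-- The right half of the tape. The list `tl` continues `p`. -/
def Zip.P (z : Zip) (tl : List Sym) : List Sym :=
  bif z.neg then z.p ++ tl else z.c.reverse ++ z.h :: (z.p ++ tl)

/-- The left half of the tape. -/
def Zip.N (z : Zip) : List Sym := bif z.neg then z.c.reverse ++ z.h :: z.n else z.n

/-- The tape that is represented on stacks. -/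
def Zip.tape (z : Zip) (tl : List Sym) : Tape :=
  ⟨zCells (z.P tl) z.N, bif z.neg then -1 - z.c.length else z.c.length⟩

theorem zCells_congr {P P' N N' : List Sym} (hP : ∀ k, P.getD k none = P'.getD k none)
    (hN : ∀ k, N.getD k none = N'.getD k none) : zCells P N = zCells P' N' := by
  funext i
  simp only [zCells, hP, hN]

theorem getD_cons_tail (l : List Sym) (k : ℕ) :
    (l.head?.getD none :: l.tail).getD k none = l.getD k none := by
  cases l <;> cases k <;> simp

theorem getD_append_congr (a : List Sym) {l l' : List Sym}
    (h : ∀ k, l.getD k none = l'.getD k none) (k : ℕ) :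
    (a ++ l).getD k none = (a ++ l').getD k none := by
  rcases lt_or_ge k a.length with hk | hk
  · rw [List.getD_append _ _ _ _ hk, List.getD_append _ _ _ _ hk]
  · rw [List.getD_append_right _ _ _ _ hk, List.getD_append_right _ _ _ _ hk, h]

theorem getD_update (a : List Sym) (x s : Sym) (l : List Sym) (k : ℕ) :
    (a ++ s :: l).getD k none = if k = a.length then s else (a ++ x :: l).getD k none := by
  grind

theorem Zip.read (z : Zip) (tl : List Sym) : (z.tape tl).cells (z.tape tl).head = z.h := by
  obtain ⟨neg, c, h, p, n⟩ := z
  cases neg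
  · simp [tape, zCells, P, N]
  · simp only [tape, zCells, P, N, cond_true]
    rw [if_neg (by omega)]
    simp

theorem Zip.write (z : Zip) (tl : List Sym) (s : Sym) :
    (z.tape tl).act s .stay = ({ z with h := s } : Zip).tape tl := by
  obtain ⟨neg, c, h, p, n⟩ := z
  cases neg
  · simp only [tape, Tape.act, Move.shift, add_zero, cond_false, P, N, Tape.mk.injEq, and_true]
    funext i
    have := getD_update c.reverse h s (p ++ tl) i.toNat
    by_cases hi : i = c.length
    · subst hi; simp [zCells]
    · rw [Function.update_of_ne hi]
      simp only [zCells]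
      split_ifs with h0
      · rw [this, if_neg]
        simp; omega
      · rfl
  · simp only [tape, Tape.act, Move.shift, add_zero, cond_true, P, N, Tape.mk.injEq, and_true]
    funext i
    have := getD_update c.reverse h s n (-1 - i).toNat
    by_cases hi : i = -1 - c.length
    · subst hi
      rw [Function.update_self, zCells, if_neg (by omega)]
      simp
    · rw [Function.update_of_ne hi]
      simp only [zCells]
      split_ifs with h0
      · rfl
      · rw [this, if_neg]
        simp; omega

/-- Moves the head after writing `s`. The second component tells whether a symbol of the list that
continues `p` has been consumed. -/
def Zip.move (z : Zip) (tl : List Sym) (s : Sym) : Move → Zip × Bool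
  | .stay => ({ z with h := s }, false)
  | .right => bif z.neg then
      match z.c with
      | [] => (⟨false, [], (z.p ++ tl).head?.getD none, z.p.tail, s :: z.n⟩, z.p.isEmpty)
      | x :: c => (⟨true, c, x, z.p, s :: z.n⟩, false)
      else (⟨false, s :: z.c, (z.p ++ tl).head?.getD none, z.p.tail, z.n⟩, z.p.isEmpty)
  | .left => bif z.neg then (⟨true, s :: z.c, z.n.head?.getD none, z.p, z.n.tail⟩, false)
      else match z.c with
      | [] => (⟨true, [], z.n.head?.getD none, s :: z.p, z.n.tail⟩, false)
      | x :: c => (⟨false, c, x, s :: z.p, z.n⟩, false)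

theorem tail_append_aux (p tl : List Sym) :
    p.tail ++ (bif p.isEmpty then tl.tail else tl) = (p ++ tl).tail := by
  cases p <;> simp

theorem Tape.act_eq (T : Tape) (s : Sym) (m : Move) :
    T.act s m = ⟨(T.act s .stay).cells, (T.act s .stay).head + m.shift⟩ := by
  simp [Tape.act, Move.shift]

theorem Zip.act (z : Zip) (tl : List Sym) (s : Sym) (m : Move) :
    (z.tape tl).act s m =
      (z.move tl s m).1.tape (bif (z.move tl s m).2 then tl.tail else tl) := by
  rw [Tape.act_eq, Zip.write]
  obtain ⟨neg, c, h, p, n⟩ := z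
  cases m
  · cases neg
    · rcases c with _ | ⟨x, c⟩
      · simp only [tape, move, P, N, Move.shift, cond_false, cond_true, List.length_nil,
          List.reverse_nil, List.nil_append, Tape.mk.injEq]
        refine ⟨zCells_congr (fun k => by simp) fun k => ?_, by simp⟩
        exact (getD_cons_tail n k).symm
      · simp only [tape, move, P, N, Move.shift, cond_false, List.length_cons, Tape.mk.injEq]
        refine ⟨by simp, by push_cast; ring⟩
    · simp only [tape, move, P, N, Move.shift, cond_true, cond_false, List.length_cons, Tape.mk.injEq]
      refine ⟨zCells_congr (fun k => rfl) fun k => ?_, by push_cast; ring⟩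
      rw [List.reverse_cons, List.append_assoc]
      refine getD_append_congr _ (getD_append_congr [s] fun k => ?_) k
      exact (getD_cons_tail n k).symm
  · simp [tape, move, Move.shift]
  · cases neg
    · simp only [tape, move, P, N, Move.shift, cond_false, List.length_cons, Tape.mk.injEq,
        tail_append_aux]
      refine ⟨zCells_congr (fun k => ?_) fun k => rfl, by push_cast; ring⟩
      rw [List.reverse_cons, List.append_assoc]
      refine getD_append_congr _ (getD_append_congr [s] fun k => ?_) k
      exact (getD_cons_tail _ k).symm
    · rcases c with _ | ⟨x, c⟩
      · simp only [tape, move, P, N, Move.shift, cond_false, cond_true, List.length_nil,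
          List.reverse_nil, List.nil_append, Tape.mk.injEq, tail_append_aux]
        refine ⟨zCells_congr (fun k => ?_) fun k => rfl, by simp⟩
        exact (getD_cons_tail _ k).symm
      · simp only [tape, move, P, N, Move.shift, cond_true, cond_false, List.length_cons,
          Tape.mk.injEq]
        refine ⟨by simp, by push_cast; ring⟩

theorem Zip.content (z : Zip) (tl : List Sym) :
    (z.tape tl).content = ((z.P tl).takeWhile Option.isSome).filterMap id :=
  Tape.content_of_getD _ _ fun n => by simp [tape, zCells]

theorem cellsOf_eq (w : Str) : cellsOf w = zCells (w.map some) [] := by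
  funext i
  simp only [cellsOf, zCells, List.getD_eq_getElem?_getD, List.getElem?_map]
  split_ifs
  · cases w[i.toNat]? <;> rfl
  · rfl

/-- The height of the stacks of a tape. -/
def Zip.size (z : Zip) : ℕ := z.c.length + z.p.length + z.n.length

theorem Zip.size_move (z : Zip) (tl : List Sym) (s : Sym) (m : Move) :
    (z.move tl s m).1.size ≤ z.size + 1 := by
  obtain ⟨neg, c, h, p, n⟩ := z
  cases m <;> cases neg <;> rcases c with _ | ⟨x, c⟩ <;> simp [move, size] <;> omega

/-! ### The simulation of an oracle machine -/

noncomputable instance (k : ℕ) : DecidableEq (TapeIx k) := Classical.decEq _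

section

variable {M : OracleMachine} {φ : Baire}

/-- The rest of the answer tape, which is consumed letter by letter. -/
def PS.tl (σ : PS M) : TapeIx M.workTapes → List Sym
  | .answer => bif σ.v.sim.real then σ.ans.map some else σ.va
  | _ => []

/-- A tape of the simulated machine. -/
def PS.zip (σ : PS M) (t : TapeIx M.workTapes) : Zip :=
  ⟨σ.v.sim.neg t, σ.tc t, σ.v.sim.hd t, σ.tp t, σ.tn t⟩

/-- The tapes of the simulated machine. -/
def PS.tapes (σ : PS M) (t : TapeIx M.workTapes) : Tape := (σ.zip t).tape (σ.tl t)

/-- The state without the components that the simulation uses. -/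
def PS.core (σ : PS M) : PS M :=
  { σ with
    v := { σ.v with sim := (Regs.init M).sim }
    tc := fun _ => [], tp := fun _ => [], tn := fun _ => [], vq := [], va := [], ans := [] }

/-- What a head movement does to the stack `tc` of its tape. -/
def tcAct (neg : Bool) (s : Sym) : Move → StackAct
  | .stay => .keep
  | .right => bif neg then .pop else .push s
  | .left => bif neg then .push s else .pop

/-- What a head movement does to the stack `tp` of its tape. -/
def tpAct (neg e : Bool) (s : Sym) : Move → StackAct
  | .stay => .keep
  | .right => bif neg then (bif e then .pop else .keep) else .pop
  | .left => bif neg then .keep else .push s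

/-- What a head movement does to the stack `tn` of its tape. -/
def tnAct (neg e : Bool) (s : Sym) : Move → StackAct
  | .stay => .keep
  | .right => bif neg then .push s else .keep
  | .left => bif neg then .pop else (bif e then .pop else .keep)

/-- The side of cell `0` after a head movement. -/
def newNeg (neg e : Bool) : Move → Bool
  | .stay => neg
  | .right => neg && !e
  | .left => neg || e

/-- The scanned symbol after a head movement. -/
def newHd (neg : Bool) (c : Option Sym) (p n s : Sym) : Move → Sym
  | .stay => s
  | .right => bif neg then c.getD p else p
  | .left => bif neg then n else c.getD n

/-- Whether a head movement consumes a letter of the rest of the answer tape. -/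
def takes (neg e pe : Bool) : Move → Bool
  | .right => pe && (!neg || e)
  | _ => false

theorem Zip.move_eq (z : Zip) (tl : List Sym) (s : Sym) (m : Move) :
    z.move tl s m = (⟨newNeg z.neg z.c.head?.isNone m, (tcAct z.neg s m).run z.c,
      newHd z.neg z.c.head? ((z.p ++ tl).head?.getD none) (z.n.head?.getD none) s m,
      (tpAct z.neg z.c.head?.isNone s m).run z.p, (tnAct z.neg z.c.head?.isNone s m).run z.n⟩,
      takes z.neg z.c.head?.isNone z.p.head?.isNone m) := by
  obtain ⟨neg, c, h, p, n⟩ := z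
  cases m <;> cases neg <;> rcases c with _ | ⟨x, c⟩ <;> rcases p with _ | ⟨y, p⟩ <;> rfl

/-- The next symbol of the rest of a tape. -/
def tlTop (v : Regs M) (t : Tops (Ix M.workTapes)) : TapeIx M.workTapes → Sym
  | .answer => nextLetter v.sim.real t
  | _ => none

/-- Simulates one step of the machine. -/
def simStep : Prog M := .op fun v t =>
  let r := M.transition v.sim.q v.sim.hd
  let e := fun u => (t.st (.tc u)).isNone
  let k := takes (v.sim.neg .answer) (e .answer) (t.st (.tp .answer)).isNone (r.2 .answer).2
  { v := { v with
      sim := { v.sim with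
      q := r.1
      hd := fun u => newHd (v.sim.neg u) (t.st (.tc u)) ((t.st (.tp u)).getD (tlTop v t u))
        ((t.st (.tn u)).getD none) (r.2 u).1 (r.2 u).2
      neg := fun u => newNeg (v.sim.neg u) (e u) (r.2 u).2 } }
    st := fun
      | .tc u => tcAct (v.sim.neg u) (r.2 u).1 (r.2 u).2
      | .tp u => tpAct (v.sim.neg u) (e u) (r.2 u).1 (r.2 u).2
      | .tn u => tnAct (v.sim.neg u) (e u) (r.2 u).1 (r.2 u).2
      | .nm .va => bif k && !v.sim.real then .pop else .keep
      | .nm _ => .keep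
    ans := k && v.sim.real }

/-- The state after a simulated step. -/
def PS.simNext (σ : PS M) : PS M :=
  let r := M.transition σ.v.sim.q σ.v.sim.hd
  let z := fun u => (σ.zip u).move (σ.tl u) (r.2 u).1 (r.2 u).2
  { σ with
    v := { σ.v with sim := { σ.v.sim with
      q := r.1, hd := fun u => (z u).1.h, neg := fun u => (z u).1.neg } }
    tc := fun u => (z u).1.c
    tp := fun u => (z u).1.p
    tn := fun u => (z u).1.n
    va := bif (z .answer).2 && !σ.v.sim.real then σ.va.tail else σ.va
    ans := bif (z .answer).2 && σ.v.sim.real then σ.ans.tail else σ.ans }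

theorem tlTop_eq (σ : PS M) (u : TapeIx M.workTapes) :
    tlTop σ.v σ.toSt.tops u = (σ.tl u).head?.getD none := by
  cases u
  case answer =>
    simp only [tlTop, nextLetter, PS.tl]
    cases h : σ.v.sim.real
    · rfl
    · change σ.ans.head? = ((σ.ans.map some).head?).getD none
      cases σ.ans <;> rfl
  all_goals rfl

theorem head_append_getD (p tl : List Sym) :
    (p ++ tl).head?.getD none = p.head?.getD (tl.head?.getD none) := by
  cases p <;> simp

theorem ex_simStep (σ : PS M) : Ex φ simStep σ 1 σ.simNext := by
  refine Ex.op ?_ ?_ ?_ ?_ ?_ rfl ?_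
  · simp only [PS.simNext, Zip.move_eq, PS.zip]
    simp only [head_append_getD, ← tlTop_eq]
    rfl
  · intro t; simp only [PS.simNext, Zip.move_eq, PS.zip]
  · intro t; simp only [PS.simNext, Zip.move_eq, PS.zip]; rfl
  · intro t; simp only [PS.simNext, Zip.move_eq, PS.zip]; rfl
  · intro i
    cases i
    case va =>
      simp only [PS.simNext, Zip.move_eq, PS.zip, PS.get]
      change (bif takes (σ.v.sim.neg .answer) (σ.tc .answer).head?.isNone
        (σ.tp .answer).head?.isNone _ && !σ.v.sim.real then StackAct.pop else .keep).run σ.va = _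
      generalize (takes _ _ _ _ && !σ.v.sim.real) = b
      cases b <;> rfl
    all_goals rfl
  · simp only [PS.simNext, Zip.move_eq, PS.zip]
    rfl

theorem PS.simNext_tapes (σ : PS M) (u : TapeIx M.workTapes) :
    σ.simNext.tapes u = (σ.tapes u).act ((M.transition σ.v.sim.q σ.v.sim.hd).2 u).1
      ((M.transition σ.v.sim.q σ.v.sim.hd).2 u).2 := by
  rw [tapes, tapes, Zip.act]
  congr 1
  cases u
  case answer =>
    simp only [tl, simNext]
    cases σ.v.sim.real <;> generalize (Zip.move _ _ _ _).2 = b <;> cases b <;> simp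
  all_goals
    simp only [tl]
    generalize (Zip.move _ _ _ _).2 = b
    cases b <;> rfl

theorem PS.tapes_read (σ : PS M) (u : TapeIx M.workTapes) :
    (σ.tapes u).cells (σ.tapes u).head = σ.v.sim.hd u := Zip.read _ _

/-! ### The content of a simulated tape -/

/-- Moves the symbols between cell `0` and the head to the stack `tp` and counts them on `t1`. -/
noncomputable def toZero (t : TapeIx M.workTapes) : Prog M :=
  .loop (fun _ s => (s.st (.tc t)).isSome) <| .op fun v s =>
    { v := v
      st := fun
        | .tc u => if u = t then .pop else .keep
        | .tp u => if u = t then .push ((s.st (.tc t)).getD none) else .keep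
        | .nm .t1 => .push none
        | _ => .keep }

theorem ex_toZero (t : TapeIx M.workTapes) (σ : PS M) (c p : List Sym) (j : ℕ) :
    Ex φ (toZero t)
      { σ with tc := Function.update σ.tc t c, tp := Function.update σ.tp t p, t1 := un j }
      (2 * c.length + 1)
      { σ with tc := Function.update σ.tc t [], tp := Function.update σ.tp t (c.reverse ++ p),
               t1 := un (j + c.length) } := by
  induction c generalizing p j with
  | nil => exact Ex.loop_end (by simp [St.tops, PS.toSt])
  | cons x c ih =>
    refine (Ex.loop_step (T₁ := 1) (Ex.op (htc := ?_) (htp := ?_)) (ih (x :: p) (j + 1))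
      ?_).congr ?_ (by simp only [List.length_cons]; omega)
    · intro u
      by_cases h : u = t
      · subst h; simp [StackAct.run]
      · simp [h, StackAct.run]
    · intro u
      by_cases h : u = t
      · subst h; simp [StackAct.run, St.tops, PS.toSt]
      · simp [h, StackAct.run]
    · simp [St.tops, PS.toSt]
    · simp only [List.reverse_cons, List.append_assoc, List.singleton_append, List.length_cons]
      rw [show j + 1 + c.length = j + (c.length + 1) by omega]

/-- Moves as many symbols from `tp` to `tc` as there are on `t1`. -/
noncomputable def fromZero (t : TapeIx M.workTapes) : Prog M :=
  .loop (has .t1) <| .op fun v s =>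
    { v := v
      st := fun
        | .tp u => if u = t then .pop else .keep
        | .tc u => if u = t then .push ((s.st (.tp t)).getD none) else .keep
        | .nm .t1 => .pop
        | _ => .keep }

theorem ex_fromZero (t : TapeIx M.workTapes) (σ : PS M) (l c p : List Sym) :
    Ex φ (fromZero t)
      { σ with tc := Function.update σ.tc t c, tp := Function.update σ.tp t (l ++ p),
               t1 := un l.length }
      (2 * l.length + 1)
      { σ with tc := Function.update σ.tc t (l.reverse ++ c), tp := Function.update σ.tp t p,
               t1 := [] } := by
  induction l generalizing c with
  | nil => exact Ex.loop_end
  | cons x l ih =>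
    refine (Ex.loop_step (T₁ := 1) (Ex.op (htc := ?_) (htp := ?_)) (ih (x :: c))
      ?_).congr ?_ (by simp only [List.length_cons]; omega)
    · intro u
      by_cases h : u = t
      · subst h; simp [StackAct.run, St.tops, PS.toSt]
      · simp [h, StackAct.run]
    · intro u
      by_cases h : u = t
      · subst h; simp [StackAct.run]
      · simp [h, StackAct.run]
    · rfl
    · simp

/-- Copies the letters before the first blank from the stack `tp` of the tape `t` to `vq`. -/
noncomputable def scan (t : TapeIx M.workTapes) : Prog M :=
  .seq (.loop (fun _ s => match s.st (.tp t) with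
      | some (some _) => true
      | _ => false) <| .op fun v s =>
    { v := v
      st := fun
        | .tp u => if u = t then .pop else .keep
        | .nm .t2 => .push ((s.st (.tp t)).getD none)
        | _ => .keep })
  (.loop (has .t2) <| .op fun v s =>
    { v := v
      st := fun
        | .tp u => if u = t then .push ((s.st (.nm .t2)).getD none) else .keep
        | .nm .vq => .push ((s.st (.nm .t2)).getD none)
        | .nm .t2 => .pop
        | _ => .keep })

theorem ex_scan (t : TapeIx M.workTapes) (σ : PS M) (p : List Sym) (h2 : σ.t2 = [])
    (hq : σ.vq = []) :
    Ex φ (scan t) { σ with tp := Function.update σ.tp t p } (4 * p.length + 3)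
      { σ with tp := Function.update σ.tp t p, vq := p.takeWhile Option.isSome } := by
  have k1 : ∀ (p l : List Sym), Ex φ (.loop (fun _ s => match s.st (.tp t) with
      | some (some _) => true
      | _ => false) <| .op fun v s =>
      { v := v
        st := fun
          | .tp u => if u = t then .pop else .keep
          | .nm .t2 => .push ((s.st (.tp t)).getD none)
          | _ => .keep }) { σ with tp := Function.update σ.tp t p, t2 := l } (2 * p.length + 1)
      { σ with tp := Function.update σ.tp t (p.dropWhile Option.isSome),
               t2 := (p.takeWhile Option.isSome).reverse ++ l } := by
    intro p
    induction p with
    | nil => intro l; exact Ex.loop_end (by simp [St.tops, PS.toSt])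
    | cons x p ih =>
      intro l
      cases x with
      | none => exact Ex.mono (Ex.loop_end (by simp [St.tops, PS.toSt])) (by simp)
      | some x =>
        refine (Ex.loop_step (T₁ := 1) (Ex.op (htp := ?_) (hnm := ?_)) (ih (some x :: l))
          ?_).congr ?_ (by simp only [List.length_cons]; omega)
        · intro u
          by_cases h : u = t
          · subst h; simp [StackAct.run]
          · simp [h, StackAct.run]
        · intro i
          cases i
          case t2 => simp [St.tops, PS.toSt, StackAct.run, PS.get]
          all_goals rfl
        · simp [St.tops, PS.toSt]
        · simp
  have k2 : ∀ (l q r : List Sym), Ex φ (.loop (has .t2) <| .op fun v s =>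
      { v := v
        st := fun
          | .tp u => if u = t then .push ((s.st (.nm .t2)).getD none) else .keep
          | .nm .vq => .push ((s.st (.nm .t2)).getD none)
          | .nm .t2 => .pop
          | _ => .keep }) { σ with tp := Function.update σ.tp t q, t2 := l, vq := r }
      (2 * l.length + 1)
      { σ with tp := Function.update σ.tp t (l.reverse ++ q), t2 := [], vq := l.reverse ++ r } := by
    intro l
    induction l with
    | nil => intro q r; exact Ex.loop_end
    | cons x l ih =>
      intro q r
      refine (Ex.loop_step (T₁ := 1) (Ex.op (htp := ?_)) (ih (x :: q) (x :: r))
        ?_).congr ?_ (by simp only [List.length_cons]; omega)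
      · intro u
        by_cases h : u = t
        · subst h; simp [StackAct.run, St.tops, PS.toSt, PS.get]
        · simp [h, StackAct.run]
      · rfl
      · simp
  have k1' := k1 p []
  have k2' := k2 (p.takeWhile Option.isSome).reverse (p.dropWhile Option.isSome) []
  have hl : (p.takeWhile Option.isSome).length ≤ p.length := (List.takeWhile_prefix _).length_le
  rw [List.append_nil] at k1'
  have e1 : ({ σ with tp := Function.update σ.tp t p, t2 := [] } : PS M) =
      { σ with tp := Function.update σ.tp t p } := by rw [← h2]
  have e2 : ({ σ with
      tp := Function.update σ.tp t (p.dropWhile Option.isSome),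
      t2 := (p.takeWhile Option.isSome).reverse, vq := [] } : PS M) =
      { σ with tp := Function.update σ.tp t (p.dropWhile Option.isSome),
               t2 := (p.takeWhile Option.isSome).reverse } := by rw [← hq]
  rw [e1] at k1'
  rw [e2] at k2'
  refine (k1'.seq k2').congr ?_ ?_
  · rw [List.reverse_reverse, List.takeWhile_append_dropWhile, List.append_nil, ← h2]
  · rw [List.length_reverse]; omega

/-- Copies the content of a tape to the stack `vq`. -/
noncomputable def getContent (t : TapeIx M.workTapes) : Prog M :=
  .ite (fun v _ => v.sim.neg t) (scan t)
    (.seq (.op fun v _ =>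
      { v := v
        st := fun
          | .tp u => if u = t then .push (v.sim.hd t) else .keep
          | _ => .keep })
    (.seq (toZero t) (.seq (scan t) (.seq (fromZero t) (.op fun v _ =>
      { v := v
        st := fun
          | .tp u => if u = t then .pop else .keep
          | _ => .keep })))))

theorem ex_getContent (t : TapeIx M.workTapes) (σ : PS M) (h1 : σ.t1 = []) (h2 : σ.t2 = [])
    (hq : σ.vq = []) (ht : σ.tl t = []) :
    Ex φ (getContent t) σ (20 * ((σ.zip t).size + 1))
      { σ with vq := (σ.tapes t).content.map some } := by
  have hc : (σ.tapes t).content.map some = ((σ.zip t).P []).takeWhile Option.isSome := by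
    rw [PS.tapes, Zip.content, ht]
    have : ∀ l : List Sym, l.all Option.isSome = true → (l.filterMap id).map some = l := by
      intro l
      induction l with
      | nil => intro; rfl
      | cons x l ih =>
        intro h
        cases x with
        | none => simp at h
        | some x => simpa using ih (by simpa using h)
    exact this _ List.all_takeWhile
  rw [hc]
  have hsz : (σ.zip t).size = (σ.tc t).length + (σ.tp t).length + (σ.tn t).length := rfl
  cases hn : σ.v.sim.neg t with
  | true =>
    have h := ex_scan (φ := φ) t σ (σ.tp t) h2 hq
    rw [Function.update_eq_self] at h
    refine (Ex.ite_true h hn).congr ?_ (by omega)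
    simp [Zip.P, PS.zip, hn]
  | false =>
    have k1 := ex_toZero (φ := φ) t σ (σ.tc t) (σ.v.sim.hd t :: σ.tp t) 0
    have k2 := ex_scan (φ := φ) t { σ with
      tc := Function.update σ.tc t [], t1 := un (0 + (σ.tc t).length) }
      ((σ.tc t).reverse ++ σ.v.sim.hd t :: σ.tp t) h2 hq
    have k3 := ex_fromZero (φ := φ) t { σ with
      vq := ((σ.tc t).reverse ++ σ.v.sim.hd t :: σ.tp t).takeWhile Option.isSome }
      (σ.tc t).reverse [] (σ.v.sim.hd t :: σ.tp t)
    rw [List.length_reverse] at k3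
    rw [Nat.zero_add] at k1 k2
    rw [List.reverse_reverse, List.append_nil] at k3
    have e0 : ({ σ with
        tc := Function.update σ.tc t (σ.tc t),
        tp := Function.update σ.tp t (σ.v.sim.hd t :: σ.tp t), t1 := un 0 } : PS M) =
        { σ with tp := Function.update σ.tp t (σ.v.sim.hd t :: σ.tp t) } := by
      rw [Function.update_eq_self]
      rw [un_zero, ← h1]
    rw [e0] at k1
    refine (Ex.ite_false (Ex.seq (T₁ := 1) (Ex.op (htp := ?_)) (k1.seq (k2.seq (k3.seq (T₂ := 1)
      (σ₂ := { σ with vq := ((σ.zip t).P []).takeWhile Option.isSome })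
      (Ex.op (htc := ?_) (htp := ?_) (hnm := ?_)))))) hn).mono ?_
    · intro u
      by_cases h : u = t
      · subst h; simp [StackAct.run]
      · simp [h, StackAct.run]
    · intro u; simp [StackAct.run]
    · intro u
      by_cases h : u = t
      · subst h; simp [StackAct.run]
      · simp [h, StackAct.run]
    · intro i
      cases i
      case t1 => exact h1.symm
      case vq => simp [StackAct.run, PS.get, Zip.P, PS.zip, hn]
      all_goals rfl
    · simp; omega

end

/-! ### Oracle calls of the simulated machine -/

noncomputable section

variable {M : OracleMachine} {φ : Baire}

/-- Empties the stacks of the answer tape and counts the cells between cell `0` and the head. -/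
def clearAnswer : Prog M :=
  .loop (fun _ s => (s.st (.tc .answer)).isSome || (s.st (.tp .answer)).isSome ||
      (s.st (.tn .answer)).isSome) <| .op fun v s =>
    { v := v
      st := fun
        | .tc .answer => .pop
        | .tp .answer => .pop
        | .tn .answer => .pop
        | .nm .t1 => if (s.st (.tc .answer)).isSome then .push none else .keep
        | _ => .keep }

theorem ex_clearAnswer (σ : PS M) (m : ℕ) (c p n : List Sym) (j : ℕ) (hc : c.length ≤ m)
    (hp : p.length ≤ m) (hn : n.length ≤ m) :
    Ex φ clearAnswer { σ with
        tc := Function.update σ.tc .answer c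
        tp := Function.update σ.tp .answer p
        tn := Function.update σ.tn .answer n
        t1 := un j } (2 * m + 1)
      { σ with
        tc := Function.update σ.tc .answer []
        tp := Function.update σ.tp .answer []
        tn := Function.update σ.tn .answer []
        t1 := un (j + c.length) } := by
  induction m generalizing c p n j with
  | zero =>
    obtain rfl := List.length_eq_zero_iff.1 (Nat.le_zero.1 hc)
    obtain rfl := List.length_eq_zero_iff.1 (Nat.le_zero.1 hp)
    obtain rfl := List.length_eq_zero_iff.1 (Nat.le_zero.1 hn)
    exact Ex.loop_end (by simp [St.tops, PS.toSt])
  | succ m ih =>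
    by_cases h : c = [] ∧ p = [] ∧ n = []
    · obtain ⟨rfl, rfl, rfl⟩ := h
      exact Ex.mono (Ex.loop_end (by simp [St.tops, PS.toSt])) (by omega)
    · refine (Ex.loop_step (T₁ := 1) (Ex.op (htc := ?_) (htp := ?_) (htn := ?_) (hnm := ?_))
        (ih c.tail p.tail n.tail (j + (c.length - c.tail.length)) (by simp; omega)
          (by simp; omega) (by simp; omega)) ?_).congr ?_ (by omega)
      · intro u
        cases u <;> simp [StackAct.run]
      · intro u
        cases u <;> simp [StackAct.run]
      · intro u
        cases u <;> simp [StackAct.run]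
      · intro i
        cases i
        case t1 =>
          cases c
          · simp [St.tops, PS.toSt, StackAct.run, PS.get]
          · simp [St.tops, PS.toSt, StackAct.run, PS.get, un_succ]
        all_goals rfl
      · cases c <;> cases p <;> cases n <;> simp [St.tops, PS.toSt] at h ⊢
      · cases c <;> simp
        rw [Nat.add_assoc, Nat.add_comm 1]

/-- What the restoration of a cell of the answer tape does to the stack `tc` and the source. -/
def fillFun (neg : Bool) (b : List Sym × Str) : List Sym × Str :=
  bif neg then (none :: b.1, b.2) else (b.2.head? :: b.1, b.2.tail)

/-- Fills the cells of the answer tape between cell `0` and the head. -/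
def fillAnswer : Prog M :=
  .loop (has .t1) <| .op fun v s =>
    { v := v
      st := fun
        | .tc .answer => .push (bif v.sim.neg .answer then none else nextLetter v.sim.real s)
        | .nm .t1 => .pop
        | .nm .va => if v.sim.neg .answer || v.sim.real then .keep else .pop
        | _ => .keep
      ans := !v.sim.neg .answer && v.sim.real }

theorem PS.src_real (σ : PS M) (w : Str) : σ.src true w = { σ with ans := w } := rfl

theorem PS.src_virtual (σ : PS M) (w : Str) : σ.src false w = { σ with va := w.map some } := rfl

theorem ex_fillAnswer (σ : PS M) (n : ℕ) (c : List Sym) (w : Str) :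
    Ex φ fillAnswer
      ({ σ with tc := Function.update σ.tc .answer c, t1 := un n }.src σ.v.sim.real w)
      (2 * n + 1)
      ({ σ with
          tc := Function.update σ.tc .answer ((fillFun (σ.v.sim.neg .answer))^[n] (c, w)).1
          t1 := [] }.src σ.v.sim.real ((fillFun (σ.v.sim.neg .answer))^[n] (c, w)).2) := by
  have key : Ex φ fillAnswer _ _ _ := Ex.loop_nat
    (fun n b => { σ with tc := Function.update σ.tc .answer b.1, t1 := un n }.src
      σ.v.sim.real b.2) (fillFun (σ.v.sim.neg .answer)) 1
    (fun n b => by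
      obtain ⟨c, w⟩ := b
      cases hr : σ.v.sim.real <;> cases hn : σ.v.sim.neg .answer <;>
        simp only [PS.src_real, PS.src_virtual, fillFun, cond_true, cond_false]
      all_goals
        refine Ex.op (htc := ?_) (hnm := ?_) (ha := ?_)
        · intro u
          cases u
          case answer =>
            cases w <;> simp [StackAct.run, nextLetter, hr, hn, St.tops, PS.toSt, PS.get]
          all_goals simp [StackAct.run]
        · intro i
          cases i
          case va => cases w <;> simp [StackAct.run, PS.get, hr, hn]
          all_goals rfl
        · simp [hr, hn])
    (by intro b; cases σ.v.sim.real <;> rfl)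
    (by intro n b; cases σ.v.sim.real <;> rfl) n (c, w)
  exact key.mono (by omega)

/-- Sets the scanned symbol of the answer tape. -/
def scanAnswer : Prog M := .op fun v s =>
  { v := { v with
      sim := { v.sim with
        hd := Function.update v.sim.hd .answer
          (bif v.sim.neg .answer then none else nextLetter v.sim.real s) } }
    st := fun
      | .nm .va => if v.sim.neg .answer || v.sim.real then .keep else .pop
      | _ => .keep
    ans := !v.sim.neg .answer && v.sim.real }

/-- Replaces the content of the answer tape by the source and keeps the position of the head. -/
def install : Prog M := .seq clearAnswer (.seq fillAnswer scanAnswer)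

theorem fill_length (neg : Bool) (n : ℕ) (c : List Sym) (w : Str) :
    ((fillFun neg)^[n] (c, w)).1.length = n + c.length := by
  induction n generalizing c w with
  | zero => simp
  | succ n ih =>
    rw [Function.iterate_succ_apply]
    cases neg <;> simp [fillFun, ih] <;> omega

theorem fill_neg (n : ℕ) (c : List Sym) (w : Str) :
    (fillFun true)^[n] (c, w) = (un n ++ c, w) := by
  induction n generalizing c with
  | zero => simp
  | succ n ih =>
    rw [Function.iterate_succ_apply, fillFun, cond_true, ih]
    rw [← List.singleton_append (x := none), ← List.append_assoc]
    exact congrArg (fun l => (l ++ c, w)) (un_add n 1)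

theorem fill_pos (n : ℕ) (c : List Sym) (w : Str) (k : ℕ) :
    (((fillFun false)^[n] (c, w)).1.reverse ++
      ((fillFun false)^[n] (c, w)).2.map some).getD k none =
      (c.reverse ++ w.map some).getD k none := by
  induction n generalizing c w with
  | zero => rfl
  | succ n ih =>
    rw [Function.iterate_succ_apply, fillFun, cond_false, ih, List.reverse_cons,
      List.append_assoc]
    refine getD_append_congr _ (fun k => ?_) k
    cases w
    · cases k <;> simp
    · simp

theorem PS.src_self {σ : PS M} {w : Str} (h : σ.tl .answer = w.map some) :
    σ.src σ.v.sim.real w = σ := by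
  simp only [tl] at h
  cases hr : σ.v.sim.real
  · rw [hr, cond_false] at h
    rw [src_virtual, ← h]
  · rw [hr, cond_true] at h
    rw [src_real, ← List.map_injective_iff.2 (Option.some_injective _) h]

theorem PS.src_v (σ : PS M) (r : Bool) (w : Str) : (σ.src r w).v = σ.v := by cases r <;> rfl
theorem PS.src_tc (σ : PS M) (r : Bool) (w : Str) : (σ.src r w).tc = σ.tc := by cases r <;> rfl
theorem PS.src_tp (σ : PS M) (r : Bool) (w : Str) : (σ.src r w).tp = σ.tp := by cases r <;> rfl
theorem PS.src_tn (σ : PS M) (r : Bool) (w : Str) : (σ.src r w).tn = σ.tn := by cases r <;> rfl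
theorem PS.src_vq (σ : PS M) (r : Bool) (w : Str) : (σ.src r w).vq = σ.vq := by cases r <;> rfl

theorem PS.src_tl (σ : PS M) (w : Str) :
    (σ.src σ.v.sim.real w).tl .answer = w.map some := by
  simp only [tl, src_v]
  cases σ.v.sim.real <;> rfl

theorem fill_snd_length (neg : Bool) (n : ℕ) (c : List Sym) (w : Str) :
    ((fillFun neg)^[n] (c, w)).2.length ≤ w.length := by
  induction n generalizing c w with
  | zero => exact le_rfl
  | succ n ih =>
    rw [Function.iterate_succ_apply]
    refine (ih _ _).trans ?_
    cases neg <;> simp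

/-- The parts of the state that an oracle call leaves unchanged. -/
structure PS.SameSim (σ σ' : PS M) : Prop where
  core : σ'.core = σ.core
  q : σ'.v.sim.q = σ.v.sim.q
  abort : σ'.v.sim.abort = σ.v.sim.abort
  vq : σ'.vq = σ.vq

theorem ex_install (σ : PS M) (w : Str) (h1 : σ.t1 = []) (hw : σ.tl .answer = w.map some) :
    ∃ σ', Ex φ install σ (20 * ((σ.zip .answer).size + 1)) σ' ∧ σ.SameSim σ' ∧
      σ'.tapes .answer = ⟨cellsOf w, (σ.tapes .answer).head⟩ ∧
      (∀ u, u ≠ .answer → σ'.tapes u = σ.tapes u) ∧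
      (∀ u, (σ'.zip u).size ≤ (σ.zip u).size) ∧ σ'.va.length ≤ σ.va.length := by
  set n := (σ.tc .answer).length with hn
  have k1 := ex_clearAnswer (φ := φ) σ (σ.zip .answer).size (σ.tc .answer) (σ.tp .answer)
    (σ.tn .answer) 0 (by simp only [Zip.size, PS.zip]; omega)
    (by simp only [Zip.size, PS.zip]; omega)
    (by simp only [Zip.size, PS.zip]; omega)
  have e0 : ({ σ with
      tc := Function.update σ.tc .answer (σ.tc .answer)
      tp := Function.update σ.tp .answer (σ.tp .answer)
      tn := Function.update σ.tn .answer (σ.tn .answer)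
      t1 := un 0 } : PS M) = σ := by
    rw [Function.update_eq_self, Function.update_eq_self, Function.update_eq_self, un_zero, ← h1]
  rw [e0, zero_add] at k1
  set r := σ.v.sim.real with hr
  set neg := σ.v.sim.neg .answer with hneg
  set b := (fillFun neg)^[n] ([], w) with hb
  set σ₁ : PS M := { σ with
    tp := Function.update σ.tp .answer [], tn := Function.update σ.tn .answer [], t1 := [] } with hσ₁
  have k2 := ex_fillAnswer (φ := φ) σ₁ n [] w
  have e1 : ({ σ₁ with
      tc := Function.update σ₁.tc .answer []
      t1 := un n }.src σ₁.v.sim.real w : PS M) = { σ₁ with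
      tc := Function.update σ₁.tc .answer []
      t1 := un n } := PS.src_self (by exact hw)
  rw [e1] at k2
  set σ₂ : PS M := { σ₁ with tc := Function.update σ.tc .answer b.1 } with hσ₂
  have e2 : Ex φ fillAnswer { σ₁ with tc := Function.update σ₁.tc .answer [], t1 := un n }
    (2 * n + 1) (σ₂.src r b.2) := k2
  set σ₃ : PS M := { σ₂ with
    v := { σ₂.v with
      sim := { σ₂.v.sim with
        hd := Function.update σ.v.sim.hd .answer (bif neg then none else b.2.head?) } } } with hσ₃
  set w' : Str := bif neg then b.2 else b.2.tail with hw'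
  have k3 : Ex φ scanAnswer (σ₂.src r b.2) 1 (σ₃.src r w') := by
    cases hrr : r <;> cases hnn : neg <;> simp only [PS.src_real, PS.src_virtual, hw', hnn,
      cond_true, cond_false, hσ₃, hσ₂, hσ₁]
    all_goals
      refine Ex.op (hv := ?_) (hnm := ?_) (ha := ?_)
      · simp only [← hneg, ← hr, hnn, hrr, nextLetter, cond_true, cond_false]
        try (cases b.2 <;> rfl)
      · intro i
        cases i
        case va => simp [← hneg, ← hr, hnn, hrr, StackAct.run, PS.get]
        all_goals rfl
      · simp [← hneg, ← hr, hnn, hrr]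
  have hσ₃r : σ₃.v.sim.real = r := rfl
  have hlen : b.1.length = n := by rw [hb, fill_length]; simp
  have hva := fill_snd_length neg n [] w
  rw [← hb] at hva
  have hwl : w'.length ≤ w.length := by
    rw [hw']
    cases neg
    · simp; omega
    · exact hva
  have htl : (σ₃.src r w').tl .answer = w'.map some := PS.src_tl σ₃ w'
  refine ⟨σ₃.src r w', (k1.seq (e2.seq k3)).mono ?_, ⟨?_, ?_, ?_, ?_⟩, ?_, ?_, ?_, ?_⟩
  · simp only [Zip.size, PS.zip]; omega
  · have e : σ.core = { σ.core with t1 := [] } := by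
      conv_rhs => rw [← show σ.core.t1 = [] from h1]
    rw [e]
    cases r <;> rfl
  · rw [PS.src_v]
  · rw [PS.src_v]
  · rw [PS.src_vq]
  · rw [PS.tapes, htl]
    have : (σ₃.src r w').zip .answer = ⟨neg, b.1, bif neg then none else b.2.head?, [], []⟩ := by
      simp only [PS.zip, PS.src_v, PS.src_tc, PS.src_tp, PS.src_tn]
      simp [hσ₃, hσ₂, hσ₁, ← hneg]
    rw [this]
    have hh : (σ.tapes .answer).head = bif neg then -1 - (n : ℤ) else (n : ℤ) := rfl
    rw [hh, Zip.tape, hlen, cellsOf_eq]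
    congr 1
    cases hnn : neg
    · refine zCells_congr (fun k => ?_) (fun k => rfl)
      have := fill_pos n [] w k
      rw [← hnn, ← hb, List.reverse_nil, List.nil_append] at this
      rw [← this]
      simp only [Zip.P, hw', hnn, cond_false, List.nil_append]
      refine getD_append_congr _ (fun k => ?_) k
      cases b.2
      · cases k <;> simp
      · simp
    · have hb' : b = (un n ++ [], w) := by rw [hb, hnn, fill_neg]
      refine zCells_congr (fun k => by simp [Zip.P, hw', hnn, hb']) (fun k => ?_)
      rw [hb']
      simp only [Zip.N, cond_true, List.append_nil]
      have : (un n).reverse ++ [none] = un (n + 1) := by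
        rw [un, List.reverse_replicate, ← un]
        exact un_add n 1
      rw [this, un]
      simp [List.getD_eq_getElem?_getD, List.getElem?_replicate]
      split_ifs <;> rfl
  · intro u hu
    have : (σ₃.src r w').zip u = σ.zip u := by
      simp only [PS.zip, PS.src_v, PS.src_tc, PS.src_tp, PS.src_tn]
      simp [hσ₃, hσ₂, hσ₁, hu]
    rw [PS.tapes, PS.tapes, this]
    congr 1
    cases u
    case answer => exact absurd rfl hu
    all_goals rfl
  · intro u
    by_cases hu : u = .answer
    · subst hu
      simp only [Zip.size, PS.zip, PS.src_tc, PS.src_tp, PS.src_tn]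
      simp [hσ₃, hσ₂, hσ₁, hlen]
      omega
    · simp only [Zip.size, PS.zip, PS.src_tc, PS.src_tp, PS.src_tn]
      simp [hσ₃, hσ₂, hσ₁, hu]
  · simp only [PS.tl, ← hr] at hw
    cases hrr : r
    · rw [hrr, cond_false] at hw
      simp only [PS.src_virtual, List.length_map, hw]
      exact hwl
    · exact le_rfl

/-! ### The run of the simulated machine -/

/-- The state represents the configuration `c`. -/
def PS.Represents (σ : PS M) (c : M.Config) : Prop :=
  σ.v.sim.q = c.state ∧ ∀ u, σ.tapes u = c.tape u

/-- The strings `w` that the machine `M` with oracle `O` asks for satisfy `good w`, from the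
configuration `c` on. -/
def GoodFrom (M : OracleMachine) (O : Baire) (good : Str → Prop) (c : M.Config) : Prop :=
  ∀ i, ((M.step O)^[i] c).state ≠ M.halt → ((M.step O)^[i] c).state = M.oracle →
    good (((M.step O)^[i] c).tape .query).content

/-- The program `blk` answers the oracle calls of the simulated machine: it replaces a query `w` on
the stack `vq` by the answer `O w`, or it gives up if the query is not good. The numbers `W` and
`V` bound the lengths of the queries and the height of `va`. -/
def Answers (φ : Baire) (blk : Prog M) (κ : PS M) (O : Baire) (good : Str → Prop)
    (W V T : ℕ) : Prop :=
  ∀ (σ : PS M) (w : Str), σ.core = κ → σ.vq = w.map some → w.length ≤ W → σ.va.length ≤ V →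
    σ.v.sim.abort = false → ∃ σ', Ex φ blk σ T σ' ∧ σ'.core = κ ∧ σ'.vq = [] ∧
      σ'.va.length ≤ V ∧ σ'.tc = σ.tc ∧ σ'.tp = σ.tp ∧ σ'.tn = σ.tn ∧
      σ'.v.sim.q = σ.v.sim.q ∧ σ'.v.sim.hd = σ.v.sim.hd ∧ σ'.v.sim.neg = σ.v.sim.neg ∧
      (good w → σ'.v.sim.abort = false ∧ σ'.tl .answer = (O w).map some) ∧
      (¬ good w → σ'.v.sim.abort = true)

/-- Simulates the machine until it halts or is given up. -/
def simLoop (blk : Prog M) : Prog M :=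
  .loop (fun v _ => !decide (v.sim.q = M.halt) && !v.sim.abort) <|
    .ite (fun v _ => decide (v.sim.q = M.oracle))
      (.seq (getContent .query) <| .seq blk <|
        .ite (fun v _ => v.sim.abort) (.op fun v _ => { v := v }) <|
          .seq install (.op fun v _ => { v := { v with sim := { v.sim with q := M.resume } } }))
      simStep

theorem step_oracle {O : Baire} {c : M.Config} (h : c.state ≠ M.halt) (h' : c.state = M.oracle) :
    M.step O c = ⟨M.resume, fun
        | .answer => ⟨cellsOf (O (c.tape .query).content), (c.tape .answer).head⟩
        | i => c.tape i⟩ :=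
  (if_neg h).trans ((if_pos h').trans rfl)

theorem step_transition {O : Baire} {c : M.Config} (h : c.state ≠ M.halt)
    (h' : c.state ≠ M.oracle) : M.step O c =
      ⟨(M.transition c.state fun i => (c.tape i).cells (c.tape i).head).1,
        fun i => (c.tape i).act
          ((M.transition c.state fun i => (c.tape i).cells (c.tape i).head).2 i).1
          ((M.transition c.state fun i => (c.tape i).cells (c.tape i).head).2 i).2⟩ := by
  simp only [OracleMachine.step, if_neg h, if_neg h']

theorem step_halt {O : Baire} {c : M.Config} (h : c.state = M.halt) (n : ℕ) :
    (M.step O)^[n] c = c := by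
  induction n with
  | zero => rfl
  | succ n ih => rw [Function.iterate_succ_apply, OracleMachine.step, if_pos h, ih]

theorem Zip.content_length (z : Zip) : (z.tape []).content.length ≤ z.size + 1 := by
  rw [Zip.content]
  refine (List.length_filterMap_le _ _).trans ((List.takeWhile_prefix _).length_le.trans ?_)
  obtain ⟨neg, c, h, p, n⟩ := z
  cases neg <;> simp [P, size] <;> omega

theorem GoodFrom.step {O : Baire} {good : Str → Prop} {c : M.Config}
    (h : GoodFrom M O good (M.step O c))
    (hc : c.state ≠ M.halt → c.state = M.oracle → good (c.tape .query).content) :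
    GoodFrom M O good c := by
  rintro (_ | i)
  · exact hc
  · exact h i

theorem GoodFrom.of_step {O : Baire} {good : Str → Prop} {c : M.Config}
    (h : GoodFrom M O good c) : GoodFrom M O good (M.step O c) := fun i => h (i + 1)

theorem PS.simNext_size (σ : PS M) (u : TapeIx M.workTapes) :
    (σ.simNext.zip u).size ≤ (σ.zip u).size + 1 := Zip.size_move _ _ _ _

theorem PS.simNext_va (σ : PS M) : σ.simNext.va.length ≤ σ.va.length := by
  simp only [simNext]
  cases (_ && _) <;> simp

/-- The simulation of `n` steps takes time linear in `n` and in the time for a step; it leaves the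
configuration that the machine reaches, unless some query is not good. -/
theorem ex_simLoop {blk : Prog M} {κ : PS M} {O : Baire} {good : Str → Prop} {B V T : ℕ}
    (hblk : Answers φ blk κ O good (B + 1) V T) (h1 : κ.t1 = []) (h2 : κ.t2 = []) (n : ℕ)
    (σ : PS M) (c : M.Config) (hr : σ.Represents c) (hκ : σ.core = κ)
    (hB : ∀ u, (σ.zip u).size + n ≤ B) (hV : σ.va.length ≤ V) (hq : σ.vq = [])
    (ha : σ.v.sim.abort = false) (hh : ((M.step O)^[n] c).state = M.halt) :
    ∃ σ', Ex φ (simLoop blk) σ (n * (40 * (B + 1) + T + 10) + 1) σ' ∧ σ'.core = κ ∧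
      (∀ u, (σ'.zip u).size ≤ B) ∧ σ'.va.length ≤ V ∧ σ'.vq = [] ∧
      (GoodFrom M O good c → σ'.v.sim.abort = false ∧ σ'.Represents ((M.step O)^[n] c)) ∧
      (¬ GoodFrom M O good c → σ'.v.sim.abort = true) := by
  induction n generalizing σ c with
  | zero =>
    have hst : c.state = M.halt := hh
    refine ⟨σ, (Ex.loop_end ?_).mono (by omega), hκ, fun u => hB u, hV, hq,
      fun _ => ⟨ha, hr⟩, fun hg => absurd ?_ hg⟩
    · simp [hr.1, hst]
    · intro i hi
      rw [step_halt hst] at hi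
      exact absurd hst hi
  | succ n ih =>
    by_cases hst : c.state = M.halt
    · refine ⟨σ, (Ex.loop_end ?_).mono (by omega), hκ, fun u => (by have := hB u; omega), hV, hq,
        fun _ => ⟨ha, by rw [step_halt hst]; exact hr⟩, fun hg => absurd ?_ hg⟩
      · simp [hr.1, hst]
      · intro i hi
        rw [step_halt hst] at hi
        exact absurd hst hi
    have hloop : (!decide (σ.v.sim.q = M.halt) && !σ.v.sim.abort) = true := by
      simp [hr.1, hst, ha]
    by_cases ho : c.state = M.oracle
    · have hcont : (σ.tapes .query).content = (c.tape .query).content := by rw [hr.2]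
      set w := (c.tape .query).content with hw
      have k1 := ex_getContent (φ := φ) .query σ (hκ ▸ h1 : σ.core.t1 = [])
        (hκ ▸ h2 : σ.core.t2 = []) hq rfl
      rw [hcont] at k1
      have hwl : w.length ≤ B + 1 := by
        rw [← hcont]
        exact (Zip.content_length (σ.zip .query)).trans (by have := hB .query; omega)
      obtain ⟨σ₂, k2, g1, g2, g3, g4, g5, g6, g7, g8, g9, g10, g11⟩ :=
        hblk { σ with vq := w.map some } w hκ rfl hwl hV ha
      have hzip : ∀ u, σ₂.zip u = σ.zip u := fun u => by
        simp only [PS.zip, g4, g5, g6, g8, g9]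
      by_cases hg : good w
      · obtain ⟨g12, g13⟩ := g10 hg
        obtain ⟨σ₃, k3, ⟨i1, i2, i3, i4⟩, i5, i6, i7, i8⟩ := ex_install (φ := φ) σ₂ (O w)
          (g1 ▸ h1 : σ₂.core.t1 = []) g13
        obtain ⟨σ', k4, j1, j2, j3, j4, j5, j6⟩ := ih
          { σ₃ with v := { σ₃.v with sim := { σ₃.v.sim with q := M.resume } } } (M.step O c)
          (by
            rw [step_oracle hst ho]
            refine ⟨rfl, fun u => ?_⟩
            change σ₃.tapes u = _
            have ht : ∀ u, u ≠ .answer → σ₃.tapes u = c.tape u := by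
              intro u hu
              rw [i6 u hu, PS.tapes, hzip, ← hr.2]
              cases u
              case answer => exact absurd rfl hu
              all_goals rfl
            cases u
            case answer =>
              rw [i5]
              change (⟨_, ((σ₂.zip .answer).tape _).head⟩ : Tape) = ⟨_, (c.tape .answer).head⟩
              rw [hzip, ← hr.2 .answer]
              rfl
            all_goals exact ht _ (by simp))
          (i1.trans g1)
          (fun u => by
            have := hB u; have := i7 u; rw [hzip] at this; change (σ₃.zip u).size + n ≤ B; omega)
          (i8.trans g3) (i4.trans g2) (i3.trans g12) hh
        refine ⟨σ', (Ex.loop_step (Ex.ite_true (k1.seq (k2.seq (Ex.ite_false (k3.seq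
          (T₂ := 1) Ex.op) g12))) ?_) k4 hloop).mono ?_, j1, j2, j3, j4, fun h => j5 h.of_step,
          fun h => j6 fun h' => h (h'.step fun _ _ => hg)⟩
        · simp [hr.1, ho]
        · have := hB .query
          have := hB .answer
          rw [hzip .answer]
          rw [add_mul]
          omega
      · refine ⟨σ₂, (Ex.loop_step (Ex.ite_true (k1.seq (k2.seq (Ex.ite_true
          (Ex.op (σ₁ := σ₂)) (g11 hg)))) ?_) (Ex.loop_end ?_) hloop).mono ?_, g1,
          fun u => by rw [hzip]; have := hB u; omega, g3, g2, fun h => absurd (h 0 hst ho) hg,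
          fun _ => g11 hg⟩
        · simp [hr.1, ho]
        · simp [g11 hg]
        · have := hB .query
          rw [add_mul]
          omega
    · obtain ⟨σ', k4, j1, j2, j3, j4, j5, j6⟩ := ih σ.simNext (M.step O c)
        (by
          have hhd : (fun i => (c.tape i).cells (c.tape i).head) = σ.v.sim.hd := by
            funext u
            rw [← hr.2, PS.tapes_read]
          rw [step_transition hst ho, hhd, ← hr.1]
          refine ⟨rfl, fun u => ?_⟩
          rw [PS.simNext_tapes, hr.2])
        hκ (fun u => by have := hB u; have := σ.simNext_size u; omega)
        (σ.simNext_va.trans hV) hq ha hh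
      refine ⟨σ', (Ex.loop_step (Ex.ite_false (ex_simStep σ) ?_) k4 hloop).mono ?_, j1, j2, j3, j4,
        fun h => j5 h.of_step, fun h => j6 fun h' => h (h'.step fun _ h => absurd h ho)⟩
      · simp [hr.1, ho]
      · rw [add_mul]
        omega

open Classical in
/-- Empties the stacks of all tapes. -/
def clearTapes : Prog M :=
  .loop (fun _ s => decide (∃ u, (s.st (.tc u)).isSome ∨ (s.st (.tp u)).isSome ∨
      (s.st (.tn u)).isSome)) <| .op fun v _ =>
    { v := v
      st := fun
        | .tc _ => .pop
        | .tp _ => .pop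
        | .tn _ => .pop
        | _ => .keep }

theorem ex_clearTapes (m : ℕ) (σ : PS M) (h : ∀ u, (σ.zip u).size ≤ m) :
    Ex φ clearTapes σ (2 * m + 1)
      { σ with tc := fun _ => [], tp := fun _ => [], tn := fun _ => [] } := by
  have key : ∀ (m : ℕ) (c p n : TapeIx M.workTapes → List Sym),
      (∀ u, (c u).length ≤ m ∧ (p u).length ≤ m ∧ (n u).length ≤ m) →
      Ex φ clearTapes { σ with tc := c, tp := p, tn := n } (2 * m + 1)
        { σ with tc := fun _ => [], tp := fun _ => [], tn := fun _ => [] } := by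
    intro m
    induction m with
    | zero =>
      intro c p n h
      simp only [Nat.le_zero, List.length_eq_zero_iff] at h
      obtain rfl : c = fun _ => [] := funext fun u => (h u).1
      obtain rfl : p = fun _ => [] := funext fun u => (h u).2.1
      obtain rfl : n = fun _ => [] := funext fun u => (h u).2.2
      exact Ex.loop_end (by simp [St.tops, PS.toSt])
    | succ m ih =>
      intro c p n h
      by_cases hp : ∃ u, (c u).head?.isSome ∨ (p u).head?.isSome ∨ (n u).head?.isSome
      · refine (Ex.loop_step (T₁ := 1) (σ := { σ with tc := c, tp := p, tn := n }) Ex.op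
          (ih (fun u => (c u).tail) (fun u => (p u).tail)
          (fun u => (n u).tail) fun u => ?_)
          (@decide_eq_true _ (Classical.propDecidable _) hp)).mono (by omega)
        have := h u
        simp only [List.length_tail]
        omega
      · refine (Ex.loop_end (@decide_eq_false _ (Classical.propDecidable _) hp)).congr ?_ (by omega)
        push Not at hp
        simp only [ne_eq, Bool.not_eq_true, Option.isSome_eq_false_iff, Option.isNone_iff_eq_none,
          List.head?_eq_none_iff] at hp
        obtain rfl : c = fun _ => [] := funext fun u => (hp u).1
        obtain rfl : p = fun _ => [] := funext fun u => (hp u).2.1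
        obtain rfl : n = fun _ => [] := funext fun u => (hp u).2.2
        rfl
  refine key m σ.tc σ.tp σ.tn fun u => ?_
  have := h u
  simp only [Zip.size, PS.zip] at this
  omega

/-- Moves `t1` to the input tape of the simulated machine. -/
def loadTape : Prog M :=
  .loop (has .t1) <| .op fun v s =>
    { v := v
      st := fun
        | .tp .input => .push ((s.st (.nm .t1)).getD none)
        | .nm .t1 => .pop
        | _ => .keep }

/-- Writes the string on `t1` on the input tape. -/
def loadInput : Prog M :=
  .seq loadTape <|
  .op fun v s =>
    { v := { v with
        sim := { v.sim with
          hd := Function.update v.sim.hd .input ((s.st (.tp .input)).getD none) } }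
      st := fun
        | .tp .input => .pop
        | _ => .keep }

theorem ex_loadInput (σ : PS M) (w : Str) (h : σ.tp .input = [])
    (ht : σ.t1 = (w.map some).reverse) :
    Ex φ loadInput σ (2 * w.length + 3) { σ with
      v := { σ.v with sim := { σ.v.sim with hd := Function.update σ.v.sim.hd .input w.head? } }
      tp := Function.update σ.tp .input (w.tail.map some)
      t1 := [] } := by
  have key : Ex φ loadTape _ _ _ := Ex.loop_foldl
    (fun l r => { σ with tp := Function.update σ.tp .input r, t1 := l })
    (fun r x => x :: r) 1
    (fun x l r => Ex.op (htp := by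
      intro u
      cases u <;> simp [StackAct.run, St.tops, PS.toSt, PS.get]))
    (by intros; rfl) (by intros; rfl) σ.t1 (σ.tp .input)
  rw [foldl_cons_eq, Function.update_eq_self, h, ht, List.reverse_reverse, List.append_nil] at key
  have e : ({ σ with t1 := (w.map some).reverse } : PS M) = σ := by rw [← ht]
  rw [e] at key
  refine (key.seq (T₂ := 1) (Ex.op (hv := ?_) (htp := ?_))).mono ?_
  · cases w <;> simp [St.tops, PS.toSt]
  · intro u
    cases u <;> simp [StackAct.run]
  · simp
    omega

/-- Runs the simulated machine on the string on `vq`, and replaces it by the output. -/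
def simProg (blk : Prog M) : Prog M :=
  .seq (.op fun v _ => { v := { v with sim := (Regs.init M).sim } }) <|
  .seq (mv .vq .t1) <|
  .seq loadInput <|
  .seq (simLoop blk) <|
  .seq (.ite (fun v _ => v.sim.abort) (.op fun v _ => { v := v }) (getContent .output)) <|
  .seq clearTapes <|
  .seq (clr .va) <|
  .op fun v _ => { v := { v with sim := { (Regs.init M).sim with abort := v.sim.abort } } }

theorem PS.eq_of_core {σ κ : PS M} (h : σ.core = κ) (htc : σ.tc = fun _ => [])
    (htp : σ.tp = fun _ => []) (htn : σ.tn = fun _ => []) (hva : σ.va = []) :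
    σ = { κ with v := { κ.v with sim := σ.v.sim }, vq := σ.vq, ans := σ.ans } := by
  subst h
  cases σ
  simp only at htc htp htn hva
  subst htc htp htn hva
  rfl

open Classical in
/-- A run of `M` on the word `w` is simulated, the queries being answered by `blk`. It is given up,
with the flag `abort` set, as soon as `M` asks a query that is not good. -/
theorem ex_simProg {blk : Prog M} {κ : PS M} {O : Baire} {good : Str → Prop} {B V T : ℕ}
    (hblk : Answers φ blk κ O good (B + 1) V T) (h1 : κ.t1 = []) (h2 : κ.t2 = [])
    (hκ : κ.core = κ) (w : Str) (n : ℕ) (hB : w.length + n ≤ B)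
    (hh : (M.run O w n).state = M.halt) (sim : SimRegs M) (a : Str) :
    ∃ a', Ex φ (simProg blk)
      { κ with v := { κ.v with sim := sim }, vq := w.map some, ans := a }
      ((n + 3) * (40 * (B + 1) + T + 2 * V + 20))
      { κ with
        v := { κ.v with
          sim := { (Regs.init M).sim with abort := !decide (GoodFrom M O good (M.init w)) } }
        vq := if GoodFrom M O good (M.init w) then
          ((M.run O w n).tape .output).content.map some else []
        ans := a' } ∧
      (GoodFrom M O good (M.init w) → ((M.run O w n).tape .output).content.length ≤ B + 1) := by
  have htc : κ.tc = fun _ => [] := by rw [← hκ]; rfl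
  have htp : κ.tp = fun _ => [] := by rw [← hκ]; rfl
  have htn : κ.tn = fun _ => [] := by rw [← hκ]; rfl
  have hva : κ.va = [] := by rw [← hκ]; rfl
  let S : PS M := { κ with v := { κ.v with sim := (Regs.init M).sim }, vq := [], ans := a }
  have k2 : Ex φ (mv .vq .t1) _ (2 * w.length + 1) { S with t1 := (w.map some).reverse } :=
    (ex_mv φ .vq .t1 { S with vq := w.map some }).congr (by
      conv_rhs => rw [← List.append_nil (w.map some).reverse]
      exact congrArg (fun l => { S with t1 := (w.map some).reverse ++ l }) h1) (by simp [PS.get])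
  have k3 := ex_loadInput (φ := φ) { S with t1 := (w.map some).reverse } w (by simp [S, htp]) rfl
  set σ₃ : PS M := { S with
      v := { S.v with
        sim := { S.v.sim with hd := Function.update (Regs.init M).sim.hd .input w.head? } }
      tp := Function.update κ.tp .input (w.tail.map some)
      t1 := [] } with hσ₃
  have hzip : ∀ u, σ₃.zip u =
      ⟨false, [], Function.update (Regs.init M).sim.hd .input w.head? u,
        Function.update κ.tp .input (w.tail.map some) u, []⟩ := by
    intro u
    simp only [PS.zip, hσ₃, S, htc, htn]
    rfl
  obtain ⟨σ₄, k4, j1, j2, j3, j4, j5, j6⟩ := ex_simLoop hblk h1 h2 n σ₃ (M.init w)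
    (by
      refine ⟨rfl, fun u => ?_⟩
      have hb : ∀ (l : List Sym), (⟨false, [], none, [], []⟩ : Zip).tape [] = ⟨cellsOf [], 0⟩ := by
        intro l
        rw [cellsOf_eq, Zip.tape]
        refine congrArg₂ _ (zCells_congr (fun k => ?_) fun k => rfl) rfl
        cases k <;> simp [Zip.P]
      cases u
      case input =>
        rw [PS.tapes, hzip]
        simp only [Function.update_self, OracleMachine.init, Zip.tape, Zip.P, Zip.N, cellsOf_eq]
        refine congrArg₂ _ (zCells_congr (fun k => ?_) fun k => rfl) rfl
        cases w <;> cases k <;> simp [PS.tl]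
      all_goals
        rw [PS.tapes, hzip, Function.update_of_ne (by simp), Function.update_of_ne (by simp), htp]
        simp only [PS.tl, hσ₃, S, hva]
        exact hb [])
    (by
      rw [← hκ]
      simp only [hσ₃, S, PS.core, PS.mk.injEq, true_and, and_true]
      exact h1.symm)
    (fun u => by
      rw [hzip]
      simp only [Zip.size, List.length_nil, Nat.zero_add, Nat.add_zero]
      by_cases hu : u = .input
      · subst hu
        simp
        omega
      · rw [Function.update_of_ne hu, htp]
        simp
        omega)
    (by rw [show σ₃.va = [] from hva]; simp) rfl rfl hh
  have hlast : ∃ σ₅, Ex φ (.ite (fun v _ => v.sim.abort) (.op fun v _ => { v := v })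
        (getContent .output)) σ₄ (20 * (B + 1) + 1) σ₅ ∧ σ₅ = { σ₄ with
          vq := if GoodFrom M O good (M.init w) then
            ((M.run O w n).tape .output).content.map some else [] } ∧
          σ₅.v.sim.abort = !decide (GoodFrom M O good (M.init w)) := by
    by_cases hg : GoodFrom M O good (M.init w)
    · obtain ⟨l1, l2⟩ := j5 hg
      have k5 := ex_getContent (φ := φ) .output σ₄ (j1 ▸ h1 : σ₄.core.t1 = [])
        (j1 ▸ h2 : σ₄.core.t2 = []) j4 rfl
      rw [l2.2] at k5
      have := j2 .output
      refine ⟨_, (Ex.ite_false k5 l1).mono (by omega), ?_, by simp [hg, l1]⟩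
      rw [if_pos hg]
      rfl
    · have l1 := j6 hg
      refine ⟨σ₄, (Ex.ite_true (Ex.op (σ₁ := σ₄)) l1).mono (by omega), ?_, by simp [hg, l1]⟩
      rw [if_neg hg, ← j4]
  obtain ⟨σ₅, k5, e5, a5⟩ := hlast
  have k6 := ex_clearTapes (φ := φ) B σ₅ (by rw [e5]; exact j2)
  let σ₆ : PS M := { σ₅ with
      v := { σ₅.v with sim := { (Regs.init M).sim with abort := σ₅.v.sim.abort } }
      tc := fun _ => [], tp := fun _ => [], tn := fun _ => []
      va := [] }
  refine ⟨σ₄.ans, (Ex.seq (T₁ := 1) Ex.op (k2.seq (k3.seq (k4.seq (k5.seq (k6.seq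
    ((ex_clr φ .va _).seq (T₂ := 1) Ex.op))))))).congr (σ₁ := σ₆) ?_ ?_, fun hg => ?_⟩
  · rw [PS.eq_of_core (σ := σ₆) (κ := κ) (by rw [← j1]; simp only [σ₆, e5, PS.core]) rfl rfl rfl
      rfl]
    simp only [σ₆]
    rw [a5, e5]
  · have hv5 : σ₅.va.length ≤ V := by rw [e5]; exact j3
    simp only [PS.get]
    have : (n + 3) * (40 * (B + 1) + T + 2 * V + 20) =
      n * (40 * (B + 1) + T + 10) + n * (2 * V + 10) + 3 * (40 * (B + 1) + T + 2 * V + 20) := by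
        ring
    omega
  · have := j2 .output
    rw [OracleMachine.run, ← (j5 hg).2.2, PS.tapes]
    exact (Zip.content_length (σ₄.zip .output)).trans (by omega)

/-! ### Programs for the identity of the reals, for the evaluation and for products -/

/-- The state at the start of a program. -/
def PS.start (M : OracleMachine) (a : Str) : PS M where
  v := Regs.init M
  tc := fun _ => []
  tp := fun _ => []
  tn := fun _ => []
  vq := []
  va := []
  t1 := []
  t2 := []
  x := []
  y := []
  cap := []
  cp := []
  c1 := []
  c2 := []
  np := []
  nk := []
  bp := []
  bk := []
  pa := []
  pk := []
  pb := []
  lv := []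
  lm := []
  iv := []
  da := []
  db := []
  dc := []
  dt := []
  du := []
  inp := a
  ans := []
  qry := []
  out := []

theorem PS.toSt_start (a : Str) : (PS.start M a).toSt = St.start (Regs.init M) a := by
  refine St.ext rfl (funext fun i => ?_) rfl rfl rfl rfl
  rcases i with t | t | t | i
  · rfl
  · rfl
  · rfl
  · cases i <;> rfl

theorem Ex.haltsWithin {c : Prog M} {a : Str} {T T' : ℕ} {σ : PS M} {w : Str}
    (h : Ex φ c (PS.start M a) T σ) (hw : σ.out = w) (hT : 4 * (T + 1) ^ 2 ≤ T') :
    (Compile.machine c (Regs.init M)).HaltsWithin φ a T' w := by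
  rw [Ex, PS.toSt_start] at h
  obtain ⟨s, hs, h1, h2⟩ := h.haltsWithin
  exact ⟨s, hs.trans hT, h1, h2.trans hw⟩

theorem PS.clean_start (a b : Str) : ({ PS.start M a with inp := b } : PS M).Clean :=
  ⟨rfl, rfl, rfl, rfl, rfl, rfl, rfl, rfl, rfl, rfl, rfl, rfl⟩

/-- Drops a letter of the input. -/
def dropInp : Prog M := .op fun v _ => { v := v, inp := true }

theorem ex_dropInp (σ : PS M) : Ex φ dropInp σ 1 { σ with inp := σ.inp.tail } := Ex.op

/-- The output of `runner` on a string with `n` letters behind the code of the sign and of the leading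
digit. -/
def runOut (C : ℕ → Option Cand) (n : ℕ) : Str := collOut (collUpTo C n)

/-- Computes a name of a real number that is not longer than necessary from the given name, which is
asked with the prefix `pre`. -/
def realProg (M : OracleMachine) : Prog M :=
  .seq dropInp (.seq dropInp (runner (realBody [])))

theorem realProg_halts (M : OracleMachine) (φ : Baire) (a : Str) :
    (Compile.machine (realProg M) (Regs.init M)).HaltsWithin φ a
      (4 * (3000 * (a.length + 1) ^ 2 + 1) ^ 2)
      (runOut (fun m => candStr m (φ (codeStr m))) (a.length - 2)) := by
  obtain ⟨σ', h, ho⟩ := ex_runner (M := M) (φ := φ) (realBody [])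
    (fun m => candStr m (φ (codeStr m))) (2000 * (a.length + 1)) a.length
    (fun m hm c hc => candStr_bound hc hm)
    (fun τ s m h1 h2 h3 h4 h5 h6 => ex_realBody [] a.length τ s m h1 h2 h3 h4 h5 h6)
    { PS.start M a with inp := a.tail.tail } (PS.clean_start a _) ⟨rfl, rfl, rfl, rfl⟩ rfl rfl
    (by simp; omega)
  refine Ex.haltsWithin (((ex_dropInp (PS.start M a)).seq ((ex_dropInp
    { PS.start M a with inp := a.tail }).seq h))) (ho.trans ?_) ?_
  · simp [PS.start, runOut, Nat.sub_sub]
  · have : 1 + (1 + ((a.length + 1) * (2000 * (a.length + 1) + 3) + 200 * (a.length + 1) + 3) + 1)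
        + 1 ≤ 3000 * (a.length + 1) ^ 2 := by nlinarith
    gcongr

/-- Computes a name of the value of a function from names of the function and of the argument. -/
def evalProg (M : OracleMachine) : Prog M := .seq dropInp (.seq dropInp (runner evalBody))

theorem evalCand_ok {L m : ℕ} (hm : m ≤ L) {c : Cand} (h : evalCand φ m = some c) :
    4 ≤ c.lvl ∧ c.lvl + c.str.length ≤ 3 * L + 2 := by
  obtain ⟨d, -, h⟩ := Option.bind_eq_some_iff.1 h
  exact candStr_bound h hm

theorem evalProg_halts (M : OracleMachine) (φ : Baire) (a : Str) :
    (Compile.machine (evalProg M) (Regs.init M)).HaltsWithin φ a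
      (4 * (5000 * (a.length + 1) ^ 2 + 1) ^ 2) (runOut (evalCand φ) (a.length - 2)) := by
  obtain ⟨σ', h, ho⟩ := ex_runner (M := M) (φ := φ) evalBody
    (evalCand φ) (4000 * (a.length + 1)) a.length
    (fun m hm c hc => evalCand_ok hm hc)
    (fun τ s m h1 h2 h3 h4 h5 h6 => ex_evalBody a.length τ s m h1 h2 h3 h4 h5 h6)
    { PS.start M a with inp := a.tail.tail } (PS.clean_start a _) ⟨rfl, rfl, rfl, rfl⟩ rfl rfl
    (by simp; omega)
  refine Ex.haltsWithin (((ex_dropInp (PS.start M a)).seq ((ex_dropInp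
    { PS.start M a with inp := a.tail }).seq h))) (ho.trans ?_) ?_
  · simp [PS.start, runOut, Nat.sub_sub]
  · have : 1 + (1 + ((a.length + 1) * (4000 * (a.length + 1) + 3) + 200 * (a.length + 1) + 3) + 1)
        + 1 ≤ 5000 * (a.length + 1) ^ 2 := by nlinarith
    gcongr

/-- Moves the input to `t1`. -/
def loadLoop : Prog M :=
  .loop (fun _ t => t.inp.isSome) <| .op fun v t =>
    { v := v
      inp := true
      st := fun
        | .nm .t1 => .push t.inp
        | _ => .keep }

/-- Moves the rest of the input to `vq`. -/
def loadQuery : Prog M :=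
  .seq loadLoop (mv .t1 .vq)

theorem ex_loadQuery (σ : PS M) (ht : σ.t1 = []) (hq : σ.vq = []) :
    Ex φ loadQuery σ (4 * σ.inp.length + 3) { σ with inp := [], vq := σ.inp.map some } := by
  have key : Ex φ loadLoop _ _ _ := Ex.loop_foldl
    (fun l r => { σ with inp := l, t1 := r }) (fun r x => some x :: r) 1
    (fun x l r => Ex.op) (by intros; rfl) (by intros; rfl) σ.inp []
  have e : ({ σ with inp := σ.inp, t1 := [] } : PS M) = σ := by rw [← ht]
  rw [List.foldl_flip_cons_eq_append, e, List.append_nil] at key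
  refine (key.seq (ex_mv _ .t1 .vq _)).congr ?_ ?_
  · simp only [PS.get, PS.put, List.reverse_reverse, hq, List.append_nil]
    rw [← ht]
  · simp [PS.get]
    omega

theorem foldl_append_singleton (l r : Str) : l.foldl (fun r x => r ++ [x]) r = r ++ l := by
  induction l generalizing r with
  | nil => simp
  | cons x l ih => simp [ih]

/-- Copies `vq` to the output. -/
def writeOut : Prog M :=
  .loop (has .vq) <| .op fun v t =>
    { v := v
      out := (t.st (.nm .vq)).getD none
      st := fun
        | .nm .vq => .pop
        | _ => .keep }

theorem ex_writeOut (σ : PS M) (w : Str) (h : σ.vq = w.map some) :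
    Ex φ writeOut σ (2 * w.length + 1) { σ with vq := [], out := σ.out ++ w } := by
  have key : Ex φ writeOut _ _ _ := Ex.loop_foldl
    (fun (l : Str) r => { σ with vq := l.map some, out := r }) (fun r x => r ++ [x]) 1
    (fun x l r => Ex.op (ho := rfl)) (by intros; rfl) (by intros; rfl) w σ.out
  have e : ({ σ with vq := w.map some, out := σ.out } : PS M) = σ := by rw [← h]
  rw [foldl_append_singleton, e] at key
  exact key.mono (by omega)

/-- Copies `vq` to the query tape. -/
def queryLoop : Prog M :=
  .loop (has .vq) <| .op fun v t =>
    { v := v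
      qry := (t.st (.nm .vq)).getD none
      st := fun
        | .nm .vq => .pop
        | _ => .keep }

/-- Passes the query on `vq` on to the oracle. -/
def realCall : Prog M :=
  .seq queryLoop <|
  .seq .call <|
  .op fun v _ => { v := { v with sim := { v.sim with real := true } } }

theorem ex_realCall (σ : PS M) (w : Str) (h : σ.vq = w.map some) :
    Ex φ realCall σ (2 * w.length + 5) { σ with
      v := { σ.v with sim := { σ.v.sim with real := true } }
      vq := [], qry := [], ans := φ (σ.qry ++ w) } := by
  have key : Ex φ queryLoop _ _ _ := Ex.loop_foldl
    (fun (l : Str) r => { σ with vq := l.map some, qry := r }) (fun r x => r ++ [x]) 1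
    (fun x l r => Ex.op (hq := rfl)) (by intros; rfl) (by intros; rfl) w σ.qry
  have e : ({ σ with vq := w.map some, qry := σ.qry } : PS M) = σ := by rw [← h]
  rw [foldl_append_singleton, e] at key
  exact (key.seq ((Ex.call _).seq (T₂ := 1) Ex.op)).mono (by omega)

/-- Answers the queries of the simulated machine with the first component of a pair. -/
def fstCall : Prog M := .seq (.op fun v _ => { v := v, qry := some (.bit false) }) realCall

theorem answers_fstCall (φ : Baire) (κ : PS M) (hq : κ.qry = []) (W V : ℕ) :
    Answers φ fstCall κ (fun b => φ (.bit false :: b)) (fun _ => True) W V (2 * W + 10) := by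
  intro σ w h1 h2 h3 h4 h5
  have hq' : σ.qry = [] := (congrArg PS.qry h1).trans hq
  have k1 : Ex φ (.op fun v _ => { v := v, qry := some (.bit false) }) σ 1
      { σ with qry := [.bit false] } := Ex.op (hq := by rw [hq']; rfl)
  refine ⟨_, (k1.seq (ex_realCall _ w h2)).mono (by omega), ?_, rfl, h4, rfl, rfl, rfl, rfl, rfl,
    rfl, fun _ => ⟨h5, rfl⟩, fun h => absurd trivial h⟩
  rw [← h1]
  simp only [PS.core, hq']

/-- Computes a name of a pair from a given one, where `M` does so for the first component and where the
second component is a real number. -/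
def prodProg (M : OracleMachine) : Prog M :=
  .ite (fun _ t => match t.inp with
      | some (.bit false) => true
      | _ => false)
    (.seq dropInp (.seq loadQuery (.seq (simProg fstCall) writeOut)))
    (.ite (fun _ t => match t.inp with
        | some (.bit true) => true
        | _ => false)
      (.seq dropInp (.seq dropInp (.seq dropInp (runner (realBody [.bit true])))))
      skip)

theorem prodProg_halts_snd (M : OracleMachine) (φ : Baire) (a : Str) :
    (Compile.machine (prodProg M) (Regs.init M)).HaltsWithin φ (.bit true :: a)
      (4 * (5000 * (a.length + 2) ^ 2 + 1) ^ 2)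
      (runOut (fun m => candStr m (φ (.bit true :: codeStr m))) (a.length - 2)) := by
  obtain ⟨σ', h, ho⟩ := ex_runner (M := M) (φ := φ) (realBody [.bit true])
    (fun m => candStr m (φ (.bit true :: codeStr m))) (2000 * (a.length + 2)) a.length
    (fun m hm c hc => candStr_bound hc hm)
    (fun τ s m h1 h2 h3 h4 h5 h6 => by
      have := ex_realBody (φ := φ) [.bit true] a.length τ s m h1 h2 h3 h4 h5 h6
      simpa using this)
    { PS.start M (.bit true :: a) with inp := a.tail.tail } (PS.clean_start _ _)
    ⟨rfl, rfl, rfl, rfl⟩ rfl rfl (by simp; omega)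
  refine Ex.haltsWithin (Ex.ite_false (Ex.ite_true
    ((ex_dropInp (PS.start M (.bit true :: a))).seq
    ((ex_dropInp { PS.start M (.bit true :: a) with inp := a }).seq
    ((ex_dropInp { PS.start M (.bit true :: a) with inp := a.tail }).seq h))))) (ho.trans ?_) ?_
  · simp [PS.start, runOut, Nat.sub_sub]
  · have : 1 + (1 + (1 + ((a.length + 1) * (2000 * (a.length + 2) + 3) + 200 * (a.length + 1) + 3)
        + 1) + 1) + 1 + 1 + 1 ≤ 5000 * (a.length + 2) ^ 2 := by nlinarith
    gcongr

theorem prodProg_halts_fst (M : OracleMachine) (φ : Baire) (a w : Str) (n : ℕ)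
    (h : M.HaltsWithin (fun b => φ (.bit false :: b)) a n w) :
    (Compile.machine (prodProg M) (Regs.init M)).HaltsWithin φ (.bit false :: a)
      (4 * (100 * (a.length + n + 3) ^ 2 + 1) ^ 2) w := by
  obtain ⟨s, hs, h1, h2⟩ := h
  obtain ⟨a', k, hlen⟩ := ex_simProg (φ := φ) (answers_fstCall φ (PS.start M [])
    rfl (a.length + s + 1) 0) rfl rfl rfl a s le_rfl h1 (Regs.init M).sim []
  have hg : GoodFrom M (fun b => φ (.bit false :: b)) (fun _ => True) (M.init a) :=
    fun _ _ _ => trivial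
  simp only [if_pos hg, h2] at k hlen
  have hw := hlen hg
  have k2 := ex_loadQuery (φ := φ) (PS.start M a) rfl rfl
  refine Ex.haltsWithin (Ex.ite_true ((ex_dropInp (PS.start M (.bit false :: a))).seq
    (k2.seq (k.seq (ex_writeOut _ w rfl))))) rfl ?_
  have e : (PS.start M a).inp.length = a.length := rfl
  rw [e]
  have : 1 + (4 * a.length + 3 + ((s + 3) * (40 * (a.length + s + 1) +
      (2 * (a.length + s + 1) + 10) + 2 * 0 + 20) + (2 * w.length + 1) + 1) + 1) + 1 + 1 ≤
      100 * (a.length + n + 3) ^ 2 := by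
    have h1 : a.length + s + 1 ≤ a.length + n + 1 := by omega
    have h2 : w.length ≤ a.length + n + 1 := by omega
    have h3 : (s + 3) * (40 * (a.length + s + 1) + (2 * (a.length + s + 1) + 10) + 2 * 0 + 20) ≤
      (n + 3) * (40 * (a.length + n + 1) + (2 * (a.length + n + 1) + 10) + 2 * 0 + 20) := by
      gcongr
    refine le_trans (b := 1 + (4 * a.length + 3 + ((n + 3) * (40 * (a.length + n + 1) +
      (2 * (a.length + n + 1) + 10) + 2 * 0 + 20) + (2 * (a.length + n + 1) + 1) + 1) + 1) + 1 + 1)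
      (by omega) ?_
    nlinarith
  gcongr

theorem prodProg_halts_other (M : OracleMachine) (φ : Baire) (a : Str)
    (h : ∀ b w, a ≠ .bit b :: w) :
    (Compile.machine (prodProg M) (Regs.init M)).HaltsWithin φ a 64 [] := by
  refine Ex.haltsWithin (T := 3) (σ := PS.start M a)
    (Ex.ite_false (Ex.ite_false (ex_skip _) ?_) ?_) rfl (by norm_num)
  all_goals
    cases a with
    | nil => rfl
    | cons x a =>
      cases x with
      | sep => rfl
      | bit b => exact absurd rfl (h b a)

/-! ### Oracle calls with a dyadic number as the second component -/

/-- The string function `χ` agrees, as far as the `k` digits `c` behind the binary point tell, with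
the name of a number close to `0.c` that consists of the intervals around its truncations. -/
structure NameFrom (c : List Bool) (χ : Baire) : Prop where
  code : ∀ j, j + 4 ≤ c.length → χ (codeStr j) = encStr (unitStr (c.take (j + 4))) (j + 4) 8
  other : ∀ b, (∀ j, b ≠ codeStr j) → χ b = []

/-- The queries that can be answered with the digits `c`. -/
def GoodQuery (c : List Bool) (w : Str) : Prop :=
  ∀ j, w = .bit true :: codeStr j → j + 4 ≤ c.length

/-- Whether a symbol is the bit `b`. -/
def isBit (b : Bool) : Option Sym → Bool
  | some (some (.bit c)) => c == b
  | _ => false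

/-- Whether a string is the code of a power of two. -/
def isCode (w : Str) : Bool :=
  isBit false (w.head?.map some) && isBit true (w.tail.head?.map some) &&
    w.tail.tail.all fun x => isBit false (some (some x))

theorem isBit_iff {b : Bool} {x : Option Letter} :
    isBit b (x.map some) = true ↔ x = some (.bit b) := by
  rcases x with _ | ⟨c⟩ | _ <;> simp [isBit]

theorem isCode_iff (w : Str) : isCode w = true ↔ w = codeStr (w.length - 2) := by
  simp only [isCode, Bool.and_eq_true, isBit_iff, List.all_eq_true]
  constructor
  · rintro ⟨⟨h1, h2⟩, h3⟩
    obtain ⟨x, w, rfl⟩ : ∃ x v, w = x :: v := by cases w <;> simp at h1 ⊢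
    obtain ⟨y, w, rfl⟩ : ∃ x v, w = x :: v := by cases w <;> simp at h2 ⊢
    simp only [List.head?_cons, Option.some.injEq, List.tail_cons] at h1 h2 h3
    subst h1 h2
    rw [codeStr]
    refine congrArg _ (congrArg _ (List.eq_replicate_iff.2 ⟨by simp, fun x hx => ?_⟩))
    have := h3 x hx
    rw [← Option.map_some, isBit_iff] at this
    simpa using this
  · intro h
    rw [h]
    refine ⟨⟨rfl, rfl⟩, fun x hx => ?_⟩
    simp only [codeStr, List.tail_cons, List.mem_replicate] at hx
    rw [hx.2]
    rfl

theorem codeStr_length (j : ℕ) : (codeStr j).length = j + 2 := by simp [codeStr]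

/-- Tests whether all letters on `vq` are zeros, and counts them on `t1`. -/
def checkLoop : Prog M :=
  .loop (has .vq) <| .op fun v t =>
    { v := { v with f1 := v.f1 && isBit false (t.st (.nm .vq)) }
      st := fun
        | .nm .vq => .pop
        | .nm .t1 => .push none
        | _ => .keep }

/-- Tells in the flag `f1` whether `vq` holds the code of a power of two, whose exponent goes to
`t1`. -/
def checkCode : Prog M :=
  .seq (.op fun v t =>
    { v := { v with f1 := isBit false (t.st (.nm .vq)) }
      st := fun
        | .nm .vq => .pop
        | _ => .keep })
  (.seq (.op fun v t =>
    { v := { v with f1 := v.f1 && isBit true (t.st (.nm .vq)) }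
      st := fun
        | .nm .vq => .pop
        | _ => .keep })
  checkLoop)

theorem ex_checkCode (σ : PS M) (w : Str) (hq : σ.vq = w.map some) (h1 : σ.t1 = []) :
    Ex φ checkCode σ (2 * w.length + 5)
      { σ with v := { σ.v with f1 := isCode w }, vq := [], t1 := un (w.length - 2) } := by
  have key : Ex φ checkLoop _ _ _ := Ex.loop_foldl
    (fun (l : Str) b => { σ with
      v := { σ.v with f1 := b.1 }, vq := l.map some, t1 := un b.2 })
    (fun (b : Bool × ℕ) x => (b.1 && isBit false (some (some x)), b.2 + 1)) 1
    (fun x l r => Ex.op) (by intros; rfl) (by intros; rfl) w.tail.tail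
    (isBit false (w.head?.map some) && isBit true (w.tail.head?.map some), 0)
  have hf : ∀ (l : Str) (b : Bool × ℕ),
      l.foldl (fun (b : Bool × ℕ) x => (b.1 && isBit false (some (some x)), b.2 + 1)) b =
      (b.1 && l.all fun x => isBit false (some (some x)), b.2 + l.length) := by
    intro l
    induction l with
    | nil => intro b; simp
    | cons x l ih => intro b; simp [ih, Bool.and_assoc]; omega
  rw [hf] at key
  have e : σ = { σ with vq := w.map some, t1 := [] } := by cases σ; simp_all
  rw [e]
  refine (Ex.seq (T₁ := 1) (σ₁ := { σ with
      v := { σ.v with f1 := isBit false (w.head?.map some) }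
      vq := w.tail.map some, t1 := [] }) ?_ (Ex.seq (T₁ := 1) (σ₁ := { σ with
      v := { σ.v with
        f1 := isBit false (w.head?.map some) && isBit true (w.tail.head?.map some) }
      vq := w.tail.tail.map some, t1 := [] }) ?_ key)).congr ?_ ?_
  · cases w <;> exact Ex.op
  · cases w.tail <;> exact Ex.op
  · simp [isCode, Nat.sub_sub]
  · simp; omega

/-- Copies digits from `dt` to `t2`, as long as there is something on `t1`, and counts them on
`pk`. -/
def takeDigits : Prog M :=
  .loop (fun _ t => (t.st (.nm .t1)).isSome && (t.st (.nm .dt)).isSome) <| .op fun v t =>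
    { v := v
      st := fun
        | .nm .t1 => .pop
        | .nm .dt => .pop
        | .nm .t2 => .push ((t.st (.nm .dt)).getD none)
        | .nm .pk => .push none
        | _ => .keep }

theorem ex_takeDigits (σ : PS M) (k p : ℕ) (l r : List Sym) :
    Ex φ takeDigits { σ with t1 := un k, dt := l, t2 := r, pk := un p } (2 * k + 1)
      { σ with
        t1 := un (k - l.length), dt := l.drop k, t2 := (l.take k).reverse ++ r
        pk := un (p + min k l.length) } := by
  induction k generalizing l r p with
  | zero => exact (Ex.loop_end (by rfl)).congr (by simp) (by omega)
  | succ k ih =>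
    cases l with
    | nil => exact (Ex.loop_end (by rfl)).congr (by simp) (by omega)
    | cons x l =>
      refine (Ex.loop_step (T₁ := 1) Ex.op (ih (p + 1) l (x :: r))).congr ?_ (by omega)
      simp
      rw [show p + 1 + min k l.length = p + (min k l.length + 1) by omega]

/-- Raises `t1` by four. -/
def push4 : Prog M :=
  .seq (push .t1 none) (.seq (push .t1 none) (.seq (push .t1 none) (push .t1 none)))

/-- Answers a query to the second component, if there are enough digits on `dt`. The exponent is on
`t1`. -/
def answerDigits : Prog M :=
  .seq push4 <| .seq takeDigits <|
  .ite (has .t1)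
    (.seq (clr .t1) (.seq (clr .pk) (.seq (mv .t2 .dt) (.op fun v _ =>
      { v := { v with f1 := false, sim := { v.sim with abort := true } } }))))
    (.seq (mv2 .t2 .pa .dt)
    (.seq (push .pa (some .sep))
    (.seq (push .pa (some (.bit false)))
    (.seq (writer .t1 fun _ => 8) (.seq (mv .t1 .va) (.op fun v _ =>
      { v := { v with f1 := false, sim := { v.sim with real := false } } }))))))

/-- The digits on a stack. -/
def bits (c : List Bool) : List Sym := (c.map Letter.bit).map some

/-- The state in which an oracle call begins, apart from the query. -/
def PS.digits (σ : PS M) (c : List Bool) : PS M :=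
  { σ with t1 := [], t2 := [], dt := bits c, pa := [], pk := [], pb := [], va := [] }

theorem ex_push4 (σ : PS M) (j : ℕ) :
    Ex φ push4 { σ with t1 := un j } 7 { σ with t1 := un (j + 4) } :=
  Ex.seq (T₁ := 1) (σ₁ := { σ with t1 := un (j + 1) }) Ex.op
    (Ex.seq (T₁ := 1) (σ₁ := { σ with t1 := un (j + 2) }) Ex.op
      (Ex.seq (T₁ := 1) (T₂ := 1) (σ₁ := { σ with t1 := un (j + 3) }) Ex.op Ex.op))

theorem length_bits (c : List Bool) : (bits c).length = c.length := by simp [bits]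

theorem ex_answerDigits_good (σ : PS M) (c : List Bool) (j : ℕ) (h : j + 4 ≤ c.length) :
    Ex φ answerDigits { σ.digits c with t1 := un j } (200 * (j + 5)) { σ.digits c with
      v := { σ.v with f1 := false, sim := { σ.v.sim with real := false } }
      va := (encStr (unitStr (c.take (j + 4))) (j + 4) 8).map some } := by
  have k1 := ex_takeDigits (φ := φ) (σ.digits c) (j + 4) 0 (bits c) []
  rw [length_bits, show j + 4 - c.length = 0 by omega, List.append_nil, Nat.zero_add,
    min_eq_left h] at k1
  have k2 : Ex φ (mv2 .t2 .pa .dt) _ (2 * (j + 4) + 1) { σ.digits c with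
      pa := bits (c.take (j + 4)), pk := un (j + 4) } :=
    (ex_mv2 φ .t2 .pa .dt { σ.digits c with
      t1 := un 0, dt := (bits c).drop (j + 4), t2 := ((bits c).take (j + 4)).reverse
      pk := un (j + 4) }).congr (by
      apply PS.ext
      all_goals first | rfl | simp [PS.put, PS.get, PS.digits, bits, List.map_take])
    (by simp [PS.get, length_bits])
  have k3 := ex_writer (φ := φ) .t1 (fun _ : Regs M => 8)
    { σ.digits c with pa := (unitStr (c.take (j + 4))).map some, pk := un (j + 4) }
    (unitStr (c.take (j + 4))) (j + 4) (by omega) rfl rfl rfl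
  set w := encStr (unitStr (c.take (j + 4))) (j + 4) 8 with hw
  have hwl : w.length = 3 * (j + 6) + 6 := by
    simp [hw, encStr, length_zipStr, unitStr]; omega
  have hul : (unitStr (c.take (j + 4))).length = j + 6 := by simp [unitStr]; omega
  rw [hul] at k3
  have k4 : Ex φ (mv .t1 .va) { σ.digits c with t1 := (w.map some).reverse ++ [] }
      (2 * (3 * (j + 6) + 6) + 1) { σ.digits c with va := w.map some } :=
    (ex_mv φ .t1 .va _).congr (by
      apply PS.ext
      all_goals first | rfl | simp [PS.put, PS.get, PS.digits])
    (by simp [PS.get, hwl])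
  refine ((ex_push4 (σ.digits c) j).seq (k1.seq (Ex.ite_false (k2.seq (Ex.seq (T₁ := 1)
    (σ₁ := { σ.digits c with
      pa := (.sep :: (c.take (j + 4)).map Letter.bit).map some, pk := un (j + 4) }) Ex.op
      (Ex.seq (T₁ := 1) Ex.op (k3.seq (k4.seq (T₂ := 1) Ex.op)))))))).mono ?_
  omega

theorem ex_answerDigits_bad (σ : PS M) (c : List Bool) (j : ℕ) (h : c.length < j + 4) :
    Ex φ answerDigits { σ.digits c with t1 := un j } (200 * (j + 5)) { σ.digits c with
      v := { σ.v with f1 := false, sim := { σ.v.sim with abort := true } } } := by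
  have k1 := ex_takeDigits (φ := φ) (σ.digits c) (j + 4) 0 (bits c) []
  rw [length_bits, List.append_nil, Nat.zero_add, min_eq_right h.le,
    List.drop_of_length_le (by rw [length_bits]; omega),
    List.take_of_length_le (by rw [length_bits]; omega)] at k1
  have k2 : Ex φ (mv .t2 .dt) { σ.digits c with dt := [], t2 := (bits c).reverse }
      (2 * c.length + 1) (σ.digits c) := (ex_mv φ .t2 .dt _).congr (by
      apply PS.ext
      all_goals first | rfl | simp [PS.put, PS.get, PS.digits])
    (by simp [PS.get, length_bits])
  have hp : (un (j + 4 - c.length)).head?.isSome = true := by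
    obtain ⟨d, hd⟩ : ∃ d, j + 4 - c.length = d + 1 := ⟨j + 3 - c.length, by omega⟩
    rw [hd]
    rfl
  refine ((ex_push4 (σ.digits c) j).seq (k1.seq (Ex.ite_true ((ex_clr _ .t1 _).seq
    ((ex_clr _ .pk _).seq (k2.seq (T₂ := 1) Ex.op))) hp))).mono ?_
  simp only [PS.get, PS.put, length_un]
  omega

/-- Gives the empty answer. -/
def answerNil : Prog M :=
  .op fun v _ => { v := { v with f1 := false, sim := { v.sim with real := false } } }

/-- Answers the queries of the simulated machine with the oracle and with the number whose digits are
on `dt`. -/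
def digitCall : Prog M :=
  .seq (clr .va) <|
  .ite (fun _ t => isBit false (t.st (.nm .vq)))
    (.seq (pop .vq) realCall)
  (.ite (fun _ t => isBit true (t.st (.nm .vq)))
    (.seq (pop .vq)
    (.seq checkCode (.ite (fun v _ => v.f1) answerDigits (.seq (clr .t1) answerNil))))
    (.seq (clr .vq) answerNil))

theorem answers_digitCall (φ : Baire) (κ : PS M) (c : List Bool) (χ : Baire)
    (hχ : NameFrom c χ) (hcl : κ.Clean) (hdt : κ.dt = bits c) (hq : κ.qry = [])
    (hf : κ.v.f1 = false) (W V : ℕ) (hV : 3 * c.length + 12 ≤ V) :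
    Answers φ digitCall κ (bairePair φ χ) (GoodQuery c) W V (300 * (W + V + 5)) := by
  intro σ w h1 h2 h3 h4 h5
  have hσ : σ = { σ.digits c with
      v := { σ.v with f1 := false }, vq := w.map some, va := σ.va, qry := [] } := by
    have e1 : σ.t1 = [] := (congrArg PS.t1 h1).trans hcl.t1
    have e2 : σ.t2 = [] := (congrArg PS.t2 h1).trans hcl.t2
    have e3 : σ.pa = [] := (congrArg PS.pa h1).trans hcl.pa
    have e4 : σ.pk = [] := (congrArg PS.pk h1).trans hcl.pk
    have e5 : σ.pb = [] := (congrArg PS.pb h1).trans hcl.pb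
    have e6 : σ.dt = bits c := (congrArg PS.dt h1).trans hdt
    have e7 : σ.qry = [] := (congrArg PS.qry h1).trans hq
    have e8 : σ.v.f1 = false := (congrArg (fun κ => κ.v.f1) h1).trans hf
    rw [PS.digits, ← e1, ← e8, ← h2]
    apply PS.ext
    all_goals first | rfl | assumption | exact e1 ▸ e2 | exact e1 ▸ e3 | exact e1 ▸ e4
                    | exact e1 ▸ e5
  have fin : ∀ (r a : Bool) (va ans : _) (T : ℕ), Ex φ digitCall { σ.digits c with
      v := { σ.v with f1 := false }, vq := w.map some, va := σ.va, qry := [] } T { σ.digits c with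
      v := { σ.v with f1 := false, sim := { σ.v.sim with real := r, abort := a } }
      vq := [], va := va, qry := [], ans := ans } → T ≤ 300 * (W + V + 5) → va.length ≤ V →
      (GoodQuery c w → a = false ∧ (bif r then ans.map some else va) =
        (bairePair φ χ w).map some) → (¬ GoodQuery c w → a = true) →
      ∃ σ', Ex φ digitCall σ (300 * (W + V + 5)) σ' ∧ σ'.core = κ ∧ σ'.vq = [] ∧
      σ'.va.length ≤ V ∧ σ'.tc = σ.tc ∧ σ'.tp = σ.tp ∧ σ'.tn = σ.tn ∧
      σ'.v.sim.q = σ.v.sim.q ∧ σ'.v.sim.hd = σ.v.sim.hd ∧ σ'.v.sim.neg = σ.v.sim.neg ∧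
      (GoodQuery c w → σ'.v.sim.abort = false ∧
        σ'.tl .answer = (bairePair φ χ w).map some) ∧
      (¬ GoodQuery c w → σ'.v.sim.abort = true) := by
    intro r a va ans T h hT hva hg hb
    rw [← hσ] at h
    exact ⟨_, h.mono hT, (congrArg PS.core hσ).symm.trans h1, rfl, hva, rfl, rfl, rfl, rfl, rfl,
      rfl, hg, hb⟩
  let S (q : List Sym) : PS M :=
    { σ.digits c with v := { σ.v with f1 := false }, vq := q, va := [], qry := [] }
  have k0 := ex_clr φ .va { σ.digits c with
      v := { σ.v with f1 := false }, vq := w.map some, va := σ.va, qry := [] }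
  have hnil : ∀ {u : Str}, (∀ v, u ≠ .bit true :: v) → GoodQuery c u :=
    fun h j hj => absurd hj (h _)
  have k9 := ex_clr φ .vq (S (w.map some))
  simp only [S, PS.get, List.length_map] at k0 k9
  rcases w with _ | ⟨(_ | _) | _, w⟩
  · have hg : GoodQuery c [] := hnil (by simp)
    exact fin false false [] σ.ans _ (k0.seq (Ex.ite_false (Ex.ite_false (k9.seq (T₂ := 1)
      (Ex.op (hv := by rw [← h5]; rfl)))))) (by simp; omega) (by simp) (fun _ => ⟨rfl, rfl⟩)
      (fun h => absurd hg h)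
  · have hg : GoodQuery c (.bit false :: w) := hnil (by simp)
    have k1 := ex_realCall (φ := φ) (S (w.map some)) w rfl
    refine fin true false [] (φ w) _ (k0.seq (Ex.ite_true (Ex.seq (T₁ := 1) Ex.op
      (k1.congr ?_ le_rfl)))) ?_ (by simp) (fun _ => ⟨rfl, rfl⟩) (fun h => absurd hg h)
    · simp only [S]; rw [← h5]; rfl
    · simp only [List.length_cons] at h3 ⊢; omega
  · have k1 := ex_checkCode (φ := φ) (S (w.map some)) w rfl rfl
    by_cases hw : isCode w = true
    · have hwj := (isCode_iff w).1 hw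
      set j := w.length - 2 with hj
      have hlw : w.length = j + 2 := by rw [hwj, codeStr_length]
      rw [hw] at k1
      by_cases hjc : j + 4 ≤ c.length
      · have k2 := ex_answerDigits_good (φ := φ) { σ with
          v := { σ.v with f1 := true }, vq := [], qry := [] } c j hjc
        have hg : GoodQuery c (.bit true :: w) := by
          intro i hi
          have := congrArg List.length hi
          simp only [List.length_cons, codeStr_length] at this
          omega
        refine fin false false ((encStr (unitStr (c.take (j + 4))) (j + 4) 8).map some) σ.ans _
          (k0.seq (Ex.ite_false (Ex.ite_true (Ex.seq (T₁ := 1) Ex.op (k1.seq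
            (Ex.ite_true (k2.congr ?_ le_rfl))))))) ?_ ?_ (fun _ => ⟨rfl, ?_⟩) (fun h => absurd hg h)
        · rw [← h5]; rfl
        · simp only [List.length_cons] at h3 ⊢; omega
        · simp [encStr, length_zipStr, unitStr]; omega
        · change _ = (χ w).map some
          rw [hwj, hχ.code j hjc]
          rfl
      · have k2 := ex_answerDigits_bad (φ := φ) { σ with
          v := { σ.v with f1 := true }, vq := [], qry := [] } c j (by omega)
        have hg : ¬ GoodQuery c (.bit true :: w) := fun h => hjc (h j (by rw [← hwj]))
        refine fin σ.v.sim.real true [] σ.ans _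
          (k0.seq (Ex.ite_false (Ex.ite_true (Ex.seq (T₁ := 1) Ex.op (k1.seq
            (Ex.ite_true k2)))))) ?_ (by simp) (fun h => absurd h hg) (fun _ => rfl)
        simp only [List.length_cons] at h3 ⊢; omega
    · have hg : GoodQuery c (.bit true :: w) := by
        intro i hi
        refine absurd ((isCode_iff w).2 ?_) hw
        rw [List.cons.injEq] at hi
        rw [hi.2, codeStr_length]
        rfl
      have hχw : χ w = [] := hχ.other w fun i hi => hw ((isCode_iff w).2 (by
        rw [hi, codeStr_length]; rfl))
      rw [Bool.not_eq_true] at hw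
      rw [hw] at k1
      have k2 := ex_clr φ .t1 { S [] with t1 := un (w.length - 2) }
      refine fin false false [] σ.ans _ (k0.seq (Ex.ite_false (Ex.ite_true (Ex.seq (T₁ := 1)
        Ex.op (k1.seq (Ex.ite_false (k2.seq (T₂ := 1) (Ex.op (hv := by rw [← h5]; rfl))))))))) ?_
        (by simp) (fun _ => ⟨rfl, ?_⟩) (fun h => absurd hg h)
      · simp only [List.length_cons, PS.get, length_un] at h3 ⊢; omega
      · change _ = (χ w).map some
        rw [hχw]
        rfl
  · have hg : GoodQuery c (.sep :: w) := hnil (by simp)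
    exact fin false false [] σ.ans _ (k0.seq (Ex.ite_false (Ex.ite_false (k9.seq (T₂ := 1)
      (Ex.op (hv := by rw [← h5]; rfl)))))) (by simp only [List.length_cons] at h3 ⊢; omega) (by simp)
      (fun _ => ⟨rfl, rfl⟩) (fun h => absurd hg h)

/-! ### The digits of the end points of an interval -/

/-- Whether a letter is a bit. -/
def Letter.isBit : Letter → Bool
  | .bit _ => true
  | .sep => false

/-- Whether a string begins with the separator. -/
def beginsSep (w : Str) : Bool := isSep (w.head?.map some)

/-- The part of the code of a dyadic number from the binary point on. -/
def fracPart (w : Str) : Str := (dropSign w).dropWhile Letter.isBit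

/-- The number of digits before the binary point, cut off at `2`. -/
def intDigits (w : Str) : Fin 3 :=
  ((dropSign w).takeWhile Letter.isBit).foldl (fun n _ => if n = 0 then 1 else 2) 0

/-- Adds and subtracts two numbers digit by digit: the carry, the borrow, and the digits of the sum
and of the difference. If `sg` is set, the first number is subtracted from the second one. -/
def arith (sg : Bool) (l : List (Bool × Bool)) : (Bool × Bool) × List Bool × List Bool :=
  l.foldr (fun p r =>
    let a := bif sg then p.2 else p.1
    let b := bif sg then p.1 else p.2
    (((p.1 && p.2) || (r.1.1 && (p.1 ^^ p.2)), (!a && b) || (r.1.2 && !(a ^^ b))),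
      (p.1 ^^ p.2 ^^ r.1.1) :: r.2.1, (a ^^ b ^^ r.1.2) :: r.2.2)) ((false, false), [], [])

/-- A digit of the lower end point, cut off to the unit interval, from the sign and the number of
digits before the point of the midpoint, the borrow, and a digit of the difference. -/
def selLow (sg : Bool) (ic : Fin 3) (bw d : Bool) : Bool :=
  if sg then false else if ic = 0 then (!bw && d) else if ic = 1 then (!bw || d) else true

/-- A digit of the upper end point, cut off to the unit interval. -/
def selHigh (sg : Bool) (ic : Fin 3) (cy bw s d : Bool) : Bool :=
  if sg then (decide (ic = 0) && !bw && d) else if ic = 0 then (cy || s) else true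

/-- The digits of the end points of an interval, cut off to the unit interval. -/
def endDigits (L : ℕ) (X Y : Str) : List Bool × List Bool :=
  let r := arith (isNeg X) ((takeBits L (fracPart X).tail).zip (takeBits L (dropSign Y).tail))
  (r.2.2.map (selLow (isNeg X) (intDigits X) r.1.2),
    (r.2.1.zip r.2.2).map fun p => selHigh (isNeg X) (intDigits X) r.1.1 r.1.2 p.1 p.2)

/-- The number of leading zeros. -/
def zeros (l : List Bool) : ℕ := (l.takeWhile (!·)).length

/-- The number of zeros behind the binary point of the radius. -/
def endLevel (L : ℕ) (X Y : Str) : ℕ :=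
  if beginsSep (dropSign Y) && beginsSep (fracPart X) then zeros (takeBits L (dropSign Y).tail) else 0

/-- Moves the digits of the radius to `db`, and counts the leading zeros on `lv`. -/
def radLoop : Prog M :=
  .loop (has .c1) <| .op fun v t =>
    { v := { v with go := v.go && !symBit (t.st (.nm .y)) }
      st := fun
        | .nm .c1 => .pop
        | .nm .y => .pop
        | .nm .db => .push (some (.bit (symBit (t.st (.nm .y)))))
        | .nm .lv => if v.go && !symBit (t.st (.nm .y)) then .push none else .keep
        | _ => .keep }

/-- Reads the radius. -/
def readRad : Prog M :=
  .seq (.op fun v t => { v := v, st := fun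
          | .nm .y => popBit (t.st (.nm .y))
          | _ => .keep }) <|
  .seq (.op fun v t => { v := { v with ok := isSep (t.st (.nm .y)), go := true }, st := fun
          | .nm .y => .pop
          | _ => .keep })
  radLoop

theorem symBit_head (w : Str) : symBit ((w.map some).head?) = headBit w := by
  rcases w with _ | ⟨_ | _, w⟩ <;> rfl

theorem zeros_cons (b : Bool) (l : List Bool) : zeros (b :: l) = if b then 0 else zeros l + 1 := by
  cases b <;> simp [zeros]

theorem ex_readRad (σ : PS M) (Y : Str) (L : ℕ) :
    ∃ g y, y.length ≤ Y.length ∧ Ex φ readRad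
      { σ with y := Y.map some, c1 := un L, db := [], lv := [] } (2 * L + 5)
      { σ with
        v := { σ.v with ok := beginsSep (dropSign Y), go := g }
        y := y, c1 := []
        db := bits (takeBits L (dropSign Y).tail).reverse
        lv := un (zeros (takeBits L (dropSign Y).tail)) } := by
  have key : ∀ (L : ℕ) (w : Str) (l : List Bool) (g : Bool) (n : ℕ) (τ : PS M), ∃ g' y,
      y.length ≤ w.length ∧
      Ex φ radLoop { τ with
          v := { τ.v with go := g }, y := w.map some, c1 := un L, db := bits l, lv := un n }
        (2 * L + 1) { τ with
          v := { τ.v with go := g' }, y := y, c1 := [], db := bits ((takeBits L w).reverse ++ l)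
          lv := un (n + if g then zeros (takeBits L w) else 0) } := by
    intro L
    induction L with
    | zero =>
      intro w l g n τ
      refine ⟨g, w.map some, by simp, Ex.congr Ex.loop_end ?_ (by omega)⟩
      simp [takeBits, zeros, bits]
    | succ L ih =>
      intro w l g n τ
      obtain ⟨g', y, hy, h⟩ := ih w.tail (headBit w :: l) (g && !headBit w)
        (n + if g && !headBit w then 1 else 0) τ
      refine ⟨g', y, hy.trans (by simp),
        (Ex.loop_step (T₁ := 1) (Ex.op (hv := ?_) (hnm := ?_)) h).congr ?_
        (by omega)⟩
      · rw [← symBit_head]; rfl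
      · intro i
        cases i
        case db => rw [← symBit_head]; rfl
        case lv =>
          rw [← symBit_head]
          change StackAct.run (if g && !symBit ((w.map some).head?) then _ else _) _ = _
          by_cases hc : (g && !symBit ((w.map some).head?)) = true
          · rw [if_pos hc]; simp only [PS.get, if_pos hc]; rfl
          · rw [if_neg hc]; simp only [PS.get, if_neg hc]; rfl
        case y => cases w <;> rfl
        all_goals rfl
      · have e : (n + if g && !headBit w then 1 else 0) +
            (if g && !headBit w then zeros (takeBits L w.tail) else 0) =
            n + if g then zeros (takeBits (L + 1) w) else 0 := by
          rw [takeBits, zeros_cons]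
          cases g <;> cases headBit w <;> simp
          omega
        rw [e, takeBits, List.reverse_cons, List.append_assoc]
        rfl
  obtain ⟨g, y, hy, h⟩ := key L (dropSign Y).tail [] true 0
    { σ with v := { σ.v with ok := beginsSep (dropSign Y) } }
  refine ⟨g, y, hy.trans ?_, (Ex.seq (T₁ := 1) (σ₁ := { σ with
    y := (dropSign Y).map some, c1 := un L, db := [], lv := [] }) ?_
    (Ex.seq (T₁ := 1) ?_ h)).congr ?_ (by omega)⟩
  · rcases Y with _ | ⟨_ | _, Y⟩ <;> simp [dropSign]; omega
  · rcases Y with _ | ⟨_ | _, Y⟩ <;> exact Ex.op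
  · cases h : dropSign Y <;> exact Ex.op
  · simp

/-- Removes the integer part of the midpoint, and counts its digits. -/
def intLoop : Prog M :=
  .loop (fun _ t => match t.st (.nm .x) with
      | some (some (.bit _)) => true
      | _ => false) <| .op fun v _ =>
    { v := { v with ic := if v.ic = 0 then 1 else 2 }
      st := fun
        | .nm .x => .pop
        | _ => .keep }

/-- Moves the fractional digits of the midpoint to `da`. -/
def midLoop : Prog M :=
  .loop (has .c2) <| .op fun v t =>
    { v := v
      st := fun
        | .nm .c2 => .pop
        | .nm .x => .pop
        | .nm .da => .push (some (.bit (symBit (t.st (.nm .x)))))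
        | _ => .keep }

/-- Reads the midpoint. -/
def readMid : Prog M :=
  .seq (.op fun v t => { v := { v with sg := symBit (t.st (.nm .x)), ic := 0 }, st := fun
          | .nm .x => popBit (t.st (.nm .x))
          | _ => .keep }) <|
  .seq intLoop <|
  .seq (.op fun v t => { v := { v with ok := v.ok && isSep (t.st (.nm .x)) }, st := fun
          | .nm .x => .pop
          | _ => .keep })
  midLoop

theorem ex_readMid (σ : PS M) (X : Str) (L : ℕ) :
    ∃ x, x.length ≤ X.length ∧ Ex φ readMid
      { σ with x := X.map some, c2 := un L, da := [] } (2 * X.length + 2 * L + 10)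
      { σ with
        v := { σ.v with
          ok := σ.v.ok && beginsSep (fracPart X), sg := isNeg X, ic := intDigits X }
        x := x, c2 := []
        da := bits (takeBits L (fracPart X).tail).reverse } := by
  have k1 : ∀ (w : Str) (n : Fin 3) (τ : PS M), Ex φ intLoop
      { τ with v := { τ.v with ic := n }, x := w.map some } (2 * w.length + 1)
      { τ with
        v := { τ.v with
          ic := (w.takeWhile Letter.isBit).foldl (fun n _ => if n = 0 then 1 else 2) n }
        x := (w.dropWhile Letter.isBit).map some } := by
    intro w
    induction w with
    | nil => intro n τ; exact Ex.loop_end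
    | cons a w ih =>
      intro n τ
      cases a with
      | bit b => exact (Ex.loop_step (T₁ := 1) Ex.op (ih _ τ)).mono (by simp; omega)
      | sep => exact Ex.mono Ex.loop_end (by simp)
  have k2 : ∀ (L : ℕ) (w : Str) (l : List Bool) (τ : PS M), ∃ x, x.length ≤ w.length ∧
      Ex φ midLoop { τ with x := w.map some, c2 := un L, da := bits l } (2 * L + 1)
        { τ with x := x, c2 := [], da := bits ((takeBits L w).reverse ++ l) } := by
    intro L
    induction L with
    | zero => intro w l τ; exact ⟨w.map some, by simp, Ex.loop_end⟩
    | succ L ih =>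
      intro w l τ
      obtain ⟨x, hx, h⟩ := ih w.tail (headBit w :: l) τ
      refine ⟨x, hx.trans (by simp),
        (Ex.loop_step (T₁ := 1) (Ex.op (hnm := ?_)) h).congr ?_ (by omega)⟩
      · intro i
        cases i
        case da => rw [← symBit_head]; rfl
        case x => cases w <;> rfl
        all_goals rfl
      · simp [takeBits]
  have h1 := k1 (dropSign X) 0 { σ with
    v := { σ.v with sg := isNeg X }, c2 := un L, da := [] }
  obtain ⟨x, hx, h2⟩ := k2 L (fracPart X).tail [] { σ with
    v := { σ.v with
          ok := σ.v.ok && beginsSep (fracPart X), sg := isNeg X, ic := intDigits X } }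
  have hd : (dropSign X).length ≤ X.length := by
    rcases X with _ | ⟨_ | _, X⟩ <;> simp [dropSign]
  have hf : (fracPart X).tail.length ≤ X.length := by
    have := (List.dropWhile_suffix (l := dropSign X) Letter.isBit).length_le
    rw [← fracPart] at this
    rw [List.length_tail]
    omega
  refine ⟨x, hx.trans hf, (Ex.seq (T₁ := 1) ?_ (h1.seq (Ex.seq (T₁ := 1) ?_ h2))).congr ?_ ?_⟩
  · rcases X with _ | ⟨_ | _, X⟩ <;> exact Ex.op
  · rw [← fracPart, ← intDigits]
    cases fracPart X <;> exact Ex.op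
  · simp
  · omega

/-- Adds and subtracts the digits on `da` and `db`. -/
def arithLoop : Prog M :=
  .loop (has .da) <| .op fun v t =>
    let p := symBit (t.st (.nm .da))
    let q := symBit (t.st (.nm .db))
    let a := bif v.sg then q else p
    let b := bif v.sg then p else q
    { v := { v with
        f1 := (p && q) || (v.f1 && (p ^^ q)), f2 := (!a && b) || (v.f2 && !(a ^^ b)) }
      st := fun
        | .nm .da => .pop
        | .nm .db => .pop
        | .nm .dt => .push (some (.bit (p ^^ q ^^ v.f1)))
        | .nm .du => .push (some (.bit (a ^^ b ^^ v.f2)))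
        | _ => .keep }

theorem ex_arithLoop (σ : PS M) (l : List (Bool × Bool)) :
    Ex φ arithLoop { σ with
      v := { σ.v with f1 := false, f2 := false }
      da := bits (l.reverse.map Prod.fst), db := bits (l.reverse.map Prod.snd), dt := [], du := [] }
      (2 * l.length + 1) { σ with
      v := { σ.v with f1 := (arith σ.v.sg l).1.1, f2 := (arith σ.v.sg l).1.2 }
      da := [], db := [], dt := bits (arith σ.v.sg l).2.1, du := bits (arith σ.v.sg l).2.2 } := by
  have key : Ex φ arithLoop _ _ _ := Ex.loop_foldl
    (fun (l : List (Bool × Bool)) (r : (Bool × Bool) × List Bool × List Bool) => { σ with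
      v := { σ.v with f1 := r.1.1, f2 := r.1.2 }
      da := bits (l.map Prod.fst), db := bits (l.map Prod.snd), dt := bits r.2.1
      du := bits r.2.2 })
    (fun r p =>
      let a := bif σ.v.sg then p.2 else p.1
      let b := bif σ.v.sg then p.1 else p.2
      (((p.1 && p.2) || (r.1.1 && (p.1 ^^ p.2)), (!a && b) || (r.1.2 && !(a ^^ b))),
        (p.1 ^^ p.2 ^^ r.1.1) :: r.2.1, (a ^^ b ^^ r.1.2) :: r.2.2)) 1
    (fun x l r => Ex.op) (by intros; rfl) (by intros; rfl) l.reverse ((false, false), [], [])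
  rw [List.foldl_reverse] at key
  exact key.mono (by rw [List.length_reverse]; omega)

/-- Selects the digits of the end points, in reverse order. -/
def selDigits : Prog M :=
  .loop (has .dt) <| .op fun v t =>
    { v := v
      st := fun
        | .nm .dt => .pop
        | .nm .du => .pop
        | .nm .t1 => .push (some (.bit (selLow v.sg v.ic v.f2 (symBit (t.st (.nm .du))))))
        | .nm .t2 => .push (some (.bit (selHigh v.sg v.ic v.f1 v.f2 (symBit (t.st (.nm .dt)))
            (symBit (t.st (.nm .du))))))
        | _ => .keep }

/-- Selects the digits of the end points. -/
def selLoop : Prog M :=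
  .seq selDigits
  (.seq (mv .t1 .da) (mv .t2 .db))

theorem ex_selLoop (σ : PS M) (l : List (Bool × Bool)) :
    Ex φ selLoop { σ with
      da := [], db := [], t1 := [], t2 := []
      dt := bits (l.map Prod.fst), du := bits (l.map Prod.snd) }
      (6 * l.length + 10) { σ with
      da := bits (l.map fun p => selLow σ.v.sg σ.v.ic σ.v.f2 p.2)
      db := bits (l.map fun p => selHigh σ.v.sg σ.v.ic σ.v.f1 σ.v.f2 p.1 p.2)
      t1 := [], t2 := [], dt := [], du := [] } := by
  have key : Ex φ selDigits _ _ _ := Ex.loop_foldl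
    (fun (l : List (Bool × Bool)) (r : List Bool × List Bool) => { σ with
      da := [], db := []
      dt := bits (l.map Prod.fst), du := bits (l.map Prod.snd), t1 := bits r.1, t2 := bits r.2 })
    (fun r p => (selLow σ.v.sg σ.v.ic σ.v.f2 p.2 :: r.1,
      selHigh σ.v.sg σ.v.ic σ.v.f1 σ.v.f2 p.1 p.2 :: r.2)) 1
    (fun x l r => Ex.op) (by intros; rfl) (by intros; rfl) l ([], [])
  have hf : ∀ (l : List (Bool × Bool)) (r : List Bool × List Bool),
      l.foldl (fun r p => (selLow σ.v.sg σ.v.ic σ.v.f2 p.2 :: r.1,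
        selHigh σ.v.sg σ.v.ic σ.v.f1 σ.v.f2 p.1 p.2 :: r.2)) r =
      ((l.map fun p => selLow σ.v.sg σ.v.ic σ.v.f2 p.2).reverse ++ r.1,
        (l.map fun p => selHigh σ.v.sg σ.v.ic σ.v.f1 σ.v.f2 p.1 p.2).reverse ++ r.2) := by
    intro l
    induction l with
    | nil => intro r; rfl
    | cons x l ih => intro r; simp [ih]
  rw [hf, List.append_nil, List.append_nil] at key
  refine (key.seq ((ex_mv _ .t1 .da _).seq
    (ex_mv _ .t2 .db _))).congr ?_ ?_
  · apply PS.ext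
    all_goals first | rfl | simp [PS.put, PS.get, bits]
  · simp [PS.put, PS.get, bits]
    omega

/-- Computes the digits of the end points of an interval, whose midpoint and radius are on `x` and
`y`. -/
def readEnds : Prog M :=
  .seq readRad <| .seq readMid <|
  .seq (clr .x) <| .seq (clr .y) <| .seq (clr .cp) <|
  .seq (.op fun v _ => { v := { v with f1 := false, f2 := false } }) <|
  .seq arithLoop <| .seq selLoop <|
  .seq (.ite (fun v _ => v.ok) skip (clr .lv)) <|
  .op fun v _ => { v := { v with
    ok := false, go := false, sg := false, f1 := false, f2 := false, ic := 0 } }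

theorem length_takeBits' (L : ℕ) (w : Str) : (takeBits L w).length = L := by
  induction L generalizing w with
  | zero => rfl
  | succ L ih => simp [takeBits, ih]

theorem length_arith (sg : Bool) (l : List (Bool × Bool)) :
    (arith sg l).2.1.length = l.length ∧ (arith sg l).2.2.length = l.length := by
  induction l with
  | nil => exact ⟨rfl, rfl⟩
  | cons p l ih => exact ⟨congrArg (· + 1) ih.1, congrArg (· + 1) ih.2⟩

theorem ex_readEnds (σ : PS M) (X Y : Str) (L : ℕ) (hX : X.length ≤ 3 * L) (hY : Y.length ≤ 3 * L) :
    Ex φ readEnds { σ with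
      v := { σ.v with ok := false, go := false, sg := false, f1 := false, f2 := false, ic := 0 }
      x := X.map some, y := Y.map some, cp := un L, c1 := un L, c2 := un L
      da := [], db := [], lv := [], dt := [], du := [], t1 := [], t2 := [] } (100 * (L + 1))
      { σ with
      v := { σ.v with ok := false, go := false, sg := false, f1 := false, f2 := false, ic := 0 }
      x := [], y := [], cp := [], c1 := [], c2 := []
      da := bits (endDigits L X Y).1, db := bits (endDigits L X Y).2, lv := un (endLevel L X Y)
      dt := [], du := [], t1 := [], t2 := [] } := by
  obtain ⟨g, y, hy, k1⟩ := ex_readRad (φ := φ) { σ with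
      v := { σ.v with ok := false, go := false, sg := false, f1 := false, f2 := false, ic := 0 }
      x := X.map some, cp := un L, c2 := un L
      da := [], dt := [], du := [], t1 := [], t2 := [] } Y L
  set er := takeBits L (dropSign Y).tail with her
  obtain ⟨x, hx, k2⟩ := ex_readMid (φ := φ) { σ with
      v := { σ.v with
        ok := beginsSep (dropSign Y), go := g, sg := false, f1 := false, f2 := false, ic := 0 }
      y := y, cp := un L, c1 := [], db := bits er.reverse, lv := un (zeros er)
      dt := [], du := [], t1 := [], t2 := [] } X L
  set fr := takeBits L (fracPart X).tail with hfr
  have l1 : fr.length = L := length_takeBits' _ _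
  have l2 : er.length = L := length_takeBits' _ _
  set ok := beginsSep (dropSign Y) && beginsSep (fracPart X) with hok
  let τ : PS M := { σ with
      v := { σ.v with
        ok := ok, go := g, sg := isNeg X, f1 := false, f2 := false, ic := intDigits X }
      x := [], y := [], cp := [], c1 := [], c2 := []
      lv := un (zeros er), dt := [], du := [], t1 := [], t2 := [] }
  have k6 := ex_arithLoop (φ := φ) τ (fr.zip er)
  have hz : (fr.zip er).length = L := by simp [l1, l2]
  rw [List.map_reverse, List.map_reverse, List.map_fst_zip (by omega), List.map_snd_zip (by omega)]
    at k6
  set r := arith τ.v.sg (fr.zip er) with hr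
  obtain ⟨l3, l4⟩ := length_arith (isNeg X) (fr.zip er)
  rw [← hr] at l3 l4
  let ρ : PS M := { τ with v := { τ.v with f1 := r.1.1, f2 := r.1.2 } }
  have k7 := ex_selLoop (φ := φ) ρ (r.2.1.zip r.2.2)
  have e1 : (r.2.1.zip r.2.2).map (fun p => selLow (isNeg X) (intDigits X) r.1.2 p.2) =
      r.2.2.map (selLow (isNeg X) (intDigits X) r.1.2) := by
    conv_rhs => rw [← List.map_snd_zip (l₁ := r.2.1) (l₂ := r.2.2) (by omega)]
    rw [List.map_map]
    rfl
  have k8 : Ex φ (.ite (fun v _ => v.ok) skip (clr .lv)) { ρ with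
      da := bits (endDigits L X Y).1, db := bits (endDigits L X Y).2 } (2 * L + 2) { ρ with
      da := bits (endDigits L X Y).1, db := bits (endDigits L X Y).2
      lv := un (endLevel L X Y) } := by
    have hzl : zeros er ≤ L := l2 ▸ (List.takeWhile_prefix _).length_le
    rw [endLevel, ← hok]
    rcases Bool.eq_false_or_eq_true ok with hk | hk <;> rw [hk]
    · exact (Ex.ite_true (ex_skip _) hk).mono (by omega)
    · exact (Ex.ite_false (ex_clr _ .lv _) hk).mono (by simp only [PS.get, τ, ρ, length_un]; omega)
  rw [List.map_fst_zip (by omega), List.map_snd_zip (by omega), e1] at k7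
  refine (k1.seq (k2.seq ((ex_clr φ .x _).seq ((ex_clr φ .y _).seq
    ((ex_clr φ .cp _).seq (Ex.seq (T₁ := 1)
    Ex.op (k6.seq (k7.seq (k8.seq (T₂ := 1) Ex.op))))))))).mono ?_
  have : (r.2.1.zip r.2.2).length = L := by simp [l3, l4, hz]
  simp only [PS.get, PS.put, length_un, hz, this]
  omega

/-! ### The evaluation of a function at the dyadic numbers close to an interval -/

open Classical in
/-- The string that the machine `M` computes. -/
def OracleMachine.result (M : OracleMachine) (O : Baire) (a : Str) : Str :=
  if h : ∃ n, (M.run O a n).state = M.halt then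
    ((M.run O a (Nat.find h)).tape .output).content else []

theorem run_add_of_halt {M : OracleMachine} {O : Baire} {a : Str} {n : ℕ}
    (h : (M.run O a n).state = M.halt) (k : ℕ) : M.run O a (k + n) = M.run O a n := by
  rw [OracleMachine.run, Function.iterate_add_apply]
  exact step_halt h k

theorem result_eq {M : OracleMachine} {O : Baire} {a : Str} {n : ℕ}
    (h : (M.run O a n).state = M.halt) :
    M.result O a = ((M.run O a n).tape .output).content := by
  classical
  have hex : ∃ n, (M.run O a n).state = M.halt := ⟨n, h⟩
  rw [OracleMachine.result, dif_pos hex]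
  obtain ⟨k, hk⟩ := Nat.exists_eq_add_of_le' (Nat.find_min' hex h)
  rw [hk, run_add_of_halt (Nat.find_spec hex)]

open Classical in
/-- The approximation that the simulation of the machine on the code of `2 ^ i` yields, if the digits
`c` suffice for it. -/
def jobCand (M : OracleMachine) (φ : Baire) (χ : List Bool → Baire) (c : List Bool)
    (i : ℕ) : Option Cand :=
  if GoodFrom M (bairePair φ (χ c)) (GoodQuery c) (M.init (codeStr i)) then
    candStr i (M.result (bairePair φ (χ c)) (codeStr i)) else none

/-- The digits of a number, from which `1` is subtracted if `b` is set. -/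
def decBits (b : Bool) (l : List Bool) : Bool × List Bool :=
  l.foldr (fun d r => (r.1 && !d, (d ^^ r.1) :: r.2)) (b, [])

/-- The difference of two numbers, cut off at `2`, after a further digit of either one. -/
def nextDiff (δ : Fin 3) (a b : Bool) : Fin 3 :=
  if δ = 2 then 2 else if δ = 1 then (if a && !b then 1 else 2) else if b && !a then 1 else 0

/-- The dyadic numbers with as many digits as `pre` that are used for an interval. The flag `nz` tells
whether `pre` is not zero, and `δ` is the difference of the digits of the end points. -/
def jobsAt (pre : List Bool) (δ nz : Fin 3) : List (List Bool) :=
  (if δ ≤ 1 then [(decBits false pre).2] else []) ++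
    if δ = 0 ∧ nz ≠ 0 then [(decBits true pre).2] else []

/-- The dyadic numbers that are used for an interval, from the digits of its end points. -/
def jobsFrom : ℕ → List Bool → Fin 3 → Fin 3 → List (Bool × Bool) → List (List Bool)
  | n + 1, pre, δ, nz, (a, b) :: l =>
    jobsAt (pre ++ [a]) (nextDiff δ a b) (if a then 1 else nz) ++
      jobsFrom n (pre ++ [a]) (nextDiff δ a b) (if a then 1 else nz) l
  | _, _, _, _, _ => []

/-- The summary of the approximations for the number with the digits `c`. -/
def addJob (M : OracleMachine) (φ : Baire) (χ : List Bool → Baire) (s : Coll)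
    (c : List Bool) : Coll :=
  (List.range (c.length + 1)).foldl (fun s i => s.addOpt (jobCand M φ χ c i)) s

/-- The states of the search. -/
def PS.search (M : OracleMachine) (lv lm du cap da db dc dt : List Sym) (df ic : Fin 3) (s : Coll)
    (r : Str) : PS M :=
  { (PS.start M []).withColl s with
    v := { ((PS.start M []).withColl s).v with df := df, ic := ic }
    lv := lv, lm := lm, du := du, cap := cap, da := da, db := db, dc := dc, dt := dt, ans := r }

theorem PS.search_clean (lv lm du cap da db dc dt : List Sym) (df ic : Fin 3) (s : Coll) (r : Str) :
    (PS.search M lv lm du cap da db dc dt df ic s r).Clean :=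
  ⟨rfl, rfl, rfl, rfl, rfl, rfl, rfl, rfl, rfl, rfl, rfl, rfl⟩

/-- Simulates the machine on the code of `2 ^ i`, where `i` is the height of `cap`. -/
def jobBody : Prog M :=
  .seq (codeOut .t1 []) <| .seq (mv .t1 .vq) <| .seq (simProg digitCall) <|
  .seq (.ite (fun v _ => v.sim.abort) (.op fun v _ => { v := { v with sim := (Regs.init M).sim } })
    (.seq (mv .vq .t1) <| .seq (mv .t1 .va) <| .seq (harvest false) (clr .va))) <|
  .op fun v _ => { v := v, st := fun
          | .nm .cap => .push none
          | _ => .keep }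

theorem ex_jobBody (χ : List Bool → Baire) (c : List Bool) (hχ : NameFrom c (χ c)) (i n K : ℕ)
    (lv lm du da db dc : List Sym) (df ic : Fin 3) (s : Coll) (r : Str)
    (hn : (M.run (bairePair φ (χ c)) (codeStr i) n).state = M.halt) (hi : i ≤ K) (hnK : n ≤ K)
    (hc : c.length ≤ K) (hs : s.Bounded K) :
    ∃ r', Ex φ jobBody (PS.search M lv lm du (un i) da db dc (bits c) df ic s r)
      (20000 * (K + 1) ^ 2) (PS.search M lv lm du (un (i + 1)) da db dc (bits c) df ic
        (s.addOpt (jobCand M φ χ c i)) r') := by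
  set O := bairePair φ (χ c) with hO
  let S := PS.search M lv lm du (un i) da db dc (bits c) df ic s
  have k1 := ex_codeOut (φ := φ) .t1 [] (S r) i rfl rfl
  have k2 : Ex φ (mv .t1 .vq) _ (2 * (i + 2) + 1) { S r with vq := (codeStr i).map some } :=
    (ex_mv φ .t1 .vq ((S r).emit .t1 ([] ++ codeStr i))).congr (by
      apply PS.ext
      all_goals first | rfl | simp [PS.put, PS.get, S, PS.search, PS.emit, PS.start, PS.withColl])
    (by simp [PS.get, S, PS.search, PS.emit, PS.start, PS.withColl, codeStr_length])
  obtain ⟨a', k3, hlen⟩ := ex_simProg (answers_digitCall φ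
    (S []) c (χ c) hχ
    (PS.search_clean _ _ _ _ _ _ _ _ _ _ _ _) rfl rfl rfl (i + 2 + n + 1) (3 * c.length + 12) le_rfl)
    rfl rfl rfl (codeStr i) n (by rw [codeStr_length]) hn (Regs.init M).sim r
  rw [← hO] at k3 hlen
  have hK2 : 20000 * (K + 1) ^ 2 = 20000 * (K * K) + 40000 * K + 20000 := by ring
  have hT : (n + 3) * (40 * (i + 2 + n + 1) + 300 * (i + 2 + n + 1 + (3 * c.length + 12) + 5) +
      2 * (3 * c.length + 12) + 20) ≤ (K + 3) * (40 * (K + 2 + K + 1) +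
      300 * (K + 2 + K + 1 + (3 * K + 12) + 5) + 2 * (3 * K + 12) + 20) := by gcongr
  have hT' : (K + 3) * (40 * (K + 2 + K + 1) + 300 * (K + 2 + K + 1 + (3 * K + 12) + 5) +
      2 * (3 * K + 12) + 20) ≤ 1586 * (K * K) + 12000 * K + 19000 := by nlinarith
  have hbd := hs.len
  by_cases hg : GoodFrom M O (GoodQuery c) (M.init (codeStr i))
  · have hw := hlen hg
    simp only [hg, decide_true, Bool.not_true] at k3
    set w := ((M.run O (codeStr i) n).tape .output).content with hwdef
    have hj : jobCand M φ χ c i = candStr i w := by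
      rw [jobCand, if_pos hg, result_eq hn]
    have k4 : Ex φ (mv .vq .t1) _ (2 * w.length + 1) { S a' with t1 := (w.map some).reverse } :=
      (ex_mv φ .vq .t1 { S a' with vq := w.map some }).congr (by
        apply PS.ext
        all_goals first | rfl | simp [PS.put, PS.get, S, PS.search, PS.start, PS.withColl])
      (by simp [PS.get])
    have k5 : Ex φ (mv .t1 .va) { S a' with t1 := (w.map some).reverse } (2 * w.length + 1)
        ((S a').src false w) := (ex_mv φ .t1 .va _).congr (by
        apply PS.ext
        all_goals first
          | rfl | simp [PS.put, PS.get, S, PS.search, PS.start, PS.withColl, PS.src])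
      (by simp [PS.get])
    obtain ⟨w', hw', k6⟩ := ex_harvest (φ := φ) false (S a') s i w
      (PS.search_clean _ _ _ _ _ _ _ _ _ _ _ _) ⟨rfl, rfl, rfl, rfl⟩ rfl
    have k7 := ex_clr φ .va (((S a').withColl (s.addOpt (candStr i w))).src false w')
    rw [hj]
    refine ⟨a', (k1.seq (k2.seq (k3.seq ((Ex.ite_false (k4.seq (k5.seq (k6.seq k7)))).seq
      (T₂ := 1) Ex.op)))).mono ?_⟩
    have e7 : ((((S a').withColl (s.addOpt (candStr i w))).src false w').get .va).length =
        w'.length := by simp [PS.get, PS.src]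
    rw [e7, hK2]
    simp only [List.length_nil]
    omega
  · simp only [hg, decide_false, Bool.not_false] at k3
    have hj : jobCand M φ χ c i = none := by rw [jobCand, if_neg hg]
    rw [hj]
    refine ⟨a', (k1.seq (k2.seq (k3.seq ((Ex.ite_true (T := 1) (σ₁ := S a') Ex.op).seq
      (T₂ := 1) Ex.op)))).mono ?_⟩
    rw [hK2]
    simp only [List.length_nil]
    omega

/-- Runs `jobBody` as often as the height of `du` says. -/
def jobRuns : Prog M := .loop (has .du) <| .seq (pop .du) jobBody

/-- Simulates the machine on the codes of `1, …, 2 ^ m`, where `m` is the height of `lm`. -/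
def jobLoop : Prog M :=
  .seq (mv2 .lm .du .t1) <| .seq (mv .t1 .lm) <|
  .seq (push .du none) <| .seq jobRuns <| .seq (clr .cap) (clr .dt)

theorem jobCand_bound {χ : List Bool → Baire} {c : List Bool} {i K : ℕ} (hi : i ≤ K) {d : Cand}
    (h : jobCand M φ χ c i = some d) : 4 ≤ d.lvl ∧ d.lvl + d.str.length ≤ 3 * K + 2 := by
  rw [jobCand] at h
  split_ifs at h
  exact candStr_bound h hi

theorem ex_jobLoop (χ : List Bool → Baire) (c : List Bool) (hχ : NameFrom c (χ c)) (K : ℕ)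
    (lv da db dc : List Sym) (df ic : Fin 3) (s : Coll) (r : Str)
    (hn : ∀ i ≤ c.length, ∃ n ≤ K, (M.run (bairePair φ (χ c)) (codeStr i) n).state = M.halt)
    (hc : c.length ≤ K) (hs : s.Bounded K) :
    (addJob M φ χ s c).Bounded K ∧
    ∃ r', Ex φ jobLoop (PS.search M lv (un c.length) [] [] da db dc (bits c) df ic s r)
      (30000 * (K + 1) ^ 3) (PS.search M lv (un c.length) [] [] da db dc [] df ic
        (addJob M φ χ s c) r') := by
  have key : ∀ (j i : ℕ) (s : Coll) (r : Str), i + j = c.length + 1 → s.Bounded K →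
      ((List.range' i j).foldl (fun s i => s.addOpt (jobCand M φ χ c i)) s).Bounded K ∧
      ∃ r', Ex φ jobRuns
        (PS.search M lv (un c.length) (un j) (un i) da db dc (bits c) df ic s r)
        (j * (20000 * (K + 1) ^ 2 + 5) + 1)
        (PS.search M lv (un c.length) [] (un (i + j)) da db dc (bits c) df ic
          ((List.range' i j).foldl (fun s i => s.addOpt (jobCand M φ χ c i)) s) r') := by
    intro j
    induction j with
    | zero => exact fun i s r _ hs => ⟨hs, r, Ex.mono Ex.loop_end (by omega)⟩
    | succ j ih =>
      intro i s r hij hs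
      obtain ⟨n, hnK, hh⟩ := hn i (by omega)
      obtain ⟨r₁, k₁⟩ := ex_jobBody χ c hχ i n K lv (un c.length) (un j) da db dc df ic s r hh
        (by omega) hnK hc hs
      obtain ⟨hb, r₂, k₂⟩ := ih (i + 1) (s.addOpt (jobCand M φ χ c i)) r₁ (by omega)
        (hs.addOpt fun d hd => jobCand_bound (by omega) hd)
      rw [List.range'_succ, List.foldl_cons]
      rw [show i + 1 + j = i + (j + 1) by omega] at k₂
      refine ⟨hb, r₂, (Ex.loop_step (Ex.seq (T₁ := 1)
        (σ₁ := PS.search M lv (un c.length) (un j) (un i) da db dc (bits c) df ic s r)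
        Ex.op k₁) k₂).mono (by rw [Nat.add_one_mul j]; omega)⟩
  obtain ⟨hb, r', k⟩ := key (c.length + 1) 0 s r (by omega) hs
  rw [← List.range_eq_range'] at hb k
  let S := fun lm du cap => PS.search M lv lm du cap da db dc (bits c) df ic
  have k1 : Ex φ (mv2 .lm .du .t1) _ (2 * c.length + 1)
      { S [] (un c.length) [] s r with t1 := un c.length } :=
    (ex_mv2 φ .lm .du .t1 (S (un c.length) [] [] s r)).congr (by
      apply PS.ext
      all_goals first | rfl | simp [PS.put, PS.get, S, PS.search, PS.start, PS.withColl, un])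
    (by simp [PS.get, S, PS.search, un])
  have k2 : Ex φ (mv .t1 .lm) _ (2 * c.length + 1) (S (un c.length) (un c.length) [] s r) :=
    (ex_mv φ .t1 .lm { S [] (un c.length) [] s r with t1 := un c.length }).congr (by
      apply PS.ext
      all_goals first | rfl | simp [PS.put, PS.get, S, PS.search, PS.start, PS.withColl, un])
    (by simp [PS.get, un])
  set s' := addJob M φ χ s c
  have k4 := ex_clr φ .cap (S (un c.length) [] (un (0 + (c.length + 1))) s' r')
  have k5 := ex_clr φ .dt (S (un c.length) [] [] s' r')
  refine ⟨hb, r', (k1.seq (k2.seq (Ex.seq (T₁ := 1) Ex.op (k.seq (k4.seq k5))))).mono ?_⟩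
  have e4 : ((S (un c.length) [] (un (0 + (c.length + 1))) s' r').get .cap).length =
      c.length + 1 := by simp [S, PS.get, PS.search, un]
  have e5 : ((S (un c.length) [] [] s' r').get .dt).length = c.length := by
    simp [S, PS.get, PS.search, length_bits]
  rw [e4, e5]
  have : (c.length + 1) * (20000 * (K + 1) ^ 2 + 5) ≤ (K + 1) * (20000 * (K + 1) ^ 2 + 5) := by
    gcongr
  have h3 : (K + 1) * (20000 * (K + 1) ^ 2 + 5) ≤ 20005 * (K + 1) ^ 3 := by
    rw [show (K + 1) ^ 3 = (K + 1) * (K + 1) ^ 2 by ring]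
    nlinarith [Nat.one_le_pow 2 (K + 1) (by omega)]
  have h4 : K + 1 ≤ (K + 1) ^ 3 := Nat.le_self_pow (by omega) _
  omega

/-- Copies the digits on `dc` to `dt` and `t1`, and subtracts `1` if the flag is set. -/
def decLoop : Prog M :=
  .loop (has .dc) <| .op fun v t =>
    { v := { v with f1 := v.f1 && !symBit (t.st (.nm .dc)) }
      st := fun
        | .nm .dc => .pop
        | .nm .t1 => .push ((t.st (.nm .dc)).getD none)
        | .nm .dt => .push (some (.bit (symBit (t.st (.nm .dc)) ^^ v.f1)))
        | _ => .keep }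

/-- Copies the digits on `dc` to `dt`, and subtracts `1` if `b` is set. -/
def copyDec (b : Bool) : Prog M :=
  .seq (.op fun v _ => { v := { v with f1 := b } }) <|
  .seq decLoop <|
  .seq (mv .t1 .dc) (.op fun v _ => { v := { v with f1 := false } })

theorem ex_copyDec (b : Bool) (pre : List Bool) (lv lm da db : List Sym) (df ic : Fin 3) (s : Coll)
    (r : Str) :
    Ex φ (copyDec b) (PS.search M lv lm [] [] da db (bits pre.reverse) [] df ic s r)
      (4 * pre.length + 10)
      (PS.search M lv lm [] [] da db (bits pre.reverse) (bits (decBits b pre).2) df ic s r) := by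
  have key : Ex φ decLoop _ _ _ := Ex.loop_foldl
    (fun (l : List Bool) (b : (Bool × List Bool) × List Bool) =>
      let σ := PS.search M lv lm [] [] da db (bits l) (bits b.1.2) df ic s r
      { σ with v := { σ.v with f1 := b.1.1 }, t1 := bits b.2 })
    (fun b d => ((b.1.1 && !d, (d ^^ b.1.1) :: b.1.2), d :: b.2)) 1
    (fun x l b => Ex.op) (by intros; rfl) (by intros; rfl) pre.reverse ((b, []), [])
  have hf : ∀ (l : List Bool) (b : Bool),
      l.reverse.foldl (fun (b : (Bool × List Bool) × List Bool) d =>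
        ((b.1.1 && !d, (d ^^ b.1.1) :: b.1.2), d :: b.2)) ((b, []), []) = (decBits b l, l) := by
    intro l b
    rw [List.foldl_reverse]
    induction l with
    | nil => rfl
    | cons x l ih => rw [List.foldr_cons, ih]; rfl
  rw [hf] at key
  refine (Ex.seq (T₁ := 1) Ex.op (key.seq ((ex_mv φ .t1 .dc _).seq (T₂ := 1)
    (Ex.op (hnm := ?_))))).mono ?_
  · intro i
    cases i
    case dc => simp [PS.put, PS.get, PS.search, bits, StackAct.run]
    all_goals rfl
  · simp [PS.get, bits]
    omega

/-- The search for a level. -/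
def levelBody : Prog M :=
  .seq (.op fun v t =>
    { v := { v with
        df := nextDiff v.df (symBit (t.st (.nm .da))) (symBit (t.st (.nm .db)))
        ic := if symBit (t.st (.nm .da)) then 1 else v.ic }
      st := fun
        | .nm .lv => .pop
        | .nm .lm => .push none
        | .nm .da => .pop
        | .nm .db => .pop
        | .nm .dc => .push (some (.bit (symBit (t.st (.nm .da)))))
        | _ => .keep }) <|
  .seq (.ite (fun v _ => decide (v.df ≤ 1)) (.seq (copyDec false) jobLoop) skip)
    (.ite (fun v _ => decide (v.df = 0 ∧ v.ic ≠ 0)) (.seq (copyDec true) jobLoop) skip)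

theorem length_decBits (b : Bool) (l : List Bool) : (decBits b l).2.length = l.length := by
  induction l with
  | nil => rfl
  | cons x l ih => exact congrArg (· + 1) ih

theorem ex_levels (χ : List Bool → Baire) (hχ : ∀ c, NameFrom c (χ c)) (K n : ℕ) (pre : List Bool)
    (df ic : Fin 3) (l : List (Bool × Bool)) (s : Coll) (r : Str) (hnl : n ≤ l.length)
    (hK : pre.length + n ≤ K)
    (hrun : ∀ c ∈ jobsFrom n pre df ic l, ∀ i ≤ c.length, ∃ n ≤ K,
      (M.run (bairePair φ (χ c)) (codeStr i) n).state = M.halt) (hs : s.Bounded K) :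
    ((jobsFrom n pre df ic l).foldl (addJob M φ χ) s).Bounded K ∧
    ∃ lm da db dc df' ic' r', Ex φ (.loop (has .lv) levelBody)
      (PS.search M (un n) (un pre.length) [] [] (bits (l.map Prod.fst)) (bits (l.map Prod.snd))
        (bits pre.reverse) [] df ic s r)
      (n * (70000 * (K + 1) ^ 3) + 1)
      (PS.search M [] lm [] [] da db dc [] df' ic'
        ((jobsFrom n pre df ic l).foldl (addJob M φ χ) s) r') := by
  induction n generalizing pre df ic l s r with
  | zero => exact ⟨hs, _, _, _, _, _, _, _, Ex.mono Ex.loop_end (by omega)⟩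
  | succ n ih =>
    rcases l with _ | ⟨⟨a, b⟩, l⟩
    · simp at hnl
    set δ := nextDiff df a b with hδ
    set nz : Fin 3 := if a then 1 else ic with hnz
    let S := PS.search M (un n) (un (pre.length + 1)) [] [] (bits (l.map Prod.fst))
      (bits (l.map Prod.snd)) (bits (pre ++ [a]).reverse) [] δ nz
    have hlen : (pre ++ [a]).length = pre.length + 1 := by simp
    have hmem := fun c hc => hrun c (List.mem_append_left _ hc)
    have step : ∀ (C : Prop) [Decidable C] (b : Bool) (s : Coll) (r : Str), s.Bounded K →
        (C → (decBits b (pre ++ [a])).2 ∈ jobsAt (pre ++ [a]) δ nz) →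
        ∀ p : Regs M → Tops (Ix M.workTapes) → Bool, (∀ lv lm du cap da db dc dt s r,
          p (PS.search M lv lm du cap da db dc dt δ nz s r).v
            (PS.search M lv lm du cap da db dc dt δ nz s r).toSt.tops = decide C) →
        ((if C then [(decBits b (pre ++ [a])).2] else []).foldl (addJob M φ χ) s).Bounded K ∧
        ∃ r', Ex φ (.ite p (.seq (copyDec b) jobLoop) skip)
          (S s r) (34000 * (K + 1) ^ 3)
          (S ((if C then [(decBits b (pre ++ [a])).2] else []).foldl (addJob M φ χ) s) r') := by
      intro C _ b s r hs hC p hp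
      have h4 : K + 1 ≤ (K + 1) ^ 3 := Nat.le_self_pow (by omega) _
      by_cases h : C
      · have hl : (decBits b (pre ++ [a])).2.length = pre.length + 1 := by
          rw [length_decBits, hlen]
        obtain ⟨hb, r', k⟩ := ex_jobLoop χ (decBits b (pre ++ [a])).2 (hχ _) K (un n)
          (bits (l.map Prod.fst)) (bits (l.map Prod.snd)) (bits (pre ++ [a]).reverse) δ nz s r
          (hmem _ (hC h)) (by omega) hs
        rw [hl] at k
        have k0 := ex_copyDec (φ := φ) (M := M) b (pre ++ [a]) (un n) (un (pre.length + 1))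
          (bits (l.map Prod.fst)) (bits (l.map Prod.snd)) δ nz s r
        rw [if_pos h]
        exact ⟨hb, r', (Ex.ite_true (k0.seq k) ((hp ..).trans (decide_eq_true h))).mono
          (by omega)⟩
      · rw [if_neg h]
        exact ⟨hs, r, (Ex.ite_false (ex_skip _) ((hp ..).trans (decide_eq_false h))).mono (by omega)⟩
    obtain ⟨hb₁, r₁, k₁⟩ := step (δ ≤ 1) false s r hs
      (fun h => List.mem_append_left _ (by simp [h])) (fun v _ => decide (v.df ≤ 1))
      (by intros; rfl)
    obtain ⟨hb₂, r₂, k₂⟩ := step (δ = 0 ∧ nz ≠ 0) true _ r₁ hb₁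
      (fun h => List.mem_append_right _ (by simp [h]))
      (fun v _ => decide (v.df = 0 ∧ v.ic ≠ 0)) (by intros; rfl)
    obtain ⟨hb₃, lm, da, db, dc, df', ic', r₃, k₃⟩ := ih (pre ++ [a]) δ nz l _ r₂
      (by simpa using hnl) (by omega)
      (fun c hc => hrun c (List.mem_append_right _ hc)) hb₂
    rw [hlen] at k₃
    have e : jobsFrom (n + 1) pre df ic ((a, b) :: l) =
        jobsAt (pre ++ [a]) δ nz ++ jobsFrom n (pre ++ [a]) δ nz l := rfl
    rw [e, List.foldl_append, jobsAt, List.foldl_append]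
    refine ⟨hb₃, lm, da, db, dc, df', ic', r₃, (Ex.loop_step (Ex.seq (T₁ := 1) (σ₁ := S s r)
      (Ex.op (hnm := ?_)) (k₁.seq k₂)) k₃).mono ?_⟩
    · intro i
      cases i
      case dc =>
        exact (show bits (pre ++ [a]).reverse = _ :: bits pre.reverse by simp [bits]; rfl).symm
      all_goals rfl
    · have h4 : K + 1 ≤ (K + 1) ^ 3 := Nat.le_self_pow (by omega) _
      rw [Nat.add_one_mul n]
      omega

/-! ### The program for currying -/

/-- Moves the input to `t1`, and counts its letters on `cap`. -/
def intervalLoop : Prog M :=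
  .loop (fun _ t => t.inp.isSome) <| .op fun v t =>
    { v := v
      inp := true
      st := fun
        | .nm .t1 => .push t.inp
        | .nm .cap => .push none
        | _ => .keep }

/-- Moves the input to `va`, and counts its letters on `cap`. -/
def loadInterval : Prog M :=
  .seq intervalLoop (mv .t1 .va)

theorem ex_loadInterval (w : Str) :
    Ex φ loadInterval (PS.start M w) (4 * w.length + 3)
      ({ PS.start M [] with cap := un w.length }.src false w) := by
  have key : Ex φ intervalLoop _ _ _ := Ex.loop_foldl
    (fun l (r : List Sym × List Sym) => { PS.start M l with t1 := r.1, cap := r.2 })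
    (fun r x => (some x :: r.1, none :: r.2)) 1
    (fun x l r => Ex.op) (by intros; rfl) (by intros; rfl) w ([], [])
  have hf : ∀ (l : Str) (a : List Sym) (n : ℕ), l.foldl (fun (r : List Sym × List Sym) x =>
      (some x :: r.1, none :: r.2)) (a, un n) = ((l.map some).reverse ++ a, un (l.length + n)) := by
    intro l
    induction l with
    | nil => intro a n; simp
    | cons x l ih =>
      intro a n
      rw [List.foldl_cons, show none :: un n = un (n + 1) from rfl, ih]
      simp [Nat.add_assoc, Nat.add_comm 1]
  rw [show (([], []) : List Sym × List Sym) = ([], un 0) from rfl, hf] at key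
  refine (key.seq (ex_mv _ .t1 .va _)).congr ?_ ?_
  · apply PS.ext
    all_goals first | rfl | simp [PS.put, PS.get, PS.src, PS.start]
  · simp [PS.get]
    omega

/-- Computes a name of a function from the values that the machine `M` computes for its arguments. -/
def curryProg (M : OracleMachine) : Prog M :=
  .seq loadInterval <| .seq (fetch false) <| .seq (clr .va) <| .seq readEnds <|
  .seq (.loop (has .lv) levelBody) finish

/-- The dyadic numbers that are used for the interval with the code `s`. -/
def jobs (s : Str) : List (List Bool) :=
  let e := endDigits s.length (tracks (3 * s.length) s).1 (tracks (3 * s.length) s).2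
  jobsFrom (endLevel s.length (tracks (3 * s.length) s).1 (tracks (3 * s.length) s).2) [] 0 0
    (e.1.zip e.2)

theorem length_endDigits (L : ℕ) (X Y : Str) :
    (endDigits L X Y).1.length = L ∧ (endDigits L X Y).2.length = L := by
  have h := length_arith (isNeg X)
    ((takeBits L (fracPart X).tail).zip (takeBits L (dropSign Y).tail))
  simp only [List.length_zip, length_takeBits', min_self] at h
  simp [endDigits, h]

theorem endLevel_le (L : ℕ) (X Y : Str) : endLevel L X Y ≤ L := by
  rw [endLevel]
  split_ifs
  · exact (List.takeWhile_sublist _).length_le.trans (length_takeBits' ..).le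
  · exact Nat.zero_le _

/-- There are at most `2 * K` jobs; each runs `M` at most `K + 1` times for at most `K` steps, and a
step costs `O(K)`. This gives the exponent `4`; the square is the cost of the compilation. -/
theorem curryProg_halts (M : OracleMachine) (φ : Baire) (χ : List Bool → Baire)
    (hχ : ∀ c, NameFrom c (χ c)) (s : Str) (K : ℕ) (hK : s.length ≤ K)
    (hrun : ∀ c ∈ jobs s, ∀ i ≤ c.length, ∃ n ≤ K,
      (M.run (bairePair φ (χ c)) (codeStr i) n).state = M.halt) :
    (Compile.machine (curryProg M) (Regs.init M)).HaltsWithin φ s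
      (4 * (80000 * (K + 1) ^ 4 + 1) ^ 2)
      (collOut ((jobs s).foldl (addJob M φ χ) Coll.empty)) := by
  set X := (tracks (3 * s.length) s).1 with hX
  set Y := (tracks (3 * s.length) s).2 with hY
  obtain ⟨hA, hB⟩ := length_endDigits s.length X Y
  have hl := length_tracks (3 * s.length) s
  rw [← hX, ← hY] at hl
  obtain ⟨w', hw', k2⟩ := ex_fetch (φ := φ) false { PS.start M [] with cap := un s.length } s
    s.length rfl rfl rfl rfl rfl rfl rfl rfl
  rw [← hX, ← hY] at k2
  have k3 := ex_clr φ .va ({ PS.start M [] with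
    cp := un s.length, c1 := un s.length, c2 := un s.length
    x := X.map some, y := Y.map some }.src false w')
  have e3 : (({ PS.start M [] with
    cp := un s.length, c1 := un s.length, c2 := un s.length
    x := X.map some, y := Y.map some }.src false w').get .va).length = w'.length := by
    simp [PS.get, PS.src]
  have k4 := ex_readEnds (φ := φ) (PS.start M []) X Y s.length hl.1 hl.2
  have hfst : ((endDigits s.length X Y).1.zip (endDigits s.length X Y).2).map Prod.fst =
      (endDigits s.length X Y).1 := List.map_fst_zip (by omega)
  have hsnd : ((endDigits s.length X Y).1.zip (endDigits s.length X Y).2).map Prod.snd =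
      (endDigits s.length X Y).2 := List.map_snd_zip (by omega)
  obtain ⟨hb, lm, da, db, dc, df', ic', r', k5⟩ := ex_levels (M := M) (φ := φ) χ hχ K
    (endLevel s.length X Y) [] 0 0 ((endDigits s.length X Y).1.zip (endDigits s.length X Y).2)
    Coll.empty [] (by simp [hA, hB, endLevel_le])
    (by simpa using (endLevel_le s.length X Y).trans hK) hrun (Coll.Bounded.empty K)
  rw [hfst, hsnd] at k5
  obtain ⟨σ', k6, ho⟩ := ex_finish (φ := φ) (PS.search M [] lm [] [] da db dc [] df' ic'
    ((jobs s).foldl (addJob M φ χ) Coll.empty) r') _ K ⟨rfl, rfl, rfl, rfl⟩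
    (PS.search_clean _ _ _ _ _ _ _ _ _ _ _ _) hb
  refine Ex.haltsWithin ((ex_loadInterval s).seq (k2.seq (k3.seq (k4.seq (k5.seq k6))))) ho ?_
  have h1 : endLevel s.length X Y * (70000 * (K + 1) ^ 3) ≤ K * (70000 * (K + 1) ^ 3) := by
    gcongr
    exact (endLevel_le _ _ _).trans hK
  have h2 : K * (70000 * (K + 1) ^ 3) + 70000 * (K + 1) ^ 3 = 70000 * (K + 1) ^ 4 := by ring
  have h4 : K + 1 ≤ (K + 1) ^ 3 := Nat.le_self_pow (by omega) _
  rw [e3]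
  gcongr
  omega

end

/-! ### Digits -/

theorem binVal_append (l l' : List Bool) :
    binVal (l ++ l') = binVal l * 2 ^ l'.length + binVal l' := by
  induction l' using List.reverseRecOn with
  | nil => simp [binVal]
  | append_singleton l' b ih =>
    rw [← List.append_assoc, binVal_append_bit, binVal_append_bit, ih, List.length_append,
      List.length_singleton, pow_succ]
    ring

theorem binVal_cons (b : Bool) (l : List Bool) :
    binVal (b :: l) = b.toNat * 2 ^ l.length + binVal l := by
  rw [← List.singleton_append, binVal_append]
  simp [binVal]

theorem binVal_lt (l : List Bool) : binVal l < 2 ^ l.length := by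
  induction l with
  | nil => simp [binVal]
  | cons b l ih =>
    rw [binVal_cons, List.length_cons, pow_succ]
    cases b <;> simp <;> omega

theorem binVal_take (l : List Bool) (m : ℕ) : binVal (l.take m) = binVal l / 2 ^ (l.length - m) := by
  conv_rhs => rw [← List.take_append_drop m l, binVal_append]
  have h := binVal_lt (l.drop m)
  rw [List.length_drop] at h ⊢
  rw [List.take_append_drop, Nat.mul_comm, Nat.mul_add_div (by positivity), Nat.div_eq_of_lt h,
    add_zero]

theorem binVal_inj {l l' : List Bool} (hl : l.length = l'.length) (h : binVal l = binVal l') :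
    l = l' := by
  induction l generalizing l' with
  | nil => simpa using hl.symm
  | cons b l ih =>
    rcases l' with _ | ⟨b', l'⟩
    · simp at hl
    have hl' : l.length = l'.length := by simpa using hl
    rw [binVal_cons, binVal_cons, hl'] at h
    have h1 := binVal_lt l
    have h2 := binVal_lt l'
    rw [hl'] at h1
    have hb : b = b' := by cases b <;> cases b' <;> simp at h ⊢ <;> omega
    subst hb
    rw [ih hl' (by omega)]

/-- The letters of the code of a dyadic number. -/
theorem DyadicCode.digits {X : Str} {r : ℚ} (h : DyadicCode X r) :
    ∃ l u : List Bool, dropSign X = l.map .bit ++ .sep :: u.map .bit ∧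
      (l = [] ∨ ∃ l', l = true :: l') ∧ u.length ≤ X.length ∧
      r = (if isNeg X then -1 else 1) * (binVal l + binVal u / 2 ^ u.length) := by
  obtain ⟨w, z, u, hw, rfl, rfl⟩ := h
  cases hw with
  | empty => exact ⟨[], u, rfl, .inl rfl, by simp, by simp [strSign, isNeg, binVal]⟩
  | single b => exact ⟨[], u, rfl, .inl rfl, by simp; omega,
      by cases b <;> simp [strSign, isNeg, binVal]⟩
  | digits b l => exact ⟨true :: l, u, rfl, .inr ⟨l, rfl⟩, by simp; omega,
      by cases b <;> simp [strSign, isNeg]⟩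

theorem tracks_flatMap (f g h : ℕ → Letter) (l : List ℕ) (n : ℕ) :
    tracks n (l.flatMap fun i => [f i, g i, h i]) = ((l.map g).take n, (l.map h).take n) := by
  induction n generalizing l with
  | zero => rfl
  | succ n ih =>
    rcases l with _ | ⟨i, l⟩
    · have h := ih []
      simp only [List.flatMap_nil, List.map_nil, List.take_nil] at h
      simp [tracks, h]
    · simp [tracks, ih]

theorem tracks_strPair (a b : Str) : ∃ k k', a.length + k ≤ (strPair a b).length ∧
    b.length + k' ≤ (strPair a b).length ∧ ∀ n, tracks n (strPair a b) =
    ((a ++ List.replicate k (Letter.bit false)).take n,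
      (b ++ List.replicate k' (Letter.bit false)).take n) := by
  have h := tracks_flatMap (pairControl a b) (fun i => a.getD i (.bit false))
    (fun i => b.getD i (.bit false))
    (List.range (max (max a.length b.length) (min a.length b.length + 2)))
  rw [range_map_getD a _ (by omega), range_map_getD b _ (by omega)] at h
  exact ⟨_, _, by rw [strPair_length]; omega, by rw [strPair_length]; omega, h⟩

theorem dropSign_take (n : ℕ) (w : Str) :
    ∃ n' ≥ n, dropSign (w.take (n + 1)) = (dropSign w).take n' ∧
      isNeg (w.take (n + 1)) = isNeg w := by
  rcases w with _ | ⟨_ | _, w⟩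
  · exact ⟨n, le_rfl, by simp [dropSign], rfl⟩
  · exact ⟨n, le_rfl, rfl, rfl⟩
  · exact ⟨n + 1, n.le_succ, rfl, rfl⟩

theorem zerosUpTo_take {m n : ℕ} (h : m ≤ n) (w : Str) :
    zerosUpTo m (w.take n) = zerosUpTo m w := by
  induction m generalizing n w with
  | zero => rfl
  | succ m ih =>
    obtain ⟨n, rfl⟩ := Nat.exists_eq_add_of_le' (show 1 ≤ n by omega)
    rcases w with _ | ⟨(_ | _) | _, w⟩
    · rfl
    · exact congrArg (· + 1) (ih (by omega) w)
    · rfl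
    · rfl

theorem takeBits_take {k n : ℕ} (h : k ≤ n) (w : Str) : takeBits k (w.take n) = takeBits k w := by
  induction k generalizing n w with
  | zero => rfl
  | succ k ih =>
    obtain ⟨n, rfl⟩ := Nat.exists_eq_add_of_le' (show 1 ≤ n by omega)
    rcases w with _ | ⟨x, w⟩
    · rfl
    · change headBit (x :: _) :: takeBits k (w.take n) = headBit (x :: _) :: takeBits k w
      rw [ih (by omega)]
      cases x <;> rfl

theorem splitSep_take {m n : ℕ} (h : m < n) (w : Str) : ∃ f : Str → ℕ, (∀ v, n ≤ f v + m + 1) ∧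
    splitSep m (w.take n) = (splitSep m w).map fun p => (p.1, p.2.take (f p.2)) := by
  induction m generalizing n w with
  | zero =>
    obtain ⟨n, rfl⟩ := Nat.exists_eq_add_of_le' (show 1 ≤ n by omega)
    rcases w with _ | ⟨_ | _, w⟩ <;> exact ⟨fun _ => n, fun _ => le_rfl, rfl⟩
  | succ m ih =>
    obtain ⟨n, rfl⟩ := Nat.exists_eq_add_of_le' (show 1 ≤ n by omega)
    rcases w with _ | ⟨_ | _, w⟩
    · exact ⟨fun _ => n, fun _ => by dsimp only; omega, rfl⟩
    · obtain ⟨f, hf, e⟩ := ih (show m < n by omega) w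
      refine ⟨f, fun v => by have := hf v; omega, ?_⟩
      simp only [List.take_succ_cons, splitSep, e, Option.map_map]
      rfl
    · exact ⟨fun _ => n, fun _ => by dsimp only; omega, rfl⟩

/-- The approximation that an interval code gives, in terms of the two strings that are paired. -/
theorem candOf_take {m : ℕ} (X Y : Str) :
    candOf m (X.take (3 * m)) (Y.take (3 * m)) = candOf m X Y := by
  rcases Nat.lt_or_ge m 4 with hm | hm
  · rw [candOf, candOf, if_neg (by have := radLevel_le m (Y.take (3 * m)); omega),
      if_neg (by have := radLevel_le m Y; omega)]
  · obtain ⟨p, hp⟩ := Nat.exists_eq_add_of_le' (show 1 ≤ 3 * m by omega)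
    obtain ⟨n, hn, e1, -⟩ := dropSign_take p Y
    obtain ⟨n', hn', e2, e3⟩ := dropSign_take p X
    have hr : radLevel m (Y.take (3 * m)) = radLevel m Y := by
      rw [radLevel, radLevel, hp, e1]
      obtain ⟨n, rfl⟩ := Nat.exists_eq_add_of_le' (show 1 ≤ n by omega)
      rcases dropSign Y with _ | ⟨_ | _, w⟩
      · rfl
      · rfl
      · exact zerosUpTo_take (by omega) w
    obtain ⟨f, hf, e⟩ := splitSep_take (show m < n' by omega) (dropSign X)
    rw [candOf, candOf, hr, hp, e2, e3, e, Option.map_map]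
    have hk := radLevel_le m Y
    congr 2
    funext q
    simp only [Function.comp]
    rw [takeBits_take (by have := hf q.2; omega)]

theorem splitSep_digits (m : ℕ) (l : List Bool) (w : Str) :
    splitSep m (l.map .bit ++ .sep :: w) = if l.length ≤ m then some (l, w) else none := by
  induction m generalizing l with
  | zero => rcases l with _ | ⟨b, l⟩ <;> simp [splitSep]
  | succ m ih =>
    rcases l with _ | ⟨b, l⟩
    · simp [splitSep]
    · simp only [List.map_cons, List.cons_append, splitSep, ih, List.length_cons]
      split_ifs <;> first | rfl | omega

theorem binVal_mul_zerosUpTo_lt (m : ℕ) (u : List Bool) :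
    binVal u * 2 ^ zerosUpTo m (u.map .bit) < 2 ^ u.length := by
  induction m generalizing u with
  | zero => simpa [zerosUpTo] using binVal_lt u
  | succ m ih =>
    rcases u with _ | ⟨b, u⟩
    · simp [zerosUpTo, binVal]
    · cases b
      · have := ih u
        simp only [List.map_cons, zerosUpTo, binVal_cons, List.length_cons, pow_succ, ← mul_assoc]
        simpa using this
      · simpa [zerosUpTo] using binVal_lt (true :: u)

theorem le_zerosUpTo {m k : ℕ} (hk : k ≤ m) {u : List Bool} (h : binVal u * 2 ^ k < 2 ^ u.length)
    (h0 : 0 < binVal u) : k ≤ zerosUpTo m (u.map .bit) := by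
  induction k generalizing m u with
  | zero => exact Nat.zero_le _
  | succ k ih =>
    obtain ⟨m, rfl⟩ := Nat.exists_eq_add_of_le' (show 1 ≤ m by omega)
    rcases u with _ | ⟨b, u⟩
    · simp [binVal] at h0
    · rw [binVal_cons, List.length_cons, pow_succ, pow_succ] at h
      rw [binVal_cons] at h0
      cases b
      · simp only [Bool.toNat_false, zero_mul, zero_add] at h h0
        exact Nat.succ_le_succ (ih (by omega) (by rw [← mul_assoc] at h; omega) h0)
      · simp only [Bool.toNat_true, one_mul] at h
        have h1 := Nat.one_le_two_pow (n := k)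
        have h2 := Nat.mul_le_mul (Nat.le_add_right (2 ^ u.length) (binVal u))
          (Nat.mul_le_mul_right 2 h1)
        omega

theorem binVal_takeBits (k : ℕ) (u : List Bool) :
    binVal (takeBits k (u.map .bit)) * 2 ^ u.length ≤ binVal u * 2 ^ k ∧
      binVal u * 2 ^ k < (binVal (takeBits k (u.map .bit)) + 1) * 2 ^ u.length := by
  induction k generalizing u with
  | zero => simpa [takeBits, binVal] using binVal_lt u
  | succ k ih =>
    rcases u with _ | ⟨b, u⟩
    · have := ih []
      simp only [binVal, List.map_nil, List.length_nil, List.foldl_nil] at this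
      change binVal (false :: takeBits k []) * _ ≤ _ ∧ _ < (binVal (false :: takeBits k []) + 1) * _
      rw [binVal_cons]
      simpa [binVal] using this
    · obtain ⟨h1, h2⟩ := ih u
      change binVal (b :: takeBits k (u.map .bit)) * _ ≤ _ ∧
        _ < (binVal (b :: takeBits k (u.map .bit)) + 1) * _
      rw [binVal_cons, binVal_cons, length_takeBits', List.length_cons, pow_succ, pow_succ]
      constructor <;> nlinarith

theorem binVal_takeBits_of_le {k : ℕ} {u : List Bool} (h : u.length ≤ k) :
    binVal (takeBits k (u.map .bit)) = binVal u * 2 ^ (k - u.length) := by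
  obtain ⟨h1, h2⟩ := binVal_takeBits k u
  have e : 2 ^ k = 2 ^ (k - u.length) * 2 ^ u.length := by rw [← pow_add]; congr 1; omega
  rw [e, ← mul_assoc] at h1 h2
  have h1 := Nat.le_of_mul_le_mul_right h1 (by positivity)
  have h2 := Nat.lt_of_mul_lt_mul_right h2
  omega

/-! ### The approximations that interval codes give -/

/-- The number of multiples of `2 ^ (-lvl)` in an approximation. -/
def Cand.num (c : Cand) : ℤ :=
  (if c.neg then -1 else 1) * (binVal c.ip * 2 ^ c.lvl + binVal c.fr : ℕ)

/-- The approximation `c` is well-formed, and it is an approximation to `y`. -/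
structure Cand.Near (y : ℝ) (c : Cand) : Prop where
  four : 4 ≤ c.lvl
  len : c.fr.length = c.lvl
  code : DyadicCode c.str (c.num / 2 ^ c.lvl)
  near : |y * 2 ^ c.lvl - c.num| < 2

theorem candStr_near {m : ℕ} {w : Str} {J : DyadicInterval} (hw : IntervalCode w J) {c : Cand}
    (h : candStr m w = some c) {y : ℝ} (hy : y ∈ J.toSet) : c.Near y := by
  cases hw with
  | infinite =>
    have e : ∀ n, tracks n [] = ([], []) := by
      intro n
      induction n with
      | zero => rfl
      | succ n ih => simp [tracks, ih]
    simp [candStr, candOf, e, radLevel, dropSign] at h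
  | @finite a b r ε hr hε pos ha hb =>
    obtain ⟨p, p', -, -, e⟩ := tracks_strPair a b
    rw [candStr, e, candOf_take] at h
    obtain ⟨l, u, hX, hl, -, hr'⟩ := (ha.pad p).digits
    obtain ⟨l', u', hY, hl', -, hε'⟩ := (hb.pad p').digits
    set X := a ++ List.replicate p (.bit false)
    set Y := b ++ List.replicate p' (.bit false)
    rw [candOf, hX, splitSep_digits] at h
    split_ifs at h with h4 hlm
    · simp only [Option.map_some, Option.some.injEq] at h
      -- the radius has no digits before the point
      obtain rfl : l' = [] := by
        rcases hl' with h' | ⟨l'', rfl⟩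
        · exact h'
        · simp [radLevel, hY] at h4
      have hk : radLevel m Y = zerosUpTo m (u'.map .bit) := by simp [radLevel, hY]
      have hz := binVal_mul_zerosUpTo_lt m u'
      rw [← hk] at hz
      obtain ⟨t1, t2⟩ := binVal_takeBits (radLevel m Y) u
      set k := radLevel m Y
      have hεk : (ε : ℝ) * 2 ^ k < 1 := by
        have : ε ≤ binVal u' / 2 ^ u'.length := by
          rw [hε']
          have : (0 : ℚ) ≤ binVal u' / 2 ^ u'.length := by positivity
          split_ifs <;> simp [binVal] at this ⊢
          linarith
        have h2 : (binVal u' : ℚ) / 2 ^ u'.length * 2 ^ k < 1 := by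
          rw [div_mul_eq_mul_div, div_lt_one (by positivity)]
          exact_mod_cast hz
        have : ε * 2 ^ k < 1 := lt_of_le_of_lt (by gcongr) h2
        exact_mod_cast this
      have hrk : |(r : ℝ) * 2 ^ k - c.num| < 1 := by
        have : |r * 2 ^ k - c.num| < 1 := by
          have e1 : (binVal (takeBits k (u.map .bit)) : ℚ) ≤ binVal u / 2 ^ u.length * 2 ^ k := by
            rw [div_mul_eq_mul_div, le_div_iff₀ (by positivity)]
            exact_mod_cast t1
          have e2 : (binVal u : ℚ) / 2 ^ u.length * 2 ^ k < binVal (takeBits k (u.map .bit)) + 1 := by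
            rw [div_mul_eq_mul_div, div_lt_iff₀ (by positivity)]
            exact_mod_cast t2
          rw [← h, hr', Cand.num]
          push_cast
          rw [mul_assoc, ← mul_sub, abs_mul]
          have : |(if isNeg X = true then -1 else 1 : ℚ)| = 1 := by split_ifs <;> simp
          rw [this, one_mul, abs_lt]
          constructor <;> linarith
        exact_mod_cast this
      have hlen : c.fr.length = c.lvl := by rw [← h]; exact length_takeBits' _ _
      have hlvl : c.lvl = k := by rw [← h]
      refine ⟨hlvl ▸ h4, hlen, ?_, ?_⟩
      · have hc : ∃ z, IntCode (.bit c.neg :: c.ip.map .bit) z ∧ |z| = binVal c.ip := by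
          rcases hl with rfl | ⟨l', rfl⟩ <;> rw [← h]
          · exact ⟨_, .single _, by simp [binVal]⟩
          · exact ⟨_, .digits _ _, by cases isNeg X <;> simp⟩
        obtain ⟨z, hz, hz'⟩ := hc
        refine ⟨_, z, c.fr, hz, rfl, ?_⟩
        rw [← Int.cast_abs, hz', hlen, Cand.num, strSign]
        push_cast
        rw [mul_div_assoc, add_div, mul_div_cancel_right₀ _ (by positivity)]
        cases c.neg <;> simp
      · rw [hlvl]
        have h2 : (0 : ℝ) < 2 ^ k := by positivity
        have i1 := mul_le_mul_of_nonneg_right hy.1 h2.le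
        have i2 := mul_le_mul_of_nonneg_right hy.2 h2.le
        obtain ⟨i3, i4⟩ := abs_lt.1 hrk
        rw [abs_lt]
        constructor <;> linarith
    · simp at h

theorem exists_candStr {m k : ℕ} {w : Str} {J : DyadicInterval} (hw : IntervalCode w J)
    (hJ : J.DiamLE k) (h4 : 4 ≤ k) (hk : k ≤ m) {y : ℝ} (hy : y ∈ J.toSet) (hm : |y| + 1 ≤ 2 ^ m) :
    ∃ c, candStr m w = some c ∧ k ≤ c.lvl := by
  cases hw with
  | infinite => simp [DyadicInterval.DiamLE, DyadicInterval.diam] at hJ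
  | @finite a b r ε hr hε pos ha hb =>
    simp only [DyadicInterval.DiamLE, DyadicInterval.diam, WithTop.coe_le_coe] at hJ
    obtain ⟨p, p', -, -, e⟩ := tracks_strPair a b
    rw [candStr, e, candOf_take]
    obtain ⟨l, u, hX, hl, -, hr'⟩ := (ha.pad p).digits
    obtain ⟨l', u', hY, hl', -, hε'⟩ := (hb.pad p').digits
    set X := a ++ List.replicate p (.bit false)
    set Y := b ++ List.replicate p' (.bit false)
    have h2k : (1 : ℚ) ≤ 2 ^ k := one_le_pow₀ (by norm_num)
    have hεk : ε * 2 ^ k < 1 := by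
      rw [le_inv_comm₀ (by positivity) (by positivity), inv_eq_one_div, le_div_iff₀ (by positivity)]
        at hJ
      nlinarith
    have hsum : (binVal l' + binVal u' / 2 ^ u'.length : ℚ) = ε := by
      have : (0 : ℚ) ≤ binVal l' + binVal u' / 2 ^ u'.length := by positivity
      split_ifs at hε' <;> linarith
    have hpow : ∀ l : List Bool, 2 ^ l.length ≤ binVal (true :: l) := fun l => by
      rw [binVal_cons]; simp
    obtain rfl : l' = [] := by
      rcases hl' with h' | ⟨l'', rfl⟩
      · exact h'
      · exfalso
        have h1 : (1 : ℚ) ≤ binVal (true :: l'') := by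
          exact_mod_cast Nat.one_le_two_pow.trans (hpow l'')
        have : (0 : ℚ) ≤ binVal u' / 2 ^ u'.length := by positivity
        nlinarith
    have hsum' : (binVal u' : ℚ) = ε * 2 ^ u'.length := by
      rw [← hsum]
      simp [binVal]
    have hrad : k ≤ radLevel m Y := by
      have e1 : radLevel m Y = zerosUpTo m (u'.map .bit) := by simp [radLevel, hY]
      rw [e1]
      refine le_zerosUpTo hk ?_ ?_
      · have : (binVal u' : ℚ) * 2 ^ k < 2 ^ u'.length := by
          rw [hsum', mul_right_comm]
          exact mul_lt_of_lt_one_left (by positivity) hεk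
        exact_mod_cast this
      · have : (0 : ℚ) < binVal u' := by rw [hsum']; positivity
        exact_mod_cast this
    have hlm : l.length ≤ m := by
      rcases hl with rfl | ⟨l', rfl⟩
      · exact Nat.zero_le _
      · have h1 : (binVal (true :: l') : ℝ) ≤ |(r : ℝ)| := by
          have : (binVal (true :: l') : ℚ) ≤ |r| := by
            rw [hr', abs_mul]
            have e1 : |(if isNeg X = true then -1 else 1 : ℚ)| = 1 := by split_ifs <;> simp
            rw [e1, one_mul, abs_of_nonneg (by positivity)]
            exact le_add_of_nonneg_right (by positivity)
          exact_mod_cast this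
        have h3 : ε < 1 := by nlinarith
        have h3' : (ε : ℝ) < 1 := by exact_mod_cast h3
        have h4 : |(r : ℝ)| < 2 ^ m := by
          have := abs_le.1 (le_refl |y|)
          rw [abs_lt]
          constructor <;> linarith [hy.1, hy.2]
        have h5 : (2 : ℝ) ^ l'.length < 2 ^ m := by
          refine lt_of_le_of_lt ?_ (h1.trans_lt h4)
          exact_mod_cast hpow l'
        exact (pow_lt_pow_iff_right₀ (by norm_num : (1 : ℝ) < 2)).1 h5
    refine ⟨⟨radLevel m Y, isNeg X, l, takeBits (radLevel m Y) (u.map .bit)⟩, ?_, hrad⟩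
    rw [candOf, if_pos (by omega), hX, splitSep_digits, if_pos hlm]
    rfl

/-! ### The interval of a set of approximations -/

theorem zipStr_eq (a b : Str) : zipStr a b = (List.range a.length).flatMap fun i =>
    [.bit true, a.getD i (.bit false), b.getD i (.bit false)] := by
  induction a generalizing b with
  | nil => rfl
  | cons x a ih =>
    rw [List.length_cons, List.range_succ_eq_map, List.flatMap_cons, List.flatMap_map, zipStr, ih]
    cases b <;> simp

theorem encStr_eq {a : Str} {k : ℕ} {r : Fin 16} (h : (radStr k r).length ≤ a.length) :
    encStr a k r =
      strPair a (radStr k r ++ List.replicate (a.length - (radStr k r).length) (.bit false)) := by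
  set b := radStr k r
  have hl : (b ++ List.replicate (a.length - b.length) (Letter.bit false)).length = a.length := by
    simp
    omega
  have hg : ∀ i, (b ++ List.replicate (a.length - b.length) (Letter.bit false)).getD i (.bit false) =
      b.getD i (.bit false) := by
    intro i
    rw [List.getD_eq_getElem?_getD, List.getD_eq_getElem?_getD, List.getElem?_append]
    split_ifs with h
    · rfl
    · rw [List.getElem?_replicate, List.getElem?_eq_none (by omega)]
      split_ifs <;> rfl
  rw [encStr, zipStr_eq, strPair, hl, max_self, min_self, max_eq_right (by omega),
    List.range_succ, List.range_succ, List.append_assoc, List.flatMap_append]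
  simp only [hg]
  congr 1
  · refine List.flatMap_congr fun i hi => ?_
    rw [pairControl, hl, min_self, if_pos (List.mem_range.1 hi)]
  · have ha : ∀ i, a.length ≤ i → a.getD i (.bit false) = .bit false := fun i hi =>
      List.getD_eq_default _ _ hi
    have hb : ∀ i, a.length ≤ i → b.getD i (.bit false) = .bit false := fun i hi =>
      List.getD_eq_default _ _ (by omega)
    simp [pairControl, hl, ha, hb, -List.getD_eq_getElem?_getD, List.replicate]

theorem length_radStr {k : ℕ} (r : Fin 16) (hk : 4 ≤ k) : (radStr k r).length = k + 2 := by
  simp [radStr, nibBits]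
  omega

theorem dyadicCode_radStr {k : ℕ} (r : Fin 16) (hk : 4 ≤ k) :
    DyadicCode (radStr k r) (r.val / 2 ^ k) := by
  have hv : binVal (List.replicate (k - 4) false ++ nibBits r) = r.val := by
    have h0 : ∀ n, binVal (List.replicate n false) = 0 := fun n => by
      simpa [binVal] using binVal_append_zeros [] n
    rw [binVal_append, h0, zero_mul, zero_add]
    revert r
    decide
  refine ⟨_, _, List.replicate (k - 4) false ++ nibBits r, .single false, by simp [radStr], ?_⟩
  rw [hv]
  have : k - 4 + 4 = k := by omega
  simp [strSign, nibBits, this]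

theorem intervalCode_encStr {a : Str} {k : ℕ} {r : Fin 16} {q : ℚ} (ha : DyadicCode a q)
    (hk : 4 ≤ k) (hl : k + 2 ≤ a.length) (hq : IsDyadic q) (hε : IsDyadic (r.val / 2 ^ k))
    (pos : (0 : ℚ) < r.val / 2 ^ k) : IntervalCode (encStr a k r) (.finite q _ hq hε pos) := by
  rw [encStr_eq (by rwa [length_radStr r hk])]
  exact .finite hq hε pos ha ((dyadicCode_radStr r hk).pad _)

theorem nibOf_val (l : List Bool) : (nibOf l).val = binVal l % 16 := by
  induction l using List.reverseRecOn with
  | nil => rfl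
  | append_singleton l b ih =>
    have : nibOf (l ++ [b]) = 2 * nibOf l + if b then 1 else 0 := by simp [nibOf]
    rw [this, binVal_append_bit, Fin.val_add, Fin.val_mul, ih]
    cases b <;> simp

namespace Cand.Near

variable {y : ℝ} {c c' : Cand}

theorem nib (h : c.Near y) : c.num % 16 = c.nib.val := by
  obtain ⟨j, hj⟩ := Nat.exists_eq_add_of_le h.four
  have e : 2 ^ c.lvl = 16 * 2 ^ j := by rw [hj, pow_add]; norm_num
  have h1 := nibOf_val c.fr
  have h2 : binVal c.ip * (16 * 2 ^ j) = 16 * (binVal c.ip * 2 ^ j) := by ring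
  rw [Cand.num, e, h2, Cand.nib]
  generalize binVal c.ip * 2 ^ j = t
  cases c.neg
  · simp only [Bool.false_eq_true, if_false]
    omega
  · simp only [if_true]
    rw [Fin.val_neg']
    omega

theorem length_str (h : c.Near y) : c.lvl + 2 ≤ c.str.length := by
  simp [Cand.str, h.len]

theorem num_le (h : c.Near y) (h' : c'.Near y) (hl : c.lvl = c'.lvl) : c.num ≤ c'.num + 3 := by
  have h1 := abs_lt.1 h.near
  have h2 := abs_lt.1 h'.near
  rw [hl] at h1
  have : (c.num : ℝ) < c'.num + 4 := by linarith [h1.1, h2.2]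
  have : c.num < c'.num + 4 := by exact_mod_cast this
  omega

end Cand.Near

/-- Among the approximations of the set `S`, those with the largest number `k` of digits are between
the numbers `n * 2 ^ (-k)` and `(n + d) * 2 ^ (-k)`, which both occur. -/
structure Hull (S : Set Cand) (k : ℕ) (n : ℤ) (d : ℕ) : Prop where
  low : ∃ c ∈ S, c.lvl = k ∧ c.num = n
  high : ∃ c ∈ S, c.lvl = k ∧ c.num = n + d
  le : ∀ c ∈ S, c.lvl ≤ k ∧ (c.lvl = k → n ≤ c.num ∧ c.num ≤ n + d)

theorem Hull.spread_le {S : Set Cand} {k d : ℕ} {n : ℤ} (h : Hull S k n d) {y : ℝ}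
    (hS : ∀ c ∈ S, c.Near y) : d ≤ 3 := by
  obtain ⟨c, hc, h1, h2⟩ := h.low
  obtain ⟨c', hc', h1', h2'⟩ := h.high
  have := (hS c' hc').num_le (hS c hc) (h1'.trans h1.symm)
  omega

/-- The summary `s` describes the set `S`. -/
def Coll.Rep (s : Coll) (S : Set Cand) : Prop :=
  (S = ∅ ∧ s = Coll.empty) ∨ ∃ n : ℤ, Hull S s.lvl n s.d.val ∧ 4 ≤ s.lvl ∧
    DyadicCode s.str (n / 2 ^ s.lvl) ∧ s.lvl + 2 ≤ s.str.length ∧ n % 16 = s.nib.val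

/-- Approximations of the same number with the same number of digits differ by at most `3` units in
the last digit, so that numerators modulo `16` are enough to compare them. -/
theorem Coll.Rep.add {s : Coll} {S : Set Cand} (h : s.Rep S) {y : ℝ} (hS : ∀ c ∈ S, c.Near y)
    {c : Cand} (hc : c.Near y) : (s.add c).Rep (insert c S) := by
  have hc4 := hc.four
  have key : s.lvl < c.lvl → (∀ c' ∈ S, c'.lvl ≤ s.lvl) → (s.add c).Rep (insert c S) := by
    intro hl hle
    rw [Coll.add, if_pos hl]
    refine .inr ⟨c.num, ⟨⟨c, .inl rfl, rfl, rfl⟩, ⟨c, .inl rfl, rfl, by simp⟩, ?_⟩, hc4, hc.code,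
      hc.length_str, hc.nib⟩
    rintro c' (rfl | hc')
    · exact ⟨le_rfl, fun _ => ⟨le_rfl, by simp⟩⟩
    · have := hle c' hc'
      exact ⟨by dsimp only; omega, fun e => by dsimp only at e; omega⟩
  rcases h with ⟨rfl, rfl⟩ | ⟨n, hH, h4, hcode, hlen, hnib⟩
  · exact key (by simp only [Coll.empty]; omega) (by simp)
  rcases lt_trichotomy s.lvl c.lvl with hl | hl | hl
  · exact key hl fun c' hc' => (hH.le c' hc').1
  · obtain ⟨cl, hcl, l1, l2⟩ := hH.low
    obtain ⟨ch, hch, m1, m2⟩ := hH.high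
    have i1 := (hS cl hcl).num_le hc (l1.trans hl)
    have i2 := hc.num_le (hS cl hcl) (hl.symm.trans l1.symm)
    have i3 := (hS ch hch).num_le hc (m1.trans hl)
    have i4 := hc.num_le (hS ch hch) (hl.symm.trans m1.symm)
    have i5 := hc.nib
    have b1 := s.nib.isLt
    have b2 := c.nib.isLt
    have f1 : (c.nib - s.nib).val = (16 - s.nib.val + c.nib.val) % 16 := by
      rw [Fin.sub_def]
    have f2 : (s.nib - c.nib).val = (16 - c.nib.val + s.nib.val) % 16 := by
      rw [Fin.sub_def]
    rw [Coll.add, if_neg (by omega), if_pos hl]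
    have f3 : 8 ≤ c.nib - s.nib ↔ 8 ≤ (c.nib - s.nib).val := Iff.rfl
    split_ifs with h8
    · rw [f3, f1] at h8
      have e : (cut14 (s.d.val + (s.nib - c.nib).val)).val = s.d.val + (n - c.num).toNat := by
        change min _ 14 = _
        rw [f2]
        omega
      refine .inr ⟨c.num, ⟨⟨c, .inl rfl, rfl, rfl⟩, ⟨ch, .inr hch, m1.trans hl, ?_⟩, ?_⟩, hc4, hc.code,
        hc.length_str, hc.nib⟩
      · dsimp only
        omega
      · dsimp only
        rw [e]
        rintro c' (rfl | hc')
        · exact ⟨le_rfl, fun _ => ⟨le_rfl, by omega⟩⟩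
        · obtain ⟨j1, j2⟩ := hH.le c' hc'
          exact ⟨by omega, fun e => by have := j2 (by omega); omega⟩
    · rw [f3, f1] at h8
      have e : (max s.d (cut14 (c.nib - s.nib).val)).val = max s.d.val (c.num - n).toNat := by
        have : (cut14 (c.nib - s.nib).val).val = (c.num - n).toNat := by
          change min _ 14 = _
          rw [f1]
          omega
        rw [← this]
        exact (Fin.val_strictMono.monotone.map_max ..)
      refine .inr ⟨n, ⟨⟨cl, .inr hcl, l1, l2⟩, ?_, ?_⟩, h4, hcode, hlen, hnib⟩
      · dsimp only
        rw [e]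
        rcases le_total s.d.val (c.num - n).toNat with hm | hm
        · exact ⟨c, .inl rfl, hl.symm, by omega⟩
        · exact ⟨ch, .inr hch, m1, by omega⟩
      · dsimp only
        rw [e]
        rintro c' (rfl | hc')
        · exact ⟨hl.ge, fun _ => ⟨by omega, by omega⟩⟩
        · obtain ⟨j1, j2⟩ := hH.le c' hc'
          exact ⟨j1, fun e => by have := j2 e; omega⟩
  · rw [Coll.add, if_neg (by omega), if_neg (by omega)]
    refine .inr ⟨n, ⟨?_, ?_, ?_⟩, h4, hcode, hlen, hnib⟩
    · obtain ⟨c', h1, h2⟩ := hH.low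
      exact ⟨c', .inr h1, h2⟩
    · obtain ⟨c', h1, h2⟩ := hH.high
      exact ⟨c', .inr h1, h2⟩
    · rintro c' (rfl | hc')
      · exact ⟨hl.le, fun e => by omega⟩
      · exact hH.le c' hc'

theorem Coll.rep_foldl {y : ℝ} (l : List (Option Cand)) (hl : ∀ c, some c ∈ l → c.Near y) :
    (l.foldl Coll.addOpt Coll.empty).Rep {c | some c ∈ l} := by
  induction l using List.reverseRecOn with
  | nil => exact .inl ⟨by simp, rfl⟩
  | append_singleton l o ih =>
    have ih := ih fun c hc => hl c (List.mem_append_left _ hc)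
    rw [List.foldl_append]
    rcases o with _ | c
    · simpa [Coll.addOpt] using ih
    · have e : {c' | some c' ∈ l ++ [some c]} = insert c {c' | some c' ∈ l} := by
        ext c'
        simp [or_comm]
      rw [e]
      exact ih.add (fun c hc => hl c (List.mem_append_left _ hc)) (hl c (by simp))

/-- The interval that stands for a set of approximations. -/
inductive HullOf (S : Set Cand) : DyadicInterval → Prop
  | infinite (h : S = ∅) : HullOf S .infinite
  | finite {k d : ℕ} {n : ℤ} (h : Hull S k n d) (hd : d < 15) : HullOf S
      (.finite (n / 2 ^ k) ((15 - d : ℤ) / 2 ^ k) ⟨_, _, rfl⟩ ⟨15 - d, k, by push_cast; rfl⟩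
        (div_pos (by have : (d : ℚ) < 15 := by exact_mod_cast hd
                     push_cast; linarith) (by positivity)))

theorem HullOf.unique {S : Set Cand} {K K' : DyadicInterval} (h : HullOf S K) (h' : HullOf S K') :
    K = K' := by
  cases h with
  | infinite h =>
    cases h' with
    | infinite => rfl
    | finite h' => obtain ⟨c, hc, -⟩ := h'.low; simp [h] at hc
  | @finite k d n h hd =>
    cases h' with
    | infinite h' => obtain ⟨c, hc, -⟩ := h.low; simp [h'] at hc
    | @finite k' d' n' h' hd' =>
      obtain ⟨c, hc, c1, c2⟩ := h.low
      obtain ⟨c', hc', c1', c2'⟩ := h'.low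
      obtain ⟨b, hb, b1, b2⟩ := h.high
      obtain ⟨b', hb', b1', b2'⟩ := h'.high
      obtain rfl : k = k' := by
        have := (h'.le c hc).1
        have := (h.le c' hc').1
        omega
      have i1 := (h'.le c hc).2 c1
      have i2 := (h.le c' hc').2 c1'
      have i3 := (h'.le b hb).2 b1
      have i4 := (h.le b' hb').2 b1'
      obtain rfl : n = n' := by omega
      obtain rfl : d = d' := by omega
      rfl

/-- The intervals are monotone in the set of approximations: the coarser ones are long enough to
contain the finer ones. -/
theorem HullOf.subset {S S' : Set Cand} {K K' : DyadicInterval} (h : HullOf S K) (h' : HullOf S' K')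
    (hS : S ⊆ S') {y : ℝ} (hy : ∀ c ∈ S', c.Near y) : K'.toSet ⊆ K.toSet := by
  cases h with
  | infinite h => exact Set.subset_univ _
  | @finite k d n h hd =>
    cases h' with
    | infinite h' => obtain ⟨c, hc, -⟩ := h.low; simpa [h'] using hS hc
    | @finite k' d' n' h' hd' =>
      obtain ⟨c, hc, c1, c2⟩ := h.low
      obtain ⟨c', hc', c1', c2'⟩ := h'.low
      obtain ⟨b, hb, b1, b2⟩ := h.high
      obtain ⟨b', hb', b1', b2'⟩ := h'.high
      have hk := (h'.le c (hS hc)).1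
      rw [c1] at hk
      simp only [DyadicInterval.toSet]
      push_cast
      rw [← sub_div, ← sub_div, ← add_div, ← add_div]
      obtain ⟨j, rfl⟩ := Nat.exists_eq_add_of_le hk
      have hp : (0 : ℝ) < 2 ^ k := by positivity
      have hpj : (0 : ℝ) < 2 ^ j := by positivity
      have hd3 : (d : ℝ) ≤ 3 := by exact_mod_cast h.spread_le fun c hc => hy c (hS hc)
      have hd0 : (0 : ℝ) ≤ d := Nat.cast_nonneg d
      have hd0' : (0 : ℝ) ≤ d' := Nat.cast_nonneg d'
      suffices hs : (n - (15 - d) : ℝ) * 2 ^ j ≤ n' - (15 - d') ∧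
          (n' + (15 - d') : ℝ) ≤ (n + (15 - d)) * 2 ^ j by
        rw [pow_add]
        apply Set.Icc_subset_Icc
        · rw [div_le_div_iff₀ hp (by positivity)]
          nlinarith [hs.1]
        · rw [div_le_div_iff₀ (by positivity) hp]
          nlinarith [hs.2]
      rcases Nat.eq_zero_or_pos j with rfl | hj
      · have i1 := (h'.le c (hS hc)).2 c1
        have i3 := (h'.le b (hS hb)).2 b1
        rw [c2] at i1
        rw [b2] at i3
        have j1 : (n' : ℝ) ≤ n := by exact_mod_cast i1.1
        have j2 : (n + d : ℝ) ≤ n' + d' := by exact_mod_cast i3.2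
        rw [pow_zero]
        constructor <;> linarith
      · have hj2 : (2 : ℝ) ≤ 2 ^ j := le_self_pow₀ (by norm_num) (by omega)
        have e1 := abs_lt.1 (hy c (hS hc)).near
        have e2 := abs_lt.1 (hy b (hS hb)).near
        have e3 := abs_lt.1 (hy c' hc').near
        have e4 := abs_lt.1 (hy b' hb').near
        rw [c1, c2] at e1
        rw [b1, b2] at e2
        rw [c1', c2', pow_add] at e3
        rw [b1', b2', pow_add] at e4
        push_cast at e2 e4
        constructor <;> nlinarith

theorem HullOf.mem {S : Set Cand} {K : DyadicInterval} (h : HullOf S K) {y : ℝ}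
    (hy : ∀ c ∈ S, c.Near y) : y ∈ K.toSet := by
  cases h with
  | infinite h => exact Set.mem_univ _
  | @finite k d n h hd =>
    have hd3 : (d : ℝ) ≤ 3 := by exact_mod_cast h.spread_le hy
    obtain ⟨c, hc, c1, c2⟩ := h.low
    have e := abs_lt.1 (hy c hc).near
    rw [c1, c2] at e
    have hp : (0 : ℝ) < 2 ^ k := by positivity
    simp only [DyadicInterval.toSet]
    push_cast
    rw [← sub_div, ← add_div]
    exact ⟨(div_le_iff₀ hp).2 (by linarith), (le_div_iff₀ hp).2 (by linarith)⟩

theorem HullOf.diamLE {S : Set Cand} {K : DyadicInterval} (h : HullOf S K) {c : Cand} (hc : c ∈ S)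
    {m : ℕ} (hm : m + 5 ≤ c.lvl) : K.DiamLE m := by
  cases h with
  | infinite h => simp [h] at hc
  | @finite k d n h hd =>
    obtain ⟨j, rfl⟩ := Nat.exists_eq_add_of_le (hm.trans (h.le c hc).1)
    simp only [DyadicInterval.DiamLE, DyadicInterval.diam, WithTop.coe_le_coe]
    have hj : (1 : ℚ) ≤ 2 ^ j := one_le_pow₀ (by norm_num)
    have hd0 : (0 : ℚ) ≤ d := Nat.cast_nonneg d
    rw [← mul_div_assoc, div_le_iff₀ (by positivity), pow_add, pow_add, mul_assoc,
      inv_mul_cancel_left₀ (by positivity)]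
    push_cast
    linarith

theorem Coll.Rep.exists_hullOf {s : Coll} {S : Set Cand} (h : s.Rep S) {y : ℝ}
    (hy : ∀ c ∈ S, c.Near y) : ∃ K, HullOf S K ∧ IntervalCode (collOut s) K := by
  rcases h with ⟨rfl, rfl⟩ | ⟨n, hH, h4, hcode, hlen, -⟩
  · exact ⟨_, .infinite rfl, .infinite⟩
  · have hd := hH.spread_le hy
    refine ⟨_, .finite hH (by omega), ?_⟩
    have e : (15 - s.d : Fin 16).val = 15 - s.d.val := by
      have : ∀ d : Fin 16, d.val ≤ 3 → (15 - d).val = 15 - d.val := by decide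
      exact this _ hd
    have e' : (((15 - s.d : Fin 16).val : ℕ) : ℚ) = ((15 - (s.d.val : ℤ) : ℤ) : ℚ) := by
      rw [e, Nat.cast_sub (by omega)]
      simp
    rw [collOut, if_neg (by omega)]
    have key := fun hε pos => intervalCode_encStr (r := 15 - s.d) hcode h4 hlen ⟨_, _, rfl⟩ hε pos
    rw [e'] at key
    exact key ⟨_, _, rfl⟩ (div_pos (Int.cast_pos.2 (by omega)) (by positivity))

/-! ### Names of real numbers and their parameters -/

theorem intCode_codeStr (n : ℕ) : IntCode (codeStr n) (2 ^ n) := by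
  have h := IntCode.digits false (List.replicate n false)
  have e : binVal (true :: List.replicate n false) = 2 ^ n := by
    have := binVal_append_zeros [true] n
    simpa [binVal] using this
  rw [e] at h
  simpa [codeStr] using h

theorem IntCode.eq_codeStr {a : Str} {n : ℕ} (h : IntCode a (2 ^ n)) : a = codeStr n := by
  generalize hz : (2 ^ n : ℤ) = z at h
  have hp : (0 : ℤ) < 2 ^ n := by positivity
  cases h with
  | empty => omega
  | single b => omega
  | digits b l =>
    cases b
    · simp only [Bool.false_eq_true, if_false, one_mul] at hz
      have hz : 2 ^ n = binVal (true :: l) := by exact_mod_cast hz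
      have h1 := binVal_lt l
      rw [binVal_cons, Bool.toNat_true, one_mul] at hz
      have hl : l.length = n := by
        have i1 : 2 ^ l.length ≤ 2 ^ n := by omega
        have i2 : 2 ^ n < 2 ^ (l.length + 1) := by rw [pow_succ]; omega
        have := (Nat.pow_le_pow_iff_right (by norm_num : 1 < 2)).1 i1
        have := (Nat.pow_lt_pow_iff_right (by norm_num : 1 < 2)).1 i2
        omega
      subst hl
      have : l = List.replicate l.length false := by
        refine binVal_inj (by simp) ?_
        have h0 : binVal (List.replicate l.length false) = 0 := by
          simpa [binVal] using binVal_append_zeros [] l.length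
        omega
      rw [codeStr, this]
      simp
    · simp only [if_true] at hz
      have : (0 : ℤ) ≤ binVal (true :: l) := Int.natCast_nonneg _
      omega

theorem encodesSeq_iff {χ : Baire} {Φ : ℕ → DyadicInterval} :
    EncodesSeq χ Φ ↔ ∀ n, IntervalCode (χ (codeStr n)) (Φ n) :=
  ⟨fun h n => h _ n (intCode_codeStr n), fun h _ n ha => ha.eq_codeStr ▸ h n⟩

theorem ceil_logb_le {x : ℝ} {k : ℕ} : ⌈Real.logb 2 (|x| + 1)⌉₊ ≤ k ↔ |x| + 1 ≤ 2 ^ k := by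
  rw [Nat.ceil_le, Real.logb_le_iff_le_rpow (by norm_num) (by positivity), Real.rpow_natCast]

section

variable {χ : Baire} {Φ : ℕ → DyadicInterval} {x : ℝ}

theorem ShrinksTo.diamLE_mono (hS : ShrinksTo Φ x) {n N N' : ℕ} (h : (Φ N).DiamLE n) (hN : N ≤ N') :
    (Φ N').DiamLE n := le_trans (DyadicInterval.diam_mono (hS.antitone hN)) h

theorem realParam_eq (hE : EncodesSeq χ Φ) (hS : ShrinksTo Φ x) (n : ℕ) :
    realParam χ n = sInf {N | (Φ N).DiamLE n} + ⌈Real.logb 2 (|x| + 1)⌉₊ := by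
  have e1 : Classical.epsilon (IsRealName χ) = x :=
    (Classical.epsilon_spec (⟨x, Φ, hE, hS⟩ : ∃ y, IsRealName χ y)).unique ⟨Φ, hE, hS⟩
  rw [realParam, e1]
  congr 2
  ext N
  exact ⟨fun ⟨Φ', h, h'⟩ => hE.unique h ▸ h', fun h => ⟨Φ, hE, h⟩⟩

theorem realParam_spec (hE : EncodesSeq χ Φ) (hS : ShrinksTo Φ x) {n N : ℕ}
    (h : realParam χ n ≤ N) : (Φ N).DiamLE n ∧ |x| + 1 ≤ 2 ^ N := by
  rw [realParam_eq hE hS] at h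
  exact ⟨hS.diamLE_mono (Nat.sInf_mem (s := {N | (Φ N).DiamLE n}) (hS.exists_diamLE n)) (by omega),
    ceil_logb_le.1 (by omega)⟩

theorem realParam_le (hE : EncodesSeq χ Φ) (hS : ShrinksTo Φ x) {n N k : ℕ}
    (h : (Φ N).DiamLE n) (hk : |x| + 1 ≤ 2 ^ k) : realParam χ n ≤ N + k := by
  rw [realParam_eq hE hS]
  exact Nat.add_le_add (Nat.sInf_le h) (ceil_logb_le.2 hk)

end

theorem IsRealName.monotone_param {χ : Baire} {x : ℝ} (h : IsRealName χ x) :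
    Monotone (realParam χ) := monotone_nat_of_le_succ fun n => realParam_mono h n

theorem collUpTo_eq (C : ℕ → Option Cand) (n : ℕ) :
    collUpTo C n = ((List.range (n + 1)).map C).foldl Coll.addOpt Coll.empty := by
  induction n with
  | zero => rfl
  | succ n ih => rw [collUpTo, ih, List.range_succ (n := n + 1)]; simp

/-- Approximations to a number that become better and better give a name of it. -/
theorem isRealName_runOut {C : ℕ → Option Cand} {y : ℝ} {ψ : Baire}
    (hC : ∀ i c, C i = some c → c.Near y) (hψ : ∀ n, ψ (codeStr n) = runOut C n) (N : ℕ → ℕ)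
    (hN : ∀ n, ∃ i ≤ N n, ∃ c, C i = some c ∧ n + 5 ≤ c.lvl) :
    IsRealName ψ y ∧ ∀ n k, |y| + 1 ≤ 2 ^ k → realParam ψ n ≤ N n + k := by
  have hS : ∀ n, {c | some c ∈ (List.range (n + 1)).map C} = {c | ∃ i ≤ n, C i = some c} := by
    intro n
    ext c
    simp
  have hnear : ∀ n, ∀ c ∈ {c | ∃ i ≤ n, C i = some c}, c.Near y :=
    fun n c ⟨i, _, h⟩ => hC i c h
  have key : ∀ n, ∃ K, HullOf {c | ∃ i ≤ n, C i = some c} K ∧ IntervalCode (runOut C n) K := by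
    intro n
    have h := Coll.rep_foldl (y := y) ((List.range (n + 1)).map C) fun c hc =>
      hnear n c (hS n ▸ hc)
    rw [hS, ← collUpTo_eq] at h
    exact h.exists_hullOf (hnear n)
  choose Φ h1 h2 using key
  have hE : EncodesSeq ψ Φ := encodesSeq_iff.2 fun n => by rw [hψ]; exact h2 n
  have hd : ∀ n, (Φ (N n)).DiamLE n := fun n => by
    obtain ⟨i, hi, c, hc, hl⟩ := hN n
    exact (h1 _).diamLE ⟨i, hi, hc⟩ hl
  have hsh : ShrinksTo Φ y := by
    refine shrinksTo_of (fun n => (h1 n).subset (h1 (n + 1)) ?_ (hnear _))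
      (fun n => (h1 n).mem (hnear n)) fun δ hδ => ?_
    · exact fun c ⟨i, hi, h⟩ => ⟨i, hi.trans n.le_succ, h⟩
    · obtain ⟨n, hn⟩ := exists_inv_pow_lt 1 hδ
      rw [one_div] at hn
      exact ⟨N n, fun z hz => ((hd n).dist_le ((h1 _).mem (hnear _)) hz).trans hn⟩
  exact ⟨⟨Φ, hE, hsh⟩, fun n k hk => realParam_le hE hsh (hd n) hk⟩

/-- A name of a real number yields approximations to it. -/
theorem IsRealName.near {φ : Baire} {x : ℝ} (h : IsRealName φ x) {i : ℕ} {c : Cand}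
    (hc : candStr i (φ (codeStr i)) = some c) : c.Near x := by
  obtain ⟨Φ, hE, hS⟩ := h
  exact candStr_near (encodesSeq_iff.1 hE i) hc (hS.mem i)

theorem IsRealName.exists_candStr {φ : Baire} {x : ℝ} (h : IsRealName φ x) {n i : ℕ} (hn : 4 ≤ n)
    (hi : realParam φ n ≤ i) (hni : n ≤ i) :
    ∃ c, candStr i (φ (codeStr i)) = some c ∧ n ≤ c.lvl := by
  obtain ⟨Φ, hE, hS⟩ := h
  obtain ⟨h1, h2⟩ := realParam_spec hE hS hi
  exact ParSpace.exists_candStr (encodesSeq_iff.1 hE i) h1 hn hni (hS.mem i) h2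

theorem IsRealName.le_param {φ : Baire} {x : ℝ} (h : IsRealName φ x) (n : ℕ) :
    |x| + 1 ≤ 2 ^ realParam φ n := by
  obtain ⟨Φ, hE, hS⟩ := h
  exact (realParam_spec hE hS le_rfl).2

/-- The name that is computed from a given name has a bounded parameter. -/
theorem IsRealName.reduce {φ ψ : Baire} {x : ℝ} (h : IsRealName φ x)
    (hψ : ∀ n, ψ (codeStr n) = runOut (fun m => candStr m (φ (codeStr m))) n) :
    IsRealName ψ x ∧ ∀ n, realParam ψ n ≤ 2 * realParam φ (n + 5) + n + 5 := by
  obtain ⟨h1, h2⟩ := isRealName_runOut (fun i c hc => h.near hc) hψ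
    (fun n => realParam φ (n + 5) + n + 5) fun n =>
      ⟨_, le_rfl, h.exists_candStr (by omega) (by omega) (by omega)⟩
  exact ⟨h1, fun n => (h2 n _ (h.le_param (n + 5))).trans (by omega)⟩

/-! ### Names of the points of the unit interval -/

/-- The interval around `0.c` whose radius is eight times the value of the last digit. -/
def unitInt (c : List Bool) : DyadicInterval :=
  .finite (binVal c / 2 ^ c.length) (8 / 2 ^ c.length) ⟨binVal c, _, by push_cast; rfl⟩
    ⟨8, _, by push_cast; rfl⟩ (by positivity)

theorem mem_unitInt {c : List Bool} {x : ℝ} :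
    x ∈ (unitInt c).toSet ↔ |x * 2 ^ c.length - binVal c| ≤ 8 := by
  have hp : (0 : ℝ) < 2 ^ c.length := by positivity
  simp only [unitInt, DyadicInterval.toSet, Set.mem_Icc]
  push_cast
  rw [← sub_div, ← add_div, div_le_iff₀ hp, le_div_iff₀ hp, abs_le]
  constructor <;> rintro ⟨h1, h2⟩ <;> constructor <;> linarith

theorem unitInt_diamLE {c : List Bool} {m : ℕ} (h : m + 4 ≤ c.length) : (unitInt c).DiamLE m := by
  obtain ⟨j, hj⟩ := Nat.exists_eq_add_of_le h
  simp only [unitInt, DyadicInterval.DiamLE, DyadicInterval.diam, WithTop.coe_le_coe]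
  have h1 : (1 : ℚ) ≤ 2 ^ j := one_le_pow₀ (by norm_num)
  rw [← mul_div_assoc, div_le_iff₀ (by positivity), hj, pow_add, pow_add, mul_assoc,
    inv_mul_cancel_left₀ (by positivity)]
  linarith

theorem intervalCode_unitInt {c : List Bool} (h : 4 ≤ c.length) :
    IntervalCode (encStr (unitStr c) c.length 8) (unitInt c) :=
  intervalCode_encStr (r := 8) ⟨_, _, c, .single false, rfl, by simp [strSign]⟩ h (by simp)
    _ ⟨8, _, rfl⟩ (div_pos (show (0 : ℚ) < (8 : ℕ) by norm_num) (by positivity))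

theorem binVal_map_false {α : Type*} (l : List α) : binVal (l.map fun _ => false) = 0 := by
  induction l with
  | nil => rfl
  | cons b l ih => rw [List.map_cons, binVal_cons, ih]; simp

theorem binVal_map_true {α : Type*} (l : List α) :
    binVal (l.map fun _ => true) + 1 = 2 ^ l.length := by
  induction l with
  | nil => rfl
  | cons b l ih => 
    rw [List.map_cons, binVal_cons, List.length_cons, List.length_map, pow_succ, Bool.toNat_true]
    omega

theorem any_id_iff (l : List Bool) : l.any id = true ↔ 1 ≤ binVal l := by
  induction l with
  | nil => simp [binVal]
  | cons b l ih =>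
    have := Nat.one_le_two_pow (n := l.length)
    rw [List.any_cons, Bool.or_eq_true, ih, binVal_cons]
    cases b <;> simp
    omega

theorem Cand.length_clamp (c : Cand) : c.clamp.length = c.fr.length := List.length_map _

theorem Cand.Near.mem_unitInt {c : Cand} {x : ℝ} (h : c.Near x) (hx : x ∈ Set.Icc (0 : ℝ) 1) :
    x ∈ (unitInt c.clamp).toSet := by
  rw [ParSpace.mem_unitInt, Cand.length_clamp, h.len]
  have hp : (0 : ℝ) < 2 ^ c.lvl := by positivity
  have hx0 := mul_nonneg hx.1 hp.le
  have hx1 := mul_le_mul_of_nonneg_right hx.2 hp.le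
  have hn := abs_lt.1 h.near
  rw [Cand.num] at hn
  have hfr : (0 : ℝ) ≤ binVal c.fr := Nat.cast_nonneg _
  have hip : (0 : ℝ) ≤ binVal c.ip * 2 ^ c.lvl := by positivity
  rw [Cand.clamp]
  push_cast at hn
  cases hneg : c.neg
  · rw [hneg] at hn
    by_cases ha : c.ip.any id = true
    · have e : ((binVal (c.fr.map fun _ => true) : ℕ) : ℝ) + 1 = 2 ^ c.lvl := by
        rw [← h.len]
        exact_mod_cast binVal_map_true c.fr
      have h1 : (1 : ℝ) ≤ binVal c.ip := by exact_mod_cast (any_id_iff _).1 ha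
      simp only [Bool.false_eq_true, if_false, ha, if_true]
      simp only [Bool.false_eq_true, if_false] at hn
      rw [abs_le]
      constructor <;> nlinarith [hn.1, hn.2]
    · have h0 : binVal c.ip = 0 := by
        rw [any_id_iff] at ha
        omega
      simp only [Bool.false_eq_true, if_false, ha, List.map_id']
      simp only [Bool.false_eq_true, if_false, h0, Nat.cast_zero, zero_mul, zero_add, one_mul] at hn
      rw [abs_le]
      constructor <;> linarith [hn.1, hn.2]
  · rw [hneg] at hn
    simp only [if_true, binVal_map_false]
    simp only [if_true] at hn
    rw [abs_le, Nat.cast_zero]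
    constructor <;> linarith [hn.1, hn.2]

/-- The first `j + 4` digits of `c`, or those of the point `x` of the unit interval, if `c` is not
that long. -/
noncomputable def digitsNear (c : List Bool) (x : ℝ) (j : ℕ) : List Bool :=
  if j + 4 ≤ c.length then c.take (j + 4) else
    (exists_binVal_of_lt (j + 4) (min ⌊x * 2 ^ (j + 4)⌋₊ (2 ^ (j + 4) - 1))
      (by have := Nat.one_le_two_pow (n := j + 4); omega)).choose

theorem length_digitsNear (c : List Bool) (x : ℝ) (j : ℕ) : (digitsNear c x j).length = j + 4 := by
  unfold digitsNear
  split_ifs with h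
  · simpa using h
  · exact (Exists.choose_spec (_ : ∃ l : List Bool, l.length = j + 4 ∧ _)).1

/-- The number `0.c` is close to `x`, in the way in which the numbers that are used for an interval
are close to its points. -/
def CloseTo (c : List Bool) (x : ℝ) : Prop :=
  binVal c ≤ x * 2 ^ c.length ∧ x * 2 ^ c.length ≤ binVal c + 2

theorem closeTo_digitsNear {c : List Bool} {x : ℝ} (h : CloseTo c x) (hx : x ∈ Set.Icc (0 : ℝ) 1)
    (j : ℕ) : CloseTo (digitsNear c x j) x := by
  rw [CloseTo, length_digitsNear]
  have hx0 : 0 ≤ x * 2 ^ (j + 4) := mul_nonneg hx.1 (by positivity)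
  have hx1 : x * 2 ^ (j + 4) ≤ 2 ^ (j + 4) := mul_le_of_le_one_left (by positivity) hx.2
  unfold digitsNear
  split_ifs with hj
  · obtain ⟨t, ht⟩ := Nat.exists_eq_add_of_le hj
    rw [binVal_take, ht, Nat.add_sub_cancel_left]
    have hv := Nat.div_add_mod (binVal c) (2 ^ t)
    have hr := Nat.mod_lt (binVal c) (show 0 < 2 ^ t by positivity)
    have ht0 : (0 : ℝ) < 2 ^ t := by positivity
    obtain ⟨h1, h2⟩ := h
    rw [ht, pow_add, ← mul_assoc] at h1 h2
    generalize x * 2 ^ (j + 4) = y at *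
    generalize binVal c / 2 ^ t = v at *
    have e1 : (v : ℝ) * 2 ^ t ≤ y * 2 ^ t := by
      refine le_trans ?_ h1
      rw [← hv]
      push_cast
      nlinarith [Nat.cast_nonneg (α := ℝ) (binVal c % 2 ^ t)]
    have e2 : y * 2 ^ t ≤ (v + 2) * 2 ^ t := by
      refine h2.trans ?_
      have : binVal c + 2 ≤ (v + 2) * 2 ^ t := by
        rcases t with _ | t
        · omega
        · have := Nat.one_le_two_pow (n := t)
          rw [pow_succ] at *
          nlinarith
      exact_mod_cast this
    exact ⟨le_of_mul_le_mul_right e1 ht0, le_of_mul_le_mul_right e2 ht0⟩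
  · generalize_proofs hc
    rw [hc.choose_spec.2]
    have h1 := Nat.floor_le hx0
    have h2 := Nat.lt_floor_add_one (x * 2 ^ (j + 4))
    have hp : ((2 ^ (j + 4) - 1 : ℕ) : ℝ) = 2 ^ (j + 4) - 1 := by
      rw [Nat.cast_sub Nat.one_le_two_pow]
      push_cast
      rfl
    rw [Nat.cast_min, hp]
    constructor
    · exact (min_le_left _ _).trans h1
    · rw [← min_add_add_right]
      exact le_min (by linarith) (by linarith)

open Classical in
/-- A name of the point `x`, which begins with the digits `c`. -/
noncomputable def pointName (c : List Bool) (x : ℝ) : Baire := fun b =>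
  if ∃ j, b = codeStr j then encStr (unitStr (digitsNear c x (b.length - 2))) (b.length - 2 + 4) 8
  else []

theorem pointName_codeStr (c : List Bool) (x : ℝ) (j : ℕ) :
    pointName c x (codeStr j) = encStr (unitStr (digitsNear c x j)) (j + 4) 8 := by
  rw [pointName, if_pos ⟨j, rfl⟩, codeStr_length, Nat.add_sub_cancel]

theorem nameFrom_pointName (c : List Bool) (x : ℝ) : NameFrom c (pointName c x) where
  code j hj := by rw [pointName_codeStr, digitsNear, if_pos hj]
  other b hb := if_neg fun ⟨j, hj⟩ => hb j hj

theorem isRealName_pointName {c : List Bool} {x : ℝ} (h : CloseTo c x)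
    (hx : x ∈ Set.Icc (0 : ℝ) 1) :
    IsRealName (pointName c x) x ∧ ∀ n, realParam (pointName c x) n ≤ n + 1 := by
  have hl := length_digitsNear c x
  have hcl := closeTo_digitsNear h hx
  have hmem : ∀ j, x ∈ (unitInt (digitsNear c x j)).toSet := fun j => by
    obtain ⟨h1, h2⟩ := hcl j
    rw [mem_unitInt, abs_le]
    constructor <;> linarith
  have hd : ∀ j, (unitInt (digitsNear c x j)).DiamLE j := fun j => unitInt_diamLE (hl j).ge
  have hE : EncodesSeq (pointName c x) fun j => unitInt (digitsNear c x j) := by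
    refine encodesSeq_iff.2 fun j => ?_
    have := intervalCode_unitInt (c := digitsNear c x j) (by rw [hl]; omega)
    rwa [hl, ← pointName_codeStr] at this
  have hS : ShrinksTo (fun j => unitInt (digitsNear c x j)) x := by
    refine shrinksTo_of (fun j y hy => ?_) hmem fun δ hδ => ?_
    · obtain ⟨h1, h2⟩ := hcl j
      obtain ⟨h1', h2'⟩ := hcl (j + 1)
      rw [mem_unitInt, hl, abs_le] at hy ⊢
      rw [hl] at h1 h2 h1' h2'
      have e : (2 : ℝ) ^ (j + 1 + 4) = 2 ^ (j + 4) * 2 := by rw [← pow_succ]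
      rw [e, ← mul_assoc] at hy h1' h2'
      constructor <;> linarith [hy.1, hy.2]
    · obtain ⟨n, hn⟩ := exists_inv_pow_lt 1 hδ
      rw [one_div] at hn
      exact ⟨n, fun z hz => ((hd n).dist_le (hmem n) hz).trans hn⟩
  refine ⟨⟨_, hE, hS⟩, fun n => realParam_le hE hS (hd n) ?_⟩
  rw [abs_of_nonneg hx.1]
  linarith [hx.2]

/-! ### Second-order polynomials -/

namespace IsSOP

variable {P Q : (ℕ → ℕ) → ℕ → ℕ}

theorem const (c : ℕ) : IsSOP fun _ _ => c := by simpa using poly (Polynomial.C c)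

theorem arg : IsSOP fun _ n => n := by simpa using poly Polynomial.X

theorem pow (h : IsSOP P) (k : ℕ) : IsSOP fun l n => P l n ^ k := by
  induction k with
  | zero => simpa using const 1
  | succ k ih => simpa only [pow_succ] using ih.mul h

theorem comp (hP : IsSOP P) (hQ : IsSOP Q) : IsSOP fun l n => P l (Q l n) := by
  induction hP with
  | poly p =>
    induction p using Polynomial.induction_on' with
    | add p q hp hq => simpa only [Polynomial.eval_add] using hp.add hq
    | monomial k a => simpa only [Polynomial.eval_monomial] using (const a).mul (hQ.pow k)
  | app _ ih => exact ih.app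
  | add _ _ ih ih' => exact ih.add ih'
  | mul _ _ ih ih' => exact ih.mul ih'

/-- A function argument `l` may be replaced by one that bounds `l` and `n ↦ n + 1`. -/
theorem subst (hP : IsSOP P) : IsSOP fun l n => P (fun k => l k + k + 1) n := by
  induction hP with
  | poly p => exact poly p
  | app _ ih => exact (ih.app.add ih).add (const 1)
  | add _ _ ih ih' => exact ih.add ih'
  | mul _ _ ih ih' => exact ih.mul ih'

theorem mono (hP : IsSOP P) {l l' : ℕ → ℕ} (hl : ∀ n, l n ≤ l' n) (hl' : Monotone l') {n n' : ℕ}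
    (hn : n ≤ n') : P l n ≤ P l' n' := by
  induction hP with
  | poly p =>
    simp only [Polynomial.eval_eq_sum, Polynomial.sum]
    gcongr
  | app _ ih => exact (hl _).trans (hl' ih)
  | add _ _ ih ih' => exact Nat.add_le_add ih ih'
  | mul _ _ ih ih' => exact Nat.mul_le_mul ih ih'

end IsSOP

theorem OracleMachine.HaltsWithin.mono {M : OracleMachine} {φ : Baire} {a w : Str} {t t' : ℕ}
    (h : M.HaltsWithin φ a t w) (ht : t ≤ t') : M.HaltsWithin φ a t' w := by
  obtain ⟨s, hs, h⟩ := h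
  exact ⟨s, hs.trans ht, h⟩

theorem PreparametrisedSpace.monotone_param {X : Type*} {A : PreparametrisedSpace X} {φ : Baire}
    {x : X} (h : A.IsName φ x) : Monotone (A.param φ) :=
  monotone_nat_of_le_succ fun n => A.param_mono h n

/-! ### Real numbers, evaluation and products -/

/-- A machine that does nothing. -/
def idleMachine : OracleMachine where
  State := Unit
  workTapes := 0
  start := ()
  oracle := ()
  resume := ()
  halt := ()
  transition _ _ := ((), fun _ => (none, .stay))

theorem isParametrised_of_realName {X : Type*} {A : PreparametrisedSpace X} {v : X → ℝ}
    (hA : ∀ φ x, A.IsName φ x ↔ IsRealName φ (v x)) (hp : A.param = realParam) :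
    A.IsParametrised := by
  refine ⟨Compile.machine (realProg idleMachine) (Regs.init _),
    fun _ n => 4 * (3000 * (n + 1) ^ 2 + 1) ^ 2, fun l n => 2 * l (n + 5) + n + 5, ?_, ?_, ?_⟩
  · exact (IsSOP.const 4).mul (.pow (.add (.mul (.const _) (.pow (.add .arg (.const 1)) 2))
      (.const 1)) 2)
  · exact .add (.add (.mul (.const 2) (.app (.add .arg (.const 5)))) .arg) (.const 5)
  · intro φ x h
    rw [hp]
    have h' := (hA φ x).1 h
    have key := h'.reduce (ψ := fun a => runOut (fun m => candStr m (φ (codeStr m))) (a.length - 2))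
      fun n => by rw [codeStr_length, Nat.add_sub_cancel]
    exact ⟨_, fun a => realProg_halts _ φ a, (hA _ x).2 key.1, key.2⟩

theorem isParametrised_intervalReals : intervalReals.IsParametrised :=
  isParametrised_of_realName (v := id) (fun _ _ => Iff.rfl) rfl

theorem isParametrised_intervalUnit : intervalUnit.IsParametrised :=
  isParametrised_of_realName (v := Subtype.val) (fun _ _ => Iff.rfl) rfl

theorem IsParametrised.prod_intervalUnit {Z : Type*} {SZ : PreparametrisedSpace Z}
    (hZ : SZ.IsParametrised) : (SZ.prod intervalUnit).IsParametrised := by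
  obtain ⟨M, P, Q, hP, hQ, hM⟩ := hZ
  refine ⟨Compile.machine (prodProg M) (Regs.init _), fun l n =>
    4 * (5000 * (n + P l n + 3) ^ 2 + 1) ^ 2, fun l n => Q l n + (2 * l (n + 5) + n + 5), ?_, ?_, ?_⟩
  · exact (IsSOP.const 4).mul (.pow (.add (.mul (.const _) (.pow (.add (.add .arg hP) (.const 3)) 2))
      (.const 1)) 2)
  · exact hQ.add (.add (.add (.mul (.const 2) (.app (.add .arg (.const 5)))) .arg) (.const 5))
  · rintro _ ⟨z, x⟩ ⟨φ, χ, rfl, hz, hx⟩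
    obtain ⟨ψ, h1, h2, h3⟩ := hM φ z hz
    have hx' : IsRealName χ x := hx
    have hmono := (SZ.prod intervalUnit).monotone_param (x := (z, x)) ⟨φ, χ, rfl, hz, hx⟩
    have hlz : ∀ n, SZ.param φ n ≤ (SZ.prod intervalUnit).param (bairePair φ χ) n :=
      fun n => le_max_left _ _
    have hlx : ∀ n, realParam χ n ≤ (SZ.prod intervalUnit).param (bairePair φ χ) n :=
      fun n => le_max_right _ _
    set l := (SZ.prod intervalUnit).param (bairePair φ χ)
    have key := hx'.reduce (ψ := fun a => runOut (fun m => candStr m (χ (codeStr m))) (a.length - 2))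
      fun n => by rw [codeStr_length, Nat.add_sub_cancel]
    set ψ' : Baire := fun a => runOut (fun m => candStr m (χ (codeStr m))) (a.length - 2)
    have h64 : ∀ t, 64 ≤ 4 * (5000 * (t + 3) ^ 2 + 1) ^ 2 := fun t =>
      le_trans (by norm_num : 64 ≤ 4 * (5000 * 1 ^ 2 + 1) ^ 2) (by gcongr; omega)
    refine ⟨bairePair ψ ψ', fun a => ?_, ⟨ψ, ψ', rfl, h2, key.1⟩, fun n => ?_⟩
    · rcases a with _ | ⟨(_ | _) | _, a⟩
      · exact (prodProg_halts_other M _ _ (by simp)).mono (h64 _)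
      · refine (prodProg_halts_fst M (bairePair φ χ) a (ψ a) _ (h1 a)).mono ?_
        have := hP.mono hlz hmono (show a.length ≤ a.length + 1 by omega)
        simp only [List.length_cons]
        gcongr <;> omega
      · refine (prodProg_halts_snd M (bairePair φ χ) a).mono ?_
        simp only [List.length_cons]
        gcongr <;> omega
      · exact (prodProg_halts_other M _ _ (by simp)).mono (h64 _)
    · refine max_le ((h3 n).trans ?_) ((key.2 n).trans ?_)
      · have := hQ.mono hlz hmono (le_refl n)
        dsimp only
        omega
      · have := hlx (n + 5)
        dsimp only
        omega

theorem IsFunName.mem {Ψ : DyadicInterval → DyadicInterval} {f : C(unitInterval, ℝ)}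
    (h : ∀ (Φ : ℕ → DyadicInterval) (x : unitInterval),
      ShrinksTo Φ x → ShrinksTo (fun n => Ψ (Φ n)) (f x)) {J : DyadicInterval} {x : unitInterval}
    (hx : (x : ℝ) ∈ J.toSet) : f x ∈ (Ψ J).toSet := by
  obtain ⟨Φ, rfl, hΦ⟩ := exists_shrinksTo_from J hx
  exact (h Φ x hΦ).mem 0

theorem funParam_eq {χ : Baire} {Ψ : DyadicInterval → DyadicInterval} {f : C(unitInterval, ℝ)}
    (hE : EncodesFun χ Ψ) (h : ∀ (Φ : ℕ → DyadicInterval) (x : unitInterval),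
      ShrinksTo Φ x → ShrinksTo (fun n => Ψ (Φ n)) (f x)) (n : ℕ) :
    funParam χ n = ⌈Real.logb 2 (|‖f‖| + 1)⌉₊ + sInf {N | ∀ J : DyadicInterval,
      (J.toSet ∩ Set.Icc 0 1).Nonempty → J.DiamLE N → (Ψ J).DiamLE n} := by
  have e1 : Classical.epsilon (IsFunName χ) = f :=
    (Classical.epsilon_spec (⟨f, Ψ, hE, h⟩ : ∃ g, IsFunName χ g)).unique ⟨Ψ, hE, h⟩
  rw [funParam, e1, abs_norm]
  congr 2
  ext N
  exact ⟨fun ⟨Ψ', h, h'⟩ => hE.unique h ▸ h', fun h => ⟨Ψ, hE, h⟩⟩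

theorem exists_evalCand {ψ φ : Baire} {f : C(unitInterval, ℝ)} {x : unitInterval}
    (hψ : IsFunName ψ f) (hφ : IsRealName φ x) :
    (∀ i c, evalCand (bairePair ψ φ) i = some c → c.Near (f x)) ∧
      ∀ n i, 4 ≤ n → n ≤ i → funParam ψ n + 4 ≤ i → realParam φ (funParam ψ n + 4) ≤ i →
        |f x| + 1 ≤ 2 ^ funParam ψ n ∧ ∃ c, evalCand (bairePair ψ φ) i = some c ∧ n ≤ c.lvl := by
  obtain ⟨Ψ, hE, h⟩ := hψ
  have hcode : ∀ {c : Cand}, c.Near x → IntervalCode (ψ (encStr (unitStr c.clamp) c.lvl 8))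
      (Ψ (unitInt c.clamp)) := fun {c} hc => hE _ _ (by
    have := intervalCode_unitInt (c := c.clamp) (by rw [Cand.length_clamp, hc.len]; exact hc.four)
    rwa [Cand.length_clamp, hc.len] at this)
  constructor
  · intro i c hc
    obtain ⟨d, hd, hc⟩ := Option.bind_eq_some_iff.1 hc
    have hd' := hφ.near hd
    exact candStr_near (hcode hd') hc (IsFunName.mem h (hd'.mem_unitInt x.2))
  · intro n i h4 hn hi hr
    obtain ⟨d, hd, hdl⟩ := hφ.exists_candStr (by omega) hr hi
    have hd' := hφ.near hd
    have hx := hd'.mem_unitInt x.2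
    have hp := funParam_eq hE h n
    have hs := Nat.sInf_mem (s := {N | ∀ J : DyadicInterval, (J.toSet ∩ Set.Icc 0 1).Nonempty →
      J.DiamLE N → (Ψ J).DiamLE n}) (exists_modulus h n)
    have hdiam := hs _ ⟨x, hx, x.2⟩ (unitInt_diamLE (by rw [Cand.length_clamp, hd'.len]; omega))
    have hfx : |f x| + 1 ≤ 2 ^ funParam ψ n := by
      have h1 := ceil_logb_le.1 (show ⌈Real.logb 2 (|‖f‖| + 1)⌉₊ ≤ funParam ψ n by omega)
      have h2 := f.norm_coe_le_norm x
      rw [abs_norm] at h1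
      rw [Real.norm_eq_abs] at h2
      linarith
    refine ⟨hfx, ?_⟩
    obtain ⟨c, hc, hl⟩ := exists_candStr (hcode hd') hdiam h4 hn (IsFunName.mem h hx)
      (hfx.trans (pow_le_pow_right₀ (by norm_num) (show funParam ψ n ≤ i by omega)))
    exact ⟨c, Option.bind_eq_some_iff.2 ⟨d, hd, hc⟩, hl⟩

theorem polytimeComputable_eval : PolytimeComputable (intervalFunctions.prod intervalUnit)
    intervalReals fun p => p.1 p.2 := by
  refine ⟨Compile.machine (evalProg idleMachine) (Regs.init _),
    fun _ n => 4 * (5000 * (n + 1) ^ 2 + 1) ^ 2,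
    -- level `n + 5` suffices for diameter `2 ^ (-n)`, and the interval around an approximation with
    -- `k` digits has radius `8 * 2 ^ (-k)`, which accounts for the `4`
    fun l n => l (l (n + 5) + 4) + l (n + 5) + n + 9 + l (n + 5), ?_, ?_, ?_⟩
  · exact (IsSOP.const 4).mul (.pow (.add (.mul (.const _) (.pow (.add .arg (.const 1)) 2))
      (.const 1)) 2)
  · have h5 : IsSOP fun l n => l (n + 5) := .app (.add .arg (.const 5))
    exact .add (.add (.add (.add (.app (.add h5 (.const 4))) h5) .arg) (.const 9)) h5
  · rintro _ ⟨f, x⟩ ⟨ψ, φ, rfl, hf, hx⟩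
    have hf' : IsFunName ψ f := hf
    have hx' : IsRealName φ x := hx
    have hlf : ∀ n, funParam ψ n ≤ (intervalFunctions.prod intervalUnit).param (bairePair ψ φ) n :=
      fun n => le_max_left _ _
    have hlx : ∀ n, realParam φ n ≤ (intervalFunctions.prod intervalUnit).param (bairePair ψ φ) n :=
      fun n => le_max_right _ _
    set l := (intervalFunctions.prod intervalUnit).param (bairePair ψ φ)
    obtain ⟨h1, h2⟩ := exists_evalCand hf' hx'
    have hb : ∀ n, realParam φ (funParam ψ (n + 5) + 4) ≤ l (l (n + 5) + 4) := fun n =>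
      (hx'.monotone_param (by have := hlf (n + 5); omega)).trans (hlx _)
    have h3 := fun n => h2 (n + 5) (l (l (n + 5) + 4) + l (n + 5) + n + 9) (by omega) (by omega)
      (by have := hlf (n + 5); omega) (by have := hb n; omega)
    obtain ⟨h4, h5⟩ := isRealName_runOut
      (ψ := fun a => runOut (evalCand (bairePair ψ φ)) (a.length - 2)) h1
      (fun n => by rw [codeStr_length, Nat.add_sub_cancel])
      (fun n => l (l (n + 5) + 4) + l (n + 5) + n + 9) fun n => ⟨_, le_rfl, (h3 n).2⟩
    exact ⟨_, fun a => evalProg_halts _ _ a, h4, fun n => (h5 n _ (h3 n).1).trans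
      (Nat.add_le_add_left (hlf _) _)⟩

/-! ### The dyadic numbers that are used for an interval -/

theorem arith_spec (sg : Bool) (l : List (Bool × Bool)) :
    binVal (l.map Prod.fst) + binVal (l.map Prod.snd) =
        binVal (arith sg l).2.1 + (arith sg l).1.1.toNat * 2 ^ l.length ∧
      (bif sg then binVal (l.map Prod.snd) else binVal (l.map Prod.fst)) +
          (arith sg l).1.2.toNat * 2 ^ l.length =
        (bif sg then binVal (l.map Prod.fst) else binVal (l.map Prod.snd)) +
          binVal (arith sg l).2.2 := by
  induction l with
  | nil => cases sg <;> exact ⟨rfl, rfl⟩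
  | cons p l ih =>
    obtain ⟨h1, h2⟩ := length_arith sg l
    obtain ⟨a, b⟩ := p
    have e : arith sg ((a, b) :: l) = (((a && b) || ((arith sg l).1.1 && (a ^^ b)),
        (!(bif sg then b else a) && (bif sg then a else b)) ||
          ((arith sg l).1.2 && !((bif sg then b else a) ^^ (bif sg then a else b)))),
        (a ^^ b ^^ (arith sg l).1.1) :: (arith sg l).2.1,
        ((bif sg then b else a) ^^ (bif sg then a else b) ^^ (arith sg l).1.2) ::
          (arith sg l).2.2) := rfl
    rw [e]
    generalize arith sg l = r at *
    obtain ⟨⟨cy, bw⟩, S, D⟩ := r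
    obtain ⟨h3, h4⟩ := ih
    simp only [List.map_cons, binVal_cons, h1, h2, List.length_map, List.length_cons, pow_succ]
    revert h3 h4
    generalize 2 ^ l.length = t
    cases sg <;> cases a <;> cases b <;> cases cy <;> cases bw <;> intro h3 h4 <;>
      simp at h3 h4 ⊢ <;> omega

/-- The digits of the end points give the end points, cut off to the unit interval. -/
theorem binVal_endDigits {L n : ℕ} {X Y : Str} {p q : ℕ}
    (hp : binVal (takeBits L (fracPart X).tail) = p) (hq : binVal (takeBits L (dropSign Y).tail) = q)
    (hn : (intDigits X = 0 ∧ n = 0) ∨ (intDigits X = 1 ∧ n = 1) ∨ (intDigits X = 2 ∧ 2 ≤ n)) {z : ℤ}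
    (hz : z = (if isNeg X then -1 else 1) * (n * 2 ^ L + p : ℕ)) :
    (binVal (endDigits L X Y).1 : ℤ) = min (max (z - q) 0) (2 ^ L - 1) ∧
      (binVal (endDigits L X Y).2 : ℤ) = min (max (z + q) 0) (2 ^ L - 1) := by
  have hpl := binVal_lt (takeBits L (fracPart X).tail)
  have hql := binVal_lt (takeBits L (dropSign Y).tail)
  obtain ⟨h1, h2⟩ := arith_spec (isNeg X)
    ((takeBits L (fracPart X).tail).zip (takeBits L (dropSign Y).tail))
  obtain ⟨l1, l2⟩ := length_arith (isNeg X)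
    ((takeBits L (fracPart X).tail).zip (takeBits L (dropSign Y).tail))
  rw [List.map_fst_zip (by simp [length_takeBits']), List.map_snd_zip (by simp [length_takeBits']),
    List.length_zip, length_takeBits', length_takeBits', min_self, hp, hq] at h1 h2
  rw [List.length_zip, length_takeBits', length_takeBits', min_self] at l1 l2
  rw [length_takeBits'] at hpl hql
  rw [hp] at hpl
  rw [hq] at hql
  rw [endDigits]
  dsimp only
  generalize arith (isNeg X) ((takeBits L (fracPart X).tail).zip (takeBits L (dropSign Y).tail)) = r
    at *
  obtain ⟨⟨cy, bw⟩, S, D⟩ := r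
  have hS := binVal_lt S
  have hD := binVal_lt D
  have t1 := binVal_map_true D
  have t2 := binVal_map_true (S.zip D)
  have f1 := binVal_map_false D
  have f2 := binVal_map_false (S.zip D)
  have e1 : binVal ((S.zip D).map fun p => p.1) = binVal S := by
    rw [List.map_fst_zip (by simp [l1, l2])]
  have e2 : binVal ((S.zip D).map fun p => p.2) = binVal D := by
    rw [List.map_snd_zip (by simp [l1, l2])]
  have hW : ((2 ^ L : ℕ) : ℤ) = 2 ^ L := by push_cast; rfl
  have hlz : (S.zip D).length = L := by simpa [l1] using l2.ge
  have hsel : ∀ a b c, selLow a b c = fun d => if a then false else if b = 0 then (!c && d) else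
      if b = 1 then (!c || d) else true := fun _ _ _ => rfl
  dsimp only at l1 l2 h1 h2
  rw [l1] at hS
  rw [l2] at hD t1
  rw [hlz] at t2
  rw [← hW]
  have hnW : 2 ≤ n → 2 * 2 ^ L ≤ n * 2 ^ L := Nat.mul_le_mul_right _
  generalize hWd : 2 ^ L = W at *
  generalize hnWd : n * W = V at *
  rcases hn with ⟨hi, rfl⟩ | ⟨hi, rfl⟩ | ⟨hi, hn⟩ <;> rw [hi] <;>
    cases hs : isNeg X <;> cases cy <;> cases bw <;>
    simp [hs, hsel, selHigh, e1, e2, f1, f2,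
      -List.map_const', -List.map_const] at hz h1 h2 hnWd hnW ⊢ <;>
    omega

theorem decBits_spec (b : Bool) (l : List Bool) :
    (decBits b l).1.toNat * 2 ^ l.length + binVal l = binVal (decBits b l).2 + b.toNat := by
  induction l with
  | nil => simp [decBits, binVal]
  | cons x l ih =>
    have e : decBits b (x :: l) =
        ((decBits b l).1 && !x, (x ^^ (decBits b l).1) :: (decBits b l).2) := rfl
    rw [e, binVal_cons, binVal_cons, length_decBits, List.length_cons, pow_succ]
    revert ih
    generalize (decBits b l).1 = w
    generalize 2 ^ l.length = t
    cases x <;> cases w <;> intro ih <;> simp at ih ⊢ <;> omega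

theorem mem_jobsAt {pre c : List Bool} {δ nz : Fin 3} {v : ℕ} (hv : binVal pre ≤ v)
    (hδ : δ.val = min 2 (v - binVal pre)) (hnz : nz = 0 ↔ binVal pre = 0) :
    c ∈ jobsAt pre δ nz ↔ c.length = pre.length ∧ binVal c ≤ binVal pre ∧ v ≤ binVal c + 1 := by
  have hc : ∀ b : Bool, b.toNat ≤ binVal pre → (c = (decBits b pre).2 ↔
      c.length = pre.length ∧ binVal c + b.toNat = binVal pre) := by
    intro b hb
    have h1 := decBits_spec b pre
    have h2 := length_decBits b pre
    have h3 := binVal_lt (decBits b pre).2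
    have h4 := binVal_lt pre
    rw [h2] at h3
    have h5 : (decBits b pre).1 = false := by
      cases h : (decBits b pre).1
      · rfl
      · rw [h, Bool.toNat_true, one_mul] at h1
        omega
    rw [h5, Bool.toNat_false, zero_mul, zero_add] at h1
    constructor
    · rintro rfl
      exact ⟨h2, h1.symm⟩
    · rintro ⟨h6, h7⟩
      exact binVal_inj (h6.trans h2.symm) (by omega)
  have h0 := hc false (Nat.zero_le _)
  have h1 := hc true
  simp only [Bool.toNat_false, Bool.toNat_true, add_zero] at h0 h1
  have m1 : (c ∈ if δ ≤ 1 then [(decBits false pre).2] else []) ↔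
      δ.val ≤ 1 ∧ c = (decBits false pre).2 := by
    rw [show δ.val ≤ 1 ↔ δ ≤ 1 from Iff.rfl]
    split_ifs with h <;> simp [h]
  have m2 : (c ∈ if δ = 0 ∧ nz ≠ 0 then [(decBits true pre).2] else []) ↔
      (δ.val = 0 ∧ binVal pre ≠ 0) ∧ c = (decBits true pre).2 := by
    rw [show δ.val = 0 ↔ δ = 0 by rw [Fin.ext_iff]; rfl, ne_eq (binVal pre), ← hnz]
    split_ifs with h
    · simp [h]
    · simpa using fun h1 h2 => absurd ⟨h1, h2⟩ h
  rw [jobsAt, List.mem_append, m1, m2, h0]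
  rcases Nat.eq_zero_or_pos (binVal pre) with hp | hp
  · simp only [hp, ne_eq, not_true_eq_false, and_false, false_and, or_false]
    omega
  · rw [h1 hp]
    omega

theorem mem_jobsFrom {n : ℕ} {pre pre' c : List Bool} {δ nz : Fin 3} {l : List (Bool × Bool)}
    (hn : n ≤ l.length) (hδ : δ.val = min 2 (binVal pre' - binVal pre))
    (hnz : nz = 0 ↔ binVal pre = 0) (hle : ∀ m ≤ l.length,
      binVal (pre ++ (l.map Prod.fst).take m) ≤ binVal (pre' ++ (l.map Prod.snd).take m)) :
    c ∈ jobsFrom n pre δ nz l ↔ ∃ m, 1 ≤ m ∧ m ≤ n ∧ c.length = pre.length + m ∧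
      binVal c ≤ binVal (pre ++ (l.map Prod.fst).take m) ∧
      binVal (pre' ++ (l.map Prod.snd).take m) ≤ binVal c + 1 := by
  induction n generalizing pre pre' δ nz l with
  | zero => simp only [jobsFrom, List.not_mem_nil, false_iff, not_exists]; omega
  | succ n ih =>
    rcases l with _ | ⟨⟨a, b⟩, l⟩
    · simp at hn
    have hl0 := hle 0 (Nat.zero_le _)
    have hl1 := hle 1 (by simp)
    simp only [List.map_cons, List.take_zero, List.take_succ_cons, List.append_nil,
      binVal_append_bit] at hl0 hl1
    have hδ' : (nextDiff δ a b).val =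
        min 2 (binVal (pre' ++ [b]) - binVal (pre ++ [a])) := by
      rw [binVal_append_bit, binVal_append_bit]
      obtain ⟨d, hd⟩ := δ
      dsimp only at hδ
      have : d = 0 ∨ d = 1 ∨ d = 2 := by omega
      rcases this with rfl | rfl | rfl <;> cases a <;> cases b <;> simp [nextDiff] at hl1 ⊢ <;> omega
    have hnz' : (if a then 1 else nz) = 0 ↔ binVal (pre ++ [a]) = 0 := by
      rw [binVal_append_bit]
      cases a <;> simp [hnz]
    rw [jobsFrom, List.mem_append, mem_jobsAt (v := binVal (pre' ++ [b])) (by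
      simpa only [binVal_append_bit] using hl1) hδ' hnz', ih (by simpa using hn) hδ' hnz']
    · constructor
      · rintro (⟨h1, h2⟩ | ⟨m, h1, h2, h3, h4⟩)
        · exact ⟨1, le_rfl, by omega, by simpa using h1, by simpa using h2⟩
        · exact ⟨m + 1, by omega, by omega, by simp at h3; omega, by simpa using h4⟩
      · rintro ⟨_ | _ | m, h1, h2, h3, h4⟩
        · omega
        · exact .inl ⟨by simpa using h3, by simpa using h4⟩
        · exact .inr ⟨m + 1, by omega, by omega, by simp; omega, by simpa using h4⟩
    · intro m hm
      simpa using hle (m + 1) (by simpa using hm)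

theorem le_zeros_iff {l : List Bool} (h : 0 < binVal l) (m : ℕ) :
    m ≤ zeros l ↔ binVal l * 2 ^ m < 2 ^ l.length := by
  induction l generalizing m with
  | nil => simp [binVal] at h
  | cons b l ih =>
    rw [binVal_cons] at h ⊢
    have h2 := Nat.one_le_two_pow (n := m)
    have hl := binVal_lt l
    cases b
    · rcases m with _ | m
      · simp [pow_succ]
        omega
      · simp only [Bool.toNat_false, zero_mul, zero_add] at h ⊢
        rw [List.length_cons, pow_succ, pow_succ, ← mul_assoc, Nat.mul_lt_mul_right (by norm_num),
          ← ih h]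
        simp [zeros]
    · simp only [zeros, Bool.toNat_true, one_mul, List.length_cons]
      rw [List.takeWhile_cons_of_neg (by simp), List.length_nil, Nat.le_zero, pow_succ]
      rcases m with _ | m
      · simp
        omega
      · have := Nat.one_le_two_pow (n := m)
        rw [pow_succ]
        have := Nat.mul_le_mul (Nat.le_add_right (2 ^ l.length) (binVal l))
          (Nat.mul_le_mul_right 2 this)
        omega

/-- The number `0.c` is used for the interval `J`: the length of `J` is less than `2` in units of
the last digit, and all numbers of `J`, after they have been cut off to the unit interval, are at
most `2` such units larger than `0.c`. -/
structure IsJob (J : DyadicInterval) (c : List Bool) : Prop where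
  pos : 1 ≤ c.length
  short : ∀ x ∈ J.toSet, ∀ y ∈ J.toSet, (y - x) * 2 ^ c.length < 2
  low : binVal c = 0 ∨ ∀ x ∈ J.toSet, binVal c ≤ x * 2 ^ c.length
  high : 2 ^ c.length ≤ binVal c + 2 ∨ ∀ x ∈ J.toSet, x * 2 ^ c.length < binVal c + 2

theorem IsJob.anti {J J' : DyadicInterval} {c : List Bool} (h : IsJob J c)
    (hJ : J'.toSet ⊆ J.toSet) : IsJob J' c :=
  ⟨h.pos, fun x hx y hy => h.short x (hJ hx) y (hJ hy), h.low.imp_right fun h x hx => h x (hJ hx),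
    h.high.imp_right fun h x hx => h x (hJ hx)⟩

theorem IsJob.closeTo {J : DyadicInterval} {c : List Bool} (h : IsJob J c) {x : ℝ}
    (hx : x ∈ J.toSet) : CloseTo c (max 0 (min 1 x)) := by
  have hp : (0 : ℝ) < 2 ^ c.length := by positivity
  have hv : (binVal c : ℝ) + 1 ≤ 2 ^ c.length := by exact_mod_cast binVal_lt c
  have h0 : (0 : ℝ) ≤ binVal c := Nat.cast_nonneg _
  have e : max 0 (min 1 x) * 2 ^ c.length = max 0 (min (2 ^ c.length) (x * 2 ^ c.length)) := by
    rw [max_mul_of_nonneg _ _ hp.le, min_mul_of_nonneg _ _ hp.le, zero_mul, one_mul]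
  rw [CloseTo, e]
  constructor
  · rcases h.low with hl | hl
    · rw [hl, Nat.cast_zero]
      exact le_max_left _ _
    · exact le_max_of_le_right (le_min (by linarith) (hl x hx))
  · refine max_le (by linarith) ?_
    rcases h.high with hh | hh
    · refine (min_le_left _ _).trans ?_
      exact_mod_cast hh
    · exact (min_le_right _ _).trans (hh x hx).le

theorem exists_isJob {J : DyadicInterval} {m : ℕ} (hm : 1 ≤ m) (hJ : J.DiamLE (m + 1)) :
    ∃ c, c.length = m ∧ IsJob J c := by
  cases J with
  | infinite => simp [DyadicInterval.DiamLE, DyadicInterval.diam] at hJ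
  | finite r ε hr hε pos =>
    have h := hJ.dist_le (x := r - ε) (y := r + ε) ⟨le_rfl, by
      have : (0 : ℝ) < ε := by exact_mod_cast pos
      linarith⟩ ⟨by have : (0 : ℝ) < ε := by exact_mod_cast pos
                    linarith, le_rfl⟩
    have hp : (0 : ℝ) < 2 ^ m := by positivity
    have h' : ((r + ε) - (r - ε) : ℝ) * 2 ^ m < 1 := by
      have h1 := mul_le_mul_of_nonneg_right ((le_abs_self _).trans h) hp.le
      rw [pow_succ, mul_inv, mul_right_comm, inv_mul_cancel₀ hp.ne'] at h1
      linarith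
    obtain ⟨c, rfl, hc⟩ := exists_binVal_of_lt m (min ⌊((r - ε : ℝ)) * 2 ^ m⌋₊ (2 ^ m - 1))
      (by have := Nat.one_le_two_pow (n := m); omega)
    refine ⟨c, rfl, hm, fun x hx y hy => ?_, ?_, ?_⟩
    · nlinarith [hx.1, hy.2]
    · rcases Nat.eq_zero_or_pos (binVal c) with h0 | h0
      · exact .inl h0
      · refine .inr fun x hx => ?_
        have h1 : binVal c ≤ ⌊((r - ε : ℝ)) * 2 ^ c.length⌋₊ := hc ▸ min_le_left _ _
        have h2 := (Nat.le_floor_iff' h0.ne').1 h1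
        exact h2.trans (mul_le_mul_of_nonneg_right hx.1 hp.le)
    · by_cases h0 : 2 ^ c.length ≤ binVal c + 2
      · exact .inl h0
      · refine .inr fun x hx => ?_
        have h1 : binVal c = ⌊((r - ε : ℝ)) * 2 ^ c.length⌋₊ := by omega
        have h2 := Nat.lt_floor_add_one ((r - ε : ℝ) * 2 ^ c.length)
        rw [← h1] at h2
        have := mul_le_mul_of_nonneg_right hx.2 hp.le
        linarith

theorem intDigits_eq {X : Str} {l u : List Bool}
    (hX : dropSign X = l.map .bit ++ .sep :: u.map .bit) (hl : l = [] ∨ ∃ l', l = true :: l') :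
    (fracPart X = .sep :: u.map .bit) ∧ ((intDigits X = 0 ∧ binVal l = 0) ∨
      (intDigits X = 1 ∧ binVal l = 1) ∨ (intDigits X = 2 ∧ 2 ≤ binVal l)) ∧
      (beginsSep (fracPart X) = true) := by
  have hb : ∀ x ∈ l.map Letter.bit, x.isBit = true := by
    simp only [List.mem_map]
    rintro _ ⟨b, -, rfl⟩
    rfl
  have e1 : fracPart X = .sep :: u.map .bit := by
    rw [fracPart, hX, List.dropWhile_append_of_pos hb, 
      List.dropWhile_cons_of_neg (by simp [Letter.isBit])]
  refine ⟨e1, ?_, by rw [e1]; rfl⟩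
  have e2 : intDigits X = l.foldl (fun n _ => if n = 0 then 1 else 2) 0 := by
    rw [intDigits, hX, List.takeWhile_append_of_pos hb, 
      List.takeWhile_cons_of_neg (by simp [Letter.isBit]), List.append_nil, List.foldl_map]
  rw [e2]
  rcases hl with rfl | ⟨_ | ⟨b, l⟩, rfl⟩
  · exact .inl ⟨rfl, rfl⟩
  · exact .inr (.inl ⟨rfl, rfl⟩)
  · have h2 : ∀ l : List Bool, l.foldl (fun (n : Fin 3) _ => if n = 0 then 1 else 2) 2 = 2 := by
      intro l
      induction l with
      | nil => rfl
      | cons x l ih => exact ih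
    refine .inr (.inr ⟨h2 l, ?_⟩)
    · have := Nat.one_le_two_pow (n := l.length)
      simp only [binVal_cons, List.length_cons, pow_succ, Bool.toNat_true]
      omega

/-- The digits `A` and `B` of the end points of `[r - ε, r + ε]`, cut off to the unit interval,
decide how the interval lies with respect to the number `0.c`. -/
theorem take_iff {L q : ℕ} {z : ℤ} {r ε : ℝ} {A B c : List Bool} (hrz : r * 2 ^ L = z)
    (hεq : ε * 2 ^ L = q) (lA : A.length = L) (lB : B.length = L)
    (hA : (binVal A : ℤ) = min (max (z - q) 0) (2 ^ L - 1))
    (hB : (binVal B : ℤ) = min (max (z + q) 0) (2 ^ L - 1)) (hcL : c.length ≤ L) :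
    (binVal c ≤ binVal (A.take c.length) ↔
      binVal c = 0 ∨ ∀ x ∈ Set.Icc (r - ε) (r + ε), binVal c ≤ x * 2 ^ c.length) ∧
    (binVal (B.take c.length) ≤ binVal c + 1 ↔ 2 ^ c.length ≤ binVal c + 2 ∨
      ∀ x ∈ Set.Icc (r - ε) (r + ε), x * 2 ^ c.length < binVal c + 2) := by
  have hε : 0 ≤ ε := nonneg_of_mul_nonneg_left (by rw [hεq]; positivity)
    (by positivity : (0 : ℝ) < 2 ^ L)
  have hW : 2 ^ c.length * 2 ^ (L - c.length) = 2 ^ L := by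
    rw [← pow_add, Nat.add_sub_cancel' hcL]
  have hWr : (2 : ℝ) ^ c.length * 2 ^ (L - c.length) = 2 ^ L := by exact_mod_cast hW
  have hT : 0 < 2 ^ (L - c.length) := by positivity
  have hTr : (0 : ℝ) < 2 ^ (L - c.length) := by positivity
  have i1 : (∀ x ∈ Set.Icc (r - ε : ℝ) (r + ε), binVal c ≤ x * 2 ^ c.length) ↔
      ((binVal c * 2 ^ (L - c.length) : ℕ) : ℤ) ≤ z - q := by
    rw [← Int.cast_le (R := ℝ)]
    push_cast
    rw [← hrz, ← hεq, ← sub_mul, ← hWr, ← mul_assoc, mul_le_mul_iff_left₀ hTr]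
    exact ⟨fun h => h _ ⟨le_rfl, by linarith⟩, fun h x hx =>
      h.trans (mul_le_mul_of_nonneg_right hx.1 (by positivity))⟩
  have i2 : (∀ x ∈ Set.Icc (r - ε : ℝ) (r + ε), x * 2 ^ c.length < binVal c + 2) ↔
      z + q < ((binVal c + 2) * 2 ^ (L - c.length) : ℕ) := by
    rw [← Int.cast_lt (R := ℝ)]
    push_cast
    rw [← hrz, ← hεq, ← add_mul, ← hWr, ← mul_assoc, mul_lt_mul_iff_left₀ hTr]
    exact ⟨fun h => h _ ⟨by linarith, le_rfl⟩, fun h x hx =>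
      (mul_le_mul_of_nonneg_right hx.2 (by positivity)).trans_lt h⟩
  have i3 : 2 ^ c.length ≤ binVal c + 2 ↔ 2 ^ L ≤ (binVal c + 2) * 2 ^ (L - c.length) := by
    rw [← hW, Nat.mul_le_mul_right_iff hT]
  have hVW := Nat.mul_le_mul_right (2 ^ (L - c.length)) (binVal_lt c)
  have i5 : binVal c = 0 ↔ binVal c * 2 ^ (L - c.length) = 0 := by simp
  have i6 : binVal B / 2 ^ (L - c.length) ≤ binVal c + 1 ↔
      binVal B < (binVal c + 2) * 2 ^ (L - c.length) := by
    rw [← Nat.div_lt_iff_lt_mul hT]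
    omega
  rw [i1, i2, i3, i5, binVal_take, binVal_take, lA, lB, Nat.le_div_iff_mul_le hT, i6]
  rw [Nat.succ_mul, hW] at hVW
  have hWz : ((2 ^ L : ℕ) : ℤ) = 2 ^ L := by push_cast; rfl
  rw [← hWz] at hA hB
  rw [Nat.add_mul (binVal c) 2]
  generalize binVal c * 2 ^ (L - c.length) = V at hVW ⊢
  generalize 2 ^ (L - c.length) = T at hVW hT ⊢
  generalize 2 ^ L = W at hA hB hVW ⊢
  generalize binVal A = a at hA ⊢
  generalize binVal B = b at hB ⊢
  clear hrz hεq i1 i2 i3 i5 i6 hWz hW hWr hTr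
  constructor <;> omega

/-- The numbers that are used for an interval do not depend on the code of the interval. -/
theorem mem_jobs_iff {s : Str} {J : DyadicInterval} (h : IntervalCode s J) (c : List Bool) :
    c ∈ jobs s ↔ IsJob J c := by
  cases h with
  | infinite =>
    refine iff_of_false (by simp [jobs, jobsFrom, Nat.le_zero.1 (endLevel_le 0 _ _)])
      fun h => ?_
    have := h.short 0 trivial 2 trivial
    have : (1 : ℝ) ≤ 2 ^ c.length := one_le_pow₀ (by norm_num)
    linarith
  | @finite a b r ε hr hε pos ha hb =>
    obtain ⟨k, k', hk, hk', e⟩ := tracks_strPair a b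
    rw [jobs, e]
    set L := (strPair a b).length
    obtain ⟨l, u, hX, hl, hu, hr'⟩ := (ha.pad k).digits
    obtain ⟨l', u', hY, hl', hu', hε'⟩ := (hb.pad k').digits
    rw [List.length_append, List.length_replicate] at hu hu'
    rw [List.take_of_length_le (by simp; omega), List.take_of_length_le (by simp; omega)]
    set X := a ++ List.replicate k (.bit false)
    set Y := b ++ List.replicate k' (.bit false)
    obtain ⟨hfX, hn, hsX⟩ := intDigits_eq hX hl
    have hp : binVal (takeBits L (fracPart X).tail) = binVal u * 2 ^ (L - u.length) := by
      rw [hfX]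
      exact binVal_takeBits_of_le (by omega)
    have hpow : ∀ v : List Bool, v.length ≤ L → (binVal v : ℝ) / 2 ^ v.length * 2 ^ L =
        (binVal v * 2 ^ (L - v.length) : ℕ) := by
      intro v hv
      have : (2 : ℝ) ^ L = 2 ^ (L - v.length) * 2 ^ v.length := by
        rw [← pow_add, Nat.sub_add_cancel hv]
      rw [this]
      push_cast
      field_simp
    have hpu := hpow u (by omega)
    rw [← hp] at hpu
    generalize hpd : binVal (takeBits L (fracPart X).tail) = p at hp hpu
    set z : ℤ := (if isNeg X then -1 else 1) * (binVal l * 2 ^ L + p : ℕ) with hz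
    have hrz : (r : ℝ) * 2 ^ L = z := by
      rw [hr', hz]
      cases isNeg X <;> simp only [Bool.false_eq_true, if_false, if_true] <;> push_cast
      · linear_combination hpu
      · linear_combination -hpu
    have hpos : (0 : ℝ) < ε := by exact_mod_cast pos
    have hsum : (ε : ℝ) = binVal l' + binVal u' / 2 ^ u'.length := by
      have h0 : (0 : ℚ) ≤ binVal l' + binVal u' / 2 ^ u'.length := by positivity
      have : ε = binVal l' + binVal u' / 2 ^ u'.length := by split_ifs at hε' <;> linarith
      have := congrArg (Rat.cast : ℚ → ℝ) this
      push_cast at this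
      exact this
    have hm1 : (1 : ℝ) ≤ 2 ^ c.length := one_le_pow₀ (by norm_num)
    have hlo : (r - ε : ℝ) ∈ Set.Icc (r - ε : ℝ) (r + ε) := ⟨le_rfl, by linarith⟩
    have hhi : (r + ε : ℝ) ∈ Set.Icc (r - ε : ℝ) (r + ε) := ⟨by linarith, le_rfl⟩
    have hshort : IsJob (.finite r ε hr hε pos) c → (ε : ℝ) * 2 ^ c.length < 1 := fun h => by
      have := h.short _ hlo _ hhi
      linarith
    rcases hl' with rfl | ⟨l', rfl⟩
    · have e0 : dropSign Y = .sep :: u'.map .bit := hY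
      have hq : binVal (takeBits L (dropSign Y).tail) = binVal u' * 2 ^ (L - u'.length) := by
        rw [e0]
        exact binVal_takeBits_of_le (by omega)
      have hqu := hpow u' (by omega)
      rw [← hq] at hqu
      have hlev : endLevel L X Y = zeros (takeBits L (dropSign Y).tail) := by
        rw [endLevel, hsX, e0]
        rfl
      have hzi := fun h => le_zeros_iff (l := takeBits L (dropSign Y).tail) h c.length
      rw [length_takeBits'] at hzi
      generalize hqd : binVal (takeBits L (dropSign Y).tail) = q at hq hqu hzi
      have hεq : (ε : ℝ) * 2 ^ L = q := by
        rw [hsum, ← hqu]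
        simp [binVal]
      have hL : (0 : ℝ) < 2 ^ L := by positivity
      have hq0 : 0 < q := by
        have : (0 : ℝ) < q := hεq ▸ mul_pos hpos hL
        exact_mod_cast this
      have hzs : c.length ≤ endLevel L X Y ↔ (ε : ℝ) * 2 ^ c.length < 1 := by
        rw [hlev, hzi hq0, ← Nat.cast_lt (α := ℝ)]
        push_cast
        rw [← hεq, mul_right_comm]
        exact mul_lt_iff_lt_one_left hL
      obtain ⟨hA, hB⟩ := binVal_endDigits hpd hqd hn hz
      obtain ⟨lA, lB⟩ := length_endDigits L X Y
      have e1 := List.map_fst_zip (l₁ := (endDigits L X Y).1) (l₂ := (endDigits L X Y).2) (by omega)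
      have e2 := List.map_snd_zip (l₁ := (endDigits L X Y).1) (l₂ := (endDigits L X Y).2) (by omega)
      rw [mem_jobsFrom (pre' := []) (by simpa [lA, lB] using endLevel_le L X Y) rfl
        (by simp [binVal]), e1, e2]
      · set A := (endDigits L X Y).1
        set B := (endDigits L X Y).2
        have key := fun hcL : c.length ≤ L => take_iff hrz hεq lA lB hA hB hcL
        constructor
        · rintro ⟨m, h1, h2, h3, h4, h5⟩
          obtain rfl : c.length = m := by simpa using h3
          obtain ⟨k1, k2⟩ := key (h2.trans (endLevel_le _ _ _))
          refine ⟨h1, fun x hx y hy => ?_, k1.1 h4, k2.1 h5⟩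
          have := hzs.1 h2
          have h6 : y - x ≤ 2 * ε := by linarith [hx.1, hy.2]
          exact (mul_le_mul_of_nonneg_right h6 (by positivity)).trans_lt
            (by rw [mul_assoc]; linarith)
        · intro h
          have h2 := hzs.2 (hshort h)
          obtain ⟨k1, k2⟩ := key (h2.trans (endLevel_le _ _ _))
          exact ⟨_, h.pos, h2, by simp, k1.2 h.low, k2.2 h.high⟩
      · intro m _
        rw [e1, e2, List.nil_append, List.nil_append, binVal_take, binVal_take, lA, lB]
        exact Nat.div_le_div_right (by omega)
    · have hlev : endLevel L X Y = 0 := by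
        rw [endLevel, hY]
        rfl
      rw [hlev]
      refine iff_of_false (by simp [jobsFrom]) fun h => ?_
      have h1 := hshort h
      have h2 : (1 : ℝ) ≤ binVal (true :: l') := by
        rw [binVal_cons]
        exact_mod_cast le_add_right (by simpa using Nat.one_le_two_pow)
      have h3 : (0 : ℝ) ≤ binVal u' / 2 ^ u'.length := by positivity
      nlinarith

/-! ### Runs with names of nearby points -/

section

variable {M : OracleMachine} {O O' : Baire}

theorem step_congr {good : Str → Prop} (hO : ∀ w, good w → O w = O' w) {c : M.Config}
    (h : GoodFrom M O good c) : M.step O' c = M.step O c := by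
  by_cases h1 : c.state = M.halt
  · rw [OracleMachine.step, OracleMachine.step, if_pos h1, if_pos h1]
  by_cases h2 : c.state = M.oracle
  · rw [step_oracle h1 h2, step_oracle h1 h2,
      show O (c.tape .query).content = O' _ from hO _ (h 0 h1 h2)]
  · rw [step_transition h1 h2, step_transition h1 h2]

theorem iterate_step_congr {good : Str → Prop} (hO : ∀ w, good w → O w = O' w) {c : M.Config}
    (h : GoodFrom M O good c) (n : ℕ) : (M.step O')^[n] c = (M.step O)^[n] c := by
  induction n generalizing c with
  | zero => rfl
  | succ n ih =>
    rw [Function.iterate_succ_apply, Function.iterate_succ_apply, step_congr hO h, ih h.of_step]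

/-- A machine cannot ask for long strings early. -/
theorem length_query_le (O : Baire) (a : Str) (n : ℕ) :
    (((M.run O a n).tape .query).content).length ≤ n := by
  have key : ((M.run O a n).tape .query).head ≤ n ∧
      ∀ k : ℤ, n ≤ k → ((M.run O a n).tape .query).cells k = none := by
    induction n with
    | zero => exact ⟨le_rfl, fun k _ => by simp [OracleMachine.run, OracleMachine.init, cellsOf]⟩
    | succ n ih =>
      obtain ⟨h1, h2⟩ := ih
      rw [show M.run O a (n + 1) = M.step O (M.run O a n) from Function.iterate_succ_apply' ..]
      push_cast
      by_cases hh : (M.run O a n).state = M.halt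
      · rw [OracleMachine.step, if_pos hh]
        exact ⟨by omega, fun k hk => h2 k (by omega)⟩
      by_cases ho : (M.run O a n).state = M.oracle
      · rw [step_oracle hh ho]
        exact ⟨by dsimp only; omega, fun k hk => h2 k (by omega)⟩
      · rw [step_transition hh ho]
        dsimp only [Tape.act]
        refine ⟨?_, fun k hk => ?_⟩
        · have : ∀ m : Move, m.shift ≤ 1 := fun m => by cases m <;> decide
          exact add_le_add h1 (this _)
        · rw [Function.update_of_ne (by omega), h2 k (by omega)]
  classical
  unfold Tape.content
  split_ifs with h
  · refine (List.length_filterMap_le _ _).trans ?_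
    rw [List.length_range]
    exact Nat.find_min' h (key.2 n le_rfl)
  · exact Nat.zero_le _

end

theorem bairePair_congr {φ χ χ' : Baire} {c : List Bool} (h : NameFrom c χ) (h' : NameFrom c χ')
    {w : Str} (hw : GoodQuery c w) : bairePair φ χ w = bairePair φ χ' w := by
  rcases w with _ | ⟨(_ | _) | _, b⟩
  · rfl
  · rfl
  · change χ b = χ' b
    by_cases hb : ∃ j, b = codeStr j
    · obtain ⟨j, rfl⟩ := hb
      rw [h.code j (hw j rfl), h'.code j (hw j rfl)]
    · push Not at hb
      rw [h.other b hb, h'.other b hb]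
  · rfl

/-- A name of the number `0.c`. -/
noncomputable def digitName (c : List Bool) : Baire := pointName c (binVal c / 2 ^ c.length)

theorem closeTo_self (c : List Bool) : CloseTo c (binVal c / 2 ^ c.length) := by
  rw [CloseTo, div_mul_cancel₀ _ (by positivity)]
  simp

theorem binVal_div_mem (c : List Bool) : (binVal c / 2 ^ c.length : ℝ) ∈ Set.Icc (0 : ℝ) 1 :=
  ⟨by positivity, div_le_one_of_le₀ (by exact_mod_cast (binVal_lt c).le) (by positivity)⟩

/-! ### The interval function of a machine -/

/-- With the oracle `φ` for the first argument the machine `M` computes names of the values of `g`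
from the names `pointName c x`; on a string of length `n` it takes at most `T n` steps, and `q`
bounds the parameter of the names. -/
def Evaluates (M : OracleMachine) (φ : Baire) (g : unitInterval → ℝ) (T q : ℕ → ℕ) : Prop :=
  ∀ (c : List Bool) (x : unitInterval), CloseTo c x → ∃ ψ : Baire,
    (∀ a, M.HaltsWithin (bairePair φ (pointName c x)) a (T a.length) (ψ a)) ∧
    IsRealName ψ (g x) ∧ ∀ n, realParam ψ n ≤ q n

/-- The approximations that are found for the interval `J`. -/
def approximations (M : OracleMachine) (φ : Baire) (J : DyadicInterval) : Set Cand :=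
  {d | ∃ c, IsJob J c ∧ ∃ i ≤ c.length, jobCand M φ digitName c i = some d}

/-- The string function that the program `curryProg M` computes. -/
noncomputable def curryOut (M : OracleMachine) (φ : Baire) (s : Str) : Str :=
  collOut ((jobs s).foldl (addJob M φ digitName) Coll.empty)

section

variable {M : OracleMachine} {φ : Baire} {g : unitInterval → ℝ} {T q : ℕ → ℕ}

/-- The result of a run without precise queries is right for all points close to `0.c`, because the
machine cannot tell them apart. -/
theorem Evaluates.near (H : Evaluates M φ g T q) {c : List Bool} {i : ℕ} {d : Cand}
    {x : unitInterval} (hx : CloseTo c x) (hd : jobCand M φ digitName c i = some d) :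
    d.Near (g x) := by
  rw [jobCand] at hd
  split_ifs at hd with hG
  obtain ⟨ψ, h1, h2, -⟩ := H c x hx
  obtain ⟨n, -, hn, ho⟩ := h1 (codeStr i)
  have e : M.run (bairePair φ (pointName c x)) (codeStr i) n =
      M.run (bairePair φ (digitName c)) (codeStr i) n :=
    iterate_step_congr (fun w hw => bairePair_congr (nameFrom_pointName c _)
      (nameFrom_pointName c x) hw) hG n
  rw [e] at hn ho
  rw [result_eq hn] at hd
  exact h2.near (ho ▸ hd)

theorem Evaluates.exists_jobCand (H : Evaluates M φ g T q) {c : List Bool} {i k : ℕ} (hk : 4 ≤ k)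
    (hq : q k ≤ i) (hki : k ≤ i) (hc : T (i + 2) ≤ c.length) :
    ∃ d, jobCand M φ digitName c i = some d ∧ k ≤ d.lvl := by
  obtain ⟨ψ, h1, h2, h3⟩ := H c ⟨_, binVal_div_mem c⟩ (closeTo_self c)
  obtain ⟨n, hn, hh, ho⟩ := h1 (codeStr i)
  rw [codeStr_length] at hn
  have hG : GoodFrom M (bairePair φ (digitName c)) (GoodQuery c) (M.init (codeStr i)) := by
    intro j hj _ j' hj'
    have hl := length_query_le (M := M) (bairePair φ (digitName c)) (codeStr i) j
    rw [OracleMachine.run, hj', List.length_cons, codeStr_length] at hl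
    have : j < n := by
      by_contra! h
      obtain ⟨e, rfl⟩ := Nat.exists_eq_add_of_le' h
      exact hj ((congrArg _ (run_add_of_halt hh e)).trans hh)
    omega
  obtain ⟨d, hd, hl⟩ := h2.exists_candStr hk ((h3 k).trans hq) hki
  refine ⟨d, ?_, hl⟩
  rw [jobCand, if_pos hG, digitName, result_eq hh, ho, hd]

theorem Evaluates.near_of_mem (H : Evaluates M φ g T q) {J : DyadicInterval} {x : ℝ}
    (hx : x ∈ J.toSet) {d : Cand} (hd : d ∈ approximations M φ J) :
    d.Near (g (Set.projIcc 0 1 zero_le_one x)) := by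
  obtain ⟨c, hc, i, -, h⟩ := hd
  exact H.near (by rw [Set.coe_projIcc]; exact hc.closeTo hx) h

theorem approximations_mono {J J' : DyadicInterval} (h : J'.toSet ⊆ J.toSet) :
    approximations M φ J ⊆ approximations M φ J' :=
  fun _ ⟨c, hc, hd⟩ => ⟨c, hc.anti h, hd⟩

theorem DyadicInterval.toSet_nonempty (J : DyadicInterval) : J.toSet.Nonempty := by
  cases J with
  | infinite => exact ⟨0, Set.mem_univ _⟩
  | finite r ε _ _ pos =>
    have : (0 : ℝ) < ε := by exact_mod_cast pos
    exact ⟨r, by constructor <;> linarith⟩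

theorem Evaluates.exists_hullOf (H : Evaluates M φ g T q) {s : Str} {J : DyadicInterval}
    (hs : IntervalCode s J) :
    ∃ K, HullOf (approximations M φ J) K ∧ IntervalCode (curryOut M φ s) K := by
  obtain ⟨x, hx⟩ := J.toSet_nonempty
  have e : (jobs s).foldl (addJob M φ digitName) Coll.empty = ((jobs s).flatMap fun c =>
      (List.range (c.length + 1)).map (jobCand M φ digitName c)).foldl Coll.addOpt Coll.empty := by
    rw [List.foldl_flatMap]
    congr 1
    funext s c
    rw [addJob, List.foldl_map]
  have hS : {d | some d ∈ (jobs s).flatMap fun c =>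
      (List.range (c.length + 1)).map (jobCand M φ digitName c)} = approximations M φ J := by
    ext d
    simp [approximations, mem_jobs_iff hs]
  rw [curryOut, e]
  refine Coll.Rep.exists_hullOf ?_ fun d hd => H.near_of_mem hx hd
  rw [← hS]
  exact Coll.rep_foldl _ fun d hd => H.near_of_mem hx (hS ▸ hd)

/-- The program turns the codes of intervals `J` into codes of intervals `Ψ J` that contain the
values on `J`, depend monotonically on `J`, and are small if `J` is. -/
theorem Evaluates.exists_encodesFun (H : Evaluates M φ g T q) : ∃ Ψ, EncodesFun (curryOut M φ) Ψ ∧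
    (∀ J J' : DyadicInterval, J'.toSet ⊆ J.toSet → (Ψ J').toSet ⊆ (Ψ J).toSet) ∧
    (∀ (J : DyadicInterval) (x : unitInterval), (x : ℝ) ∈ J.toSet → g x ∈ (Ψ J).toSet) ∧
    ∀ (J : DyadicInterval) (n : ℕ),
      J.DiamLE (T (q (n + 5) + n + 7) + (q (n + 5) + n + 7)) → (Ψ J).DiamLE n := by
  have key : ∀ J, ∃ K, HullOf (approximations M φ J) K := fun J =>
    let ⟨_, hs⟩ := exists_intervalCode J
    let ⟨K, hK, _⟩ := H.exists_hullOf hs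
    ⟨K, hK⟩
  choose Ψ hΨ using key
  refine ⟨Ψ, fun s J hs => ?_, fun J J' hJ => ?_, fun J x hx => ?_, fun J n hJ => ?_⟩
  · obtain ⟨K, hK, h⟩ := H.exists_hullOf hs
    rwa [(hΨ J).unique hK]
  · obtain ⟨x, hx⟩ := J'.toSet_nonempty
    exact (hΨ J).subset (hΨ J') (approximations_mono hJ) fun d hd => H.near_of_mem hx hd
  · have := (hΨ J).mem fun d hd => H.near_of_mem hx hd
    rwa [Set.projIcc_val] at this
  · obtain ⟨c, hl, hc⟩ := exists_isJob
      (m := T (q (n + 5) + n + 7) + (q (n + 5) + n + 6)) (by omega) hJ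
    obtain ⟨d, hd, hk⟩ := H.exists_jobCand (c := c) (i := q (n + 5) + n + 5) (k := n + 5)
      (by omega) (by omega) (by omega) (by rw [hl]; exact Nat.le_add_right _ _)
    exact (hΨ J).diamLE ⟨c, hc, _, by omega, hd⟩ hk

theorem Evaluates.continuous (H : Evaluates M φ g T q) : Continuous g := by
  obtain ⟨Ψ, -, -, h2, h3⟩ := H.exists_encodesFun
  refine Metric.continuous_iff.2 fun x δ hδ => ?_
  obtain ⟨n, hn⟩ := exists_inv_pow_lt 1 (half_pos hδ)
  obtain ⟨Φ, hΦ, hsub⟩ := exists_shrinksTo x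
  obtain ⟨N, hN⟩ := hΦ.exists_diamLE (T (q (n + 5) + n + 7) + (q (n + 5) + n + 7))
  refine ⟨(2 ^ N)⁻¹, by positivity, fun y hy => ?_⟩
  have hyN : (y : ℝ) ∈ (Φ N).toSet := hsub N (by
    have := abs_lt.1 (show |(y : ℝ) - x| < _ from hy)
    constructor <;> linarith)
  have := (h3 _ _ hN).dist_le (h2 _ _ (hΦ.mem N)) (h2 _ _ hyN)
  rw [Real.dist_eq]
  rw [one_div] at hn
  linarith

theorem Evaluates.isFunName (H : Evaluates M φ g T q) {f : C(unitInterval, ℝ)}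
    (hf : ∀ x, f x = g x) : IsFunName (curryOut M φ) f ∧
      ∀ n, funParam (curryOut M φ) n ≤
        q 0 + (T (q (n + 5) + n + 7) + (q (n + 5) + n + 7)) := by
  obtain ⟨Ψ, hE, h1, h2, h3⟩ := H.exists_encodesFun
  have hS : ∀ (Φ : ℕ → DyadicInterval) (x : unitInterval),
      ShrinksTo Φ x → ShrinksTo (fun n => Ψ (Φ n)) (f x) := by
    intro Φ x hΦ
    refine shrinksTo_of (fun n => h1 _ _ (hΦ.1 n)) (fun n => hf x ▸ h2 _ _ (hΦ.mem n)) fun δ hδ => ?_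
    obtain ⟨n, hn⟩ := exists_inv_pow_lt 1 hδ
    obtain ⟨N, hN⟩ := hΦ.exists_diamLE (T (q (n + 5) + n + 7) + (q (n + 5) + n + 7))
    refine ⟨N, fun y hy => ((h3 _ _ hN).dist_le (hf x ▸ h2 _ _ (hΦ.mem N)) hy).trans ?_⟩
    rwa [← one_div]
  refine ⟨⟨Ψ, hE, hS⟩, fun n => ?_⟩
  rw [funParam_eq hE hS]
  refine Nat.add_le_add (ceil_logb_le.2 ?_) (Nat.sInf_le fun J _ hJ => h3 J n hJ)
  rw [abs_norm, ← le_sub_iff_add_le, ContinuousMap.norm_le _ (sub_nonneg.2 (one_le_pow₀ one_le_two))]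
  intro x
  have hx : CloseTo [] (x : ℝ) := by
    have := x.2
    constructor
    · simpa [binVal] using this.1
    · simpa [binVal] using this.2.trans one_le_two
  obtain ⟨ψ, -, h5, h6⟩ := H [] x hx
  rw [hf, le_sub_iff_add_le]
  exact (h5.le_param 0).trans (pow_le_pow_right₀ one_le_two (h6 0))

end

/-! ### Currying -/

theorem length_le_of_mem_jobsFrom {n : ℕ} {pre c : List Bool} {δ nz : Fin 3}
    {l : List (Bool × Bool)} (h : c ∈ jobsFrom n pre δ nz l) : c.length ≤ pre.length + n := by
  induction n generalizing pre δ nz l with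
  | zero => simp [jobsFrom] at h
  | succ n ih =>
    rcases l with _ | ⟨⟨a, b⟩, l⟩
    · simp [jobsFrom] at h
    · rw [jobsFrom, List.mem_append] at h
      rcases h with h | h
      · have : c.length = (pre ++ [a]).length := by
          rw [jobsAt, List.mem_append] at h
          rcases h with h | h <;> split_ifs at h <;>
            simp only [List.mem_singleton, List.not_mem_nil] at h <;> rw [h, length_decBits]
        rw [this, List.length_append, List.length_singleton]
        omega
      · have := ih h
        rw [List.length_append, List.length_singleton] at this
        omega

theorem length_le_of_mem_jobs {s : Str} {c : List Bool} (h : c ∈ jobs s) : c.length ≤ s.length :=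
  (length_le_of_mem_jobsFrom h).trans (by simpa using endLevel_le _ _ _)

theorem exists_curry {Z : Type*} {SZ : PreparametrisedSpace Z} {F : Z × unitInterval → ℝ}
    (hF : PolytimeComputable (SZ.prod intervalUnit) intervalReals F) :
    ∃ c : Z → C(unitInterval, ℝ), PolytimeComputable SZ intervalFunctions c ∧
      ∀ z x, c z x = F (z, x) := by
  obtain ⟨M, P, Q, hP, hQ, hM⟩ := hF
  have hmono : ∀ {φ z}, SZ.IsName φ z → Monotone fun k => SZ.param φ k + k + 1 := fun h _ _ hab =>
    Nat.succ_le_succ (Nat.add_le_add (PreparametrisedSpace.monotone_param h hab) hab)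
  -- the names of the points of the unit interval have small parameters
  have H : ∀ φ z, SZ.IsName φ z → Evaluates M φ (fun x => F (z, x))
      (P fun k => SZ.param φ k + k + 1) (Q fun k => SZ.param φ k + k + 1) := by
    intro φ z hz c x hx
    obtain ⟨h1, h2⟩ := isRealName_pointName hx x.2
    obtain ⟨ψ, h3, h4, h5⟩ := hM _ (z, x) ⟨φ, pointName c x, rfl, hz, h1⟩
    have hl : ∀ n, (SZ.prod intervalUnit).param (bairePair φ (pointName c x)) n ≤
        SZ.param φ n + n + 1 := fun n => max_le (by change SZ.param φ n ≤ _; omega)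
      ((h2 n).trans (by omega))
    exact ⟨ψ, fun a => (h3 a).mono (hP.mono hl (hmono hz) le_rfl), h4,
      fun n => (h5 n).trans (hQ.mono hl (hmono hz) le_rfl)⟩
  choose φ₀ hφ₀ using SZ.exists_isName
  refine ⟨fun z => ⟨_, (H _ z (hφ₀ z)).continuous⟩,
    ⟨Compile.machine (curryProg M) (Regs.init M),
      fun l n => 4 * (80000 * (P (fun k => l k + k + 1) (n + 2) + n + 1) ^ 4 + 1) ^ 2,
      fun l n => Q (fun k => l k + k + 1) 0 + (P (fun k => l k + k + 1)
        (Q (fun k => l k + k + 1) (n + 5) + n + 7) + (Q (fun k => l k + k + 1) (n + 5) + n + 7)),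
      ?_, ?_, fun φ z hz => ?_⟩, fun z x => rfl⟩
  · have h1 := (hP.comp (.add .arg (.const 2))).subst
    exact (IsSOP.const 4).mul (.pow (.add (.mul (.const _)
      (.pow (.add (.add h1 .arg) (.const 1)) 4)) (.const 1)) 2)
  · have h1 : IsSOP fun l n => Q l (n + 5) + n + 7 :=
      .add (.add (hQ.comp (.add .arg (.const 5))) .arg) (.const 7)
    have h2 : IsSOP fun l n => Q l (n + 5) := hQ.comp (.add .arg (.const 5))
    exact .add (hQ.comp (.const 0)).subst (.add (hP.comp h1).subst
      (.add (.add h2.subst .arg) (.const 7)))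
  · obtain ⟨h1, h2⟩ := (H φ z hz).isFunName
      (f := ⟨fun x => F (z, x), (H _ z (hφ₀ z)).continuous⟩) fun x => rfl
    refine ⟨curryOut M φ, fun s => ?_, h1, h2⟩
    refine curryProg_halts M φ digitName (fun c => nameFrom_pointName c _) s _ (by omega)
      fun c hc i hi => ?_
    obtain ⟨ψ, h3, -, -⟩ := H φ z hz c ⟨_, binVal_div_mem c⟩ (closeTo_self c)
    obtain ⟨n, hn, hh, -⟩ := h3 (codeStr i)
    refine ⟨n, hn.trans (le_trans ?_ (Nat.le_add_right _ _)), hh⟩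
    have := length_le_of_mem_jobs hc
    exact hP.mono (fun _ => le_rfl) (hmono hz) (by rw [codeStr_length]; omega)

theorem isParametrised_intervalFunctions : intervalFunctions.IsParametrised := by
  obtain ⟨c, hc, h⟩ := exists_curry polytimeComputable_eval
  rwa [show c = id from funext fun f => ContinuousMap.ext fun x => h f x] at hc

end ParSpace

theorem mainTheorem5 :
    ParSpace.intervalReals.IsParametrised ∧
    ParSpace.intervalUnit.IsParametrised ∧
    ParSpace.intervalFunctions.IsParametrised ∧
    ParSpace.PolytimeComputable (ParSpace.intervalFunctions.prod ParSpace.intervalUnit)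
      ParSpace.intervalReals (fun p => p.1 p.2) ∧
    ∀ (Z : Type u) (SZ : ParSpace.PreparametrisedSpace Z), SZ.IsParametrised →
      (SZ.prod ParSpace.intervalUnit).IsParametrised ∧
      ∀ F : Z × unitInterval → ℝ,
        ParSpace.PolytimeComputable (SZ.prod ParSpace.intervalUnit) ParSpace.intervalReals F →
        ∃! c : Z → C(unitInterval, ℝ),
          ParSpace.PolytimeComputable SZ ParSpace.intervalFunctions c ∧
          ∀ (z : Z) (x : unitInterval), c z x = F (z, x) := by
  refine ⟨ParSpace.isParametrised_intervalReals, ParSpace.isParametrised_intervalUnit,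
    ParSpace.isParametrised_intervalFunctions, ParSpace.polytimeComputable_eval,
    fun Z SZ hZ => ⟨ParSpace.IsParametrised.prod_intervalUnit hZ, fun F hF => ?_⟩⟩
  obtain ⟨c, hc, h⟩ := ParSpace.exists_curry hF
  exact ⟨c, ⟨hc, h⟩, fun c' ⟨_, h'⟩ => funext fun z => ContinuousMap.ext fun x =>
    (h' z x).trans (h z x).symm⟩
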